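/- **Notation.** On $L^2(0,1)=L^2((0,1),\mathbb C)$ let $A=-\partial_x^2$ with $D(A)=H^2\cap H^1_0(0,1)$, $\lambda_j=(j\pi)^2$, $\varphi_j=\sqrt2\sin(j\pi\,\cdot)$ ($j\in\mathbb N^*$), $\psi_1(t)=e^{-i\lambda_1t}\varphi_1$, and $H^s_{(0)}=D(A^{s/2})$ with $\|\varphi\|_{H^s_{(0)}}=\big(\sum_{j\ge1}|j^s\langle\varphi,\varphi_j\rangle|^2\big)^{1/2}$. For $T>0$ and $k\in\mathbb N$, $H^k_0(0,T)$ is the closure of $C_c^\infty(0,T)$ in the real Sobolev space $H^k((0,T),\mathbb R)$, and $\|u\|_{H^k_0}:=\|u^{(k)}\|_{L^2(0,T)}$. The iterated primitives of $u$ are $u_0=u$, $u_{n+1}(t)=\int_0^tu_n(\tau)\,d\tau$. For $m\ge0$, $\|u\|_{H^m}$ is the usual norm of $H^m(0,T)$; for $m=-l<0$, $\|u\|_{H^{-l}}:=|u_1(T)|+\|u_l\|_{L^2(0,T)}$. For $J\subset\mathbb N^*$, $\mathbb P_J$ is the orthogonal projection of $L^2(0,1)$ onto the closed span of $\{\varphi_j\}_{j\in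 J}$, and $\Pi_{\psi_1(T)}\xi=\xi-\mathrm{Re}\langle\xi,\psi_1(T)\rangle\,\psi_1(T)$. Let $T>0$, $(p,k)\in\mathbb N^2$ with $p\ge k$, and $\mu\in H^{2(p+k)+3}((0,1),\mathbb R)$ with $\mu^{(2n+1)}(0)=\mu^{(2n+1)}(1)=0$ for $n=0,\dots,p-1$. For $\psi_0\in H^{2(p+k)+3}_{(0)}$ and $u\in H^k_0(0,T)$, let $\psi\in C^k([0,T],H^{2p+3}_{(0)})$ be the solution of $$\psi(t)=e^{-iAt}\psi_0+i\int_0^te^{-iA(t-\tau)}\big(u(\tau)\mu\psi(\tau)\big)\,d\tau,\qquad t\in[0,T],$$ (the weak form of $i\partial_t\psi=-\partial_x^2\psi-u(t)\mu(x)\psi$, $\psi(t,0)=\psi(t,1)=0$, $\psi(0)=\psi_0$), and, for $J\subset\mathbb N^*$, let $$\Theta_T(\psi_0,u)=\big(\psi_0,\ \Pi_{\psi_1(T)}\mathbb P_J\,\psi(T)\big).$$ **Proposition 4.3.** The solution $\psi$ exists and is unique, and $\psi(T)\in H^{2(p+k)+3}_{(0)}$; the map $\Theta_T:H^{2(p+k)+3}_{(0)}\times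 H^k_0(0,T)\to H^{2(p+k)+3}_{(0)}\times H^{2(p+k)+3}_{(0)}$ is (Fréchet, over $\mathbb R$) differentiable at $(\varphi_1,0)$. Moreover, for every $R>0$ there is a constant $C=C(T,\mu,R)>0$ (which may also depend on $p,k$, but not on $J$, $\psi_0$, $u$) such that for all $J\subset\mathbb N^*$, all $\psi_0\in H^{2(p+k)+3}_{(0)}$ and all $u\in H^k_0(0,T)$ with $\|u\|_{H^k_0}<R$ and $u_2(T)=\dots=u_{k+1}(T)=0$, $$\big\|\Theta_T(\psi_0,u)-\Theta_T(\varphi_1,0)-d\Theta_T(\varphi_1,0).(\psi_0-\varphi_1,u)\big\|_{H^{2(p+m)+3}_{(0)}\times H^{2(p+m)+3}_{(0)}}\le C\,\|u\|_{H^m}\Big(\|\psi_0-\varphi_1\|_{H^{2(p+k)+3}_{(0)}}+\|u\|_{H^k_0}\Big)$$ for every integer $m$ with $-(k+1)\le m\le k$. -/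

import Mathlib

namespace BilinearSchrodinger

open MeasureTheory Set

noncomputable section

/-- The complex Hilbert space `L²(0,1)`. -/
abbrev L2 : Type := Lp ℂ 2 (volume.restrict (Ioo (0 : ℝ) 1))

/-- The function `x ↦ √2 sin(jπx)`. -/
def modeFun (j : ℕ+) (x : ℝ) : ℂ := ((Real.sqrt 2 * Real.sin (j * Real.pi * x) : ℝ) : ℂ)

theorem memLp_modeFun (j : ℕ+) : MemLp (modeFun j) 2 (volume.restrict (Ioo (0 : ℝ) 1)) := by
  refine MemLp.of_bound (C := Real.sqrt 2) ?_ ?_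
  · exact (by unfold modeFun; fun_prop : Continuous (modeFun j)).aestronglyMeasurable
  · refine Filter.Eventually.of_forall fun x => ?_
    rw [modeFun, Complex.norm_real, Real.norm_eq_abs, abs_mul, abs_of_nonneg (Real.sqrt_nonneg 2)]
    exact mul_le_of_le_one_right (Real.sqrt_nonneg 2) (Real.abs_sin_le_one _)

/-- The eigenvector `φ_j = √2 sin(jπ·)` of the Dirichlet Laplacian. -/
def mode (j : ℕ+) : L2 := (memLp_modeFun j).toLp

/-- The eigenvalue `λ_j = (jπ)²`. -/
def eigenvalue (j : ℕ+) : ℝ := (j * Real.pi) ^ 2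

/-- The coefficient `⟨φ, φ_j⟩ = ∫₀¹ φ φ_j` (Mathlib's inner product is conjugate-linear in its
first argument). -/
def coeff (j : ℕ+) (φ : L2) : ℂ := inner ℂ (mode j) φ

theorem inner_mode (j : ℕ+) (φ : L2) :
    coeff j φ = ∫ x in Ioo (0 : ℝ) 1, modeFun j x * φ x := by
  rw [coeff, L2.inner_def]
  refine integral_congr_ae ?_
  filter_upwards [(memLp_modeFun j).coeFn_toLp] with x hx
  rw [mode, hx, RCLike.inner_apply, mul_comm, modeFun, Complex.conj_ofReal]

theorem integral_sin_mul_sin (i j : ℕ+) :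
    ∫ x in (0 : ℝ)..1, 2 * (Real.sin (i * Real.pi * x) * Real.sin (j * Real.pi * x)) =
      if i = j then 1 else 0 := by
  have h1 : ∀ x : ℝ, 2 * (Real.sin (i * Real.pi * x) * Real.sin (j * Real.pi * x)) =
      Real.cos ((((i : ℤ) - j : ℤ) : ℝ) * Real.pi * x) -
        Real.cos ((((i : ℤ) + j : ℤ) : ℝ) * Real.pi * x) := by
    intro x
    push_cast
    rw [sub_mul, sub_mul, add_mul, add_mul, Real.cos_sub, Real.cos_add]
    ring
  have h2 : ∀ n : ℤ, ∫ x in (0 : ℝ)..1, Real.cos ((n : ℝ) * Real.pi * x) =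
      if n = 0 then 1 else 0 := by
    intro n
    split_ifs with hn
    · simp [hn]
    · have hc : (n : ℝ) * Real.pi ≠ 0 := mul_ne_zero (by exact_mod_cast hn) Real.pi_ne_zero
      rw [intervalIntegral.integral_comp_mul_left (fun y => Real.cos y) hc]
      simp [integral_cos, Real.sin_int_mul_pi]
  simp_rw [h1]
  rw [intervalIntegral.integral_sub
    (Continuous.intervalIntegrable (by fun_prop) _ _)
    (Continuous.intervalIntegrable (by fun_prop) _ _), h2, h2]
  have hi := i.pos
  have hj := j.pos
  have e1 : ((i : ℤ) + j = 0) = False := by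
    rw [eq_iff_iff, iff_false]; omega
  have e2 : ((i : ℤ) - j = 0) = (i = j) := by
    rw [← PNat.coe_inj, eq_iff_iff]; omega
  simp [e1, e2]

theorem coeff_mode (i j : ℕ+) : coeff i (mode j) = if i = j then 1 else 0 := by
  rw [inner_mode]
  have : ∫ x in Ioo (0 : ℝ) 1, modeFun i x * (mode j : L2) x =
      ∫ x in Ioo (0 : ℝ) 1, ((2 * (Real.sin (i * Real.pi * x) *
        Real.sin (j * Real.pi * x)) : ℝ) : ℂ) := by
    refine integral_congr_ae ?_
    filter_upwards [(memLp_modeFun j).coeFn_toLp] with x hx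
    rw [mode, hx, modeFun, modeFun, ← Complex.ofReal_mul]
    congr 1
    have := Real.mul_self_sqrt (show (0 : ℝ) ≤ 2 by norm_num)
    linear_combination (Real.sin (i * Real.pi * x) * Real.sin (j * Real.pi * x)) * this
  rw [this, integral_complex_ofReal, ← integral_Ioc_eq_integral_Ioo,
    ← intervalIntegral.integral_of_le zero_le_one, integral_sin_mul_sin]
  split_ifs <;> simp

/-- The sine system is complete: only `0` has vanishing coefficients. -/
theorem eq_zero_of_coeff_eq_zero (φ : L2) (h : ∀ j, coeff j φ = 0) : φ = 0 := by
  set g : ℝ → ℂ := (Ioo (0 : ℝ) 1).indicator φ with hg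
  have hgL : MemLp g 2 volume := (memLp_indicator_iff_restrict measurableSet_Ioo).2 (Lp.memLp φ)
  have hgL' : MemLp (fun x => g (-x)) 2 volume :=
    hgL.comp_measurePreserving (Measure.measurePreserving_neg volume)
  have hFL : MemLp (fun x => g x - g (-x)) 2 volume := hgL.sub hgL'
  have hsin : ∀ n : ℤ, ∫ x in Ioo (0 : ℝ) 1, ((Real.sin (n * Real.pi * x) : ℝ) : ℂ) * φ x = 0 := by
    have hpos : ∀ j : ℕ+, ∫ x in Ioo (0 : ℝ) 1, ((Real.sin (j * Real.pi * x) : ℝ) : ℂ) * φ x = 0 := by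
      intro j
      have hj := h j
      rw [inner_mode] at hj
      simp only [modeFun, Complex.ofReal_mul, mul_assoc] at hj
      rw [integral_const_mul] at hj
      simp only [mul_eq_zero, Complex.ofReal_eq_zero] at hj
      rcases hj with hj | hj
      · exact absurd hj (by positivity)
      · simpa only [Complex.ofReal_mul, mul_assoc] using hj
    intro n
    rcases lt_trichotomy n 0 with hn | hn | hn
    · have := hpos ⟨n.natAbs, by omega⟩
      have e : ((n.natAbs : ℕ) : ℝ) = -(n : ℝ) := by
        rw [Nat.cast_natAbs, abs_of_neg hn]; push_cast; rfl
      simp only [PNat.mk_coe, e, neg_mul, Real.sin_neg, Complex.ofReal_neg, integral_neg,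
        neg_eq_zero] at this
      exact this
    · simp [hn]
    · have := hpos ⟨n.natAbs, by omega⟩
      have e : ((n.natAbs : ℕ) : ℝ) = (n : ℝ) := by
        rw [Nat.cast_natAbs, abs_of_pos hn]
      simpa only [PNat.mk_coe, e] using this
  have hab : (-1 : ℝ) < 1 := by norm_num
  have hsub : Ioo (0 : ℝ) 1 ⊆ Ioc (-1) 1 := fun x hx => ⟨by linarith [hx.1], hx.2.le⟩
  have hP := hasSum_sq_fourierCoeffOn hab (hFL.restrict (Ioc (-1 : ℝ) 1))
  have hc : ∀ n : ℤ, fourierCoeffOn hab (fun x => g x - g (-x)) n = 0 := by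
    intro n
    rw [fourierCoeffOn_eq_integral]
    have hgi : ∀ m : ℤ, IntervalIntegrable
        (fun x : ℝ => fourier m (x : AddCircle ((1 : ℝ) - -1)) • g x) volume (-1) 1 := by
      intro m
      have h0 : IntegrableOn g (Ioc (-1 : ℝ) 1) :=
        (hgL.restrict (Ioc (-1 : ℝ) 1)).integrable (by norm_num)
      refine (intervalIntegrable_iff_integrableOn_Ioc_of_le hab.le).2 ?_
      refine Integrable.bdd_mul (c := 1) h0 ?_ ?_
      · exact ((map_continuous (fourier m)).comp
          (AddCircle.continuous_mk' _)).aestronglyMeasurable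
      · exact Filter.Eventually.of_forall fun x => by
          rw [fourier_apply, Circle.norm_coe]
    have hgi' : IntervalIntegrable
        (fun x : ℝ => fourier (-n) (x : AddCircle ((1 : ℝ) - -1)) • g (-x)) volume (-1) 1 := by
      have := (IntervalIntegrable.iff_comp_neg (by simp [hg])).1 (hgi n)
      simp only [neg_neg] at this
      have := this.symm
      refine this.congr ?_
      intro x _
      simp [fourier_apply]
    simp only [smul_sub]
    rw [intervalIntegral.integral_sub (hgi _) hgi']
    have hneg : ∫ x in (-1 : ℝ)..1, fourier (-n) (x : AddCircle ((1 : ℝ) - -1)) • g (-x) =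
        ∫ x in (-1 : ℝ)..1, fourier n (x : AddCircle ((1 : ℝ) - -1)) • g x := by
      have := intervalIntegral.integral_comp_neg (a := -1) (b := 1)
        (fun x : ℝ => fourier n (x : AddCircle ((1 : ℝ) - -1)) • g x)
      simp only [neg_neg] at this
      rw [← this]
      refine intervalIntegral.integral_congr fun x _ => ?_
      simp [fourier_apply]
    rw [hneg, ← intervalIntegral.integral_sub (hgi _) (hgi _)]
    have hpt : ∀ x : ℝ, fourier (-n) (x : AddCircle ((1 : ℝ) - -1)) • g x -
        fourier n (x : AddCircle ((1 : ℝ) - -1)) • g x =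
        (Ioo (0 : ℝ) 1).indicator (fun x => -2 * Complex.I *
          (((Real.sin (n * Real.pi * x) : ℝ) : ℂ) * φ x)) x := by
      intro x
      by_cases hx : x ∈ Ioo (0 : ℝ) 1
      · rw [hg, indicator_of_mem hx, indicator_of_mem hx, fourier_coe_apply, fourier_coe_apply]
        have e1 : 2 * (Real.pi : ℂ) * Complex.I * ((-n : ℤ) : ℂ) * (x : ℂ) / ((1 - -1 : ℝ) : ℂ) =
            -((n * Real.pi * x : ℂ)) * Complex.I := by push_cast; ring
        have e2 : 2 * (Real.pi : ℂ) * Complex.I * (n : ℂ) * (x : ℂ) / ((1 - -1 : ℝ) : ℂ) =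
            ((n * Real.pi * x : ℂ)) * Complex.I := by push_cast; ring
        rw [e1, e2, Complex.ofReal_sin]
        push_cast
        rw [Complex.sin, smul_eq_mul, smul_eq_mul]
        linear_combination ((Complex.exp (-((n * Real.pi * x : ℂ)) * Complex.I) -
          Complex.exp ((n * Real.pi * x : ℂ) * Complex.I)) * φ x) * Complex.I_sq
      · simp [hg, indicator_of_notMem hx]
    simp only [hpt]
    rw [intervalIntegral.integral_of_le hab.le, setIntegral_indicator measurableSet_Ioo,
      inter_eq_right.2 hsub,
      integral_const_mul, hsin]
    simp
  have hz : ∫ x in (-1 : ℝ)..1, ‖g x - g (-x)‖ ^ 2 = 0 := by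
    simp only [hc, norm_zero, ne_eq, OfNat.ofNat_ne_zero, not_false_eq_true, zero_pow] at hP
    have := hP.unique hasSum_zero
    simp only [smul_eq_mul, mul_eq_zero, inv_eq_zero] at this
    rcases this with h | h
    · norm_num at h
    · exact h
  rw [intervalIntegral.integral_of_le hab.le,
    integral_eq_zero_iff_of_nonneg (fun x => by positivity)
      ((hFL.restrict (Ioc (-1 : ℝ) 1)).integrable_norm_pow (by norm_num))] at hz
  have hz' := ae_mono (Measure.restrict_mono hsub le_rfl) hz
  refine (Lp.eq_zero_iff_ae_eq_zero).2 ?_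
  filter_upwards [hz', ae_restrict_mem measurableSet_Ioo] with x hx hm
  have hn : -x ∉ Ioo (0 : ℝ) 1 := fun hh => by linarith [hh.1, hm.1]
  simpa [hg, indicator_of_mem hm, indicator_of_notMem hn] using hx

/-! ### The spaces `H^s_{(0)}(0,1)` -/

/-- The norm `‖φ‖_{H^s_{(0)}} = (∑_{j ≥ 1} |j^s ⟨φ, φ_j⟩|²)^{1/2}`. -/
def hNorm (s : ℝ) (φ : L2) : ℝ := Real.sqrt (∑' j : ℕ+, ((j : ℝ) ^ s * ‖coeff j φ‖) ^ 2)

/-- The weighted sequence `(j^s ⟨φ, φ_j⟩)_j`. -/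
def weightedCoeff (s : ℝ) (φ : L2) (j : ℕ+) : ℂ := (((j : ℝ) ^ s : ℝ) : ℂ) * coeff j φ

theorem norm_weightedCoeff (s : ℝ) (φ : L2) (j : ℕ+) :
    ‖weightedCoeff s φ j‖ = (j : ℝ) ^ s * ‖coeff j φ‖ := by
  rw [weightedCoeff, norm_mul, Complex.norm_real, Real.norm_of_nonneg (by positivity)]

theorem memℓp_weightedCoeff_iff (s : ℝ) (φ : L2) :
    Memℓp (weightedCoeff s φ) 2 ↔ Summable fun j : ℕ+ => ((j : ℝ) ^ s * ‖coeff j φ‖) ^ 2 := by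
  rw [memℓp_gen_iff (by norm_num)]
  simp [norm_weightedCoeff]

theorem weightedCoeff_add (s : ℝ) (φ χ : L2) :
    weightedCoeff s (φ + χ) = weightedCoeff s φ + weightedCoeff s χ := by
  funext j; simp [weightedCoeff, coeff, inner_add_right, mul_add]

theorem weightedCoeff_smul (s : ℝ) (c : ℂ) (φ : L2) :
    weightedCoeff s (c • φ) = c • weightedCoeff s φ := by
  funext j; simp [weightedCoeff, coeff, inner_smul_right]; ring

/-- `H^s_{(0)}(0,1) = D(A^{s/2})` as a linear subspace of `L²(0,1)`: the functions whose sine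
coefficients satisfy `∑_j |j^s ⟨φ, φ_j⟩|² < ∞`. -/
def hZeroSubmodule (s : ℝ) : Submodule ℂ L2 where
  carrier := {φ | Summable fun j : ℕ+ => ((j : ℝ) ^ s * ‖coeff j φ‖) ^ 2}
  zero_mem' := by simp [coeff]
  add_mem' {φ χ} hφ hχ := by
    simp only [mem_ofPred_eq, ← memℓp_weightedCoeff_iff] at hφ hχ ⊢
    rw [weightedCoeff_add]; exact hφ.add hχ
  smul_mem' c φ hφ := by
    simp only [mem_ofPred_eq, ← memℓp_weightedCoeff_iff] at hφ ⊢
    rw [weightedCoeff_smul]; exact hφ.const_smul c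

/-- The space `H^s_{(0)}(0,1)`, to be equipped with its own norm (not that of `L²`). -/
def HZero (s : ℝ) : Type := hZeroSubmodule s

namespace HZero

instance (s : ℝ) : AddCommGroup (HZero s) := inferInstanceAs (AddCommGroup (hZeroSubmodule s))

instance (s : ℝ) : Module ℂ (HZero s) := inferInstanceAs (Module ℂ (hZeroSubmodule s))

/-- The inclusion of `H^s_{(0)}(0,1)` in `L²(0,1)`. -/
def toL2 {s : ℝ} : HZero s →ₗ[ℂ] L2 := (hZeroSubmodule s).subtype

theorem toL2_injective (s : ℝ) : Function.Injective (toL2 : HZero s → L2) :=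
  Subtype.val_injective

/-- The isometry `φ ↦ (j^s ⟨φ, φ_j⟩)_j` into `ℓ²` which transports the norm. -/
def toSeq (s : ℝ) : HZero s →ₗ[ℂ] lp (fun _ : ℕ+ => ℂ) 2 where
  toFun φ := ⟨weightedCoeff s (toL2 φ), (memℓp_weightedCoeff_iff s _).2 φ.2⟩
  map_add' φ χ := by
    apply Subtype.ext; simp only [map_add, weightedCoeff_add]; rfl
  map_smul' c φ := by
    apply Subtype.ext; simp only [map_smul, weightedCoeff_smul]; rfl

theorem toSeq_injective (s : ℝ) : Function.Injective (toSeq s) := by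
  refine (injective_iff_map_eq_zero _).2 fun φ h => toL2_injective s ?_
  rw [map_zero]
  refine eq_zero_of_coeff_eq_zero _ fun j => ?_
  have h1 : weightedCoeff s (toL2 φ) j = 0 := congrFun (congrArg Subtype.val h) j
  rcases mul_eq_zero.1 h1 with h2 | h2
  · have : (0 : ℝ) < (j : ℝ) ^ s := Real.rpow_pos_of_pos (by exact_mod_cast j.pos) s
    exact absurd (Complex.ofReal_eq_zero.1 h2) this.ne'
  · exact h2

instance (s : ℝ) : NormedAddCommGroup (HZero s) :=
  NormedAddCommGroup.induced (HZero s) (lp (fun _ : ℕ+ => ℂ) 2) (toSeq s) (toSeq_injective s)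

instance (s : ℝ) : NormedSpace ℂ (HZero s) :=
  NormedSpace.induced ℂ (HZero s) (lp (fun _ : ℕ+ => ℂ) 2) (toSeq s)

/-- The norm of `HZero s` is the one announced. -/
theorem norm_eq {s : ℝ} (φ : HZero s) : ‖φ‖ = hNorm s (toL2 φ) := by
  change ‖toSeq s φ‖ = _
  rw [lp.norm_eq_tsum_rpow (by norm_num), hNorm, Real.sqrt_eq_rpow]
  simp [toSeq, norm_weightedCoeff]

end HZero

theorem mode_mem (s : ℝ) (j : ℕ+) : mode j ∈ hZeroSubmodule s := by
  change Summable _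
  refine summable_of_ne_finset_zero (s := {j}) fun i hi => ?_
  rw [coeff_mode, if_neg (by simpa using hi)]
  simp

/-- The eigenvector `φ_j` as an element of `H^s_{(0)}(0,1)`. -/
def HZero.mode (s : ℝ) (j : ℕ+) : HZero s := ⟨BilinearSchrodinger.mode j, mode_mem s j⟩

/-- The value `ψ_1(t) = e^{-iλ_1 t} φ_1` of the ground state at time `t`. -/
def HZero.groundState (s t : ℝ) : HZero s :=
  Complex.exp (-Complex.I * eigenvalue 1 * t) • HZero.mode s 1

/-! ### The projections -/

/-- `H_J`, the closed linear span of the `φ_j`, `j ∈ J`. -/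
def modeSpan (J : Set ℕ+) : Submodule ℂ L2 := (Submodule.span ℂ (mode '' J)).topologicalClosure

instance (J : Set ℕ+) : CompleteSpace (modeSpan J) :=
  inferInstanceAs (CompleteSpace (Submodule.span ℂ (mode '' J)).topologicalClosure)

open Classical in
theorem starProjection_mode (J : Set ℕ+) (j : ℕ+) :
    (modeSpan J).starProjection (mode j) = if j ∈ J then mode j else 0 := by
  split_ifs with hj
  · exact Submodule.starProjection_eq_self_iff.2
      (Submodule.le_topologicalClosure _ (Submodule.subset_span (mem_image_of_mem _ hj)))
  · rw [Submodule.starProjection_apply_eq_zero_iff, modeSpan, Submodule.orthogonal_closure,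
      Submodule.mem_orthogonal]
    intro x hx
    induction hx using Submodule.span_induction with
    | mem x hx =>
      obtain ⟨i, hi, rfl⟩ := hx
      have := coeff_mode i j
      rwa [if_neg (fun h : i = j => hj (h ▸ hi))] at this
    | zero => simp
    | add x y _ _ hx hy => rw [inner_add_left, hx, hy, add_zero]
    | smul c x _ hx => rw [inner_smul_left, hx, mul_zero]

open Classical in
theorem coeff_starProjection (J : Set ℕ+) (j : ℕ+) (φ : L2) :
    coeff j ((modeSpan J).starProjection φ) = if j ∈ J then coeff j φ else 0 := by
  rw [coeff, ← Submodule.inner_starProjection_left_eq_right, starProjection_mode]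
  split_ifs
  · rfl
  · simp

/-- The orthogonal projection `P_J` of `L²(0,1)` onto `H_J`, acting on `H^s_{(0)}(0,1)`. -/
def HZero.projJ {s : ℝ} (J : Set ℕ+) (φ : HZero s) : HZero s :=
  ⟨(modeSpan J).starProjection (HZero.toL2 φ), by
    have h : Summable fun j : ℕ+ => ((j : ℝ) ^ s * ‖coeff j (HZero.toL2 φ)‖) ^ 2 := φ.2
    refine Summable.of_nonneg_of_le (fun j => by positivity) (fun j => ?_) h
    rw [coeff_starProjection]
    split_ifs
    · exact le_rfl
    · simp only [norm_zero, mul_zero, ne_eq, OfNat.ofNat_ne_zero, not_false_eq_true, zero_pow]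
      positivity⟩

/-- The orthogonal projection `Π_{ψ_1(T)} ξ = ξ - Re⟨ξ, ψ_1(T)⟩ ψ_1(T)` onto the tangent space at
`ψ_1(T)` of the unit sphere of `L²(0,1)`, acting on `H^s_{(0)}(0,1)`. -/
def HZero.projTangent {s : ℝ} (T : ℝ) (ξ : HZero s) : HZero s :=
  ξ - (((inner ℂ (HZero.toL2 (HZero.groundState s T)) (HZero.toL2 ξ) : ℂ).re : ℝ) : ℂ) •
    HZero.groundState s T

/-! ### Sobolev spaces -/

/-- `φ ∈ C_c^∞(a,b)`. -/
def IsTestFunction (a b : ℝ) (φ : ℝ → ℝ) : Prop :=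
  ContDiff ℝ ((⊤ : ℕ∞) : WithTop ℕ∞) φ ∧ HasCompactSupport φ ∧ tsupport φ ⊆ Ioo a b

/-- `g` is the `n`-th weak derivative of `f` on `(a,b)`. -/
def IsWeakDeriv (a b : ℝ) (n : ℕ) (f g : ℝ → ℝ) : Prop :=
  ∀ φ : ℝ → ℝ, IsTestFunction a b φ →
    ∫ x in Ioo a b, f x * iteratedDeriv n φ x = (-1) ^ n * ∫ x in Ioo a b, g x * φ x

/-- `f ∈ H^N((a,b), ℝ)`: `f` and its weak derivatives up to order `N` are in `L²(a,b)`. -/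
def MemSobolev (a b : ℝ) (N : ℕ) (f : ℝ → ℝ) : Prop :=
  MemLp f 2 (volume.restrict (Ioo a b)) ∧
    ∀ n ≤ N, ∃ g : ℝ → ℝ, MemLp g 2 (volume.restrict (Ioo a b)) ∧ IsWeakDeriv a b n f g

/-- `f^{(n)}(a) = f^{(n)}(b) = 0`: the `n`-th weak derivative of `f` on `(a,b)` has a continuous
representative on `[a,b]`, which vanishes at both ends. -/
def DerivVanishesAtEnds (a b : ℝ) (n : ℕ) (f : ℝ → ℝ) : Prop :=
  ∃ g : ℝ → ℝ, ContinuousOn g (Icc a b) ∧ IsWeakDeriv a b n f g ∧ g a = 0 ∧ g b = 0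

/-- The Hilbert space `L²((0,T), ℝ)^{k+1}`, in which a function `u ∈ H^k((0,T), ℝ)` is represented
by the tuple `(u, u', …, u^{(k)})` of its weak derivatives. Its norm is then the usual norm
`(∑_{i ≤ k} ‖u^{(i)}‖²_{L²})^{1/2}` of `H^k(0,T)`. -/
abbrev Jets (T : ℝ) (k : ℕ) : Type :=
  PiLp 2 fun _ : Fin (k + 1) => Lp ℝ 2 (volume.restrict (Ioo 0 T))

/-- The tuples `(φ, φ', …, φ^{(k)})`, `φ ∈ C_c^∞(0,T)`. -/
def testJets (T : ℝ) (k : ℕ) : Submodule ℝ (Jets T k) where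
  carrier := {v | ∃ φ : ℝ → ℝ, IsTestFunction 0 T φ ∧
    ∀ i : Fin (k + 1), v i =ᵐ[volume.restrict (Ioo 0 T)] iteratedDeriv i φ}
  zero_mem' := by
    refine ⟨0, ⟨contDiff_const, HasCompactSupport.zero, by simp [tsupport]⟩, fun i => ?_⟩
    filter_upwards [Lp.coeFn_zero ℝ 2 (volume.restrict (Ioo 0 T))] with x hx
    have : iteratedDeriv (i : ℕ) (0 : ℝ → ℝ) x = 0 := by
      simp
    rw [this]
    exact hx
  add_mem' := by
    rintro v w ⟨φ, ⟨h1, h2, h3⟩, hφ⟩ ⟨χ, ⟨h4, h5, h6⟩, hχ⟩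
    refine ⟨φ + χ, ⟨h1.add h4, h2.add h5, (tsupport_add _ _).trans (union_subset h3 h6)⟩,
      fun i => ?_⟩
    filter_upwards [Lp.coeFn_add (v i) (w i), hφ i, hχ i] with x hx h7 h8
    rw [iteratedDeriv_add ((h1.of_le (by exact_mod_cast le_top)).contDiffAt)
      ((h4.of_le (by exact_mod_cast le_top)).contDiffAt), ← h7, ← h8]
    exact hx
  smul_mem' := by
    rintro c v ⟨φ, ⟨h1, h2, h3⟩, hφ⟩
    refine ⟨c • φ, ⟨h1.const_smul c, h2.smul_left (f := fun _ => c),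
      (tsupport_smul_subset_right (fun _ => c) φ).trans h3⟩, fun i => ?_⟩
    filter_upwards [Lp.coeFn_smul c (v i), hφ i] with x hx h7
    have : iteratedDeriv (i : ℕ) (c • φ) x = c • iteratedDeriv (i : ℕ) φ x :=
      iteratedDeriv_const_smul_field c φ
    rw [this, ← h7]
    exact hx

/-- `H^k_0((0,T), ℝ)`: the closure of `C_c^∞(0,T)` for the norm of `H^k(0,T)`. -/
abbrev H0 (T : ℝ) (k : ℕ) : Type := (testJets T k).topologicalClosure

/-- The function underlying an element of `H^k_0(0,T)`. -/
def H0.fn {T : ℝ} {k : ℕ} (u : H0 T k) : ℝ → ℝ := (u : Jets T k) 0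

/-- `‖u‖_{H^k_0} = ‖u^{(k)}‖_{L²(0,T)}`. -/
def H0.norm0 {T : ℝ} {k : ℕ} (u : H0 T k) : ℝ := ‖(u : Jets T k) (Fin.last k)‖

/-- The iterated primitives `u_0 = u`, `u_{n+1}(t) = ∫_0^t u_n`. -/
def iterPrim (u : ℝ → ℝ) : ℕ → ℝ → ℝ
  | 0 => u
  | n + 1 => fun t => ∫ τ in (0 : ℝ)..t, iterPrim u n τ

/-- `‖u‖_{H^m(0,T)}`. For `0 ≤ m ≤ k` it is the usual norm `(∑_{i ≤ m} ‖u^{(i)}‖²_{L²})^{1/2}`; for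
`m = -l < 0` it is `|u_1(T)| + ‖u_l‖_{L²(0,T)}`. -/
def H0.sobNorm {T : ℝ} {k : ℕ} (u : H0 T k) : ℤ → ℝ
  | Int.ofNat m => Real.sqrt (∑ i ∈ Finset.univ.filter (fun i : Fin (k + 1) => (i : ℕ) ≤ m), ‖(u : Jets T k) i‖ ^ 2)
  | Int.negSucc l => |iterPrim u.fn 1 T| +
      Real.sqrt (∫ t in (0 : ℝ)..T, iterPrim u.fn (l + 1) t ^ 2)

/-! ### The Schrödinger equation and the end-point map -/

/-- The group `e^{-iAt}`: `e^{-iAt} φ = ∑_j e^{-iλ_j t} ⟨φ, φ_j⟩ φ_j`. -/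
def schrGroup (t : ℝ) (φ : L2) : L2 :=
  ∑' j : ℕ+, (Complex.exp (-Complex.I * eigenvalue j * t) * coeff j φ) • mode j

open Classical in
/-- The product `μφ` in `L²(0,1)`. It is the pointwise product whenever this is square integrable,
hence always if `μ` is (a.e. equal to) a bounded function, such as a function of `H^1(0,1)`. -/
def mulL2 (μ : ℝ → ℝ) (φ : L2) : L2 :=
  if h : MemLp (fun x => (μ x : ℂ) * φ x) 2 (volume.restrict (Ioo (0 : ℝ) 1)) then h.toLp else 0

/-- `ψ ∈ C^k([0,T], H^{2p+3}_{(0)})` is the (weak) solution of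
`i∂_t ψ = -∂_x² ψ - u(t) μ(x) ψ`, `ψ(t,0) = ψ(t,1) = 0`, `ψ(0) = ψ₀`, that is
`ψ(t) = e^{-iAt} ψ₀ + i ∫_0^t e^{-iA(t-τ)} (u(τ) μ ψ(τ)) dτ` for `t ∈ [0,T]`. -/
structure IsWeakSolution (T : ℝ) (p k : ℕ) (μ : ℝ → ℝ) (ψ₀ : HZero (2 * (p + k) + 3))
    (u : H0 T k) (ψ : ℝ → HZero (2 * p + 3)) : Prop where
  contDiffOn : ContDiffOn ℝ k ψ (Icc 0 T)
  duhamel : ∀ t ∈ Icc 0 T, HZero.toL2 (ψ t) = schrGroup t (HZero.toL2 ψ₀) +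
    Complex.I • ∫ τ in (0 : ℝ)..t,
      schrGroup (t - τ) ((u.fn τ : ℂ) • mulL2 μ (HZero.toL2 (ψ τ)))

open Classical in
/-- The final state `ψ(T)` of the solution, as an element of `H^{2(p+k)+3}_{(0)}`. (The default value
`0` is used only if there is no solution, or if its final state is not in this space.) -/
def finalState (T : ℝ) (p k : ℕ) (μ : ℝ → ℝ) (ψ₀ : HZero (2 * (p + k) + 3)) (u : H0 T k) :
    HZero (2 * (p + k) + 3) :=
  if h : ∃ (χ : HZero (2 * (p + k) + 3)) (ψ : ℝ → HZero (2 * p + 3)),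
    IsWeakSolution T p k μ ψ₀ u ψ ∧ HZero.toL2 χ = HZero.toL2 (ψ T) then h.choose else 0

/-- The end-point map `Θ_T(ψ₀, u) = (ψ₀, Π_{ψ_1(T)} P_J ψ(T))`. -/
def endPointMap (T : ℝ) (p k : ℕ) (μ : ℝ → ℝ) (J : Set ℕ+) (x : HZero (2 * (p + k) + 3) × H0 T k) :
    HZero (2 * (p + k) + 3) × HZero (2 * (p + k) + 3) :=
  (x.1, HZero.projTangent T (HZero.projJ J (finalState T p k μ x.1 x.2)))

/-- The norm of `H^s_{(0)} × H^s_{(0)}`, for any `s ≤ r`, of an element of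
`H^r_{(0)} × H^r_{(0)}`. -/
def pairNorm (s : ℝ) {r : ℝ} (y : HZero r × HZero r) : ℝ :=
  hNorm s (HZero.toL2 y.1) + hNorm s (HZero.toL2 y.2)

end

end BilinearSchrodinger

open MeasureTheory Set BilinearSchrodinger

namespace BilinearSchrodinger

open MeasureTheory Set

noncomputable section

/-! ### Primitives of integrable functions -/

/-! Put `s = 2p+3`, `r = s+2k`. The equation is studied on sine coefficients, where `e^{-iAt}`
multiplies by `e^{-iλ_j t}`. Derivatives in `x` and in `t` are handled as chains of primitives, so
that integration by parts is available with the last derivative merely integrable.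

Multiplication by `μ`. Integrating by parts `s` times against `sin(jπx)` shows that `j^s` times the
coefficients of `μφ`, `φ ∈ H^s_{(0)}`, is `b₀(φ) + (-1)^j b₁(φ)` plus a square summable sequence
(`exists_mul_decomposition`). The traces `b₀`, `b₁` are there because `μ^{(2p+1)}` is not assumed to
vanish at the ends. Hence `μφ` need not lie in `H^s_{(0)}`, but Duhamel integrals do: the
differences `λ_i - λ_j` are multiples of `π²`, so the exponentials `e^{iλ_j t}` are orthogonal on
intervals of length a multiple of `2/π`, and Bessel's inequality in time makes the trace terms
square summable in `j` (`exists_hidden_regularity`). In `H^{s-2}_{(0)}` no trace is left and `μ`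
acts boundedly.

Existence. Because `u ∈ H^k_0`, the Duhamel equation can be differentiated `k` times without
boundary terms; the `k`-th time derivative of the deviation from the free evolution solves a linear
Volterra equation in `C([0,T], H^s_{(0)})` (`exists_fixedPoint`, `exists_evolution`). At time `T`
the lower derivatives of `u` vanish again, so this `k`-th derivative equals `(-iA)^k` applied to the
deviation, which is therefore in `H^r_{(0)}` (`IsEvolution.exists_final`).

Remainder. With `w(t) = ψ(t) - e^{-iAt}φ₁`, the remainder of the final state is exactly `i e^{-iAT}
∫₀ᵀ e^{iAτ} u μ w dτ` (`coef_remainder`), and `w` with its first `k` time derivatives is of size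
`‖ψ₀ - φ₁‖ + ‖u‖` (`exists_state_bounds`). It remains to put the wanted norm on `u`. For `m ≥ 0`,
`m` integrations by parts in time exchange the weight `λ_j^m` for `m` derivatives of `u μ w`
(`exists_positive_estimate`). For `m = -(l+1)`, `u` is integrated `l+1` times; the derivatives fall
on `e^{iλ_j t}`, which the weaker weight absorbs, or on `w`, and the moment conditions leave only
the boundary term with `u₁(T)` (`exists_negative_estimate`). When all `k+1` derivatives fall on `w`,
which is only `C^k` in `H^s_{(0)}`, the equation itself gives the last one in `H^{s-2}_{(0)}`.
Finally `Π_{ψ_1(T)} P_J` does not increase the modulus of any coefficient, whence uniformity in `J`;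
the case `m = k` also gives differentiability. -/

/-- `F` is a primitive on `[0,T]` of the integrable function `f`. -/
structure IsPrim {E : Type*} [NormedAddCommGroup E] [NormedSpace ℝ E] (T : ℝ) (F f : ℝ → E) :
    Prop where
  integrable : IntervalIntegrable f volume 0 T
  eq : ∀ t ∈ Icc 0 T, F t = F 0 + ∫ τ in (0 : ℝ)..t, f τ

namespace IsPrim

section General

variable {E : Type*} [NormedAddCommGroup E] [NormedSpace ℝ E] {T : ℝ} {F f G g : ℝ → E}

theorem integrable_of_mem (h : IsPrim T F f) {t : ℝ} (ht : t ∈ Icc 0 T) :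
    IntervalIntegrable f volume 0 t :=
  h.integrable.mono_set (uIcc_subset_uIcc left_mem_uIcc (by rwa [uIcc_of_le (ht.1.trans ht.2)]))

theorem continuousOn (h : IsPrim T F f) : ContinuousOn F (Icc 0 T) := by
  rcases le_or_gt 0 T with hT | hT
  · have h1 := intervalIntegral.continuousOn_primitive_interval (μ := volume) (f := f) (a := 0)
      (b := T) (by
        rw [uIcc_of_le hT, integrableOn_Icc_iff_integrableOn_Ioc]
        exact h.integrable.1)
    rw [uIcc_of_le hT] at h1
    exact (continuousOn_const.add h1).congr fun t ht => h.eq t ht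
  · simp [Icc_eq_empty_of_lt hT]

theorem add (hF : IsPrim T F f) (hG : IsPrim T G g) :
    IsPrim T (fun t => F t + G t) fun t => f t + g t := by
  refine ⟨hF.integrable.add hG.integrable, fun t ht => ?_⟩
  rw [intervalIntegral.integral_add (hF.integrable_of_mem ht) (hG.integrable_of_mem ht),
    hF.eq t ht, hG.eq t ht]
  abel

theorem sum {ι : Type*} (s : Finset ι) {F f : ι → ℝ → E} (h : ∀ i ∈ s, IsPrim T (F i) (f i)) :
    IsPrim T (fun t => ∑ i ∈ s, F i t) fun t => ∑ i ∈ s, f i t := by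
  classical
  induction s using Finset.induction_on with
  | empty => exact ⟨by simp, by simp⟩
  | insert a s ha ih =>
    simp only [Finset.sum_insert ha]
    exact (h a (by simp)).add (ih fun i hi => h i (by simp [hi]))

theorem congr (h : IsPrim T F f) (hF : EqOn F G (Icc 0 T))
    (hf : ∀ᵐ t ∂volume.restrict (Ioo 0 T), f t = g t) (hT : 0 ≤ T) : IsPrim T G g := by
  have hae : f =ᵐ[volume.restrict (Ioc 0 T)] g := by
    rwa [← restrict_Ioo_eq_restrict_Ioc]
  refine ⟨?_, fun t ht => ?_⟩
  · refine h.integrable.congr_ae ?_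
    rwa [uIoc_of_le hT]
  · rw [← hF ht, ← hF (left_mem_Icc.2 hT), h.eq t ht]
    congr 1
    rw [intervalIntegral.integral_of_le ht.1, intervalIntegral.integral_of_le ht.1]
    exact integral_congr_ae (ae_mono (Measure.restrict_mono (Ioc_subset_Ioc_right ht.2) le_rfl) hae)

theorem clm {E' : Type*} [NormedAddCommGroup E'] [NormedSpace ℝ E'] [CompleteSpace E]
    [CompleteSpace E'] (h : IsPrim T F f) (L : E →L[ℝ] E') :
    IsPrim T (fun t => L (F t)) fun t => L (f t) := by
  refine ⟨⟨L.integrable_comp h.integrable.1, L.integrable_comp h.integrable.2⟩, fun t ht => ?_⟩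
  rw [h.eq t ht, map_add, L.intervalIntegral_comp_comm (h.integrable_of_mem ht)]

theorem integral_eq (h : IsPrim T F f) (hT : 0 ≤ T) : ∫ τ in (0 : ℝ)..T, f τ = F T - F 0 := by
  rw [h.eq T (right_mem_Icc.2 hT)]; abel

theorem of_continuousOn (hf : IntervalIntegrable f volume 0 T) (c : E) :
    IsPrim T (fun t => c + ∫ τ in (0 : ℝ)..t, f τ) f :=
  ⟨hf, fun t _ => by simp⟩

theorem of_hasDerivAt [CompleteSpace E] (h : ∀ t, HasDerivAt F (f t) t) (hf : Continuous f) :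
    IsPrim T F f := by
  refine ⟨hf.intervalIntegrable _ _, fun t _ => ?_⟩
  rw [intervalIntegral.integral_eq_sub_of_hasDerivAt (fun x _ => h x) (hf.intervalIntegrable _ _)]
  abel

end General

theorem const_mul {T : ℝ} {F f : ℝ → ℂ} (h : IsPrim T F f) (c : ℂ) :
    IsPrim T (fun t => c * F t) fun t => c * f t := by
  refine ⟨h.integrable.const_mul c, fun t ht => ?_⟩
  rw [intervalIntegral.integral_const_mul, h.eq t ht, mul_add]

theorem absolutelyContinuous_integral {a b : ℝ} {f : ℝ → ℂ} (h : IntervalIntegrable f volume a b) :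
    AbsolutelyContinuousOnInterval (fun t => ∫ τ in a..t, f τ) a b := by
  have hre : IntervalIntegrable (fun t => (f t).re) volume a b := ⟨h.1.re, h.2.re⟩
  have him : IntervalIntegrable (fun t => (f t).im) volume a b := ⟨h.1.im, h.2.im⟩
  have hc : ∀ c : ℂ, AbsolutelyContinuousOnInterval (fun _ : ℝ => c) a b := fun c =>
    (LipschitzWith.const c).lipschitzOnWith.absolutelyContinuousOnInterval
  -- The real and imaginary parts are treated separately and recombined as `re • 1 + im • I`.
  have h1 := ((hre.absolutelyContinuousOnInterval_intervalIntegral left_mem_uIcc).fun_smul (hc 1)).fun_add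
    ((him.absolutelyContinuousOnInterval_intervalIntegral left_mem_uIcc).fun_smul (hc Complex.I))
  have hE : EqOn (fun t => (∫ τ in a..t, (f τ).re) • (1 : ℂ) + (∫ τ in a..t, (f τ).im) • Complex.I)
      (fun t => ∫ τ in a..t, f τ) (uIcc a b) := by
    intro t ht
    have ht' : IntervalIntegrable f volume a t :=
      h.mono_set (uIcc_subset_uIcc left_mem_uIcc ht)
    have e1 := (Complex.reCLM.intervalIntegral_comp_comm ht')
    have e2 := (Complex.imCLM.intervalIntegral_comp_comm ht')
    simp only [Complex.reCLM_apply, Complex.imCLM_apply] at e1 e2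
    simp only [e1, e2]
    apply Complex.ext <;> simp
  rw [absolutelyContinuousOnInterval_iff] at h1 ⊢
  intro ε hε
  obtain ⟨δ, hδ, H⟩ := h1 ε hε
  refine ⟨δ, hδ, fun E hE' hs => ?_⟩
  convert H E hE' hs using 1
  refine Finset.sum_congr rfl fun i hi => ?_
  exact (congrArg₂ dist (hE (hE'.1 i hi).1) (hE (hE'.1 i hi).2)).symm

/-- Integration by parts with merely integrable derivatives. The product of the two primitives minus
the integral of the candidate derivative is absolutely continuous and has derivative zero almost
everywhere, hence is constant. -/
theorem mul {T : ℝ} (hT : 0 ≤ T) {F f G g : ℝ → ℂ} (hF : IsPrim T F f) (hG : IsPrim T G g) :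
    IsPrim T (fun t => F t * G t) fun t => f t * G t + F t * g t := by
  have hFc := hF.continuousOn
  have hGc := hG.continuousOn
  rw [← uIcc_of_le hT] at hFc hGc
  have hi : IntervalIntegrable (fun t => f t * G t + F t * g t) volume 0 T :=
    (hF.integrable.mul_continuousOn hGc).add (hG.integrable.continuousOn_mul hFc)
  refine ⟨hi, fun t ht => ?_⟩
  set F' : ℝ → ℂ := fun t => F 0 + ∫ τ in (0 : ℝ)..t, f τ with hF'
  set G' : ℝ → ℂ := fun t => G 0 + ∫ τ in (0 : ℝ)..t, g τ with hG'
  have hc : ∀ c : ℂ, AbsolutelyContinuousOnInterval (fun _ : ℝ => c) 0 T := fun c =>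
    (LipschitzWith.const c).lipschitzOnWith.absolutelyContinuousOnInterval
  have hFa : AbsolutelyContinuousOnInterval F' 0 T := (hc _).add (absolutelyContinuous_integral hF.integrable)
  have hGa : AbsolutelyContinuousOnInterval G' 0 T := (hc _).add (absolutelyContinuous_integral hG.integrable)
  have hP : AbsolutelyContinuousOnInterval
      (fun t => F' t * G' t - ∫ τ in (0 : ℝ)..t, (f τ * G τ + F τ * g τ)) 0 T :=
    (hFa.smul hGa).sub (absolutelyContinuous_integral hi)
  have h0 : ∀ᵐ x, x ∈ uIcc 0 T → HasDerivAt
      (fun t => F' t * G' t - ∫ τ in (0 : ℝ)..t, (f τ * G τ + F τ * g τ)) 0 x := by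
    filter_upwards [hF.integrable.ae_hasDerivAt_integral, hG.integrable.ae_hasDerivAt_integral,
      hi.ae_hasDerivAt_integral] with x h1 h2 h3 hx
    have e1 := (h1 hx 0 left_mem_uIcc).const_add (F 0)
    have e2 := (h2 hx 0 left_mem_uIcc).const_add (G 0)
    have e3 := (e1.mul e2).sub (h3 hx 0 left_mem_uIcc)
    rw [uIcc_of_le hT] at hx
    rw [← hF.eq x hx, ← hG.eq x hx, sub_self] at e3
    exact e3
  obtain ⟨C, hC⟩ := hP.const_of_ae_hasDerivAt_zero h0
  have h1 := hC 0 left_mem_uIcc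
  have h2 := hC t (by rwa [uIcc_of_le hT])
  simp only [hF', hG'] at h1 h2
  rw [← hF.eq t ht, ← hG.eq t ht] at h2
  simp only [intervalIntegral.integral_same, add_zero, sub_zero] at h1
  rw [h1]
  linear_combination h2

end IsPrim

/-! ### The Leibniz formula for chains of primitives -/

/-- The Leibniz expression of the `n`-th derivative of a product. -/
def leibniz (a b : ℕ → ℝ → ℂ) (n : ℕ) (t : ℝ) : ℂ :=
  ∑ ij ∈ Finset.HasAntidiagonal.antidiagonal n, (n.choose ij.1 : ℂ) * (a ij.1 t * b ij.2 t)

/-- The product rule in each term, followed by Pascal's identity. It serves three times: for `μφ` in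
space, for the control times the state in time, and for the exponential times the state in time. -/
theorem IsPrim.leibniz {T : ℝ} (hT : 0 ≤ T) {a b : ℕ → ℝ → ℂ} {n : ℕ}
    (ha : ∀ i ≤ n, IsPrim T (a i) (a (i + 1))) (hb : ∀ i ≤ n, IsPrim T (b i) (b (i + 1))) :
    IsPrim T (leibniz a b n) (leibniz a b (n + 1)) := by
  have h := IsPrim.sum (T := T) (Finset.HasAntidiagonal.antidiagonal n)
    (F := fun ij t => (n.choose ij.1 : ℂ) * (a ij.1 t * b ij.2 t))
    (f := fun ij t => (n.choose ij.1 : ℂ) * (a (ij.1 + 1) t * b ij.2 t + a ij.1 t * b (ij.2 + 1) t))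
    fun ij hij => by
      have := Finset.HasAntidiagonal.mem_antidiagonal.1 hij
      exact ((ha ij.1 (by omega)).mul hT (hb ij.2 (by omega))).const_mul _
  have e : BilinearSchrodinger.leibniz a b (n + 1) = fun t => ∑ ij ∈ Finset.HasAntidiagonal.antidiagonal n,
      (n.choose ij.1 : ℂ) * (a (ij.1 + 1) t * b ij.2 t + a ij.1 t * b (ij.2 + 1) t) := by
    funext t
    rw [BilinearSchrodinger.leibniz, Finset.sum_antidiagonal_choose_succ_mul
      (fun i j => a i t * b j t) n, add_comm, ← Finset.sum_add_distrib]
    refine Finset.sum_congr rfl fun ij hij => ?_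
    rw [Nat.choose_symm_of_eq_add (Finset.HasAntidiagonal.mem_antidiagonal.1 hij).symm]
    ring
  rw [e]
  exact h

/-! ### The sine basis and the spaces `H^s_{(0)}` -/

theorem orthonormal_mode : Orthonormal ℂ mode := by
  rw [orthonormal_iff_ite]
  exact fun i j => coeff_mode i j

/-- The Hilbert basis of eigenvectors. -/
def modeBasis : HilbertBasis ℕ+ ℂ L2 :=
  HilbertBasis.mkOfOrthogonalEqBot orthonormal_mode (by
    rw [Submodule.eq_bot_iff]
    intro φ hφ
    refine eq_zero_of_coeff_eq_zero φ fun j => ?_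
    exact (Submodule.mem_orthogonal _ _).1 hφ _ (Submodule.subset_span (mem_range_self j)))

theorem coe_modeBasis : ⇑modeBasis = mode := HilbertBasis.coe_mkOfOrthogonalEqBot _ _

theorem modeBasis_repr (φ : L2) (j : ℕ+) : modeBasis.repr φ j = coeff j φ := by
  rw [HilbertBasis.repr_apply_apply, coe_modeBasis, coeff]

theorem coeff_add (j : ℕ+) (φ χ : L2) : coeff j (φ + χ) = coeff j φ + coeff j χ :=
  inner_add_right _ _ _

theorem coeff_sub (j : ℕ+) (φ χ : L2) : coeff j (φ - χ) = coeff j φ - coeff j χ :=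
  inner_sub_right _ _ _

theorem coeff_smul (j : ℕ+) (c : ℂ) (φ : L2) : coeff j (c • φ) = c * coeff j φ :=
  inner_smul_right _ _ _

/-- `coeff j` as a continuous linear functional on `L²`. -/
def coeffCLM (j : ℕ+) : L2 →L[ℂ] ℂ := innerSL ℂ (mode j)

theorem coeffCLM_apply (j : ℕ+) (φ : L2) : coeffCLM j φ = coeff j φ := rfl

theorem coeff_ext {φ χ : L2} (h : ∀ j, coeff j φ = coeff j χ) : φ = χ :=
  sub_eq_zero.1 (eq_zero_of_coeff_eq_zero _ fun j => by rw [coeff_sub, h, sub_self])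

theorem hasSum_coeff (φ : L2) : HasSum (fun j => coeff j φ • mode j) φ := by
  have := modeBasis.hasSum_repr φ
  simpa only [modeBasis_repr, coe_modeBasis] using this

/-- Riesz–Fischer for the sine basis. -/
theorem exists_coeff_eq (c : ℕ+ → ℂ) (hc : Summable fun j => ‖c j‖ ^ 2) :
    ∃ φ : L2, ∀ j, coeff j φ = c j := by
  have hm : Memℓp c 2 := by
    rw [memℓp_gen_iff (by norm_num)]
    simpa using hc
  refine ⟨modeBasis.repr.symm ⟨c, hm⟩, fun j => ?_⟩
  rw [← modeBasis_repr, LinearIsometryEquiv.apply_symm_apply]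

theorem hasSum_norm_coeff_sq (φ : L2) : HasSum (fun j => ‖coeff j φ‖ ^ 2) (‖φ‖ ^ 2) := by
  have h := lp.hasSum_norm (p := 2) (by norm_num) (modeBasis.repr φ)
  simpa [modeBasis_repr] using h

theorem coeff_schrGroup (t : ℝ) (φ : L2) (j : ℕ+) :
    coeff j (schrGroup t φ) = Complex.exp (-Complex.I * eigenvalue j * t) * coeff j φ := by
  have hn : ∀ i : ℕ+, ‖Complex.exp (-Complex.I * eigenvalue i * t)‖ = 1 := fun i => by
    rw [show -Complex.I * eigenvalue i * t = ((-(eigenvalue i * t) : ℝ) : ℂ) * Complex.I by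
      push_cast; ring, Complex.norm_exp_ofReal_mul_I]
  -- The series defining `schrGroup t φ` is recognised as the expansion of the vector with these
  -- coefficients, which also settles its convergence.
  obtain ⟨χ, hχ⟩ := exists_coeff_eq
    (fun i => Complex.exp (-Complex.I * eigenvalue i * t) * coeff i φ) (by
      simpa only [norm_mul, hn, one_mul] using (hasSum_norm_coeff_sq φ).summable)
  have h := (hasSum_coeff χ).tsum_eq
  simp only [hχ] at h
  rw [schrGroup, h, hχ]

namespace HZero

variable {s : ℝ}

/-- The sine coefficients of an element of `H^s_{(0)}`. -/
def coef (j : ℕ+) (φ : HZero s) : ℂ := coeff j (toL2 φ)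

theorem coef_add (j : ℕ+) (φ χ : HZero s) : coef j (φ + χ) = coef j φ + coef j χ := by
  simp [coef, coeff_add]

theorem coef_sub (j : ℕ+) (φ χ : HZero s) : coef j (φ - χ) = coef j φ - coef j χ := by
  simp [coef, coeff_sub]

theorem coef_smul (j : ℕ+) (c : ℂ) (φ : HZero s) : coef j (c • φ) = c * coef j φ := by
  simp [coef, coeff_smul]

theorem coef_zero (j : ℕ+) : coef j (0 : HZero s) = 0 := by
  have := coef_smul j 0 (0 : HZero s)
  simpa using this

theorem coef_mode (i j : ℕ+) : coef i (mode s j) = if i = j then 1 else 0 := coeff_mode i j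

theorem coef_ext {φ χ : HZero s} (h : ∀ j, coef j φ = coef j χ) : φ = χ :=
  toL2_injective s (coeff_ext h)

theorem summable_sq (φ : HZero s) : Summable fun j : ℕ+ => ((j : ℝ) ^ s * ‖coef j φ‖) ^ 2 := φ.2

theorem norm_sq (φ : HZero s) : ‖φ‖ ^ 2 = ∑' j : ℕ+, ((j : ℝ) ^ s * ‖coef j φ‖) ^ 2 := by
  rw [norm_eq, hNorm, Real.sq_sqrt (tsum_nonneg fun j => by positivity)]
  rfl

theorem sum_le_norm_sq (φ : HZero s) (F : Finset ℕ+) :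
    ∑ j ∈ F, ((j : ℝ) ^ s * ‖coef j φ‖) ^ 2 ≤ ‖φ‖ ^ 2 := by
  rw [norm_sq]
  exact (summable_sq φ).sum_le_tsum F fun j _ => by positivity

theorem norm_le_of_sum_le {φ : HZero s} {B : ℝ} (hB : 0 ≤ B)
    (h : ∀ F : Finset ℕ+, ∑ j ∈ F, ((j : ℝ) ^ s * ‖coef j φ‖) ^ 2 ≤ B ^ 2) : ‖φ‖ ≤ B := by
  refine le_of_sq_le_sq ?_ hB
  rw [norm_sq]
  exact (summable_sq φ).tsum_le_of_sum_le h

theorem one_le_rpow (j : ℕ+) (hs : 0 ≤ s) : 1 ≤ (j : ℝ) ^ s :=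
  Real.one_le_rpow (Nat.one_le_cast.2 j.pos) hs

/-- Vectors of `H^s_{(0)}` are always produced from their coefficients in this way: a bound uniform
over finite sums gives both membership and the norm. The condition `0 ≤ s` ensures that the sequence
is already in `ℓ²`. -/
theorem exists_of_sum_le (hs : 0 ≤ s) (c : ℕ+ → ℂ) {B : ℝ} (hB : 0 ≤ B)
    (h : ∀ F : Finset ℕ+, ∑ j ∈ F, ((j : ℝ) ^ s * ‖c j‖) ^ 2 ≤ B ^ 2) :
    ∃ φ : HZero s, (∀ j, coef j φ = c j) ∧ ‖φ‖ ≤ B := by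
  have h1 : Summable fun j : ℕ+ => ((j : ℝ) ^ s * ‖c j‖) ^ 2 :=
    summable_of_sum_le (fun j => by positivity) h
  obtain ⟨φ, hφ⟩ := exists_coeff_eq c (Summable.of_nonneg_of_le (fun j => by positivity)
    (fun j => by
      have := one_le_rpow j hs
      gcongr
      exact le_mul_of_one_le_left (norm_nonneg _) this) h1)
  have hmem : φ ∈ hZeroSubmodule s := by
    change Summable _
    simpa only [hφ] using h1
  have hc : ∀ j, coef j (⟨φ, hmem⟩ : HZero s) = c j := hφ
  exact ⟨⟨φ, hmem⟩, hc, norm_le_of_sum_le hB fun F => by simpa only [hc] using h F⟩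

theorem norm_toL2_le (hs : 0 ≤ s) (φ : HZero s) : ‖toL2 φ‖ ≤ ‖φ‖ := by
  refine le_of_sq_le_sq ?_ (norm_nonneg _)
  rw [← (hasSum_norm_coeff_sq (toL2 φ)).tsum_eq, norm_sq]
  refine (hasSum_norm_coeff_sq (toL2 φ)).summable.tsum_le_tsum (fun j => ?_) (summable_sq φ)
  have := one_le_rpow j hs
  gcongr
  exact le_mul_of_one_le_left (norm_nonneg _) this

/-- The inclusion in `L²` as a continuous linear map. -/
def toL2CLM (hs : 0 ≤ s) : HZero s →L[ℂ] L2 :=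
  LinearMap.mkContinuous toL2 1 fun φ => by simpa using norm_toL2_le hs φ

/-- The `j`-th coefficient as a continuous linear functional. -/
def coefCLM (hs : 0 ≤ s) (j : ℕ+) : HZero s →L[ℂ] ℂ := (coeffCLM j).comp (toL2CLM hs)

theorem coefCLM_apply (hs : 0 ≤ s) (j : ℕ+) (φ : HZero s) : coefCLM hs j φ = coef j φ := rfl

/-- Needed for completeness of `H^s_{(0)}`; dividing a square summable sequence by `j^s ≥ 1` leaves
it square summable. -/
theorem toSeq_surjective (hs : 0 ≤ s) : Function.Surjective (toSeq s) := by
  intro x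
  have h0 : ∀ j : ℕ+, (0 : ℝ) < (j : ℝ) ^ s := fun j => Real.rpow_pos_of_pos (by exact_mod_cast j.pos) s
  have hn : ∀ j : ℕ+, (j : ℝ) ^ s * ‖(((j : ℝ) ^ s : ℝ) : ℂ)⁻¹ * x j‖ = ‖x j‖ := by
    intro j
    have := (h0 j).ne'
    rw [norm_mul, norm_inv, Complex.norm_real, Real.norm_of_nonneg (h0 j).le]
    field_simp
  obtain ⟨φ, hφ, -⟩ := exists_of_sum_le hs (fun j => (((j : ℝ) ^ s : ℝ) : ℂ)⁻¹ * x j)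
    (norm_nonneg x) (by
      intro F
      simp only [hn]
      have := lp.sum_rpow_le_norm_rpow (p := 2) (by norm_num) x F
      simpa using this)
  refine ⟨φ, ?_⟩
  ext j
  change (((j : ℝ) ^ s : ℝ) : ℂ) * coef j φ = x j
  rw [hφ, mul_inv_cancel_left₀]
  exact_mod_cast (h0 j).ne'

theorem completeSpace (hs : 0 ≤ s) : CompleteSpace (HZero s) := by
  let e : HZero s →ₗᵢ[ℂ] lp (fun _ : ℕ+ => ℂ) 2 := ⟨toSeq s, fun _ => rfl⟩
  have he : IsUniformInducing e := e.isometry.isUniformInducing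
  refine (he.completeSpace_congr (toSeq_surjective hs)).2 inferInstance

/-- Boundedness of Fourier multipliers. It yields the group, the inclusion `H^s ⊂ H^{s-2}`, the
operator `A`, and the powers `(-iA)^n`. -/
theorem exists_diag {r s : ℝ} (hr : 0 ≤ r) (m : ℕ+ → ℂ) {C : ℝ} (hC : 0 ≤ C)
    (h : ∀ j : ℕ+, (j : ℝ) ^ r * ‖m j‖ ≤ C * (j : ℝ) ^ s) :
    ∃ D : HZero s →L[ℂ] HZero r, (∀ j φ, coef j (D φ) = m j * coef j φ) ∧
      ∀ φ, ‖D φ‖ ≤ C * ‖φ‖ := by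
  have key : ∀ φ : HZero s, ∃ χ : HZero r, (∀ j, coef j χ = m j * coef j φ) ∧ ‖χ‖ ≤ C * ‖φ‖ := by
    intro φ
    refine exists_of_sum_le hr _ (by positivity) fun F => ?_
    rw [mul_pow]
    refine le_trans ?_ (mul_le_mul_of_nonneg_left (sum_le_norm_sq φ F) (sq_nonneg C))
    rw [Finset.mul_sum]
    refine Finset.sum_le_sum fun j _ => ?_
    rw [← mul_pow, norm_mul, ← mul_assoc, ← mul_assoc]
    exact pow_le_pow_left₀ (by positivity) (mul_le_mul_of_nonneg_right (h j) (norm_nonneg _)) 2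
  choose D hD hDn using key
  refine ⟨LinearMap.mkContinuous ⟨⟨D, fun φ χ => ?_⟩, fun c φ => ?_⟩ C hDn, fun j φ => hD φ j, hDn⟩
  · refine coef_ext fun j => ?_
    rw [coef_add, hD, hD, hD, coef_add, mul_add]
  · refine coef_ext fun j => ?_
    rw [RingHom.id_apply, coef_smul, hD, hD, coef_smul]
    ring

theorem coef_finsuppSum (a : ℕ+ →₀ ℂ) (j : ℕ+) :
    coef j (a.linearCombination ℂ (mode s)) = a j := by
  induction a using Finsupp.induction_linear with
  | zero => simp [coef_zero]
  | add f g hf hg => rw [map_add, coef_add, hf, hg, Finsupp.add_apply]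
  | single i c =>
    rw [Finsupp.linearCombination_single, coef_smul, coef_mode, Finsupp.single_apply]
    simp [eq_comm]

/-- Truncations of the sine series converge in `H^s_{(0)}`: the squared norm of the error is a tail
of a convergent series. This allows estimates to be proved for finite sums and then extended. -/
theorem denseRange_linearCombination :
    DenseRange (Finsupp.linearCombination ℂ (mode s)) := by
  classical
  intro φ
  rw [Metric.mem_closure_iff]
  intro ε hε
  obtain ⟨F, hF⟩ := ((tendsto_order.1 (summable_sq φ).hasSum).1
    (∑' j : ℕ+, ((j : ℝ) ^ s * ‖coef j φ‖) ^ 2 - (ε / 2) ^ 2)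
    (by have := sq_pos_of_pos (half_pos hε); linarith)).exists
  obtain ⟨a, ha⟩ : ∃ a : ℕ+ →₀ ℂ, ∀ j, a j = if j ∈ F then coef j φ else 0 :=
    ⟨Finsupp.onFinset F (fun j => if j ∈ F then coef j φ else 0)
      (fun j hj => by by_contra h; simp [h] at hj), fun j => rfl⟩
  refine ⟨_, ⟨a, rfl⟩, ?_⟩
  rw [dist_eq_norm]
  refine lt_of_le_of_lt (norm_le_of_sum_le (B := ε / 2) (by positivity) fun G => ?_)
    (half_lt_self hε)
  have h1 := (summable_sq φ).sum_le_tsum (F ∪ (G \ F)) fun j _ => by positivity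
  rw [Finset.sum_union Finset.disjoint_sdiff] at h1
  have h2 : ∑ j ∈ G, ((j : ℝ) ^ s * ‖coef j (φ - Finsupp.linearCombination ℂ (mode s) a)‖) ^ 2 =
      ∑ j ∈ G \ F, ((j : ℝ) ^ s * ‖coef j φ‖) ^ 2 := by
    rw [Finset.sdiff_eq_filter, Finset.sum_filter]
    refine Finset.sum_congr rfl fun j _ => ?_
    rw [coef_sub, coef_finsuppSum, ha]
    by_cases hj : j ∈ F <;> simp [hj]
  rw [h2]
  linarith

/-! ### The Schrödinger group on `H^s_{(0)}` -/

theorem norm_exp_eigenvalue (j : ℕ+) (t : ℝ) :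
    ‖Complex.exp (-Complex.I * eigenvalue j * t)‖ = 1 := by
  rw [show -Complex.I * eigenvalue j * t = ((-(eigenvalue j * t) : ℝ) : ℂ) * Complex.I by
    push_cast; ring, Complex.norm_exp_ofReal_mul_I]

theorem exists_group (hs : 0 ≤ s) (t : ℝ) : ∃ D : HZero s →L[ℂ] HZero s,
    (∀ j φ, coef j (D φ) = Complex.exp (-Complex.I * eigenvalue j * t) * coef j φ) ∧
      ∀ φ, ‖D φ‖ ≤ 1 * ‖φ‖ :=
  exists_diag hs _ zero_le_one fun j => by rw [norm_exp_eigenvalue, one_mul, mul_one]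

/-- The group `e^{-iAt}` on `H^s_{(0)}`. -/
def group (hs : 0 ≤ s) (t : ℝ) : HZero s →L[ℂ] HZero s := (exists_group hs t).choose

theorem coef_group (hs : 0 ≤ s) (t : ℝ) (j : ℕ+) (φ : HZero s) :
    coef j (group hs t φ) = Complex.exp (-Complex.I * eigenvalue j * t) * coef j φ :=
  (exists_group hs t).choose_spec.1 j φ

theorem norm_group_le (hs : 0 ≤ s) (t : ℝ) (φ : HZero s) : ‖group hs t φ‖ ≤ ‖φ‖ := by
  exact ((exists_group hs t).choose_spec.2 φ).trans_eq (one_mul _)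

/-- Dominated convergence in the series of squares: each term tends to zero and is at most `4` times
the corresponding term of `‖φ‖²`. -/
theorem continuous_group_apply (hs : 0 ≤ s) (φ : HZero s) :
    Continuous fun t => group hs t φ := by
  rw [continuous_iff_continuousAt]
  intro t
  rw [ContinuousAt, tendsto_iff_norm_sub_tendsto_zero]
  have h : Filter.Tendsto (fun r => ‖group hs r φ - group hs t φ‖ ^ 2) (nhds t) (nhds 0) := by
    simp only [norm_sq, coef_sub, coef_group]
    have h0 : (0 : ℝ) = ∑' j : ℕ+, (0 : ℝ) := by simp
    rw [h0]
    refine tendsto_tsum_of_dominated_convergence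
      (bound := fun j : ℕ+ => 4 * ((j : ℝ) ^ s * ‖coef j φ‖) ^ 2)
      ((summable_sq φ).mul_left 4) (fun j => ?_) (Filter.Eventually.of_forall fun r j => ?_)
    · have hc : Continuous fun r : ℝ => ((j : ℝ) ^ s * ‖Complex.exp (-Complex.I * eigenvalue j * r) *
          coef j φ - Complex.exp (-Complex.I * eigenvalue j * t) * coef j φ‖) ^ 2 := by fun_prop
      have := hc.tendsto t
      simpa using this
    · have h1 : ‖Complex.exp (-Complex.I * eigenvalue j * r) * coef j φ -
          Complex.exp (-Complex.I * eigenvalue j * t) * coef j φ‖ ≤ 2 * ‖coef j φ‖ := by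
        refine (norm_sub_le _ _).trans ?_
        rw [norm_mul, norm_mul, norm_exp_eigenvalue, norm_exp_eigenvalue]
        linarith
      rw [Real.norm_of_nonneg (by positivity)]
      calc _ ≤ ((j : ℝ) ^ s * (2 * ‖coef j φ‖)) ^ 2 := by gcongr
        _ = _ := by ring
  have h2 := h.sqrt
  simpa [Real.sqrt_sq] using h2

theorem continuousOn_group (hs : 0 ≤ s) {S : Set ℝ} {f : ℝ → HZero s} (hf : ContinuousOn f S)
    {a : ℝ → ℝ} (ha : ContinuousOn a S) : ContinuousOn (fun t => group hs (a t) (f t)) S := by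
  intro t ht
  have h1 : Filter.Tendsto (fun r => group hs (a r) (f t)) (nhdsWithin t S)
      (nhds (group hs (a t) (f t))) :=
    ((continuous_group_apply hs (f t)).tendsto (a t)).comp (ha t ht)
  have h2 : Filter.Tendsto (fun r => group hs (a r) (f r - f t)) (nhdsWithin t S) (nhds 0) := by
    refine squeeze_zero_norm (fun r => norm_group_le hs _ _) ?_
    exact tendsto_iff_norm_sub_tendsto_zero.1 (hf t ht)
  have h3 := h1.add h2
  simp only [← map_add, add_sub_cancel, add_zero] at h3
  exact h3

theorem exists_toL2_eq (φ : L2) : ∃ χ : HZero 0, toL2 χ = φ ∧ ‖χ‖ ≤ ‖φ‖ := by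
  obtain ⟨χ, hχ, hn⟩ := exists_of_sum_le (s := 0) le_rfl (fun j => coeff j φ) (norm_nonneg φ)
    (fun F => by
      simp only [Real.rpow_zero, one_mul]
      rw [← (hasSum_norm_coeff_sq φ).tsum_eq]
      exact (hasSum_norm_coeff_sq φ).summable.sum_le_tsum F fun j _ => by positivity)
  exact ⟨χ, coeff_ext hχ, hn⟩

end HZero

/-- Transferred from the group on `H^0_{(0)}`, which is `L²(0,1)` with the same norm. -/
theorem continuousOn_schrGroup {S : Set ℝ} {f : ℝ → L2} (hf : ContinuousOn f S)
    {a : ℝ → ℝ} (ha : ContinuousOn a S) : ContinuousOn (fun t => schrGroup (a t) (f t)) S := by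
  choose g hg hgn using HZero.exists_toL2_eq
  have hsub : ∀ φ χ, g φ - g χ = g (φ - χ) := fun φ χ => HZero.toL2_injective 0 (by
    rw [map_sub, hg, hg]; exact (hg _).symm)
  have hgc : Continuous g := by
    rw [continuous_iff_continuousAt]
    intro φ
    rw [ContinuousAt, tendsto_iff_norm_sub_tendsto_zero]
    refine squeeze_zero (g := fun χ => ‖χ - φ‖) (fun χ => norm_nonneg _)
      (fun χ => by rw [hsub]; exact hgn _) ?_
    exact tendsto_iff_norm_sub_tendsto_zero.1 Filter.tendsto_id
  have h := (HZero.toL2CLM le_rfl).continuous.comp_continuousOn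
    (HZero.continuousOn_group le_rfl (hgc.comp_continuousOn hf) ha)
  refine h.congr fun t _ => coeff_ext fun j => ?_
  rw [coeff_schrGroup]
  change _ = HZero.coef j _
  rw [HZero.coef_group]
  change _ = _ * coeff j (HZero.toL2 (g (f t)))
  rw [hg]

/-! ### Cauchy–Schwarz and Bessel inequalities -/

theorem norm_toLp_sq {α 𝕜 : Type*} [RCLike 𝕜] [MeasurableSpace α] {ν : Measure α} {f : α → 𝕜}
    (hf : MemLp f 2 ν) : ‖hf.toLp f‖ ^ 2 = ∫ x, ‖f x‖ ^ 2 ∂ν := by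
  rw [← inner_self_eq_norm_sq (𝕜 := 𝕜), L2.inner_def]
  have h : ∫ x, inner 𝕜 (hf.toLp f x) (hf.toLp f x) ∂ν = ∫ x, ((‖f x‖ ^ 2 : ℝ) : 𝕜) ∂ν := by
    refine integral_congr_ae ?_
    filter_upwards [hf.coeFn_toLp] with x hx
    rw [hx, inner_self_eq_norm_sq_to_K]
    norm_cast
  rw [h, integral_ofReal, RCLike.ofReal_re]

theorem norm_Lp_sq {α 𝕜 : Type*} [RCLike 𝕜] [MeasurableSpace α] {ν : Measure α} (f : Lp 𝕜 2 ν) :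
    ‖f‖ ^ 2 = ∫ x, ‖f x‖ ^ 2 ∂ν := by
  have := norm_toLp_sq (Lp.memLp f)
  rwa [Lp.toLp_coeFn] at this

theorem inner_toLp {α : Type*} [MeasurableSpace α] {ν : Measure α} {f g : α → ℂ}
    (hf : MemLp f 2 ν) (hg : MemLp g 2 ν) :
    inner ℂ (hf.toLp f) (hg.toLp g) = ∫ x, (starRingEnd ℂ) (f x) * g x ∂ν := by
  rw [L2.inner_def]
  refine integral_congr_ae ?_
  filter_upwards [hf.coeFn_toLp, hg.coeFn_toLp] with x hx hx'
  rw [hx, hx', RCLike.inner_apply, mul_comm]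

theorem norm_integral_mul_sq_le {α : Type*} [MeasurableSpace α] {ν : Measure α} {f g : α → ℂ}
    (hf : MemLp f 2 ν) (hg : MemLp g 2 ν) :
    ‖∫ x, f x * g x ∂ν‖ ^ 2 ≤ (∫ x, ‖f x‖ ^ 2 ∂ν) * ∫ x, ‖g x‖ ^ 2 ∂ν := by
  have hf' : MemLp (fun x => (starRingEnd ℂ) (f x)) 2 ν := hf.star
  have h := inner_toLp hf' hg
  simp only [Complex.conj_conj] at h
  have h2 := norm_toLp_sq hf'
  simp only [RCLike.norm_conj] at h2
  rw [← h, ← h2, ← norm_toLp_sq hg, ← mul_pow]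
  gcongr
  exact norm_inner_le_norm _ _

/-- Minkowski's inequality: the `ℓ²` norm of an integral is at most the integral of the `ℓ²` norms.
It follows from Cauchy–Schwarz after writing `|g| = √|g| · √|g|`, so `g` only has to be integrable.
-/
theorem sum_norm_integral_mul_sq_le {α ι : Type*} [MeasurableSpace α] {ν : Measure α}
    (F : Finset ι) {g : α → ℝ} (hg : Integrable g ν) {c : ι → α → ℂ}
    (hc : ∀ j ∈ F, AEStronglyMeasurable (c j) ν) {B : ℝ} (hB : 0 ≤ B)
    (h : ∀ᵐ x ∂ν, ∑ j ∈ F, ‖c j x‖ ^ 2 ≤ B ^ 2) :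
    ∑ j ∈ F, ‖∫ x, (g x : ℂ) * c j x ∂ν‖ ^ 2 ≤ (B * ∫ x, |g x| ∂ν) ^ 2 := by
  have hsq : ∀ x, ‖((Real.sqrt |g x| : ℝ) : ℂ)‖ ^ 2 = |g x| := fun x => by
    rw [Complex.norm_real, Real.norm_of_nonneg (Real.sqrt_nonneg _), Real.sq_sqrt (abs_nonneg _)]
  have hgm : AEStronglyMeasurable (fun x => ((Real.sqrt |g x| : ℝ) : ℂ)) ν :=
    (Complex.continuous_ofReal.comp (Real.continuous_sqrt.comp continuous_abs)).comp_aestronglyMeasurable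
      hg.1
  have h1 : MemLp (fun x => ((Real.sqrt |g x| : ℝ) : ℂ)) 2 ν := by
    rw [memLp_two_iff_integrable_sq_norm hgm]
    simpa only [hsq] using hg.abs
  have hle : ∀ j ∈ F, ∀ᵐ x ∂ν, ‖c j x‖ ≤ B := fun j hj => by
    filter_upwards [h] with x hx
    refine le_of_sq_le_sq (le_trans ?_ hx) hB
    exact Finset.single_le_sum (f := fun j => ‖c j x‖ ^ 2) (fun i _ => by positivity) hj
  have hint : ∀ j ∈ F, Integrable (fun x => |g x| * ‖c j x‖ ^ 2) ν := fun j hj => by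
    refine hg.abs.mul_bdd (c := B ^ 2) ((hc j hj).norm.pow 2) ?_
    filter_upwards [hle j hj] with x hx
    rw [Real.norm_of_nonneg (by positivity)]
    gcongr
  have h2 : ∀ j ∈ F, ‖∫ x, (g x : ℂ) * c j x ∂ν‖ ^ 2 ≤
      (∫ x, |g x| ∂ν) * ∫ x, |g x| * ‖c j x‖ ^ 2 ∂ν := by
    intro j hj
    have hn2 : ∀ x, ‖((Real.sqrt |g x| : ℝ) : ℂ) * (‖c j x‖ : ℝ)‖ ^ 2 = |g x| * ‖c j x‖ ^ 2 := by
      intro x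
      rw [norm_mul, mul_pow, hsq, Complex.norm_real, norm_norm]
    have hm2 : MemLp (fun x => ((Real.sqrt |g x| : ℝ) : ℂ) * (‖c j x‖ : ℝ)) 2 ν := by
      have hm : AEStronglyMeasurable (fun x => ((Real.sqrt |g x| : ℝ) : ℂ) * (‖c j x‖ : ℝ)) ν :=
        hgm.mul (Complex.continuous_ofReal.comp_aestronglyMeasurable (hc j hj).norm)
      rw [memLp_two_iff_integrable_sq_norm hm]
      simpa only [hn2] using hint j hj
    have h3 := norm_integral_mul_sq_le h1 hm2
    have e1 : ∀ x, ((Real.sqrt |g x| : ℝ) : ℂ) * (((Real.sqrt |g x| : ℝ) : ℂ) * (‖c j x‖ : ℝ)) =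
        ((|g x| * ‖c j x‖ : ℝ) : ℂ) := by
      intro x
      rw [← mul_assoc, ← Complex.ofReal_mul, Real.mul_self_sqrt (abs_nonneg _), Complex.ofReal_mul]
    simp only [e1, hn2, hsq] at h3
    rw [integral_complex_ofReal, Complex.norm_real, Real.norm_of_nonneg
      (integral_nonneg fun x => by positivity)] at h3
    refine le_trans ?_ h3
    gcongr
    refine (norm_integral_le_integral_norm _).trans_eq ?_
    simp only [norm_mul, Complex.norm_real, Real.norm_eq_abs]
  calc ∑ j ∈ F, ‖∫ x, (g x : ℂ) * c j x ∂ν‖ ^ 2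
      ≤ ∑ j ∈ F, (∫ x, |g x| ∂ν) * ∫ x, |g x| * ‖c j x‖ ^ 2 ∂ν := Finset.sum_le_sum h2
    _ = (∫ x, |g x| ∂ν) * ∫ x, |g x| * ∑ j ∈ F, ‖c j x‖ ^ 2 ∂ν := by
      rw [← Finset.mul_sum, ← integral_finsetSum F hint]
      simp only [Finset.mul_sum]
    _ ≤ (∫ x, |g x| ∂ν) * ∫ x, |g x| * B ^ 2 ∂ν := by
      refine mul_le_mul_of_nonneg_left ?_ (integral_nonneg fun x => abs_nonneg _)
      refine integral_mono_ae ?_ (hg.abs.mul_const _) ?_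
      · simp only [Finset.mul_sum]
        exact integrable_finsetSum F hint
      · filter_upwards [h] with x hx
        gcongr
    _ = _ := by rw [integral_mul_const]; ring

/-- Bessel's inequality for an orthogonal system of continuous functions on an interval. -/
theorem bessel_Ioo {ι : Type*} [DecidableEq ι] {a b c : ℝ} (hc : 0 < c) {e : ι → ℝ → ℂ}
    (he : ∀ i, MemLp (e i) 2 (volume.restrict (Ioo a b)))
    (ho : ∀ i j, ∫ x in Ioo a b, (starRingEnd ℂ) (e i x) * e j x = if i = j then (c : ℂ) else 0)
    {g : ℝ → ℂ} (hg : MemLp g 2 (volume.restrict (Ioo a b))) (F : Finset ι) :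
    ∑ i ∈ F, ‖∫ x in Ioo a b, (starRingEnd ℂ) (e i x) * g x‖ ^ 2 ≤
      c * ∫ x in Ioo a b, ‖g x‖ ^ 2 := by
  have hs : Real.sqrt c ≠ 0 := (Real.sqrt_pos.2 hc).ne'
  have hv : Orthonormal ℂ fun i => ((Real.sqrt c : ℝ) : ℂ)⁻¹ • (he i).toLp (e i) := by
    rw [orthonormal_iff_ite]
    intro i j
    rw [inner_smul_left, inner_smul_right, inner_toLp, ho]
    split_ifs
    · have h2 : (c : ℂ) = ((Real.sqrt c : ℝ) : ℂ) * ((Real.sqrt c : ℝ) : ℂ) := by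
        rw [← Complex.ofReal_mul, Real.mul_self_sqrt hc.le]
      have hs' : ((Real.sqrt c : ℝ) : ℂ) ≠ 0 := by exact_mod_cast hs
      rw [map_inv₀, Complex.conj_ofReal]
      rw [h2]
      field_simp
    · simp
  have h := hv.sum_inner_products_le (hg.toLp g) (s := F)
  rw [norm_toLp_sq hg] at h
  simp only [inner_smul_left, inner_toLp, norm_mul, mul_pow] at h
  rw [← Finset.mul_sum] at h
  have h3 : ‖(starRingEnd ℂ) ((Real.sqrt c : ℝ) : ℂ)⁻¹‖ ^ 2 = c⁻¹ := by
    rw [RCLike.norm_conj, norm_inv, Complex.norm_real, Real.norm_of_nonneg (Real.sqrt_nonneg _),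
      inv_pow, Real.sq_sqrt hc.le]
  rw [h3] at h
  calc _ = c * (c⁻¹ * ∑ i ∈ F, ‖∫ x in Ioo a b, (starRingEnd ℂ) (e i x) * g x‖ ^ 2) := by
        field_simp
    _ ≤ _ := by gcongr

/-- Since `λ_i - λ_j = π²(i² - j²)`, the quotients of two exponentials `e^{iλ_j t}` are periodic of
period `2/π`; this is what makes the exponentials orthogonal. -/
theorem eigenvalue_sub_mul (i j : ℕ+) (n : ℕ) :
    (eigenvalue i - eigenvalue j) * (n * (2 / Real.pi)) =
      (((n : ℤ) * ((i : ℤ) ^ 2 - (j : ℤ) ^ 2) : ℤ) : ℝ) * (2 * Real.pi) := by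
  have := Real.pi_ne_zero
  simp only [eigenvalue]
  push_cast
  field_simp

theorem eigenvalue_injective : Function.Injective eigenvalue := by
  intro i j h
  simp only [eigenvalue] at h
  have h1 := (sq_eq_sq₀ (by positivity) (by positivity)).1 h
  have h2 := mul_right_cancel₀ Real.pi_ne_zero h1
  exact PNat.coe_injective (by exact_mod_cast h2)

/-- The Bessel inequality for the exponentials `e^{iλ_j t}` on `(0,T)`. -/
theorem exists_bessel_exp {T : ℝ} (hT : 0 < T) : ∃ C : ℝ, 0 < C ∧ ∀ g : ℝ → ℂ,
    MemLp g 2 (volume.restrict (Ioo 0 T)) → ∀ F : Finset ℕ+,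
      ∑ j ∈ F, ‖∫ t in Ioo 0 T, Complex.exp (Complex.I * eigenvalue j * t) * g t‖ ^ 2 ≤
        C * ∫ t in Ioo 0 T, ‖g t‖ ^ 2 := by
  -- The interval is enlarged to `(0,P)`, with `P ≥ T` a multiple of `2/π`, where the exponentials
  -- are orthogonal with squared norm `P`; the function `g` is extended by zero.
  obtain ⟨n, hn⟩ := exists_nat_ge (T / (2 / Real.pi))
  have hpi := Real.pi_pos
  set P : ℝ := n * (2 / Real.pi) with hP
  have hTP : T ≤ P := by rwa [div_le_iff₀ (by positivity)] at hn
  have hP0 : 0 < P := hT.trans_le hTP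
  refine ⟨P, hP0, fun g hg F => ?_⟩
  have hconj : ∀ (j : ℕ+) (t : ℝ), (starRingEnd ℂ) (Complex.exp (-Complex.I * eigenvalue j * t)) =
      Complex.exp (Complex.I * eigenvalue j * t) := by
    intro j t
    rw [← Complex.exp_conj]
    simp
  have he : ∀ j : ℕ+, MemLp (fun t : ℝ => Complex.exp (-Complex.I * eigenvalue j * t)) 2
      (volume.restrict (Ioo 0 P)) := fun j =>
    MemLp.of_bound (C := 1) (Continuous.aestronglyMeasurable (by fun_prop))
      (Filter.Eventually.of_forall fun t => (HZero.norm_exp_eigenvalue j t).le)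
  have hsub : Ioo 0 T ⊆ Ioo 0 P := Ioo_subset_Ioo_right hTP
  have hgP : MemLp ((Ioo 0 T).indicator g) 2 (volume.restrict (Ioo 0 P)) := by
    rw [memLp_indicator_iff_restrict measurableSet_Ioo, Measure.restrict_restrict measurableSet_Ioo,
      inter_eq_left.2 hsub]
    exact hg
  have ho : ∀ i j : ℕ+, ∫ x in Ioo 0 P, (starRingEnd ℂ) (Complex.exp (-Complex.I * eigenvalue i * x)) *
      Complex.exp (-Complex.I * eigenvalue j * x) = if i = j then (P : ℂ) else 0 := by
    intro i j
    have e1 : ∀ x : ℝ, (starRingEnd ℂ) (Complex.exp (-Complex.I * eigenvalue i * x)) *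
      Complex.exp (-Complex.I * eigenvalue j * x) =
        Complex.exp ((Complex.I * (eigenvalue i - eigenvalue j : ℝ)) * x) := by
      intro x
      rw [hconj, ← Complex.exp_add]
      congr 1
      push_cast
      ring
    simp only [e1]
    rw [← integral_Ioc_eq_integral_Ioo, ← intervalIntegral.integral_of_le hP0.le]
    split_ifs with hij
    · simp [hij]
    · have hne : (Complex.I * (eigenvalue i - eigenvalue j : ℝ)) ≠ 0 :=
        mul_ne_zero Complex.I_ne_zero (by
          exact_mod_cast sub_ne_zero.2 fun h => hij (eigenvalue_injective h))
      rw [integral_exp_mul_complex hne]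
      have e2 : Complex.I * (eigenvalue i - eigenvalue j : ℝ) * P =
          (((n : ℤ) * ((i : ℤ) ^ 2 - (j : ℤ) ^ 2) : ℤ) : ℂ) * (2 * Real.pi * Complex.I) := by
        have := congrArg (fun x : ℝ => (x : ℂ)) (eigenvalue_sub_mul i j n)
        simp only [← hP] at this
        push_cast at this ⊢
        linear_combination Complex.I * this
      rw [e2, Complex.exp_int_mul_two_pi_mul_I]
      simp
  have h := bessel_Ioo hP0 he ho hgP F
  have e3 : ∀ j : ℕ+, ∫ x in Ioo 0 P, (starRingEnd ℂ) (Complex.exp (-Complex.I * eigenvalue j * x)) *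
      (Ioo 0 T).indicator g x = ∫ t in Ioo 0 T, Complex.exp (Complex.I * eigenvalue j * t) * g t := by
    intro j
    have : ∀ x : ℝ, Complex.exp (Complex.I * eigenvalue j * x) * (Ioo 0 T).indicator g x =
        (Ioo 0 T).indicator (fun x : ℝ => Complex.exp (Complex.I * eigenvalue j * x) * g x) x := by
      intro x
      by_cases hx : x ∈ Ioo 0 T <;> simp [hx]
    simp only [hconj, this]
    rw [setIntegral_indicator measurableSet_Ioo, inter_eq_right.2 hsub]
  have e4 : ∫ x in Ioo 0 P, ‖(Ioo 0 T).indicator g x‖ ^ 2 = ∫ t in Ioo 0 T, ‖g t‖ ^ 2 := by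
    have : ∀ x, ‖(Ioo 0 T).indicator g x‖ ^ 2 = (Ioo 0 T).indicator (fun x => ‖g x‖ ^ 2) x := by
      intro x
      by_cases hx : x ∈ Ioo 0 T <;> simp [hx]
    simp only [this]
    rw [setIntegral_indicator measurableSet_Ioo, inter_eq_right.2 hsub]
  simpa only [e3, e4] using h

/-! ### Weak derivatives on an interval -/

theorem IsTestFunction.eq_zero {a b : ℝ} {φ : ℝ → ℝ} (h : IsTestFunction a b φ) {x : ℝ}
    (hx : x ∉ Ioo a b) : φ x = 0 :=
  image_eq_zero_of_notMem_tsupport fun hx' => hx (h.2.2 hx')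

theorem IsTestFunction.integral_Ioo {a b : ℝ} {φ : ℝ → ℝ} (h : IsTestFunction a b φ) (f : ℝ → ℝ) :
    ∫ x in Ioo a b, f x * φ x = ∫ x, f x * φ x := by
  refine setIntegral_eq_integral_of_forall_compl_eq_zero fun x hx => ?_
  rw [h.eq_zero hx, mul_zero]

theorem IsTestFunction.deriv {a b : ℝ} {φ : ℝ → ℝ} (h : IsTestFunction a b φ) :
    IsTestFunction a b (deriv φ) :=
  ⟨(contDiff_infty_iff_deriv.1 h.1).2, h.2.1.deriv, (tsupport_deriv_subset (𝕜 := ℝ)).trans h.2.2⟩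

theorem exists_isTestFunction_integral_eq_one {a b : ℝ} (hab : a < b) :
    ∃ η : ℝ → ℝ, IsTestFunction a b η ∧ ∫ x, η x = 1 := by
  let f : ContDiffBump ((a + b) / 2) := ⟨(b - a) / 8, (b - a) / 4, by linarith, by linarith⟩
  refine ⟨f.normed volume, ⟨f.contDiff_normed, f.hasCompactSupport_normed, ?_⟩, f.integral_normed⟩
  rw [f.tsupport_normed_eq, Real.closedBall_eq_Icc]
  intro x hx
  have h1 : (a + b) / 2 - (b - a) / 4 ≤ x := hx.1
  have h2 : x ≤ (a + b) / 2 + (b - a) / 4 := hx.2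
  constructor <;> linarith

/-- The primitive from `a` is zero to the left of the support and equal to the total integral, which
is zero, to its right. -/
theorem IsTestFunction.exists_primitive {a b : ℝ} (hab : a < b) {θ : ℝ → ℝ}
    (h : IsTestFunction a b θ) (h0 : ∫ x, θ x = 0) :
    ∃ Φ : ℝ → ℝ, IsTestFunction a b Φ ∧ _root_.deriv Φ = θ := by
  have hcont : Continuous θ := h.1.continuous
  have hint : Integrable θ := hcont.integrable_of_hasCompactSupport h.2.1
  obtain ⟨c, d, hc, hd, hcd⟩ : ∃ c d : ℝ, a < c ∧ d < b ∧ tsupport θ ⊆ Icc c d := by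
    rcases (tsupport θ).eq_empty_or_nonempty with he | hne
    -- For `θ = 0` the empty interval `Icc b a` is taken as the hull of the support.
    · exact ⟨b, a, hab, hab, by simp [he]⟩
    · obtain ⟨c, hc⟩ := (h.2.1 : IsCompact (tsupport θ)).exists_isLeast hne
      obtain ⟨d, hd⟩ := (h.2.1 : IsCompact (tsupport θ)).exists_isGreatest hne
      exact ⟨c, d, (h.2.2 hc.1).1, (h.2.2 hd.1).2, fun x hx => ⟨hc.2 hx, hd.2 hx⟩⟩
  have hz : ∀ x, x ∉ Icc c d → θ x = 0 := fun x hx =>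
    image_eq_zero_of_notMem_tsupport fun hx' => hx (hcd hx')
  set Φ : ℝ → ℝ := fun x => ∫ y in a..x, θ y with hΦ
  have hder : ∀ x, HasDerivAt Φ (θ x) x := fun x =>
    intervalIntegral.integral_hasDerivAt_right (hcont.intervalIntegrable _ _)
      (hcont.stronglyMeasurableAtFilter _ _) hcont.continuousAt
  have hd' : _root_.deriv Φ = θ := funext fun x => (hder x).deriv
  have hsupp : ∀ x, x ∉ Icc c d → Φ x = 0 := by
    intro x hx
    rw [mem_Icc, not_and_or, not_le, not_le] at hx
    rcases hx with hx | hx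
    · have : ∀ y ∈ uIcc a x, θ y = 0 := fun y hy => hz y fun hy' => by
        have := hy.2
        rcases le_max_iff.1 this with h3 | h3
        · linarith [hy'.1]
        · linarith [hy'.1]
      rw [hΦ]
      simp only
      rw [intervalIntegral.integral_congr (g := fun _ => (0 : ℝ)) this]
      simp
    · by_cases hxa : a ≤ x
      · have h4 : ∫ y in Ioc a x, θ y = ∫ y, θ y := by
          refine setIntegral_eq_integral_of_forall_compl_eq_zero fun y hy => hz y fun hy' => hy ?_
          exact ⟨hc.trans_le hy'.1, hy'.2.trans hx.le⟩
        rw [hΦ]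
        simp only
        rw [intervalIntegral.integral_of_le hxa, h4, h0]
      · have : ∀ y ∈ uIcc a x, θ y = 0 := fun y hy => hz y fun hy' => by
          have := hy.2
          rw [max_eq_left (not_le.1 hxa).le] at this
          linarith [hy'.1]
        rw [hΦ]
        simp only
        rw [intervalIntegral.integral_congr (g := fun _ => (0 : ℝ)) this]
        simp
  have hts : tsupport Φ ⊆ Icc c d :=
    closure_minimal (fun x hx => by by_contra h'; exact hx (hsupp x h')) isClosed_Icc
  refine ⟨Φ, ⟨?_, ?_, ?_⟩, hd'⟩
  · rw [contDiff_infty_iff_deriv, hd']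
    exact ⟨fun x => (hder x).differentiableAt, h.1⟩
  · exact HasCompactSupport.of_support_subset_isCompact isCompact_Icc ((subset_tsupport _).trans hts)
  · exact hts.trans fun x hx => ⟨hc.trans_le hx.1, hx.2.trans_lt hd⟩

theorem ae_eq_zero_of_integral_test {a b : ℝ} {h : ℝ → ℝ}
    (hh : IntegrableOn h (Ioo a b))
    (H : ∀ φ, IsTestFunction a b φ → ∫ x in Ioo a b, h x * φ x = 0) :
    ∀ᵐ x ∂volume.restrict (Ioo a b), h x = 0 := by
  rw [ae_restrict_iff' measurableSet_Ioo]
  refine isOpen_Ioo.ae_eq_zero_of_integral_contDiff_smul_eq_zero hh.locallyIntegrableOn ?_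
  intro g hg1 hg2 hg3
  have ht : IsTestFunction a b g := ⟨hg1, hg2, hg3⟩
  have := H g ht
  rw [ht.integral_Ioo] at this
  simpa [mul_comm] using this

theorem IsTestFunction.sub_smul {a b : ℝ} {φ η : ℝ → ℝ} (h : IsTestFunction a b φ)
    (hη : IsTestFunction a b η) (c : ℝ) : IsTestFunction a b (fun x => φ x - c * η x) := by
  refine ⟨h.1.sub (contDiff_const.mul hη.1), h.2.1.sub (hη.2.1.mul_left), ?_⟩
  refine (tsupport_sub φ fun x => c * η x).trans (union_subset h.2.2 ?_)
  exact (tsupport_mul_subset_right (f := fun _ => c)).trans hη.2.2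

/-- The du Bois-Reymond lemma. -/
theorem exists_ae_eq_const {a b : ℝ} (hab : a < b) {h : ℝ → ℝ} (hh : IntegrableOn h (Ioo a b))
    (H : ∀ φ, IsTestFunction a b φ → ∫ x in Ioo a b, h x * deriv φ x = 0) :
    ∃ c, ∀ᵐ x ∂volume.restrict (Ioo a b), h x = c := by
  obtain ⟨η, hη, hη1⟩ := exists_isTestFunction_integral_eq_one hab
  have hmul : ∀ {k : ℝ → ℝ}, IntegrableOn k (Ioo a b) → ∀ {φ}, IsTestFunction a b φ →
      IntegrableOn (fun x => k x * φ x) (Ioo a b) := by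
    intro k hk φ hφ
    obtain ⟨C, hC⟩ := hφ.2.1.exists_bound_of_continuous hφ.1.continuous
    exact Integrable.mul_bdd (c := C) hk hφ.1.continuous.aestronglyMeasurable
      (Filter.Eventually.of_forall hC)
  have hint : ∀ {φ}, IsTestFunction a b φ → Integrable φ := fun {φ} hφ =>
    hφ.1.continuous.integrable_of_hasCompactSupport hφ.2.1
  set c : ℝ := ∫ x in Ioo a b, h x * η x with hc
  refine ⟨c, ?_⟩
  have := ae_eq_zero_of_integral_test (a := a) (b := b) (h := fun x => h x - c)
    (hh.sub (by simp)) (by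
    intro φ hφ
    -- Subtracting a multiple of the fixed bump `η` makes the integral of `φ` zero, so the
    -- difference is the derivative of a test function and the hypothesis applies to it.
    have hθ := hφ.sub_smul hη (∫ x, φ x)
    obtain ⟨Φ, hΦ, hΦd⟩ := hθ.exists_primitive hab (by
      rw [integral_sub (hint hφ) ((hint hη).const_mul _), integral_const_mul, hη1]
      ring)
    have h1 := H Φ hΦ
    rw [hΦd] at h1
    have e1 : ∀ x, h x * (φ x - (∫ x, φ x) * η x) = h x * φ x - (∫ x, φ x) * (h x * η x) := by
      intro x; ring
    simp only [e1] at h1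
    rw [integral_sub (hmul hh hφ) ((hmul hh hη).const_mul _), integral_const_mul, ← hc] at h1
    have e2 : ∀ x, (h x - c) * φ x = h x * φ x - c * φ x := by intro x; ring
    simp only [e2]
    rw [integral_sub (hmul hh hφ) ((hint hφ).integrableOn.const_mul _), integral_const_mul]
    have e3 := hφ.integral_Ioo (fun _ => 1)
    simp only [one_mul] at e3
    rw [e3]
    linear_combination h1)
  filter_upwards [this] with x hx
  linarith

theorem IsPrim.ofReal {T : ℝ} {F f : ℝ → ℝ} (h : IsPrim T F f) :
    IsPrim T (fun t => (F t : ℂ)) fun t => (f t : ℂ) := h.clm Complex.ofRealCLM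

/-- A function with a weak derivative is a.e. equal to a primitive of it. -/
theorem exists_ae_eq_primitive {T : ℝ} (hT : 0 < T) {f g : ℝ → ℝ}
    (hf : MemLp f 2 (volume.restrict (Ioo 0 T))) (hg : MemLp g 2 (volume.restrict (Ioo 0 T)))
    (h : ∀ φ, IsTestFunction 0 T φ → ∫ x in Ioo 0 T, f x * deriv φ x = -∫ x in Ioo 0 T, g x * φ x) :
    ∃ c, ∀ᵐ x ∂volume.restrict (Ioo 0 T), f x = c + ∫ y in (0 : ℝ)..x, g y := by
  have hgI : IntegrableOn g (Ioo 0 T) := hg.integrable (by norm_num)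
  have hfI : IntegrableOn f (Ioo 0 T) := hf.integrable (by norm_num)
  have hgi : IntervalIntegrable g volume 0 T :=
    (intervalIntegrable_iff_integrableOn_Ioo_of_le hT.le).2 hgI
  have hG := IsPrim.of_continuousOn hgi 0
  have hGI : IntegrableOn (fun x => ∫ y in (0 : ℝ)..x, g y) (Ioo 0 T) := by
    have := (hG.continuousOn.integrableOn_Icc (μ := volume)).mono_set Ioo_subset_Icc_self
    simpa using this
  -- The difference between `f` and a primitive of `g` has weak derivative zero.
  obtain ⟨c, hc⟩ := exists_ae_eq_const hT (h := fun x => f x - ∫ y in (0 : ℝ)..x, g y)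
    (hfI.sub hGI) (by
    intro φ hφ
    have hφd : ∀ x, HasDerivAt φ (deriv φ x) x := fun x =>
      ((hφ.1.differentiable (by simp)) x).hasDerivAt
    have hφP : IsPrim T φ (deriv φ) := IsPrim.of_hasDerivAt hφd hφ.deriv.1.continuous
    have hP := hG.ofReal.mul hT.le hφP.ofReal
    have e := hP.integral_eq hT.le
    rw [hφ.eq_zero (x := 0) (by simp), hφ.eq_zero (x := T) (by simp)] at e
    simp only [Complex.ofReal_zero, mul_zero, sub_zero, zero_add, ← Complex.ofReal_mul,
      ← Complex.ofReal_add] at e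
    rw [intervalIntegral.integral_ofReal, Complex.ofReal_eq_zero,
      intervalIntegral.integral_of_le hT.le, integral_Ioc_eq_integral_Ioo] at e
    obtain ⟨C, hC⟩ := hφ.2.1.exists_bound_of_continuous hφ.1.continuous
    obtain ⟨C', hC'⟩ := hφ.deriv.2.1.exists_bound_of_continuous hφ.deriv.1.continuous
    have i1 : IntegrableOn (fun x => g x * φ x) (Ioo 0 T) :=
      Integrable.mul_bdd (c := C) hgI hφ.1.continuous.aestronglyMeasurable
        (Filter.Eventually.of_forall hC)
    have i2 : IntegrableOn (fun x => (∫ y in (0 : ℝ)..x, g y) * deriv φ x) (Ioo 0 T) :=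
      Integrable.mul_bdd (c := C') hGI hφ.deriv.1.continuous.aestronglyMeasurable
        (Filter.Eventually.of_forall hC')
    have i3 : IntegrableOn (fun x => f x * deriv φ x) (Ioo 0 T) :=
      Integrable.mul_bdd (c := C') hfI hφ.deriv.1.continuous.aestronglyMeasurable
        (Filter.Eventually.of_forall hC')
    rw [integral_add i1 i2] at e
    simp only [sub_mul]
    rw [integral_sub i3 i2, h φ hφ]
    linarith)
  refine ⟨c, ?_⟩
  filter_upwards [hc] with x hx
  linarith

/-- A function of `H^N(0,1)` has a chain of derivatives which are primitives of each other. -/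
theorem MemSobolev.exists_chain {N : ℕ} {f : ℝ → ℝ} (h : MemSobolev 0 1 N f) :
    ∃ m : ℕ → ℝ → ℝ, (∀ i < N, IsPrim 1 (m i) (m (i + 1))) ∧
      (∀ᵐ x ∂volume.restrict (Ioo (0 : ℝ) 1), f x = m 0 x) ∧
      MemLp (m N) 2 (volume.restrict (Ioo 0 1)) ∧ ∀ i ≤ N, IsWeakDeriv 0 1 i f (m i) := by
  obtain ⟨hf, hd⟩ := h
  choose! g hg hw using hd
  have hprim : ∀ i < N, ∃ c, ∀ᵐ x ∂volume.restrict (Ioo (0 : ℝ) 1),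
      g i x = c + ∫ y in (0 : ℝ)..x, g (i + 1) y := by
    intro i hi
    refine exists_ae_eq_primitive zero_lt_one (hg i hi.le) (hg (i + 1) hi) fun φ hφ => ?_
    have e1 := hw i hi.le _ hφ.deriv
    have e2 := hw (i + 1) hi φ hφ
    rw [iteratedDeriv_succ'] at e2
    rw [e1] at e2
    have h1 : ((-1 : ℝ) ^ i) ≠ 0 := by simp
    refine mul_left_cancel₀ h1 ?_
    rw [e2]
    ring
  choose! c hc using hprim
  -- Below order `N` each derivative is replaced by a primitive of the next one; at order `N` there
  -- is only a square integrable function, kept as it is.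
  set m : ℕ → ℝ → ℝ := fun i => if i < N then fun x => c i + ∫ y in (0 : ℝ)..x, g (i + 1) y else g i
    with hm
  have hmg : ∀ i ≤ N, ∀ᵐ x ∂volume.restrict (Ioo (0 : ℝ) 1), g i x = m i x := by
    intro i hi
    rcases hi.lt_or_eq with hi | rfl
    · simpa [hm, hi] using hc i hi
    · simp [hm]
  have hw0 : ∀ i ≤ N, IsWeakDeriv 0 1 i f (m i) := by
    intro i hi φ hφ
    rw [hw i hi φ hφ]
    congr 1
    refine integral_congr_ae ?_
    filter_upwards [hmg i hi] with x hx
    rw [hx]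
  refine ⟨m, fun i hi => ?_, ?_, by simpa [hm] using hg N le_rfl, hw0⟩
  · have hgi : IntervalIntegrable (g (i + 1)) volume 0 1 :=
      (intervalIntegrable_iff_integrableOn_Ioo_of_le zero_le_one).2
        ((hg (i + 1) hi).integrable (by norm_num))
    refine (IsPrim.of_continuousOn hgi (c i)).congr (fun x _ => by simp [hm, hi]) (hmg _ hi)
      zero_le_one
  · have hmem : MemLp (m 0) 2 (volume.restrict (Ioo (0 : ℝ) 1)) :=
      (hg 0 (Nat.zero_le _)).ae_eq (hmg 0 (Nat.zero_le _))
    have := ae_eq_zero_of_integral_test (h := fun x => f x - m 0 x) (a := 0) (b := 1)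
      ((hf.sub hmem).integrable (by norm_num)) (by
        intro φ hφ
        have e := hw0 0 (Nat.zero_le _) φ hφ
        simp only [iteratedDeriv_zero, pow_zero, one_mul] at e
        obtain ⟨C, hC⟩ := hφ.2.1.exists_bound_of_continuous hφ.1.continuous
        simp only [sub_mul]
        rw [integral_sub, e, sub_self]
        · exact Integrable.mul_bdd (c := C) (hf.integrable (by norm_num))
            hφ.1.continuous.aestronglyMeasurable (Filter.Eventually.of_forall hC)
        · exact Integrable.mul_bdd (c := C) (hmem.integrable (by norm_num))
            hφ.1.continuous.aestronglyMeasurable (Filter.Eventually.of_forall hC))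
    filter_upwards [this] with x hx
    linarith

/-- Two continuous representatives of the same weak derivative agree almost everywhere, hence on the
closed interval, so the vanishing at the ends does not depend on the representative. -/
theorem DerivVanishesAtEnds.eq_zero {n : ℕ} {f g : ℝ → ℝ} (h : DerivVanishesAtEnds 0 1 n f)
    (hg : ContinuousOn g (Icc 0 1)) (hw : IsWeakDeriv 0 1 n f g) : g 0 = 0 ∧ g 1 = 0 := by
  obtain ⟨r, hr, hrw, h0, h1⟩ := h
  have hd : ContinuousOn (fun x => g x - r x) (Icc 0 1) := hg.sub hr
  have hI : ∀ {k : ℝ → ℝ}, ContinuousOn k (Icc 0 1) → ∀ {φ}, IsTestFunction 0 1 φ →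
      IntegrableOn (fun x => k x * φ x) (Ioo 0 1) := fun hk _ hφ =>
    (hk.mul hφ.1.continuous.continuousOn).integrableOn_Icc.mono_set Ioo_subset_Icc_self
  have hz := ae_eq_zero_of_integral_test (h := fun x => g x - r x) (a := 0) (b := 1)
    (hd.integrableOn_Icc.mono_set Ioo_subset_Icc_self) (by
      intro φ hφ
      have e1 := hw φ hφ
      rw [hrw φ hφ] at e1
      have e2 := mul_left_cancel₀ (by simp : ((-1 : ℝ) ^ n) ≠ 0) e1
      simp only [sub_mul]
      rw [integral_sub (hI hg hφ) (hI hr hφ), e2, sub_self])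
  have he : EqOn g r (Icc 0 1) := by
    refine Measure.eqOn_Icc_of_ae_eq (μ := volume) zero_ne_one ?_ hg hr
    rw [← restrict_Ioo_eq_restrict_Icc]
    filter_upwards [hz] with x hx
    linarith
  rw [he (by simp), he (by simp)]
  exact ⟨h0, h1⟩

/-! ### Integration by parts against the sine system -/

theorem isPrim_cos (c : ℝ) : IsPrim 1 (fun x => ((Real.cos (c * x) : ℝ) : ℂ))
    fun x => ((-(c * Real.sin (c * x)) : ℝ) : ℂ) := by
  refine IsPrim.of_hasDerivAt (fun x => ?_) (by fun_prop)
  refine HasDerivAt.ofReal_comp ?_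
  exact ((Real.hasDerivAt_cos (c * x)).comp x ((hasDerivAt_id x).const_mul c)).congr_deriv (by ring)

theorem isPrim_sin (c : ℝ) : IsPrim 1 (fun x => ((Real.sin (c * x) : ℝ) : ℂ))
    fun x => ((c * Real.cos (c * x) : ℝ) : ℂ) := by
  refine IsPrim.of_hasDerivAt (fun x => ?_) (by fun_prop)
  refine HasDerivAt.ofReal_comp ?_
  exact ((Real.hasDerivAt_sin (c * x)).comp x ((hasDerivAt_id x).const_mul c)).congr_deriv (by ring)

theorem IsPrim.mul_sin {F f : ℝ → ℂ} (h : IsPrim 1 F f) (j : ℕ+) :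
    ((j * Real.pi : ℝ) : ℂ) * ∫ x in (0 : ℝ)..1, F x * ((Real.sin (j * Real.pi * x) : ℝ) : ℂ) =
      F 0 - (-1) ^ (j : ℕ) * F 1 +
        ∫ x in (0 : ℝ)..1, f x * ((Real.cos (j * Real.pi * x) : ℝ) : ℂ) := by
  have hP := h.mul zero_le_one (isPrim_cos (j * Real.pi))
  have e := hP.integral_eq zero_le_one
  have hc : ContinuousOn F (uIcc 0 1) := by rw [uIcc_of_le zero_le_one]; exact h.continuousOn
  rw [intervalIntegral.integral_add (h.integrable.mul_continuousOn (by fun_prop))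
    (IntervalIntegrable.continuousOn_mul (Continuous.intervalIntegrable (by fun_prop) _ _) hc)] at e
  have e2 : ∀ x : ℝ, F x * ((-(j * Real.pi * Real.sin (j * Real.pi * x)) : ℝ) : ℂ) =
      -((j * Real.pi : ℝ) : ℂ) * (F x * ((Real.sin (j * Real.pi * x) : ℝ) : ℂ)) := by
    intro x; push_cast; ring
  simp only [e2] at e
  rw [intervalIntegral.integral_const_mul] at e
  have e3 : Real.cos (j * Real.pi * 1) = (-1) ^ (j : ℕ) := by
    rw [mul_one, Real.cos_nat_mul_pi]
  rw [e3, mul_zero, Real.cos_zero] at e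
  push_cast at e ⊢
  linear_combination -e

theorem IsPrim.mul_cos {F f : ℝ → ℂ} (h : IsPrim 1 F f) (j : ℕ+) :
    ((j * Real.pi : ℝ) : ℂ) * ∫ x in (0 : ℝ)..1, F x * ((Real.cos (j * Real.pi * x) : ℝ) : ℂ) =
      -∫ x in (0 : ℝ)..1, f x * ((Real.sin (j * Real.pi * x) : ℝ) : ℂ) := by
  have hP := h.mul zero_le_one (isPrim_sin (j * Real.pi))
  have e := hP.integral_eq zero_le_one
  have hc : ContinuousOn F (uIcc 0 1) := by rw [uIcc_of_le zero_le_one]; exact h.continuousOn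
  rw [intervalIntegral.integral_add (h.integrable.mul_continuousOn (by fun_prop))
    (IntervalIntegrable.continuousOn_mul (Continuous.intervalIntegrable (by fun_prop) _ _) hc)] at e
  have e2 : ∀ x : ℝ, F x * ((j * Real.pi * Real.cos (j * Real.pi * x) : ℝ) : ℂ) =
      ((j * Real.pi : ℝ) : ℂ) * (F x * ((Real.cos (j * Real.pi * x) : ℝ) : ℂ)) := by
    intro x; push_cast; ring
  simp only [e2] at e
  rw [intervalIntegral.integral_const_mul] at e
  have e3 : Real.sin (j * Real.pi * 1) = 0 := by
    rw [mul_one, Real.sin_nat_mul_pi]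
  rw [e3, mul_zero, Real.sin_zero] at e
  push_cast at e ⊢
  linear_combination e

/-- Of two successive integrations by parts only the first one produces boundary terms, since the
sine vanishes at both ends. Thus only derivatives of even order are seen at the ends; those of order
below `2q` vanish by hypothesis and the traces of order `2q` remain. -/
theorem integral_mul_sin_of_chain {c : ℕ → ℝ → ℂ} {q : ℕ}
    (hc : ∀ i < 2 * q + 1, IsPrim 1 (c i) (c (i + 1)))
    (h0 : ∀ r < q, c (2 * r) 0 = 0 ∧ c (2 * r) 1 = 0) (j : ℕ+) :
    ((j * Real.pi : ℝ) : ℂ) ^ (2 * q + 1) *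
        ∫ x in (0 : ℝ)..1, c 0 x * ((Real.sin (j * Real.pi * x) : ℝ) : ℂ) =
      (-1) ^ q * (c (2 * q) 0 - (-1) ^ (j : ℕ) * c (2 * q) 1 +
        ∫ x in (0 : ℝ)..1, c (2 * q + 1) x * ((Real.cos (j * Real.pi * x) : ℝ) : ℂ)) := by
  have key : ∀ r ≤ q, ((j * Real.pi : ℝ) : ℂ) ^ (2 * r) *
      ∫ x in (0 : ℝ)..1, c 0 x * ((Real.sin (j * Real.pi * x) : ℝ) : ℂ) =
        (-1) ^ r * ∫ x in (0 : ℝ)..1, c (2 * r) x * ((Real.sin (j * Real.pi * x) : ℝ) : ℂ) := by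
    intro r
    induction r with
    | zero => simp
    | succ r ih =>
      intro hr
      have e1 := (hc (2 * r) (by omega)).mul_sin j
      have e2 := (hc (2 * r + 1) (by omega)).mul_cos j
      rw [(h0 r (by omega)).1, (h0 r (by omega)).2] at e1
      rw [show 2 * (r + 1) = 2 * r + 1 + 1 by ring, pow_succ, pow_succ]
      have e3 := ih (by omega)
      linear_combination ((j * Real.pi : ℝ) : ℂ) ^ 2 * e3 +
        (-1) ^ r * ((j * Real.pi : ℝ) : ℂ) * e1 + (-1) ^ r * e2
  have e1 := (hc (2 * q) (by omega)).mul_sin j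
  have e2 := key q le_rfl
  rw [pow_succ]
  linear_combination ((j * Real.pi : ℝ) : ℂ) * e2 + (-1) ^ q * e1

theorem integral_norm_sq_sum {ι : Type*} [DecidableEq ι] {a b c : ℝ} {e : ι → ℝ → ℂ}
    (he : ∀ i, MemLp (e i) 2 (volume.restrict (Ioo a b)))
    (ho : ∀ i j, ∫ x in Ioo a b, (starRingEnd ℂ) (e i x) * e j x = if i = j then (c : ℂ) else 0)
    (F : Finset ι) (β : ι → ℂ) :
    ∫ x in Ioo a b, ‖∑ i ∈ F, β i * e i x‖ ^ 2 = c * ∑ i ∈ F, ‖β i‖ ^ 2 := by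
  have hm : MemLp (fun x => ∑ i ∈ F, β i * e i x) 2 (volume.restrict (Ioo a b)) :=
    memLp_finsetSum F fun i _ => (he i).const_mul (β i)
  have hi : ∀ i j, Integrable (fun x => (starRingEnd ℂ) (e i x) * e j x)
      (volume.restrict (Ioo a b)) := fun i j => (he i).star.integrable_mul (he j)
  have e1 : ((∫ x in Ioo a b, ‖∑ i ∈ F, β i * e i x‖ ^ 2 : ℝ) : ℂ) =
      ∫ x in Ioo a b, ∑ i ∈ F, ∑ j ∈ F, (starRingEnd ℂ) (β i) * β j *
        ((starRingEnd ℂ) (e i x) * e j x) := by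
    rw [← integral_complex_ofReal]
    congr 1
    funext x
    rw [Complex.ofReal_pow, ← Complex.conj_mul', map_sum, Finset.sum_mul_sum]
    refine Finset.sum_congr rfl fun i _ => Finset.sum_congr rfl fun j _ => ?_
    rw [map_mul]
    ring
  apply Complex.ofReal_injective
  rw [e1, integral_finsetSum _ fun i _ => integrable_finsetSum _ fun j _ => (hi i j).const_mul _]
  have e2 : ∀ i ∈ F, ∫ x in Ioo a b, ∑ j ∈ F, (starRingEnd ℂ) (β i) * β j *
        ((starRingEnd ℂ) (e i x) * e j x) = c * (‖β i‖ ^ 2 : ℝ) := by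
    intro i hi'
    rw [integral_finsetSum _ fun j _ => (hi i j).const_mul _]
    simp only [integral_const_mul, ho]
    rw [Finset.sum_eq_single i]
    · rw [if_pos rfl, Complex.conj_mul', Complex.ofReal_pow]
      ring
    · intro j _ hj
      rw [if_neg hj.symm, mul_zero]
    · exact fun h => absurd hi' h
  rw [Finset.sum_congr rfl e2, ← Finset.mul_sum]
  push_cast
  rfl

theorem integral_cos_mul_cos (i j : ℕ+) :
    ∫ x in Ioo (0 : ℝ) 1, (starRingEnd ℂ) ((Real.sqrt 2 * Real.cos (i * Real.pi * x) : ℝ) : ℂ) *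
      ((Real.sqrt 2 * Real.cos (j * Real.pi * x) : ℝ) : ℂ) = if i = j then ((1 : ℝ) : ℂ) else 0 := by
  have hS : ∀ x : ℝ, (starRingEnd ℂ) ((Real.sqrt 2 * Real.cos (i * Real.pi * x) : ℝ) : ℂ) *
      ((Real.sqrt 2 * Real.cos (j * Real.pi * x) : ℝ) : ℂ) =
      ((2 * Real.cos (((i : ℝ) - j) * Real.pi * x) -
        2 * (Real.sin (i * Real.pi * x) * Real.sin (j * Real.pi * x)) : ℝ) : ℂ) := by
    intro x
    rw [Complex.conj_ofReal, ← Complex.ofReal_mul]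
    congr 1
    rw [sub_mul, sub_mul, Real.cos_sub]
    have := Real.mul_self_sqrt (show (0 : ℝ) ≤ 2 by norm_num)
    linear_combination (Real.cos (i * Real.pi * x) * Real.cos (j * Real.pi * x)) * this
  simp only [hS]
  rw [integral_complex_ofReal, ← integral_Ioc_eq_integral_Ioo,
    ← intervalIntegral.integral_of_le zero_le_one,
    intervalIntegral.integral_sub (Continuous.intervalIntegrable (by fun_prop) _ _)
    (Continuous.intervalIntegrable (by fun_prop) _ _), integral_sin_mul_sin]
  split_ifs with h
  · subst h
    simp
    norm_num
  · have hc : ((i : ℝ) - j) * Real.pi ≠ 0 := mul_ne_zero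
      (sub_ne_zero.2 fun h' => h (PNat.coe_injective (by exact_mod_cast h'))) Real.pi_ne_zero
    rw [intervalIntegral.integral_const_mul,
      intervalIntegral.integral_comp_mul_left (fun y => Real.cos y) hc]
    have : Real.sin (((i : ℝ) - j) * Real.pi) = 0 := by
      have := Real.sin_int_mul_pi ((i : ℤ) - j)
      push_cast at this
      exact this
    simp [integral_cos, this]

theorem memLp_cos (j : ℕ+) : MemLp (fun x => ((Real.sqrt 2 * Real.cos (j * Real.pi * x) : ℝ) : ℂ)) 2
    (volume.restrict (Ioo (0 : ℝ) 1)) :=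
  MemLp.of_bound (C := Real.sqrt 2) (Continuous.aestronglyMeasurable (by fun_prop))
    (Filter.Eventually.of_forall fun x => by
      rw [Complex.norm_real, Real.norm_eq_abs, abs_mul, abs_of_nonneg (Real.sqrt_nonneg 2)]
      exact mul_le_of_le_one_right (Real.sqrt_nonneg 2) (Real.abs_cos_le_one _))

/-! ### Derivatives of finite sums of eigenvectors -/

/-- The `i`-th derivative of `√2 sin(lπ·)`. -/
def modeDeriv (l : ℕ+) (i : ℕ) (x : ℝ) : ℝ :=
  (l * Real.pi) ^ i * (Real.sqrt 2 * Real.sin (l * Real.pi * x + i * (Real.pi / 2)))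

/-- The `i`-th derivative at `x` of the finite sum `∑_l a_l φ_l`. -/
def trigSum (i : ℕ) (x : ℝ) : (ℕ+ →₀ ℂ) →ₗ[ℂ] ℂ :=
  Finsupp.linearCombination ℂ fun l => ((modeDeriv l i x : ℝ) : ℂ)

theorem trigSum_apply (i : ℕ) (x : ℝ) (a : ℕ+ →₀ ℂ) :
    trigSum i x a = ∑ l ∈ a.support, a l * ((modeDeriv l i x : ℝ) : ℂ) := rfl

theorem continuous_modeDeriv (l : ℕ+) (i : ℕ) : Continuous (modeDeriv l i) := by
  unfold modeDeriv; fun_prop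

theorem continuous_trigSum (i : ℕ) (a : ℕ+ →₀ ℂ) : Continuous fun x => trigSum i x a := by
  simp only [trigSum_apply]
  exact continuous_finsetSum _ fun l _ =>
    continuous_const.mul (Complex.continuous_ofReal.comp (continuous_modeDeriv l i))

theorem hasDerivAt_modeDeriv (l : ℕ+) (i : ℕ) (x : ℝ) :
    HasDerivAt (modeDeriv l i) (modeDeriv l (i + 1) x) x := by
  have h1 : HasDerivAt (fun x : ℝ => l * Real.pi * x + i * (Real.pi / 2)) (l * Real.pi) x := by
    simpa using ((hasDerivAt_id x).const_mul (l * Real.pi : ℝ)).add_const (i * (Real.pi / 2))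
  have h2 := ((Real.hasDerivAt_sin _).comp x h1).const_mul (Real.sqrt 2) |>.const_mul
    ((l * Real.pi : ℝ) ^ i)
  refine h2.congr_deriv ?_
  rw [modeDeriv, Nat.cast_succ, show l * Real.pi * x + (i + 1) * (Real.pi / 2) =
    l * Real.pi * x + i * (Real.pi / 2) + Real.pi / 2 by ring, Real.sin_add_pi_div_two]
  ring

theorem isPrim_trigSum (i : ℕ) (a : ℕ+ →₀ ℂ) :
    IsPrim 1 (fun x => trigSum i x a) fun x => trigSum (i + 1) x a := by
  refine IsPrim.of_hasDerivAt (fun x => ?_) (continuous_trigSum _ a)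
  simp only [trigSum_apply]
  exact HasDerivAt.fun_sum fun l _ => (hasDerivAt_modeDeriv l i x).ofReal_comp.const_mul (a l)

theorem modeDeriv_even (l : ℕ+) (r : ℕ) : modeDeriv l (2 * r) 0 = 0 ∧ modeDeriv l (2 * r) 1 = 0 := by
  constructor
  · have : (l : ℝ) * Real.pi * 0 + ((2 * r : ℕ) : ℝ) * (Real.pi / 2) = r * Real.pi := by
      push_cast; ring
    rw [modeDeriv, this, Real.sin_nat_mul_pi]
    ring
  · have : (l : ℝ) * Real.pi * 1 + ((2 * r : ℕ) : ℝ) * (Real.pi / 2) = ((l + r : ℕ) : ℝ) * Real.pi := by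
      push_cast; ring
    rw [modeDeriv, this, Real.sin_nat_mul_pi]
    ring

theorem trigSum_even (r : ℕ) (a : ℕ+ →₀ ℂ) :
    trigSum (2 * r) 0 a = 0 ∧ trigSum (2 * r) 1 a = 0 := by
  constructor <;> simp [trigSum_apply, modeDeriv_even]

theorem modeDeriv_odd (l : ℕ+) (q : ℕ) (x : ℝ) : modeDeriv l (2 * q + 1) x =
    (-1) ^ q * (l * Real.pi) ^ (2 * q + 1) * (Real.sqrt 2 * Real.cos (l * Real.pi * x)) := by
  have : (l : ℝ) * Real.pi * x + ((2 * q + 1 : ℕ) : ℝ) * (Real.pi / 2) =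
      l * Real.pi * x + Real.pi / 2 + q * Real.pi := by push_cast; ring
  rw [modeDeriv, this, Real.sin_add_nat_mul_pi, Real.sin_add_pi_div_two]
  ring

/-! ### Multiplication by a bounded function -/

theorem exists_mulCLM {μ : ℝ → ℝ} (hμm : AEStronglyMeasurable μ (volume.restrict (Ioo (0 : ℝ) 1)))
    {B : ℝ} (hB : ∀ᵐ x ∂volume.restrict (Ioo (0 : ℝ) 1), |μ x| ≤ B) :
    ∃ M : L2 →L[ℂ] L2, ∀ φ, M φ = mulL2 μ φ ∧
      ∀ᵐ x ∂volume.restrict (Ioo (0 : ℝ) 1), M φ x = (μ x : ℂ) * φ x := by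
  have hmem : ∀ φ : L2, MemLp (fun x => (μ x : ℂ) * φ x) 2 (volume.restrict (Ioo (0 : ℝ) 1)) := by
    intro φ
    refine MemLp.of_le_mul (c := B) (Lp.memLp φ)
      ((Complex.continuous_ofReal.comp_aestronglyMeasurable hμm).mul (Lp.aestronglyMeasurable φ)) ?_
    filter_upwards [hB] with x hx
    rw [norm_mul, Complex.norm_real]
    gcongr
    exact hx
  -- As `μ` is essentially bounded, the default value in `mulL2` is never taken.
  have hmul : ∀ φ, mulL2 μ φ = (hmem φ).toLp := fun φ => dif_pos (hmem φ)
  have hae : ∀ φ, ∀ᵐ x ∂volume.restrict (Ioo (0 : ℝ) 1), mulL2 μ φ x = (μ x : ℂ) * φ x := fun φ => by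
    rw [hmul]; exact (hmem φ).coeFn_toLp
  let M : L2 →ₗ[ℂ] L2 :=
    { toFun := mulL2 μ
      map_add' := fun φ χ => by
        apply Lp.ext
        filter_upwards [hae (φ + χ), hae φ, hae χ, Lp.coeFn_add φ χ, Lp.coeFn_add (mulL2 μ φ) (mulL2 μ χ)]
          with x h1 h2 h3 h4 h5
        rw [h5, Pi.add_apply, h1, h2, h3, h4, Pi.add_apply, mul_add]
      map_smul' := fun c φ => by
        apply Lp.ext
        filter_upwards [hae (c • φ), hae φ, Lp.coeFn_smul c φ, Lp.coeFn_smul c (mulL2 μ φ)]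
          with x h1 h2 h3 h4
        rw [RingHom.id_apply, h4, Pi.smul_apply, h1, h2, h3, Pi.smul_apply, smul_eq_mul, smul_eq_mul]
        ring }
  refine ⟨M.mkContinuous B fun φ => ?_, fun φ => ⟨rfl, hae φ⟩⟩
  refine Lp.norm_le_mul_norm_of_ae_le_mul (f := mulL2 μ φ) (g := φ) ?_
  filter_upwards [hae φ, hB] with x h1 h2
  rw [h1, norm_mul, Complex.norm_real]
  gcongr
  exact h2

theorem toL2_linearCombination_ae (s : ℝ) (a : ℕ+ →₀ ℂ) :
    ∀ᵐ x ∂volume.restrict (Ioo (0 : ℝ) 1),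
      HZero.toL2 (a.linearCombination ℂ (HZero.mode s)) x = trigSum 0 x a := by
  induction a using Finsupp.induction_linear with
  | zero =>
    simp only [map_zero]
    exact Lp.coeFn_zero ℂ 2 (volume.restrict (Ioo (0 : ℝ) 1))
  | add f g hf hg =>
    simp only [map_add]
    filter_upwards [hf, hg, Lp.coeFn_add (HZero.toL2 (f.linearCombination ℂ (HZero.mode s)))
      (HZero.toL2 (g.linearCombination ℂ (HZero.mode s)))] with x h1 h2 h3
    rw [h3, Pi.add_apply, h1, h2]
  | single l c =>
    simp only [Finsupp.linearCombination_single, map_smul, trigSum]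
    filter_upwards [Lp.coeFn_smul c (HZero.toL2 (HZero.mode s l)), (memLp_modeFun l).coeFn_toLp]
      with x h1 h2
    rw [h1, Pi.smul_apply]
    congr 1
    refine h2.trans ?_
    simp [modeFun, modeDeriv]

theorem coeff_mul_linearCombination {μ m : ℝ → ℝ} {M : L2 →L[ℂ] L2}
    (hM : ∀ φ, ∀ᵐ x ∂volume.restrict (Ioo (0 : ℝ) 1), M φ x = (μ x : ℂ) * φ x)
    (hm : ∀ᵐ x ∂volume.restrict (Ioo (0 : ℝ) 1), μ x = m x) (s : ℝ) (a : ℕ+ →₀ ℂ) (j : ℕ+) :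
    coeff j (M (HZero.toL2 (a.linearCombination ℂ (HZero.mode s)))) =
      Real.sqrt 2 * ∫ x in (0 : ℝ)..1, ((m x : ℂ) * trigSum 0 x a) *
        ((Real.sin (j * Real.pi * x) : ℝ) : ℂ) := by
  rw [inner_mode, intervalIntegral.integral_of_le zero_le_one, integral_Ioc_eq_integral_Ioo,
    ← integral_const_mul]
  refine integral_congr_ae ?_
  filter_upwards [hM (HZero.toL2 (a.linearCombination ℂ (HZero.mode s))), hm,
    toL2_linearCombination_ae s a] with x h1 h2 h3
  rw [h1, h2, h3, modeFun]
  push_cast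
  ring

/-! ### Bounds for finite sums of eigenvectors -/

/-- The Sobolev embedding of `H^N_{(0)}` into `C^{N-1}`, for finite sums: Cauchy–Schwarz against the
convergent series `∑ l⁻²`. -/
theorem exists_norm_trigSum_le (N : ℕ) : ∃ C : ℝ, 0 ≤ C ∧ ∀ i < N, ∀ x (a : ℕ+ →₀ ℂ),
    ‖trigSum i x a‖ ≤ C * ‖a.linearCombination ℂ (HZero.mode N)‖ := by
  have hsum : Summable fun l : ℕ+ => (((l : ℝ)⁻¹) ^ 2) := by
    have h : Summable fun n : ℕ => (((n : ℝ) ^ 2)⁻¹) := Real.summable_nat_pow_inv.2 one_lt_two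
    have := h.comp_injective PNat.coe_injective
    simpa [Function.comp_def] using this
  set S : ℝ := ∑' l : ℕ+, ((l : ℝ)⁻¹) ^ 2
  refine ⟨Real.pi ^ N * Real.sqrt 2 * Real.sqrt S, by positivity, fun i hi x a => ?_⟩
  have h1 : ‖trigSum i x a‖ ≤ Real.pi ^ N * Real.sqrt 2 *
      ∑ l ∈ a.support, ((l : ℝ)⁻¹) * ((l : ℝ) ^ (N : ℝ) * ‖a l‖) := by
    rw [trigSum_apply, Finset.mul_sum]
    refine (norm_sum_le _ _).trans (Finset.sum_le_sum fun l _ => ?_)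
    have hl : (1 : ℝ) ≤ l := Nat.one_le_cast.2 l.pos
    have hpi : (1 : ℝ) ≤ Real.pi := by linarith [Real.pi_gt_three]
    have h2 : |modeDeriv l i x| ≤ (l : ℝ) ^ i * Real.pi ^ i * Real.sqrt 2 := by
      rw [modeDeriv, abs_mul, abs_mul, abs_of_nonneg (by positivity : (0 : ℝ) ≤ (l * Real.pi) ^ i),
        abs_of_nonneg (Real.sqrt_nonneg 2), mul_pow]
      refine mul_le_mul_of_nonneg_left ?_ (by positivity)
      exact mul_le_of_le_one_right (Real.sqrt_nonneg 2) (Real.abs_sin_le_one _)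
    -- As `i < N`, one power of `l` is left over; it provides the summable factor.
    have h3 : (l : ℝ) ^ i ≤ (l : ℝ)⁻¹ * (l : ℝ) ^ N := by
      obtain ⟨n, rfl⟩ : ∃ n, N = n + 1 := ⟨N - 1, by omega⟩
      rw [pow_succ, mul_comm, mul_assoc, mul_inv_cancel₀ (by positivity), mul_one]
      exact pow_le_pow_right₀ hl (by omega)
    have h4 : Real.pi ^ i ≤ Real.pi ^ N := pow_le_pow_right₀ hpi hi.le
    rw [norm_mul, Complex.norm_real, Real.norm_eq_abs, Real.rpow_natCast]
    calc ‖a l‖ * |modeDeriv l i x| ≤ ‖a l‖ * (((l : ℝ)⁻¹ * (l : ℝ) ^ N) * Real.pi ^ N * Real.sqrt 2) := by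
          gcongr
          refine h2.trans ?_
          gcongr
      _ = _ := by ring
  refine h1.trans ?_
  rw [mul_assoc (Real.pi ^ N * Real.sqrt 2) (Real.sqrt S)]
  gcongr
  refine le_of_sq_le_sq ?_ (by positivity)
  refine (Finset.sum_mul_sq_le_sq_mul_sq _ _ _).trans ?_
  rw [mul_pow, Real.sq_sqrt (tsum_nonneg fun l : ℕ+ => sq_nonneg ((l : ℝ)⁻¹))]
  refine mul_le_mul (hsum.sum_le_tsum _ fun l _ => sq_nonneg _) ?_
    (Finset.sum_nonneg fun l _ => by positivity)
    (tsum_nonneg fun l : ℕ+ => sq_nonneg ((l : ℝ)⁻¹))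
  simpa only [HZero.coef_finsuppSum] using
    HZero.sum_le_norm_sq (a.linearCombination ℂ (HZero.mode N)) a.support

/-- A derivative of odd order turns the sines into cosines, which are again orthonormal, so the top
derivative is controlled in `L²` by Parseval without any loss. -/
theorem integral_norm_sq_trigSum_le (q : ℕ) (a : ℕ+ →₀ ℂ) :
    ∫ x in Ioo (0 : ℝ) 1, ‖trigSum (2 * q + 1) x a‖ ^ 2 ≤
      (Real.pi ^ (2 * q + 1) * ‖a.linearCombination ℂ (HZero.mode (2 * q + 1 : ℕ))‖) ^ 2 := by
  have h := integral_norm_sq_sum memLp_cos integral_cos_mul_cos a.support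
    fun l => a l * ((-1) ^ q * ((l * Real.pi : ℝ) : ℂ) ^ (2 * q + 1))
  have e : ∀ x, trigSum (2 * q + 1) x a = ∑ l ∈ a.support, (a l *
      ((-1) ^ q * ((l * Real.pi : ℝ) : ℂ) ^ (2 * q + 1))) *
        ((Real.sqrt 2 * Real.cos (l * Real.pi * x) : ℝ) : ℂ) := by
    intro x
    rw [trigSum_apply]
    refine Finset.sum_congr rfl fun l _ => ?_
    rw [modeDeriv_odd]
    push_cast
    ring
  simp only [← e, one_mul] at h
  rw [h, mul_pow]
  refine le_trans (le_of_eq ?_) (mul_le_mul_of_nonneg_left (HZero.sum_le_norm_sq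
    (a.linearCombination ℂ (HZero.mode (2 * q + 1 : ℕ))) a.support) (sq_nonneg _))
  rw [Finset.mul_sum]
  refine Finset.sum_congr rfl fun l _ => ?_
  rw [HZero.coef_finsuppSum, norm_mul, norm_mul, norm_pow, norm_pow, norm_neg, norm_one, one_pow,
    Complex.norm_real, Real.norm_of_nonneg (by positivity), Real.rpow_natCast]
  ring

/-! ### The structure of the multiplication operator on `H^{2q+1}_{(0)}` -/

/-- The `r`-th derivative at `x` of the product of `m 0` with a finite sum of eigenvectors. -/
def prodDeriv (m : ℕ → ℝ → ℝ) (r : ℕ) (x : ℝ) : (ℕ+ →₀ ℂ) →ₗ[ℂ] ℂ :=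
  ∑ ij ∈ Finset.HasAntidiagonal.antidiagonal r,
    ((r.choose ij.1 : ℂ) * (m ij.1 x : ℂ)) • trigSum ij.2 x

theorem prodDeriv_apply (m : ℕ → ℝ → ℝ) (r : ℕ) (x : ℝ) (a : ℕ+ →₀ ℂ) :
    prodDeriv m r x a = leibniz (fun i x => (m i x : ℂ)) (fun i x => trigSum i x a) r x := by
  simp only [prodDeriv, leibniz, LinearMap.coe_sum, Finset.sum_apply, LinearMap.smul_apply,
    smul_eq_mul]
  exact Finset.sum_congr rfl fun ij _ => by ring

theorem isPrim_prodDeriv {m : ℕ → ℝ → ℝ} {N : ℕ} (hm : ∀ i < N, IsPrim 1 (m i) (m (i + 1)))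
    (a : ℕ+ →₀ ℂ) {r : ℕ} (hr : r < N) :
    IsPrim 1 (fun x => prodDeriv m r x a) fun x => prodDeriv m (r + 1) x a := by
  simp only [prodDeriv_apply]
  exact IsPrim.leibniz zero_le_one (fun i hi => (hm i (by omega)).ofReal)
    fun i _ => isPrim_trigSum i a

/-- In a Leibniz term of even total order the two orders have the same parity. If both are even, the
sine sum vanishes at the ends; if both are odd, the derivative of `m 0` does. -/
theorem prodDeriv_even {m : ℕ → ℝ → ℝ} {q : ℕ}
    (h0 : ∀ n < q, m (2 * n + 1) 0 = 0 ∧ m (2 * n + 1) 1 = 0) :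
    prodDeriv m (2 * q) 0 = 0 ∧ prodDeriv m (2 * q) 1 = 0 := by
  have key : ∀ x : ℝ, (∀ n < q, m (2 * n + 1) x = 0) → (∀ r (a : ℕ+ →₀ ℂ), trigSum (2 * r) x a = 0) →
      prodDeriv m (2 * q) x = 0 := by
    intro x h1 h2
    refine Finset.sum_eq_zero fun ij hij => ?_
    have hij' := Finset.HasAntidiagonal.mem_antidiagonal.1 hij
    rcases Nat.even_or_odd' ij.1 with ⟨n, hn | hn⟩
    · have : trigSum ij.2 x = 0 := by
        ext1 a
        obtain ⟨r, hr⟩ : ∃ r, ij.2 = 2 * r := ⟨q - n, by omega⟩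
        rw [hr]
        exact LinearMap.ext fun _ => by simp [h2]
      rw [this, smul_zero]
    · rw [hn, h1 n (by omega)]
      simp
  exact ⟨key 0 (fun n hn => (h0 n hn).1) fun r a => (trigSum_even r a).1,
    key 1 (fun n hn => (h0 n hn).2) fun r a => (trigSum_even r a).2⟩

theorem exists_norm_prodDeriv_le (m : ℕ → ℝ → ℝ) (q : ℕ) (x : ℝ) :
    ∃ C : ℝ, 0 ≤ C ∧ ∀ a : ℕ+ →₀ ℂ, ‖prodDeriv m (2 * q) x a‖ ≤
      C * ‖a.linearCombination ℂ (HZero.mode (2 * q + 1 : ℕ))‖ := by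
  obtain ⟨C, hC, h⟩ := exists_norm_trigSum_le (2 * q + 1)
  refine ⟨∑ ij ∈ Finset.HasAntidiagonal.antidiagonal (2 * q),
    ‖(((2 * q).choose ij.1 : ℂ) * (m ij.1 x : ℂ))‖ * C, by positivity, fun a => ?_⟩
  rw [prodDeriv, LinearMap.coe_sum, Finset.sum_apply, Finset.sum_mul]
  refine (norm_sum_le _ _).trans (Finset.sum_le_sum fun ij hij => ?_)
  have hij' := Finset.HasAntidiagonal.mem_antidiagonal.1 hij
  rw [LinearMap.smul_apply, norm_smul, mul_assoc]
  gcongr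
  exact h _ (by omega) x a

/-- When all derivatives fall on the finite sum, `m 0` is bounded and Parseval applies. In every
other term at least one derivative falls on `m 0`, so the sum is differentiated at most `2q` times
and is bounded uniformly, while the derivative of `m 0` is in `L²`. -/
theorem exists_integral_norm_sq_prodDeriv_le {m : ℕ → ℝ → ℝ} {q : ℕ}
    (hm : ∀ i < 2 * q + 1, IsPrim 1 (m i) (m (i + 1)))
    (hN : MemLp (m (2 * q + 1)) 2 (volume.restrict (Ioo 0 1))) :
    ∃ C : ℝ, 0 ≤ C ∧ ∀ a : ℕ+ →₀ ℂ,
      MemLp (fun x => prodDeriv m (2 * q + 1) x a) 2 (volume.restrict (Ioo 0 1)) ∧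
      ∫ x in Ioo (0 : ℝ) 1, ‖prodDeriv m (2 * q + 1) x a‖ ^ 2 ≤
        C * ‖a.linearCombination ℂ (HZero.mode (2 * q + 1 : ℕ))‖ ^ 2 := by
  set N := 2 * q + 1 with hNq
  obtain ⟨C, hC, h⟩ := exists_norm_trigSum_le N
  have hcont : ∀ i < N, ContinuousOn (m i) (Icc 0 1) := fun i hi => (hm i hi).continuousOn
  have hbdd : ∀ i < N, ∃ B, ∀ x ∈ Ioo (0 : ℝ) 1, ‖m i x‖ ≤ B := fun i hi => by
    obtain ⟨B, hB⟩ := isCompact_Icc.exists_bound_of_continuousOn (hcont i hi)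
    exact ⟨B, fun x hx => hB x (Ioo_subset_Icc_self hx)⟩
  have hmeas : ∀ i < N, AEStronglyMeasurable (m i) (volume.restrict (Ioo 0 1)) := fun i hi =>
    ((hcont i hi).mono Ioo_subset_Icc_self).aestronglyMeasurable measurableSet_Ioo
  have hmL : ∀ i ≤ N, MemLp (m i) 2 (volume.restrict (Ioo 0 1)) := by
    intro i hi
    rcases hi.lt_or_eq with hi | rfl
    · obtain ⟨B, hB⟩ := hbdd i hi
      exact MemLp.of_bound (hmeas i hi) B ((ae_restrict_iff' measurableSet_Ioo).2
        (Filter.Eventually.of_forall hB))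
    · exact hN
  have key : ∀ ij : ℕ × ℕ, ij ∈ Finset.HasAntidiagonal.antidiagonal N → ∃ K : ℝ, 0 ≤ K ∧ ∀ a : ℕ+ →₀ ℂ,
      MemLp (fun x => ((N.choose ij.1 : ℂ) * (m ij.1 x : ℂ)) * trigSum ij.2 x a) 2
        (volume.restrict (Ioo 0 1)) ∧
      ∫ x in Ioo (0 : ℝ) 1, ‖((N.choose ij.1 : ℂ) * (m ij.1 x : ℂ)) * trigSum ij.2 x a‖ ^ 2 ≤
        K * ‖a.linearCombination ℂ (HZero.mode N)‖ ^ 2 := by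
    intro ij hij
    have hij' := Finset.HasAntidiagonal.mem_antidiagonal.1 hij
    rcases Nat.eq_zero_or_pos ij.1 with h0 | h0
    · have h1 : ij.2 = N := by omega
      obtain ⟨B, hB⟩ := hbdd 0 (by omega)
      refine ⟨B ^ 2 * (Real.pi ^ N) ^ 2, by positivity, fun a => ?_⟩
      rw [h0, h1]
      simp only [Nat.choose_zero_right, Nat.cast_one, one_mul]
      obtain ⟨D, hD⟩ := isCompact_Icc.exists_bound_of_continuousOn
        ((continuous_trigSum N a).continuousOn (s := Icc (0 : ℝ) 1))
      have hT : MemLp (fun x => trigSum N x a) 2 (volume.restrict (Ioo (0 : ℝ) 1)) :=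
        MemLp.of_bound (continuous_trigSum N a).aestronglyMeasurable D
          ((ae_restrict_iff' measurableSet_Ioo).2 (Filter.Eventually.of_forall
            fun x hx => hD x (Ioo_subset_Icc_self hx)))
      have hle : ∀ x ∈ Ioo (0 : ℝ) 1, ‖(m 0 x : ℂ) * trigSum N x a‖ ≤ B * ‖trigSum N x a‖ := by
        intro x hx
        rw [norm_mul, Complex.norm_real]
        gcongr
        exact hB x hx
      have hM : MemLp (fun x => (m 0 x : ℂ) * trigSum N x a) 2 (volume.restrict (Ioo (0 : ℝ) 1)) := by
        refine MemLp.of_le_mul (c := B) hT ((Complex.continuous_ofReal.comp_aestronglyMeasurable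
          (hmeas 0 (by omega))).mul (continuous_trigSum N a).aestronglyMeasurable) ?_
        exact (ae_restrict_iff' measurableSet_Ioo).2 (Filter.Eventually.of_forall hle)
      refine ⟨hM, ?_⟩
      calc ∫ x in Ioo (0 : ℝ) 1, ‖(m 0 x : ℂ) * trigSum N x a‖ ^ 2
          ≤ ∫ x in Ioo (0 : ℝ) 1, B ^ 2 * ‖trigSum N x a‖ ^ 2 := by
            refine setIntegral_mono_on (hM.integrable_norm_pow (by norm_num))
              ((hT.integrable_norm_pow (by norm_num)).const_mul _) measurableSet_Ioo fun x hx => ?_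
            rw [← mul_pow]
            have := hle x hx
            gcongr
        _ = B ^ 2 * ∫ x in Ioo (0 : ℝ) 1, ‖trigSum N x a‖ ^ 2 := integral_const_mul _ _
        _ ≤ B ^ 2 * (Real.pi ^ N * ‖a.linearCombination ℂ (HZero.mode N)‖) ^ 2 :=
            mul_le_mul_of_nonneg_left (integral_norm_sq_trigSum_le q a) (sq_nonneg _)
        _ = _ := by ring
    · have hL := hmL ij.1 (by omega)
      refine ⟨((N.choose ij.1 : ℝ) * C) ^ 2 * ∫ x in Ioo (0 : ℝ) 1, ‖m ij.1 x‖ ^ 2,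
        mul_nonneg (sq_nonneg _) (integral_nonneg fun x => by positivity), fun a => ?_⟩
      set n := ‖a.linearCombination ℂ (HZero.mode N)‖
      have hle : ∀ x : ℝ, ‖((N.choose ij.1 : ℂ) * (m ij.1 x : ℂ)) * trigSum ij.2 x a‖ ≤
          ((N.choose ij.1 : ℝ) * C * n) * ‖m ij.1 x‖ := by
        intro x
        rw [norm_mul, norm_mul, Complex.norm_real, Complex.norm_natCast]
        calc _ ≤ (N.choose ij.1 : ℝ) * ‖m ij.1 x‖ * (C * n) := by
              gcongr
              exact h _ (by omega) x a
          _ = _ := by ring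
      have hM : MemLp (fun x => ((N.choose ij.1 : ℂ) * (m ij.1 x : ℂ)) * trigSum ij.2 x a) 2
          (volume.restrict (Ioo 0 1)) :=
        MemLp.of_le_mul hL ((aestronglyMeasurable_const.mul
          (Complex.continuous_ofReal.comp_aestronglyMeasurable hL.1)).mul
            (continuous_trigSum _ a).aestronglyMeasurable) (Filter.Eventually.of_forall hle)
      refine ⟨hM, ?_⟩
      calc _ ≤ ∫ x in Ioo (0 : ℝ) 1, ((N.choose ij.1 : ℝ) * C * n) ^ 2 * ‖m ij.1 x‖ ^ 2 := by
            refine integral_mono (hM.integrable_norm_pow (by norm_num))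
              ((hL.integrable_norm_pow (by norm_num)).const_mul _) fun x => ?_
            simp only
            rw [← mul_pow]
            have := hle x
            gcongr
        _ = _ := by rw [integral_const_mul]; ring
  choose! K hK0 hK using key
  refine ⟨(Finset.HasAntidiagonal.antidiagonal N).card *
    ∑ ij ∈ Finset.HasAntidiagonal.antidiagonal N, K ij,
    mul_nonneg (Nat.cast_nonneg _) (Finset.sum_nonneg hK0), fun a => ?_⟩
  have e : ∀ x, prodDeriv m N x a = ∑ ij ∈ Finset.HasAntidiagonal.antidiagonal N,
      ((N.choose ij.1 : ℂ) * (m ij.1 x : ℂ)) * trigSum ij.2 x a := by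
    intro x
    simp [prodDeriv, LinearMap.coe_sum, Finset.sum_apply]
  simp only [e]
  have hM := memLp_finsetSum (Finset.HasAntidiagonal.antidiagonal N) fun ij hij => (hK ij hij a).1
  refine ⟨hM, ?_⟩
  have hI : ∀ ij ∈ Finset.HasAntidiagonal.antidiagonal N, Integrable (fun x =>
      ‖((N.choose ij.1 : ℂ) * (m ij.1 x : ℂ)) * trigSum ij.2 x a‖ ^ 2)
        (volume.restrict (Ioo (0 : ℝ) 1)) :=
    fun ij hij => (hK ij hij a).1.integrable_norm_pow (by norm_num)
  calc _ ≤ ∫ x in Ioo (0 : ℝ) 1, ((Finset.HasAntidiagonal.antidiagonal N).card : ℝ) *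
        ∑ ij ∈ Finset.HasAntidiagonal.antidiagonal N,
          ‖((N.choose ij.1 : ℂ) * (m ij.1 x : ℂ)) * trigSum ij.2 x a‖ ^ 2 := by
        refine integral_mono (hM.integrable_norm_pow (by norm_num))
          ((integrable_finsetSum _ hI).const_mul _) fun x => ?_
        refine le_trans ?_ sq_sum_le_card_mul_sum_sq
        gcongr
        exact norm_sum_le _ _
    _ = ((Finset.HasAntidiagonal.antidiagonal N).card : ℝ) *
        ∑ ij ∈ Finset.HasAntidiagonal.antidiagonal N, ∫ x in Ioo (0 : ℝ) 1,
          ‖((N.choose ij.1 : ℂ) * (m ij.1 x : ℂ)) * trigSum ij.2 x a‖ ^ 2 := by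
        rw [integral_const_mul, integral_finsetSum _ hI]
    _ ≤ _ := by
        rw [mul_assoc, Finset.sum_mul]
        gcongr with ij hij
        exact (hK ij hij a).2

/-- On `H^{2q+1}_{(0)}` the coefficients of the product with `μ` are, up to the weight `j^{2q+1}`, the
sum of two boundary terms and of a square summable sequence. -/
theorem exists_mul_decomposition {μ : ℝ → ℝ} {m : ℕ → ℝ → ℝ} {q : ℕ} {s : ℝ}
    (hs : s = (2 * q + 1 : ℕ)) {M : L2 →L[ℂ] L2}
    (hM : ∀ φ, ∀ᵐ x ∂volume.restrict (Ioo (0 : ℝ) 1), M φ x = (μ x : ℂ) * φ x)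
    (hμ : ∀ᵐ x ∂volume.restrict (Ioo (0 : ℝ) 1), μ x = m 0 x)
    (hm : ∀ i < 2 * q + 1, IsPrim 1 (m i) (m (i + 1)))
    (hN : MemLp (m (2 * q + 1)) 2 (volume.restrict (Ioo 0 1)))
    (h0 : ∀ n, n + 1 < q → m (2 * n + 1) 0 = 0 ∧ m (2 * n + 1) 1 = 0) :
    ∃ (b₀ b₁ : HZero s →L[ℂ] ℂ) (d : ℕ+ → HZero s →L[ℂ] ℂ) (C : ℝ), 0 ≤ C ∧
      (∀ φ (F : Finset ℕ+), ∑ j ∈ F, ‖d j φ‖ ^ 2 ≤ C * ‖φ‖ ^ 2) ∧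
      (∀ φ (j : ℕ+), (((j : ℝ) ^ s : ℝ) : ℂ) * coeff j (M (HZero.toL2 φ)) =
        b₀ φ + (-1) ^ (j : ℕ) * b₁ φ + d j φ) ∧
      ((∀ n < q, m (2 * n + 1) 0 = 0 ∧ m (2 * n + 1) 1 = 0) → b₀ = 0 ∧ b₁ = 0) := by
  subst hs
  set N := 2 * q + 1 with hNq
  have hs0 : (0 : ℝ) ≤ (N : ℕ) := Nat.cast_nonneg _
  obtain ⟨K, hK0, hK⟩ := exists_integral_norm_sq_prodDeriv_le hm hN
  set e : (ℕ+ →₀ ℂ) →ₗ[ℂ] HZero (N : ℕ) := Finsupp.linearCombination ℂ (HZero.mode (N : ℕ)) with he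
  have hde : DenseRange e := HZero.denseRange_linearCombination
  -- The integrations by parts produce the weight `(jπ)^N`; `κ` removes `π^N` and carries the sign,
  -- so that exactly `j^N` is left.
  set κ : ℂ := (-1) ^ q * ((Real.pi : ℂ) ^ N)⁻¹ with hκ
  have hκ1 : ‖κ‖ ≤ 1 := by
    rw [hκ, norm_mul, norm_pow, norm_neg, norm_one, one_pow, one_mul, norm_inv, norm_pow,
      Complex.norm_real, Real.norm_of_nonneg Real.pi_pos.le]
    refine inv_le_one_of_one_le₀ (one_le_pow₀ ?_)
    linarith [Real.pi_gt_three]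
  have hint : ∀ (j : ℕ+) (a : ℕ+ →₀ ℂ), Integrable (fun x => (starRingEnd ℂ)
      ((Real.sqrt 2 * Real.cos (j * Real.pi * x) : ℝ) : ℂ) * prodDeriv m N x a)
      (volume.restrict (Ioo (0 : ℝ) 1)) := fun j a => (memLp_cos j).star.integrable_mul (hK a).1
  -- The trace functional `β x` and the remainders `δ j` are first defined on finite sums, where the
  -- differentiations are explicit, and at the end extended by density.
  let β (x : ℝ) : (ℕ+ →₀ ℂ) →ₗ[ℂ] ℂ := (κ * Real.sqrt 2) • prodDeriv m (2 * q) x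
  let δ (j : ℕ+) : (ℕ+ →₀ ℂ) →ₗ[ℂ] ℂ := κ •
    { toFun := fun a => ∫ x in Ioo (0 : ℝ) 1, (starRingEnd ℂ)
        ((Real.sqrt 2 * Real.cos (j * Real.pi * x) : ℝ) : ℂ) * prodDeriv m N x a
      map_add' := fun a b => by
        simp only [map_add, mul_add]
        exact integral_add (hint j a) (hint j b)
      map_smul' := fun c a => by
        simp only [map_smul, smul_eq_mul, RingHom.id_apply, mul_left_comm _ c]
        exact integral_const_mul _ _ }
  have hδ : ∀ (F : Finset ℕ+) a, ∑ j ∈ F, ‖δ j a‖ ^ 2 ≤ K * ‖e a‖ ^ 2 := by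
    intro F a
    -- The remainders are the cosine coefficients of the top derivative, so Bessel's inequality
    -- bounds their squares by its `L²` norm.
    have h1 := bessel_Ioo zero_lt_one memLp_cos integral_cos_mul_cos (hK a).1 F
    rw [one_mul] at h1
    refine le_trans (Finset.sum_le_sum fun j _ => ?_) (h1.trans (hK a).2)
    change ‖κ * _‖ ^ 2 ≤ _
    rw [norm_mul]
    gcongr
    exact mul_le_of_le_one_left (norm_nonneg _) hκ1
  have hβb : ∀ x, ∃ C, ∀ a, ‖β x a‖ ≤ C * ‖e a‖ := by
    intro x
    obtain ⟨C, hC, h⟩ := exists_norm_prodDeriv_le m q x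
    refine ⟨‖κ * Real.sqrt 2‖ * C, fun a => ?_⟩
    change ‖(κ * Real.sqrt 2) * _‖ ≤ _
    rw [norm_mul]
    exact (mul_le_mul_of_nonneg_left (h a) (norm_nonneg _)).trans_eq (mul_assoc _ _ _).symm
  have hδb : ∀ j, ∃ C, ∀ a, ‖δ j a‖ ≤ C * ‖e a‖ := by
    intro j
    refine ⟨Real.sqrt K, fun a => ?_⟩
    refine le_of_sq_le_sq ?_ (by positivity)
    rw [mul_pow, Real.sq_sqrt hK0]
    simpa using hδ {j} a
  have hid : ∀ a (j : ℕ+), (((j : ℝ) ^ ((N : ℕ) : ℝ) : ℝ) : ℂ) * coeff j (M (HZero.toL2 (e a))) =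
      β 0 a + (-1) ^ (j : ℕ) * (-β 1 a) + δ j a := by
    intro a j
    -- The traces of order `2r` with `r < q` involve the odd derivatives of `m 0` up to order `2r-1
    -- ≤ 2q-3` only, hence the range `n + 1 < q` in `h0`.
    have h1 := integral_mul_sin_of_chain (c := fun r x => prodDeriv m r x a) (q := q)
      (fun i hi => isPrim_prodDeriv hm a hi) (fun r hr => by
        have := prodDeriv_even (m := m) (q := r) fun n hn => h0 n (by omega)
        simp [this.1, this.2]) j
    rw [coeff_mul_linearCombination hM hμ]
    have h2 : ∀ x, prodDeriv m 0 x a = (m 0 x : ℂ) * trigSum 0 x a := by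
      intro x
      simp [prodDeriv]
    simp only [h2] at h1
    change _ = (κ * Real.sqrt 2) * prodDeriv m (2 * q) 0 a + (-1) ^ (j : ℕ) *
      (-((κ * Real.sqrt 2) * prodDeriv m (2 * q) 1 a)) + κ * ∫ x in Ioo (0 : ℝ) 1, (starRingEnd ℂ)
        ((Real.sqrt 2 * Real.cos (j * Real.pi * x) : ℝ) : ℂ) * prodDeriv m N x a
    have h3 : ∫ x in Ioo (0 : ℝ) 1, (starRingEnd ℂ)
        ((Real.sqrt 2 * Real.cos (j * Real.pi * x) : ℝ) : ℂ) * prodDeriv m N x a =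
        Real.sqrt 2 * ∫ x in (0 : ℝ)..1, prodDeriv m N x a *
          ((Real.cos (j * Real.pi * x) : ℝ) : ℂ) := by
      rw [intervalIntegral.integral_of_le zero_le_one, integral_Ioc_eq_integral_Ioo,
        ← integral_const_mul]
      congr 1
      funext x
      rw [Complex.conj_ofReal]
      push_cast
      ring
    rw [h3, hκ, Real.rpow_natCast]
    have hpi : (Real.pi : ℂ) ^ N ≠ 0 := pow_ne_zero _ (by exact_mod_cast Real.pi_ne_zero)
    rw [← hNq] at h1
    push_cast at h1 ⊢
    rw [mul_pow] at h1
    field_simp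
    linear_combination h1
  refine ⟨(β 0).extendOfNorm e, -(β 1).extendOfNorm e, fun j => (δ j).extendOfNorm e, K, hK0,
    fun φ F => ?_, fun φ j => ?_, fun h => ?_⟩
  · refine hde.induction_on φ (isClosed_le (by fun_prop) (by fun_prop)) fun a => ?_
    simp only [fun j => LinearMap.extendOfNorm_eq hde (hδb j) a]
    exact hδ F a
  · refine hde.induction_on φ (isClosed_eq ?_ (by fun_prop)) fun a => ?_
    · exact continuous_const.mul ((coeffCLM j).continuous.comp
        (M.continuous.comp (HZero.toL2CLM hs0).continuous))
    · rw [neg_apply, LinearMap.extendOfNorm_eq hde (hβb 0),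
        LinearMap.extendOfNorm_eq hde (hβb 1), LinearMap.extendOfNorm_eq hde (hδb j)]
      exact hid a j
  · have := prodDeriv_even h
    have hz : ∀ x, prodDeriv m (2 * q) x = 0 → (β x).extendOfNorm e = 0 := by
      intro x hx
      ext φ
      refine hde.induction_on φ (isClosed_eq (by fun_prop) (by fun_prop)) fun a => ?_
      rw [LinearMap.extendOfNorm_eq hde (hβb x)]
      simp [β, hx]
    exact ⟨hz 0 this.1, by rw [hz 1 this.2, neg_zero]⟩

/-! ### Hidden regularity of the Duhamel integral -/

/-- The `j`-th coefficient of the image of `φ` under an operator of `L²`. -/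
def mulCoef (M : L2 →L[ℂ] L2) {s : ℝ} (j : ℕ+) (φ : HZero s) : ℂ := coeff j (M (HZero.toL2 φ))

/-- `mulCoef` as a continuous linear functional. -/
def mulCoefCLM (M : L2 →L[ℂ] L2) {s : ℝ} (hs : 0 ≤ s) (j : ℕ+) : HZero s →L[ℂ] ℂ :=
  (coeffCLM j).comp (M.comp (HZero.toL2CLM hs))

theorem mulCoefCLM_apply (M : L2 →L[ℂ] L2) {s : ℝ} (hs : 0 ≤ s) (j : ℕ+) (φ : HZero s) :
    mulCoefCLM M hs j φ = mulCoef M j φ := rfl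

/-- The properties of the multiplication operator which are used for the Schrödinger equation in
`H^s_{(0)}`. -/
structure IsRegularMul (s : ℝ) (M : L2 →L[ℂ] L2) : Prop where
  two_le : 2 ≤ s
  high : ∃ (b₀ b₁ : HZero s →L[ℂ] ℂ) (d : ℕ+ → HZero s →L[ℂ] ℂ) (C : ℝ), 0 ≤ C ∧
    (∀ φ (F : Finset ℕ+), ∑ j ∈ F, ‖d j φ‖ ^ 2 ≤ C * ‖φ‖ ^ 2) ∧
    ∀ φ (j : ℕ+), (((j : ℝ) ^ s : ℝ) : ℂ) * mulCoef M j φ = b₀ φ + (-1) ^ (j : ℕ) * b₁ φ + d j φ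
  low : ∃ C : ℝ, 0 ≤ C ∧ ∀ (φ : HZero (s - 2)) (F : Finset ℕ+),
    ∑ j ∈ F, ((j : ℝ) ^ (s - 2) * ‖mulCoef M j φ‖) ^ 2 ≤ C * ‖φ‖ ^ 2

theorem IsRegularMul.nonneg {s : ℝ} {M : L2 →L[ℂ] L2} (h : IsRegularMul s M) : 0 ≤ s :=
  zero_le_two.trans h.two_le

theorem ContinuousOn.aestronglyMeasurable_Ioo {E : Type*} [NormedAddCommGroup E] {T : ℝ}
    {h : ℝ → E} (hh : ContinuousOn h (Icc 0 T)) :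
    AEStronglyMeasurable h (volume.restrict (Ioo 0 T)) := by
  have h2 := hh.aestronglyMeasurable (μ := volume) measurableSet_Icc
  exact h2.mono_measure (Measure.restrict_mono Ioo_subset_Icc_self le_rfl)

theorem ContinuousOn.ae_norm_le {E : Type*} [NormedAddCommGroup E] {T : ℝ}
    {h : ℝ → E} (hh : ContinuousOn h (Icc 0 T)) :
    ∃ B, 0 ≤ B ∧ (∀ t ∈ Icc 0 T, ‖h t‖ ≤ B) ∧ ∀ᵐ t ∂volume.restrict (Ioo 0 T), ‖h t‖ ≤ B := by
  obtain ⟨B, hB⟩ := isCompact_Icc.exists_bound_of_continuousOn hh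
  refine ⟨max B 0, le_max_right _ _, fun t ht => (hB t ht).trans (le_max_left _ _), ?_⟩
  exact (ae_restrict_iff' measurableSet_Ioo).2 (Filter.Eventually.of_forall fun t ht =>
    (hB t (Ioo_subset_Icc_self ht)).trans (le_max_left _ _))

theorem memLp_mul_continuousOn {T : ℝ} {g : ℝ → ℝ} (hg : MemLp g 2 (volume.restrict (Ioo 0 T)))
    {h : ℝ → ℂ} (hh : ContinuousOn h (Icc 0 T)) :
    MemLp (fun t => (g t : ℂ) * h t) 2 (volume.restrict (Ioo 0 T)) := by
  obtain ⟨B, hB0, -, hB⟩ := ContinuousOn.ae_norm_le hh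
  refine MemLp.of_le_mul (c := B) hg ((Complex.continuous_ofReal.comp_aestronglyMeasurable
    hg.1).mul (ContinuousOn.aestronglyMeasurable_Ioo hh)) ?_
  filter_upwards [hB] with x hx
  rw [norm_mul, Complex.norm_real, mul_comm]
  gcongr

theorem integrable_sq_mul_norm_sq {E : Type*} [NormedAddCommGroup E] {T : ℝ} {g : ℝ → ℝ}
    (hg : MemLp g 2 (volume.restrict (Ioo 0 T))) {f : ℝ → E} (hf : ContinuousOn f (Icc 0 T)) :
    Integrable (fun t => g t ^ 2 * ‖f t‖ ^ 2) (volume.restrict (Ioo 0 T)) := by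
  obtain ⟨B, hB0, -, hB⟩ := ContinuousOn.ae_norm_le hf
  have h1 : Integrable (fun t => g t ^ 2) (volume.restrict (Ioo 0 T)) := hg.integrable_sq
  refine h1.mul_bdd (c := B ^ 2) ((ContinuousOn.aestronglyMeasurable_Ioo hf).norm.pow 2) ?_
  filter_upwards [hB] with x hx
  rw [Real.norm_of_nonneg (by positivity)]
  gcongr

theorem norm_sq_mul_clm_le {s : ℝ} (b : HZero s →L[ℂ] ℂ) {T : ℝ} {g : ℝ → ℝ}
    (hg : MemLp g 2 (volume.restrict (Ioo 0 T))) {f : ℝ → HZero s} (hf : ContinuousOn f (Icc 0 T)) :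
    ∫ t in Ioo 0 T, ‖(g t : ℂ) * b (f t)‖ ^ 2 ≤ ‖b‖ ^ 2 * ∫ t in Ioo 0 T, g t ^ 2 * ‖f t‖ ^ 2 := by
  rw [← integral_const_mul]
  refine integral_mono ((memLp_mul_continuousOn hg
    (b.continuous.comp_continuousOn hf)).integrable_norm_pow (by norm_num))
    ((integrable_sq_mul_norm_sq hg hf).const_mul _) fun t => ?_
  simp only [norm_mul, mul_pow, Complex.norm_real, Real.norm_eq_abs, sq_abs]
  have := b.le_opNorm (f t)
  calc g t ^ 2 * ‖b (f t)‖ ^ 2 ≤ g t ^ 2 * (‖b‖ * ‖f t‖) ^ 2 := by gcongr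
    _ = _ := by ring

theorem norm_exp_I_eigenvalue (j : ℕ+) (t : ℝ) :
    ‖Complex.exp (Complex.I * eigenvalue j * t)‖ = 1 := by
  rw [show Complex.I * eigenvalue j * t = ((eigenvalue j * t : ℝ) : ℂ) * Complex.I by
    push_cast; ring, Complex.norm_exp_ofReal_mul_I]

/-- The gain from time integration. The trace parts `b₀(f)`, `b₁(f)` do not depend on `j` apart from
the factor `(-1)^j` of modulus one, so their integrals against `e^{iλ_j t}` are square summable in
`j` by `exists_bessel_exp`. The part `d j` is square summable at each time, and Cauchy–Schwarz in
time suffices for it. -/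
theorem exists_hidden_regularity {s T : ℝ} {M : L2 →L[ℂ] L2} (hM : IsRegularMul s M) (hT : 0 < T) :
    ∃ C : ℝ, 0 ≤ C ∧ ∀ (g : ℝ → ℝ), MemLp g 2 (volume.restrict (Ioo 0 T)) →
      ∀ f : ℝ → HZero s, ContinuousOn f (Icc 0 T) → ∀ F : Finset ℕ+,
        ∑ j ∈ F, ((j : ℝ) ^ s * ‖∫ t in Ioo 0 T, Complex.exp (Complex.I * eigenvalue j * t) *
          ((g t : ℂ) * mulCoef M j (f t))‖) ^ 2 ≤ C * ∫ t in Ioo 0 T, g t ^ 2 * ‖f t‖ ^ 2 := by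
  obtain ⟨b₀, b₁, d, K, hK0, hd, hdec⟩ := hM.high
  obtain ⟨C, hC, hB⟩ := exists_bessel_exp hT
  refine ⟨3 * (C * ‖b₀‖ ^ 2 + C * ‖b₁‖ ^ 2 + T * K), by positivity, fun g hg f hf F => ?_⟩
  set Q := ∫ t in Ioo 0 T, g t ^ 2 * ‖f t‖ ^ 2 with hQ
  have hmem : ∀ b : HZero s →L[ℂ] ℂ, MemLp (fun t => (g t : ℂ) * b (f t)) 2
      (volume.restrict (Ioo 0 T)) := fun b =>
    memLp_mul_continuousOn hg (b.continuous.comp_continuousOn hf)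
  have hE : ∀ j : ℕ+, MemLp (fun t : ℝ => Complex.exp (Complex.I * eigenvalue j * t)) 2
      (volume.restrict (Ioo 0 T)) := fun j =>
    MemLp.of_bound (C := 1) (Continuous.aestronglyMeasurable (by fun_prop))
      (Filter.Eventually.of_forall fun t => (norm_exp_I_eigenvalue j t).le)
  have hint : ∀ (j : ℕ+) (b : HZero s →L[ℂ] ℂ), Integrable
      (fun t : ℝ => Complex.exp (Complex.I * eigenvalue j * t) * ((g t : ℂ) * b (f t)))
      (volume.restrict (Ioo 0 T)) := fun j b => (hE j).integrable_mul (hmem b)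
  have hb : ∀ b : HZero s →L[ℂ] ℂ, ∑ j ∈ F, ‖∫ t in Ioo 0 T,
      Complex.exp (Complex.I * eigenvalue j * t) * ((g t : ℂ) * b (f t))‖ ^ 2 ≤ C * ‖b‖ ^ 2 * Q := by
    intro b
    refine (hB _ (hmem b) F).trans ?_
    rw [mul_assoc]
    gcongr
    exact norm_sq_mul_clm_le b hg hf
  have hdd : ∑ j ∈ F, ‖∫ t in Ioo 0 T,
      Complex.exp (Complex.I * eigenvalue j * t) * ((g t : ℂ) * d j (f t))‖ ^ 2 ≤ T * K * Q := by
    have h1 : ∀ j ∈ F, ‖∫ t in Ioo 0 T,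
        Complex.exp (Complex.I * eigenvalue j * t) * ((g t : ℂ) * d j (f t))‖ ^ 2 ≤
          T * ∫ t in Ioo 0 T, ‖(g t : ℂ) * d j (f t)‖ ^ 2 := by
      intro j _
      refine (norm_integral_mul_sq_le (hE j) (hmem (d j))).trans_eq ?_
      simp [norm_exp_I_eigenvalue, hT.le]
    refine (Finset.sum_le_sum h1).trans ?_
    have hI : ∀ j ∈ F, Integrable (fun t => ‖(g t : ℂ) * d j (f t)‖ ^ 2)
        (volume.restrict (Ioo 0 T)) := fun j _ => (hmem (d j)).integrable_norm_pow (by norm_num)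
    have h2 : ∫ t in Ioo 0 T, ∑ j ∈ F, ‖(g t : ℂ) * d j (f t)‖ ^ 2 ≤ K * Q := by
      rw [hQ, ← integral_const_mul]
      refine integral_mono (integrable_finsetSum F hI)
        ((integrable_sq_mul_norm_sq hg hf).const_mul _) fun t => ?_
      simp only [norm_mul, mul_pow, Complex.norm_real, Real.norm_eq_abs, sq_abs]
      rw [← Finset.mul_sum]
      calc g t ^ 2 * ∑ j ∈ F, ‖d j (f t)‖ ^ 2 ≤ g t ^ 2 * (K * ‖f t‖ ^ 2) := by
            gcongr
            exact hd _ F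
        _ = _ := by ring
    rw [← Finset.mul_sum, ← integral_finsetSum F hI, mul_assoc]
    exact mul_le_mul_of_nonneg_left h2 hT.le
  have hsplit : ∀ j : ℕ+, (((j : ℝ) ^ s : ℝ) : ℂ) * ∫ t in Ioo 0 T,
      Complex.exp (Complex.I * eigenvalue j * t) * ((g t : ℂ) * mulCoef M j (f t)) =
      (∫ t in Ioo 0 T, Complex.exp (Complex.I * eigenvalue j * t) * ((g t : ℂ) * b₀ (f t))) +
      (-1) ^ (j : ℕ) * (∫ t in Ioo 0 T, Complex.exp (Complex.I * eigenvalue j * t) *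
        ((g t : ℂ) * b₁ (f t))) +
      ∫ t in Ioo 0 T, Complex.exp (Complex.I * eigenvalue j * t) * ((g t : ℂ) * d j (f t)) := by
    intro j
    have h12 : Integrable (fun t : ℝ => Complex.exp (Complex.I * eigenvalue j * t) *
        ((g t : ℂ) * b₀ (f t)) + (-1) ^ (j : ℕ) * (Complex.exp (Complex.I * eigenvalue j * t) *
        ((g t : ℂ) * b₁ (f t)))) (volume.restrict (Ioo 0 T)) :=
      (hint j b₀).add ((hint j b₁).const_mul _)
    rw [← integral_const_mul, ← integral_const_mul, ← integral_add (hint j b₀)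
      ((hint j b₁).const_mul _), ← integral_add h12 (hint j (d j))]
    refine integral_congr_ae (Filter.Eventually.of_forall fun t => ?_)
    have := hdec (f t) j
    simp only
    linear_combination (Complex.exp (Complex.I * eigenvalue j * t) * (g t : ℂ)) * this
  have hfin : ∀ j ∈ F, ((j : ℝ) ^ s * ‖∫ t in Ioo 0 T, Complex.exp (Complex.I * eigenvalue j * t) *
          ((g t : ℂ) * mulCoef M j (f t))‖) ^ 2 ≤
      3 * (‖∫ t in Ioo 0 T, Complex.exp (Complex.I * eigenvalue j * t) * ((g t : ℂ) * b₀ (f t))‖ ^ 2 +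
        ‖∫ t in Ioo 0 T, Complex.exp (Complex.I * eigenvalue j * t) * ((g t : ℂ) * b₁ (f t))‖ ^ 2 +
        ‖∫ t in Ioo 0 T, Complex.exp (Complex.I * eigenvalue j * t) *
          ((g t : ℂ) * d j (f t))‖ ^ 2) := by
    intro j _
    have h1 := congrArg norm (hsplit j)
    rw [norm_mul, Complex.norm_real, Real.norm_of_nonneg (by positivity)] at h1
    rw [h1]
    have h2 := norm_add₃_le (a := ∫ t in Ioo 0 T, Complex.exp (Complex.I * eigenvalue j * t) *
      ((g t : ℂ) * b₀ (f t))) (b := (-1) ^ (j : ℕ) * (∫ t in Ioo 0 T,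
        Complex.exp (Complex.I * eigenvalue j * t) * ((g t : ℂ) * b₁ (f t))))
      (c := ∫ t in Ioo 0 T, Complex.exp (Complex.I * eigenvalue j * t) * ((g t : ℂ) * d j (f t)))
    rw [norm_mul, norm_pow, norm_neg, norm_one, one_pow, one_mul] at h2
    refine (pow_le_pow_left₀ (norm_nonneg _) h2 2).trans ?_
    generalize ‖∫ t in Ioo 0 T, Complex.exp (Complex.I * eigenvalue j * t) *
      ((g t : ℂ) * b₀ (f t))‖ = x
    generalize ‖∫ t in Ioo 0 T, Complex.exp (Complex.I * eigenvalue j * t) *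
      ((g t : ℂ) * b₁ (f t))‖ = y
    generalize ‖∫ t in Ioo 0 T, Complex.exp (Complex.I * eigenvalue j * t) *
      ((g t : ℂ) * d j (f t))‖ = z
    nlinarith [sq_nonneg (x - y), sq_nonneg (y - z), sq_nonneg (x - z)]
  refine (Finset.sum_le_sum hfin).trans ?_
  rw [← Finset.mul_sum, Finset.sum_add_distrib, Finset.sum_add_distrib]
  have := hb b₀
  have := hb b₁
  linarith

theorem exists_duhamel_vector {s T : ℝ} {M : L2 →L[ℂ] L2} (hM : IsRegularMul s M) (hT : 0 < T) :
    ∃ C : ℝ, 0 ≤ C ∧ ∀ (g : ℝ → ℝ), MemLp g 2 (volume.restrict (Ioo 0 T)) →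
      ∀ f : ℝ → HZero s, ContinuousOn f (Icc 0 T) → ∃ v : HZero s,
        (∀ j, HZero.coef j v = ∫ t in Ioo 0 T, Complex.exp (Complex.I * eigenvalue j * t) *
          ((g t : ℂ) * mulCoef M j (f t))) ∧
        ‖v‖ ^ 2 ≤ C * ∫ t in Ioo 0 T, g t ^ 2 * ‖f t‖ ^ 2 := by
  obtain ⟨C, hC, h⟩ := exists_hidden_regularity hM hT
  refine ⟨C, hC, fun g hg f hf => ?_⟩
  have h0 : 0 ≤ C * ∫ t in Ioo 0 T, g t ^ 2 * ‖f t‖ ^ 2 :=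
    mul_nonneg hC (integral_nonneg fun t => by positivity)
  obtain ⟨v, hv, hn⟩ := HZero.exists_of_sum_le hM.nonneg _ (Real.sqrt_nonneg _) (fun F => by
    rw [Real.sq_sqrt h0]
    exact h g hg f hf F)
  exact ⟨v, hv, by rw [← Real.sq_sqrt h0]; gcongr⟩

/-! ### Operators on continuous paths -/

/-- Continuous paths `[0,T] → H^s_{(0)}`. -/
abbrev Path (s T : ℝ) : Type := C(Icc (0 : ℝ) T, HZero s)

/-- The constant extension of a path to the real line. -/
def extPath {s T : ℝ} (hT : 0 ≤ T) (w : Path s T) (t : ℝ) : HZero s := w (projIcc 0 T hT t)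

theorem continuous_extPath {s T : ℝ} (hT : 0 ≤ T) (w : Path s T) : Continuous (extPath hT w) :=
  w.continuous.comp continuous_projIcc

theorem norm_extPath_le {s T : ℝ} (hT : 0 ≤ T) (w : Path s T) (t : ℝ) : ‖extPath hT w t‖ ≤ ‖w‖ :=
  w.norm_coe_le_norm _

theorem exists_path_eq {s T : ℝ} (f : ℝ → HZero s) (hf : ContinuousOn f (Icc 0 T)) :
    ∃ w : Path s T, ∀ t, w t = f t := ⟨⟨(Icc 0 T).domRestrict f, hf.domRestrict⟩, fun _ => rfl⟩

theorem integral_indicator_Iic {E : Type*} [NormedAddCommGroup E] [NormedSpace ℝ E] {T t : ℝ}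
    (ht : t ∈ Icc 0 T) (f : ℝ → E) :
    ∫ τ in Ioo 0 T, (Iic t).indicator f τ = ∫ τ in (0 : ℝ)..t, f τ := by
  rw [← integral_Ioc_eq_integral_Ioo, setIntegral_indicator measurableSet_Iic,
    Ioc_inter_Iic, min_eq_right ht.2, intervalIntegral.integral_of_le ht.1]

theorem integrable_duhamel {s T : ℝ} (M : L2 →L[ℂ] L2) (hs : 0 ≤ s) {g : ℝ → ℝ}
    (hg : MemLp g 2 (volume.restrict (Ioo 0 T))) {f : ℝ → HZero s} (hf : ContinuousOn f (Icc 0 T))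
    (j : ℕ+) : Integrable (fun t : ℝ => Complex.exp (Complex.I * eigenvalue j * t) *
      ((g t : ℂ) * mulCoef M j (f t))) (volume.restrict (Ioo 0 T)) := by
  have h1 := memLp_mul_continuousOn hg ((mulCoefCLM M hs j).continuous.comp_continuousOn hf)
  refine (h1.integrable (by norm_num)).bdd_mul (c := 1)
    (Continuous.aestronglyMeasurable (by fun_prop)) ?_
  exact Filter.Eventually.of_forall fun t => (norm_exp_I_eigenvalue j t).le

theorem memLp_indicator_Iic {T : ℝ} {g : ℝ → ℝ} (hg : MemLp g 2 (volume.restrict (Ioo 0 T)))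
    (t : ℝ) : MemLp ((Iic t).indicator g) 2 (volume.restrict (Ioo 0 T)) :=
  hg.indicator measurableSet_Iic

theorem intervalIntegrable_of_integrable {E : Type*} [NormedAddCommGroup E] {T t : ℝ}
    (ht : t ∈ Icc 0 T) {f : ℝ → E} (hf : Integrable f (volume.restrict (Ioo 0 T))) :
    IntervalIntegrable f volume 0 t :=
  (intervalIntegrable_iff_integrableOn_Ioo_of_le ht.1).2
    (IntegrableOn.mono_set hf (Ioo_subset_Ioo_right ht.2))

/-- The Duhamel operator `w ↦ ∫_0^t e^{-iA(t-τ)} g(τ) M w(τ) dτ` on continuous paths. -/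
theorem exists_duhamelOp {s T : ℝ} {M : L2 →L[ℂ] L2} (hM : IsRegularMul s M) (hT : 0 < T) :
    ∃ C : ℝ, 0 ≤ C ∧ ∀ (g : ℝ → ℝ), MemLp g 2 (volume.restrict (Ioo 0 T)) →
      ∃ G : Path s T →L[ℂ] Path s T,
        (∀ w t j, HZero.coef j (G w t) = Complex.exp (-Complex.I * eigenvalue j * (t : ℝ)) *
          ∫ τ in (0 : ℝ)..t, Complex.exp (Complex.I * eigenvalue j * τ) *
            ((g τ : ℂ) * mulCoef M j (extPath hT.le w τ))) ∧
        ∀ w (t : Icc (0 : ℝ) T),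
          ‖G w t‖ ^ 2 ≤ C * ∫ τ in (0 : ℝ)..t, g τ ^ 2 * ‖extPath hT.le w τ‖ ^ 2 := by
  obtain ⟨C, hC, H⟩ := exists_duhamel_vector hM hT
  refine ⟨C, hC, fun g hg => ?_⟩
  have hs := hM.nonneg
  have hcont : ∀ w : Path s T, ContinuousOn (extPath hT.le w) (Icc 0 T) := fun w =>
    (continuous_extPath hT.le w).continuousOn
  have hVex : ∀ (w : Path s T) (t : ℝ), ∃ v : HZero s, t ∈ Icc 0 T →
      ((∀ j, HZero.coef j v = ∫ τ in (0 : ℝ)..t, Complex.exp (Complex.I * eigenvalue j * τ) *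
        ((g τ : ℂ) * mulCoef M j (extPath hT.le w τ))) ∧
      ‖v‖ ^ 2 ≤ C * ∫ τ in (0 : ℝ)..t, g τ ^ 2 * ‖extPath hT.le w τ‖ ^ 2) := by
    intro w t
    -- The integral up to `t` is an integral over the whole interval with `g` cut off after `t`. One
    -- constant therefore serves for all `t`.
    obtain ⟨v, hv, hn⟩ := H _ (memLp_indicator_Iic hg t) _ (hcont w)
    refine ⟨v, fun ht => ⟨fun j => ?_, ?_⟩⟩
    · rw [hv, ← integral_indicator_Iic ht]
      congr 1
      funext τ
      by_cases hτ : τ ∈ Iic t <;> simp [hτ]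
    · rw [← integral_indicator_Iic ht]
      convert hn using 4 with τ
      by_cases hτ : τ ∈ Iic t <;> simp [hτ]
  choose V hV using hVex
  have hVc : ∀ w, ContinuousOn (V w) (Icc 0 T) := by
    intro w
    have hgI : Integrable (fun τ => g τ ^ 2) (volume.restrict (Ioo 0 T)) := hg.integrable_sq
    have hU : ContinuousOn (fun t => ∫ τ in (0 : ℝ)..t, g τ ^ 2) (Icc 0 T) := by
      have := (IsPrim.of_continuousOn (intervalIntegrable_of_integrable
        (right_mem_Icc.2 hT.le) hgI) 0).continuousOn
      simpa using this
    have key : ∀ r ∈ Icc 0 T, ∀ t ∈ Icc 0 T, ‖V w t - V w r‖ ^ 2 ≤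
        C * ‖w‖ ^ 2 * |(∫ τ in (0 : ℝ)..t, g τ ^ 2) - ∫ τ in (0 : ℝ)..r, g τ ^ 2| := by
      intro r hr t ht
      -- The increment between two times is the vector attached to the difference of the two
      -- cut-offs; its squared norm is controlled by the integral of `g²` between these times, which
      -- gives continuity.
      obtain ⟨v, hv, hn⟩ := H _ ((memLp_indicator_Iic hg t).sub (memLp_indicator_Iic hg r)) _ (hcont w)
      have hvV : v = V w t - V w r := by
        refine HZero.coef_ext fun j => ?_
        rw [HZero.coef_sub, hv, (hV w t ht).1, (hV w r hr).1, ← integral_indicator_Iic ht,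
          ← integral_indicator_Iic hr, ← integral_sub]
        · refine integral_congr_ae (Filter.Eventually.of_forall fun τ => ?_)
          by_cases h1 : τ ∈ Iic t <;> by_cases h2 : τ ∈ Iic r <;> simp [h1, h2]
        · exact (integrable_duhamel M hs hg (hcont w) j).indicator measurableSet_Iic
        · exact (integrable_duhamel M hs hg (hcont w) j).indicator measurableSet_Iic
      rw [← hvV]
      refine hn.trans ?_
      rw [mul_assoc]
      refine mul_le_mul_of_nonneg_left ?_ hC
      have hd : Integrable (fun τ => ((Iic t).indicator (fun τ => g τ ^ 2) τ -
          (Iic r).indicator (fun τ => g τ ^ 2) τ)) (volume.restrict (Ioo 0 T)) :=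
        (hgI.indicator measurableSet_Iic).sub (hgI.indicator measurableSet_Iic)
      have h3 : ∀ τ, ((Iic t).indicator g - (Iic r).indicator g) τ ^ 2 =
          |(Iic t).indicator (fun τ => g τ ^ 2) τ - (Iic r).indicator (fun τ => g τ ^ 2) τ| := by
        intro τ
        by_cases h1 : τ ∈ Iic t <;> by_cases h2 : τ ∈ Iic r <;> simp [h1, h2]
      have h4 : ∫ τ in Ioo 0 T, |(Iic t).indicator (fun τ => g τ ^ 2) τ -
          (Iic r).indicator (fun τ => g τ ^ 2) τ| =
          |(∫ τ in (0 : ℝ)..t, g τ ^ 2) - ∫ τ in (0 : ℝ)..r, g τ ^ 2| := by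
        rw [← integral_indicator_Iic ht, ← integral_indicator_Iic hr,
          ← integral_sub (hgI.indicator measurableSet_Iic) (hgI.indicator measurableSet_Iic)]
        rcases le_total r t with hrt | hrt
        · have hp : ∀ τ, 0 ≤ (Iic t).indicator (fun τ => g τ ^ 2) τ -
              (Iic r).indicator (fun τ => g τ ^ 2) τ := fun τ => sub_nonneg.2
            (indicator_le_indicator_of_subset (Iic_subset_Iic.2 hrt) (fun _ => sq_nonneg _) τ)
          simp only [fun τ => abs_of_nonneg (hp τ)]
          rw [abs_of_nonneg (integral_nonneg hp)]
        · have hp : ∀ τ, (Iic t).indicator (fun τ => g τ ^ 2) τ -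
              (Iic r).indicator (fun τ => g τ ^ 2) τ ≤ 0 := fun τ => sub_nonpos.2
            (indicator_le_indicator_of_subset (Iic_subset_Iic.2 hrt) (fun _ => sq_nonneg _) τ)
          simp only [fun τ => abs_of_nonpos (hp τ)]
          rw [abs_of_nonpos (integral_nonpos hp), integral_neg]
      rw [← h4, ← integral_const_mul]
      refine integral_mono_of_nonneg (Filter.Eventually.of_forall fun τ => by positivity)
        (hd.abs.const_mul _) (Filter.Eventually.of_forall fun τ => ?_)
      simp only [h3]
      rw [mul_comm]
      gcongr
      exact norm_extPath_le hT.le w τ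
    intro r hr
    rw [ContinuousWithinAt, tendsto_iff_norm_sub_tendsto_zero]
    have h5 : Filter.Tendsto (fun t => ‖V w t - V w r‖ ^ 2) (nhdsWithin r (Icc 0 T)) (nhds 0) := by
      refine squeeze_zero' (Filter.Eventually.of_forall fun t => by positivity)
        (eventually_mem_nhdsWithin.mono fun t ht => key r hr t ht) ?_
      have h6 := ((hU r hr).sub_const (∫ τ in (0 : ℝ)..r, g τ ^ 2)).abs.const_mul (C * ‖w‖ ^ 2)
      simpa using h6
    have h7 := h5.sqrt
    simpa [Real.sqrt_sq] using h7
  -- The vectors `V w t` carry the factor `e^{iλ_j τ}` only; applying `e^{-iAt}` restores the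
  -- convolution.
  choose P hP using fun w => exists_path_eq (T := T) (fun t => HZero.group hs t (V w t))
    (HZero.continuousOn_group hs (hVc w) continuousOn_id)
  have hPc : ∀ w (t : Icc (0 : ℝ) T) j, HZero.coef j (P w t) =
      Complex.exp (-Complex.I * eigenvalue j * (t : ℝ)) *
          ∫ τ in (0 : ℝ)..t, Complex.exp (Complex.I * eigenvalue j * τ) *
            ((g τ : ℂ) * mulCoef M j (extPath hT.le w τ)) := by
    intro w t j
    rw [hP, HZero.coef_group, (hV w t t.2).1]
  have hPn : ∀ w (t : Icc (0 : ℝ) T),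
      ‖P w t‖ ^ 2 ≤ C * ∫ τ in (0 : ℝ)..t, g τ ^ 2 * ‖extPath hT.le w τ‖ ^ 2 := by
    intro w t
    rw [hP]
    refine le_trans ?_ (hV w t t.2).2
    gcongr
    exact HZero.norm_group_le hs _ _
  let L : Path s T →ₗ[ℂ] Path s T :=
    { toFun := P
      map_add' := fun w z => by
        ext1 t
        refine HZero.coef_ext fun j => ?_
        have e : ∀ τ, extPath hT.le (w + z) τ = extPath hT.le w τ + extPath hT.le z τ := fun τ => rfl
        rw [ContinuousMap.add_apply, HZero.coef_add, hPc, hPc, hPc, ← mul_add,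
          ← intervalIntegral.integral_add
            (intervalIntegrable_of_integrable t.2 (integrable_duhamel M hs hg (hcont w) j))
            (intervalIntegrable_of_integrable t.2 (integrable_duhamel M hs hg (hcont z) j))]
        simp only [e, ← mulCoefCLM_apply M hs, map_add, mul_add]
      map_smul' := fun c w => by
        ext1 t
        refine HZero.coef_ext fun j => ?_
        have e : ∀ τ, extPath hT.le (c • w) τ = c • extPath hT.le w τ := fun τ => rfl
        rw [RingHom.id_apply, ContinuousMap.smul_apply, HZero.coef_smul, hPc, hPc, mul_left_comm,
          ← intervalIntegral.integral_const_mul c]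
        refine congrArg _ (congrArg (fun f => ∫ τ in (0 : ℝ)..t, f τ) (funext fun τ => ?_))
        simp only [e, ← mulCoefCLM_apply M hs, map_smul, smul_eq_mul]
        ring }
  refine ⟨L.mkContinuous (Real.sqrt (C * ∫ τ in (0 : ℝ)..T, g τ ^ 2)) fun w => ?_, hPc, hPn⟩
  have hgI : Integrable (fun τ => g τ ^ 2) (volume.restrict (Ioo 0 T)) := hg.integrable_sq
  have hgi : ∀ t ∈ Icc 0 T, IntervalIntegrable (fun τ => g τ ^ 2) volume 0 t := fun t ht =>
    intervalIntegrable_of_integrable ht hgI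
  refine (ContinuousMap.norm_le _ (by positivity)).2 fun t => ?_
  refine le_of_sq_le_sq ?_ (by positivity)
  have h0 : 0 ≤ ∫ τ in (0 : ℝ)..T, g τ ^ 2 :=
    intervalIntegral.integral_nonneg hT.le fun τ _ => sq_nonneg _
  rw [mul_pow, Real.sq_sqrt (mul_nonneg hC h0), mul_assoc]
  refine (hPn w t).trans (mul_le_mul_of_nonneg_left ?_ hC)
  calc ∫ τ in (0 : ℝ)..t, g τ ^ 2 * ‖extPath hT.le w τ‖ ^ 2
      ≤ ∫ τ in (0 : ℝ)..t, g τ ^ 2 * ‖w‖ ^ 2 := by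
        refine intervalIntegral.integral_mono_on t.2.1
          (intervalIntegrable_of_integrable t.2 (integrable_sq_mul_norm_sq hg (hcont w)))
          ((hgi t t.2).mul_const _) fun τ _ => ?_
        gcongr
        exact norm_extPath_le hT.le w τ
    _ = (∫ τ in (0 : ℝ)..t, g τ ^ 2) * ‖w‖ ^ 2 := intervalIntegral.integral_mul_const _ _
    _ ≤ (∫ τ in (0 : ℝ)..T, g τ ^ 2) * ‖w‖ ^ 2 := by
        gcongr
        exact intervalIntegral.integral_mono_interval le_rfl t.2.1 t.2.2
          (Filter.Eventually.of_forall fun τ => sq_nonneg _) (hgi T (right_mem_Icc.2 hT.le))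

/-! ### A Volterra fixed point theorem -/

/-- The integrand is almost everywhere the derivative of `4⁻¹ exp(4U)`, where `U` is the primitive
of `γ`. As this function is nondecreasing, the integral of its derivative is at most its increment,
and no more is needed. -/
theorem integral_mul_exp_integral_le {T : ℝ} {γ : ℝ → ℝ}
    (hγ : Integrable γ (volume.restrict (Ioo 0 T))) (hγ0 : ∀ t, 0 ≤ γ t) {t : ℝ}
    (ht : t ∈ Icc 0 T) :
    ∫ τ in (0 : ℝ)..t, γ τ * Real.exp (4 * ∫ σ in (0 : ℝ)..τ, γ σ) ≤
      4⁻¹ * Real.exp (4 * ∫ σ in (0 : ℝ)..t, γ σ) := by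
  have hi : ∀ t ∈ Icc 0 T, IntervalIntegrable γ volume 0 t := fun t ht =>
    intervalIntegrable_of_integrable ht hγ
  set U : ℝ → ℝ := fun t => ∫ σ in (0 : ℝ)..t, γ σ with hU
  have hmono : MonotoneOn (fun τ => 4⁻¹ * Real.exp (4 * U τ)) (uIcc 0 t) := by
    rw [uIcc_of_le ht.1]
    intro a ha b hb hab
    have : U a ≤ U b := intervalIntegral.integral_mono_interval le_rfl ha.1 hab
      (Filter.Eventually.of_forall fun τ => hγ0 τ) (hi b ⟨hb.1, hb.2.trans ht.2⟩)
    simp only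
    gcongr
  have h1 := hmono.intervalIntegral_deriv_mem_uIcc
  have hle : 4⁻¹ * Real.exp (4 * U 0) ≤ 4⁻¹ * Real.exp (4 * U t) :=
    hmono left_mem_uIcc right_mem_uIcc ht.1
  rw [uIcc_of_le (sub_nonneg.2 hle)] at h1
  have h2 : ∫ τ in (0 : ℝ)..t, γ τ * Real.exp (4 * U τ) =
      ∫ τ in (0 : ℝ)..t, deriv (fun τ => 4⁻¹ * Real.exp (4 * U τ)) τ := by
    refine intervalIntegral.integral_congr_ae ?_
    filter_upwards [(hi t ht).ae_hasDerivAt_integral] with x hx hxt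
    have h3 := ((hx (uIoc_subset_uIcc hxt) 0 left_mem_uIcc).const_mul 4).exp.const_mul (4⁻¹ : ℝ)
    rw [h3.deriv]
    ring
  rw [h2]
  refine h1.2.trans (sub_le_self _ (by positivity))

/-- A contraction for a weighted norm, without any smallness assumption: with `U` the primitive of
`γ`, induction gives `‖K^n r(t)‖² ≤ ‖r‖² 4^{-n} e^{4U(t)}`. The Neumann series then converges
geometrically with ratio `1/2`, which is the origin of the factors `2` and `exp(2U(T))`. The
hypothesis on `K` is the Volterra property: the value at `t` is bounded through times before `t`
only. -/
theorem exists_fixedPoint {s T : ℝ} (hs : 0 ≤ s) (hT : 0 < T) {γ : ℝ → ℝ}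
    (hγ : Integrable γ (volume.restrict (Ioo 0 T))) (hγ0 : ∀ t, 0 ≤ γ t)
    (K : Path s T →L[ℂ] Path s T)
    (hK : ∀ (w : Path s T) (ρ : ℝ → ℝ), MonotoneOn ρ (Icc 0 T) → ContinuousOn ρ (Icc 0 T) →
      (∀ t : Icc (0 : ℝ) T, ‖w t‖ ^ 2 ≤ ρ t) →
      ∀ t : Icc (0 : ℝ) T, ‖K w t‖ ^ 2 ≤ ∫ τ in (0 : ℝ)..t, γ τ * ρ τ) (r : Path s T) :
    ∃ w, w = r + K w ∧ ‖w‖ ≤ 2 * Real.exp (2 * ∫ τ in (0 : ℝ)..T, γ τ) * ‖r‖ ∧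
      ∀ z, z = r + K z → z = w := by
  have := HZero.completeSpace hs
  have hi : ∀ t ∈ Icc 0 T, IntervalIntegrable γ volume 0 t := fun t ht =>
    intervalIntegrable_of_integrable ht hγ
  set U : ℝ → ℝ := fun t => ∫ σ in (0 : ℝ)..t, γ σ with hU
  have hTm : T ∈ Icc 0 T := right_mem_Icc.2 hT.le
  have hUc : ContinuousOn U (Icc 0 T) := by
    simpa [hU] using (IsPrim.of_continuousOn (hi T hTm) 0).continuousOn
  have hUm : MonotoneOn U (Icc 0 T) := fun a ha b hb hab =>
    intervalIntegral.integral_mono_interval le_rfl ha.1 hab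
      (Filter.Eventually.of_forall fun τ => hγ0 τ) (hi b hb)
  have hU0 : ∀ t ∈ Icc 0 T, 0 ≤ U t := fun t ht =>
    intervalIntegral.integral_nonneg ht.1 fun τ _ => hγ0 τ
  have hpow : ∀ (r : Path s T) (n : ℕ) (t : Icc (0 : ℝ) T),
      ‖(K ^ n) r t‖ ^ 2 ≤ ‖r‖ ^ 2 * (4⁻¹) ^ n * Real.exp (4 * U t) := by
    intro r n
    induction n with
    | zero =>
      intro t
      have h1 : ‖r t‖ ≤ ‖r‖ := r.norm_coe_le_norm t
      have h2 : 1 ≤ Real.exp (4 * U t) := Real.one_le_exp (by have := hU0 t t.2; positivity)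
      rw [pow_zero, pow_zero, mul_one]
      calc ‖r t‖ ^ 2 ≤ ‖r‖ ^ 2 * 1 := by rw [mul_one]; gcongr
        _ ≤ _ := by gcongr
    | succ n ih =>
      intro t
      have h1 := hK ((K ^ n) r) (fun t => ‖r‖ ^ 2 * (4⁻¹) ^ n * Real.exp (4 * U t))
        (fun a ha b hb hab => by
          have := hUm ha hb hab
          simp only
          gcongr)
        (continuousOn_const.mul (Real.continuous_exp.comp_continuousOn (continuousOn_const.mul hUc)))
        ih t
      rw [pow_succ' K n]
      refine h1.trans ?_
      have h2 := integral_mul_exp_integral_le hγ hγ0 t.2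
      have h3 : ∀ τ, γ τ * (‖r‖ ^ 2 * (4⁻¹) ^ n * Real.exp (4 * U τ)) =
        ‖r‖ ^ 2 * (4⁻¹) ^ n * (γ τ * Real.exp (4 * U τ)) := fun τ => by ring
      simp only [h3]
      rw [intervalIntegral.integral_const_mul]
      calc _ ≤ ‖r‖ ^ 2 * (4⁻¹) ^ n * (4⁻¹ * Real.exp (4 * U t)) := by gcongr
        _ = _ := by ring
  have hnorm : ∀ (r : Path s T) (n : ℕ), ‖(K ^ n) r‖ ≤ Real.exp (2 * U T) * ‖r‖ * (2⁻¹) ^ n := by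
    intro r n
    refine (ContinuousMap.norm_le _ (by positivity)).2 fun t => ?_
    refine le_of_sq_le_sq ((hpow r n t).trans ?_) (by positivity)
    have h1 : Real.exp (4 * U t) ≤ Real.exp (2 * U T) ^ 2 := by
      rw [← Real.exp_nat_mul]
      have := hUm t.2 hTm t.2.2
      refine Real.exp_le_exp.2 ?_
      push_cast
      linarith
    calc _ ≤ ‖r‖ ^ 2 * (4⁻¹) ^ n * Real.exp (2 * U T) ^ 2 := by gcongr
      _ = _ := by
        rw [show (4⁻¹ : ℝ) = (2⁻¹) ^ 2 by norm_num, ← pow_mul, mul_comm 2 n, pow_mul]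
        ring
  have hgeo : HasSum (fun n : ℕ => Real.exp (2 * U T) * ‖r‖ * (2⁻¹) ^ n)
      (Real.exp (2 * U T) * ‖r‖ * 2) := by
    have := hasSum_geometric_two.mul_left (Real.exp (2 * U T) * ‖r‖)
    simpa using this
  have hsum : Summable fun n : ℕ => (K ^ n) r :=
    Summable.of_norm_bounded hgeo.summable (hnorm r)
  have hfix : ∑' n, (K ^ n) r = r + K (∑' n, (K ^ n) r) := by
    rw [K.map_tsum hsum, hsum.tsum_eq_zero_add]
    simp [pow_succ']
  refine ⟨∑' n, (K ^ n) r, hfix, ?_, fun z hz => ?_⟩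
  · refine (tsum_of_norm_bounded hgeo (hnorm r)).trans_eq ?_
    ring
  · set w := ∑' n, (K ^ n) r
    -- A difference of two solutions is fixed by every power of `K`, while the norms of the powers
    -- applied to it tend to zero.
    have hd : K (z - w) = z - w := by
      have h1 : K z = z - r := eq_sub_of_add_eq' hz.symm
      have h2 : K w = w - r := eq_sub_of_add_eq' hfix.symm
      rw [map_sub, h1, h2]
      abel
    have hdn : ∀ n, (K ^ n) (z - w) = z - w := fun n => by
      induction n with
      | zero => simp
      | succ n ih => rw [pow_succ K n, mul_apply_eq_comp, hd, ih]
    have h0 : ‖z - w‖ ≤ 0 := by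
      have h1 : Filter.Tendsto (fun n : ℕ => Real.exp (2 * U T) * ‖z - w‖ * (2⁻¹ : ℝ) ^ n)
          Filter.atTop (nhds 0) := by
        simpa using (tendsto_pow_atTop_nhds_zero_of_lt_one (r := (2⁻¹ : ℝ)) (by norm_num)
          (by norm_num)).const_mul (Real.exp (2 * U T) * ‖z - w‖)
      refine ge_of_tendsto' h1 fun n => ?_
      have := hnorm (z - w) n
      rwa [hdn] at this
    exact sub_eq_zero.1 (norm_le_zero_iff.1 h0)

/-! ### Iterated primitives of paths -/

theorem exists_primOp {s T : ℝ} (hT : 0 < T) : ∃ V : Path s T →L[ℂ] Path s T,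
    ∀ w t, V w t = ∫ τ in (0 : ℝ)..t, extPath hT.le w τ := by
  have hc : ∀ w : Path s T, Continuous fun t : ℝ => ∫ τ in (0 : ℝ)..t, extPath hT.le w τ := fun w =>
    intervalIntegral.continuous_primitive
      (fun a b => (continuous_extPath hT.le w).intervalIntegrable a b) 0
  choose P hP using fun w => exists_path_eq (T := T) _ (hc w).continuousOn
  let L : Path s T →ₗ[ℂ] Path s T :=
    { toFun := P
      map_add' := fun w z => by
        ext1 t
        rw [ContinuousMap.add_apply, hP, hP, hP, ← intervalIntegral.integral_add
          ((continuous_extPath hT.le w).intervalIntegrable _ _)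
          ((continuous_extPath hT.le z).intervalIntegrable _ _)]
        rfl
      map_smul' := fun c w => by
        ext1 t
        rw [RingHom.id_apply, ContinuousMap.smul_apply, hP, hP, ← intervalIntegral.integral_smul]
        rfl }
  refine ⟨L.mkContinuous T fun w => ?_, hP⟩
  refine (ContinuousMap.norm_le _ (by positivity)).2 fun t => ?_
  change ‖P w t‖ ≤ _
  rw [hP]
  refine (intervalIntegral.norm_integral_le_of_norm_le_const (C := ‖w‖)
    fun τ _ => norm_extPath_le hT.le w τ).trans ?_
  rw [sub_zero, abs_of_nonneg t.2.1, mul_comm]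
  gcongr
  exact t.2.2

/-- The operator `w ↦ ∫_0^t w` on continuous paths. -/
def primOp {s T : ℝ} (hT : 0 < T) : Path s T →L[ℂ] Path s T :=
  (exists_primOp hT).choose

theorem primOp_apply {s T : ℝ} (hT : 0 < T) (w : Path s T) (t : Icc (0 : ℝ) T) :
    primOp hT w t = ∫ τ in (0 : ℝ)..t, extPath hT.le w τ := (exists_primOp hT).choose_spec w t

/-- Since `ρ` is nondecreasing, a bound by `ρ` at earlier times is a bound by `ρ t`; iterated
primitives therefore keep the same majorant up to powers of `T`. -/
theorem norm_sq_primOp_pow_le {s T : ℝ} (hT : 0 < T) {w : Path s T} {ρ : ℝ → ℝ}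
    (hρ : MonotoneOn ρ (Icc 0 T)) (h : ∀ t : Icc (0 : ℝ) T, ‖w t‖ ^ 2 ≤ ρ t) (i : ℕ)
    (t : Icc (0 : ℝ) T) : ‖(primOp hT ^ i) w t‖ ^ 2 ≤ (T ^ i) ^ 2 * ρ t := by
  have hρ0 : ∀ t : Icc (0 : ℝ) T, 0 ≤ ρ t := fun t => (sq_nonneg _).trans (h t)
  induction i generalizing t with
  | zero => simpa using h t
  | succ i ih =>
    rw [pow_succ' (primOp hT) i, mul_apply_eq_comp, primOp_apply]
    have h1 : ‖∫ τ in (0 : ℝ)..t, extPath hT.le ((primOp hT ^ i) w) τ‖ ≤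
        Real.sqrt ((T ^ i) ^ 2 * ρ t) * |(t : ℝ) - 0| := by
      refine intervalIntegral.norm_integral_le_of_norm_le_const fun τ hτ => ?_
      rw [uIoc_of_le t.2.1] at hτ
      have hτ' : τ ∈ Icc 0 T := ⟨hτ.1.le, hτ.2.trans t.2.2⟩
      refine Real.le_sqrt_of_sq_le ?_
      rw [extPath, projIcc_of_mem hT.le hτ']
      refine (ih ⟨τ, hτ'⟩).trans ?_
      gcongr
      exact hρ hτ' t.2 hτ.2
    rw [sub_zero, abs_of_nonneg t.2.1] at h1
    calc _ ≤ (Real.sqrt ((T ^ i) ^ 2 * ρ t) * t) ^ 2 := by gcongr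
      _ = (T ^ i) ^ 2 * ρ t * (t : ℝ) ^ 2 := by
        rw [mul_pow, Real.sq_sqrt (mul_nonneg (by positivity) (hρ0 t))]
      _ ≤ (T ^ i) ^ 2 * ρ t * T ^ 2 := by
        have := t.2.1
        have := t.2.2
        have := hρ0 t
        gcongr
      _ = _ := by ring

/-! ### Solutions of the Schrödinger equation and their time derivatives -/

/-- The hypothesis says that `b = -iAa` is still in `H^s_{(0)}`. The path `e^{-iAt}a` is then the
primitive of the continuous path `e^{-iAt}b`, as is seen on each coefficient. -/
theorem HZero.hasDerivAt_group {s : ℝ} (hs : 0 ≤ s) {a b : HZero s}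
    (h : ∀ j, coef j b = -Complex.I * eigenvalue j * coef j a) (t : ℝ) :
    HasDerivAt (fun t => group hs t a) (group hs t b) t := by
  have := completeSpace hs
  have hb := continuous_group_apply hs b
  have h1 : ∀ t, group hs t a = group hs 0 a + ∫ τ in (0 : ℝ)..t, group hs τ b := by
    intro t
    refine coef_ext fun j => ?_
    have h2 := ((coefCLM hs j).restrictScalars ℝ).intervalIntegral_comp_comm
      (hb.intervalIntegrable (μ := volume) 0 t)
    simp only [ContinuousLinearMap.coe_restrictScalars', coefCLM_apply] at h2
    rw [coef_add, ← h2]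
    simp only [coef_group, h]
    have hd : ∀ t : ℝ, HasDerivAt (fun t : ℝ => Complex.exp (-Complex.I * eigenvalue j * t) * coef j a)
        (Complex.exp (-Complex.I * eigenvalue j * t) *
          (-Complex.I * eigenvalue j * coef j a)) t := by
      intro t
      have h3 : HasDerivAt (fun t : ℝ => -Complex.I * eigenvalue j * (t : ℂ))
          (-Complex.I * eigenvalue j * 1) t :=
        (Complex.ofRealCLM.hasDerivAt (x := t)).const_mul _
      refine (h3.cexp.mul_const (coef j a)).congr_deriv ?_
      ring
    rw [intervalIntegral.integral_eq_sub_of_hasDerivAt (fun t _ => hd t)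
      (Continuous.intervalIntegrable (by fun_prop) _ _)]
    ring
  have h4 : (fun t => group hs t a) = fun t => group hs 0 a + ∫ τ in (0 : ℝ)..t, group hs τ b :=
    funext h1
  rw [h4]
  exact (hb.integral_hasStrictDerivAt 0 t).hasDerivAt.const_add _

/-- The function `v 0` and its derivatives `v 1`, …, `v k`, all but the last vanishing at `0`
and `T`. -/
structure IsControl (T : ℝ) (k : ℕ) (v : ℕ → ℝ → ℝ) : Prop where
  prim : ∀ i < k, IsPrim T (v i) (v (i + 1))
  zero : ∀ i < k, v i 0 = 0
  final : ∀ i < k, v i T = 0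
  memLp : ∀ i ≤ k, MemLp (v i) 2 (volume.restrict (Ioo 0 T))

/-- `e^{-iAt} a_n + E_n(t)`. -/
def state {s : ℝ} (hs : 0 ≤ s) (a : ℕ → HZero s) (E : ℕ → ℝ → HZero s) (n : ℕ) (t : ℝ) : HZero s :=
  HZero.group hs t (a n) + E n t

/-- The `n`-th time derivative of the `j`-th coefficient of the potential term `v M ψ`. -/
def source {s : ℝ} (hs : 0 ≤ s) (M : L2 →L[ℂ] L2) (v : ℕ → ℝ → ℝ) (a : ℕ → HZero s)
    (E : ℕ → ℝ → HZero s) (j : ℕ+) : ℕ → ℝ → ℂ :=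
  leibniz (fun i t => (v i t : ℂ)) fun i t => mulCoef M j (state hs a E i t)

/-- `E 0`, …, `E k` are the successive derivatives of the difference between the solution of the
Schrödinger equation with control `v` and initial datum `a 0`, and the free evolution. -/
structure IsEvolution {s : ℝ} (hs : 0 ≤ s) (T : ℝ) (k : ℕ) (M : L2 →L[ℂ] L2) (v : ℕ → ℝ → ℝ)
    (a : ℕ → HZero s) (E : ℕ → ℝ → HZero s) : Prop where
  cont : ∀ n ≤ k, Continuous (E n)
  deriv : ∀ n < k, ∀ t, HasDerivAt (E n) (E (n + 1) t) t
  zero : ∀ n ≤ k, E n 0 = 0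
  succ : ∀ n < k, ∀ t ∈ Icc 0 T, ∀ j, HZero.coef j (E (n + 1) t) =
    -Complex.I * eigenvalue j * HZero.coef j (E n t) + Complex.I * source hs M v a E j n t
  prim : ∀ n ≤ k, ∀ j, IsPrim T (fun t => HZero.coef j (E n t)) fun t =>
    -Complex.I * eigenvalue j * HZero.coef j (E n t) + Complex.I * source hs M v a E j n t

theorem norm_sum_sq_le {E : Type*} [NormedAddCommGroup E] {ι : Type*} (F : Finset ι) (x : ι → E) :
    ‖∑ i ∈ F, x i‖ ^ 2 ≤ F.card * ∑ i ∈ F, ‖x i‖ ^ 2 :=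
  (pow_le_pow_left₀ (norm_nonneg _) (norm_sum_le F x) 2).trans sq_sum_le_card_mul_sum_sq

/-- The iterated primitives of a path, as functions on the real line. -/
def iterPath {s T : ℝ} (hT : 0 < T) (w : Path s T) : ℕ → ℝ → HZero s
  | 0 => extPath hT.le w
  | i + 1 => fun t => ∫ τ in (0 : ℝ)..t, iterPath hT w i τ

theorem continuous_iterPath {s T : ℝ} (hT : 0 < T) (w : Path s T) (i : ℕ) :
    Continuous (iterPath hT w i) := by
  induction i with
  | zero => exact continuous_extPath hT.le w
  | succ i ih => exact intervalIntegral.continuous_primitive (fun a b => ih.intervalIntegrable a b) 0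

theorem hasDerivAt_iterPath {s T : ℝ} (hs : 0 ≤ s) (hT : 0 < T) (w : Path s T) (i : ℕ) (t : ℝ) :
    HasDerivAt (iterPath hT w (i + 1)) (iterPath hT w i t) t := by
  have := HZero.completeSpace hs
  exact ((continuous_iterPath hT w i).integral_hasStrictDerivAt 0 t).hasDerivAt

theorem iterPath_eq {s T : ℝ} (hT : 0 < T) (w : Path s T) (i : ℕ) {t : ℝ} (ht : t ∈ Icc 0 T) :
    iterPath hT w i t = (primOp hT ^ i) w ⟨t, ht⟩ := by
  induction i generalizing t with
  | zero => rw [iterPath, extPath, projIcc_of_mem hT.le ht, pow_zero, one_apply_eq_self]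
  | succ i ih =>
    rw [pow_succ' (primOp hT) i, mul_apply_eq_comp, primOp_apply, iterPath]
    refine intervalIntegral.integral_congr fun τ hτ => ?_
    rw [uIcc_of_le ht.1] at hτ
    have hτ' : τ ∈ Icc 0 T := ⟨hτ.1, hτ.2.trans ht.2⟩
    rw [ih hτ', extPath, projIcc_of_mem hT.le hτ']

/-! ### Existence for the Schrödinger equation -/

theorem leibniz_eq_sum_range (a b : ℕ → ℝ → ℂ) (n : ℕ) (t : ℝ) :
    leibniz a b n t = ∑ i ∈ Finset.range (n + 1), (n.choose i : ℂ) * (a i t * b (n - i) t) :=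
  Finset.Nat.sum_antidiagonal_eq_sum_range_succ (fun i j => (n.choose i : ℂ) * (a i t * b j t)) n

theorem leibniz_zero_of {a b : ℕ → ℝ → ℂ} {n : ℕ} {t : ℝ} (h : ∀ i ≤ n, a i t = 0) :
    leibniz a b n t = 0 := by
  rw [leibniz_eq_sum_range]
  refine Finset.sum_eq_zero fun i hi => ?_
  rw [h i (by simpa [Nat.lt_succ_iff] using hi)]
  ring

theorem isPrim_mulCoef {s T : ℝ} (hs : 0 ≤ s) (M : L2 →L[ℂ] L2) (j : ℕ+) {f g : ℝ → HZero s}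
    (h : ∀ t, HasDerivAt f (g t) t) (hg : Continuous g) :
    IsPrim T (fun t => mulCoef M j (f t)) fun t => mulCoef M j (g t) := by
  have := HZero.completeSpace hs
  exact (IsPrim.of_hasDerivAt h hg).clm ((mulCoefCLM M hs j).restrictScalars ℝ)

theorem isPrim_coef {s T : ℝ} (hs : 0 ≤ s) (j : ℕ+) {f g : ℝ → HZero s}
    (h : ∀ t, HasDerivAt f (g t) t) (hg : Continuous g) :
    IsPrim T (fun t => HZero.coef j (f t)) fun t => HZero.coef j (g t) := by
  have := HZero.completeSpace hs
  exact (IsPrim.of_hasDerivAt h hg).clm ((HZero.coefCLM hs j).restrictScalars ℝ)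

theorem hasDerivAt_exp_eigenvalue (c : ℂ) (t : ℝ) :
    HasDerivAt (fun t : ℝ => Complex.exp (c * t)) (c * Complex.exp (c * t)) t := by
  have h3 : HasDerivAt (fun t : ℝ => c * (t : ℂ)) (c * 1) t :=
    (Complex.ofRealCLM.hasDerivAt (x := t)).const_mul _
  exact h3.cexp.congr_deriv (by ring)

theorem isPrim_exp {T : ℝ} (c : ℂ) :
    IsPrim T (fun t : ℝ => Complex.exp (c * t)) fun t => c * Complex.exp (c * t) :=
  IsPrim.of_hasDerivAt (hasDerivAt_exp_eigenvalue c) (by fun_prop)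

/-- Variation of constants for one mode; with `IsPrim.duhamel`, which uses the integrating factor
`e^{ict}`, it allows passing between the mild and the differential form of the equation. -/
theorem isPrim_of_duhamel {T c : ℝ} (hT : 0 ≤ T) {y F : ℝ → ℂ}
    (hF : IntervalIntegrable (fun t : ℝ => Complex.exp (Complex.I * c * t) * F t) volume 0 T)
    (hy : ∀ t ∈ Icc 0 T, y t = Complex.exp (-Complex.I * c * t) *
      (Complex.I * ∫ τ in (0 : ℝ)..t, Complex.exp (Complex.I * c * τ) * F τ)) :
    IsPrim T y fun t => -Complex.I * c * y t + Complex.I * F t := by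
  have h1 := (isPrim_exp (T := T) (-Complex.I * c)).mul hT
    ((IsPrim.of_continuousOn hF 0).const_mul Complex.I)
  refine h1.congr (fun t ht => ?_) ?_ hT
  · simp only [hy t ht, zero_add]
  · refine (ae_restrict_iff' measurableSet_Ioo).2 (Filter.Eventually.of_forall fun t ht => ?_)
    rw [hy t (Ioo_subset_Icc_self ht), zero_add]
    have h2 : Complex.exp (-Complex.I * c * t) * Complex.exp (Complex.I * c * t) = 1 := by
      rw [← Complex.exp_add]; ring_nf; exact Complex.exp_zero
    linear_combination (Complex.I * F t) * h2

theorem IsPrim.duhamel {T c : ℝ} (hT : 0 ≤ T) {y F : ℝ → ℂ}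
    (h : IsPrim T y fun t => -Complex.I * c * y t + Complex.I * F t) {t : ℝ} (ht : t ∈ Icc 0 T) :
    y t = Complex.exp (-Complex.I * c * t) *
      (y 0 + Complex.I * ∫ τ in (0 : ℝ)..t, Complex.exp (Complex.I * c * τ) * F τ) := by
  have h1 := ((isPrim_exp (T := T) (Complex.I * c)).mul hT h).eq t ht
  have h2 : Complex.exp (-Complex.I * c * t) * Complex.exp (Complex.I * c * t) = 1 := by
    rw [← Complex.exp_add]; ring_nf; exact Complex.exp_zero
  have h3 : (fun τ : ℝ => Complex.I * (c : ℂ) * Complex.exp (Complex.I * c * τ) * y τ +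
      Complex.exp (Complex.I * c * τ) * (-Complex.I * c * y τ + Complex.I * F τ)) =
      fun τ : ℝ => Complex.I * (Complex.exp (Complex.I * c * τ) * F τ) := by
    funext τ; ring
  rw [h3, intervalIntegral.integral_const_mul] at h1
  simp only [Complex.ofReal_zero, mul_zero, Complex.exp_zero, one_mul] at h1
  rw [← h1]
  linear_combination (-y t) * h2

theorem hasDerivAt_state {s : ℝ} (hs : 0 ≤ s) {a : ℕ → HZero s} {E : ℕ → ℝ → HZero s} {n : ℕ}
    (ha : ∀ j, HZero.coef j (a (n + 1)) = -Complex.I * eigenvalue j * HZero.coef j (a n))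
    {t : ℝ} (hE : HasDerivAt (E n) (E (n + 1) t) t) :
    HasDerivAt (state hs a E n) (state hs a E (n + 1) t) t :=
  (HZero.hasDerivAt_group hs ha t).add hE

theorem continuous_state {s : ℝ} (hs : 0 ≤ s) {a : ℕ → HZero s} {E : ℕ → ℝ → HZero s} {n : ℕ}
    (hE : Continuous (E n)) : Continuous (state hs a E n) :=
  (HZero.continuous_group_apply hs _).add hE

theorem isPrim_source {s T : ℝ} (hs : 0 ≤ s) (hT : 0 ≤ T) {k : ℕ} {v : ℕ → ℝ → ℝ}
    (hv : IsControl T k v) (M : L2 →L[ℂ] L2) {a : ℕ → HZero s} {E : ℕ → ℝ → HZero s}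
    (ha : ∀ n < k, ∀ j, HZero.coef j (a (n + 1)) = -Complex.I * eigenvalue j * HZero.coef j (a n))
    (hc : ∀ n ≤ k, Continuous (E n)) (hE : ∀ n < k, ∀ t, HasDerivAt (E n) (E (n + 1) t) t)
    (j : ℕ+) {n : ℕ} (hn : n < k) :
    IsPrim T (source hs M v a E j n) (source hs M v a E j (n + 1)) :=
  IsPrim.leibniz hT (fun i hi => (hv.prim i (by omega)).ofReal) fun i hi =>
    isPrim_mulCoef hs M j (fun t => hasDerivAt_state hs (ha i (by omega)) (hE i (by omega) t))
      (continuous_state hs (hc (i + 1) (by omega)))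

theorem source_zero {s T : ℝ} (hs : 0 ≤ s) {k : ℕ} {v : ℕ → ℝ → ℝ}
    (hv : IsControl T k v) (M : L2 →L[ℂ] L2) {a : ℕ → HZero s} {E : ℕ → ℝ → HZero s}
    (j : ℕ+) {n : ℕ} (hn : n < k) : source hs M v a E j n 0 = 0 :=
  leibniz_zero_of fun i hi => by rw [hv.zero i (by omega), Complex.ofReal_zero]

/-- The evolution equation for the `k`-th derivative implies the equations for the lower ones. -/
theorem isEvolution_of_prim_last {s T : ℝ} (hs : 0 ≤ s) (hT : 0 ≤ T) {k : ℕ} {v : ℕ → ℝ → ℝ}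
    (hv : IsControl T k v) (M : L2 →L[ℂ] L2) {a : ℕ → HZero s} {E : ℕ → ℝ → HZero s}
    (ha : ∀ n < k, ∀ j, HZero.coef j (a (n + 1)) = -Complex.I * eigenvalue j * HZero.coef j (a n))
    (hc : ∀ n ≤ k, Continuous (E n)) (hE : ∀ n < k, ∀ t, HasDerivAt (E n) (E (n + 1) t) t)
    (h0 : ∀ n ≤ k, E n 0 = 0)
    (hk : ∀ j, IsPrim T (fun t => HZero.coef j (E k t)) fun t =>
      -Complex.I * eigenvalue j * HZero.coef j (E k t) + Complex.I * source hs M v a E j k t) :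
    IsEvolution hs T k M v a E := by
  -- The two sides have the same almost everywhere derivative, and both vanish at `0`: the source
  -- does so because the derivatives of the control of order below `k` vanish there.
  have hstep : ∀ n < k, ∀ j, IsPrim T (fun t => HZero.coef j (E (n + 1) t)) (fun t =>
      -Complex.I * eigenvalue j * HZero.coef j (E (n + 1) t) +
        Complex.I * source hs M v a E j (n + 1) t) →
      ∀ t ∈ Icc 0 T, HZero.coef j (E (n + 1) t) =
        -Complex.I * eigenvalue j * HZero.coef j (E n t) + Complex.I * source hs M v a E j n t := by
    intro n hn j h t ht
    have h1 := isPrim_coef (T := T) hs j (hE n hn) (hc (n + 1) hn)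
    have h2 := isPrim_source hs hT hv M ha hc hE j hn
    have h3 := (h1.const_mul (-Complex.I * eigenvalue j)).add (h2.const_mul Complex.I)
    have e1 := h.eq t ht
    have e2 := h3.eq t ht
    simp only [source_zero hs hv M j hn, h0 n hn.le, h0 (n + 1) hn, HZero.coef_zero, mul_zero,
      zero_add] at e1 e2
    rw [e1, ← e2]
  -- Descending induction on the order `k - m` of the time derivative.
  have hprim : ∀ m ≤ k, ∀ j, IsPrim T (fun t => HZero.coef j (E (k - m) t)) fun t =>
      -Complex.I * eigenvalue j * HZero.coef j (E (k - m) t) +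
        Complex.I * source hs M v a E j (k - m) t := by
    intro m
    induction m with
    | zero => exact fun _ j => hk j
    | succ m ih =>
      intro hm j
      have hlt : k - (m + 1) < k := by omega
      have e : k - (m + 1) + 1 = k - m := by omega
      have h1 := isPrim_coef (T := T) hs j (hE _ hlt) (hc _ hlt)
      have h2 := ih (by omega) j
      rw [← e] at h2
      refine h1.congr (fun _ _ => rfl) ?_ hT
      exact (ae_restrict_iff' measurableSet_Ioo).2 (Filter.Eventually.of_forall fun t ht =>
        hstep _ hlt j h2 t (Ioo_subset_Icc_self ht))
  have hprim' : ∀ n ≤ k, ∀ j, IsPrim T (fun t => HZero.coef j (E n t)) fun t =>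
      -Complex.I * eigenvalue j * HZero.coef j (E n t) + Complex.I * source hs M v a E j n t := by
    intro n hn j
    have := hprim (k - n) (by omega) j
    rwa [Nat.sub_sub_self hn] at this
  exact ⟨hc, hE, h0, fun n hn t ht j => hstep n hn j (hprim' (n + 1) hn j) t ht, hprim'⟩

/-- The unknown is the `k`-th time derivative `ω` of the deviation from the free evolution, the
lower derivatives being its iterated primitives. Differentiating the equation `k` times gives `ω = i
∑ (k choose i) G_i(e^{-iAt}a_{k-i} + V^i ω)`, where `G_i` is the Duhamel operator with weight `v_i`
and `V` is the primitive operator. This is a Volterra equation to which `exists_fixedPoint` applies.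
-/
theorem exists_evolution {s T : ℝ} {M : L2 →L[ℂ] L2} (hM : IsRegularMul s M) (hT : 0 < T) (k : ℕ) :
    ∃ C : ℝ, 0 ≤ C ∧ ∀ v : ℕ → ℝ → ℝ, IsControl T k v → ∀ a : ℕ → HZero s,
      (∀ n < k, ∀ j, HZero.coef j (a (n + 1)) = -Complex.I * eigenvalue j * HZero.coef j (a n)) →
      ∃ E : ℕ → ℝ → HZero s, IsEvolution hM.nonneg T k M v a E ∧
        ∀ A : ℝ, (∀ i ≤ k, ‖a i‖ ≤ A) → ∀ n ≤ k, ∀ t ∈ Icc 0 T, ‖E n t‖ ≤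
          C * Real.exp (C * ∑ i ∈ Finset.range (k + 1), ∫ t in Ioo 0 T, v i t ^ 2) *
            Real.sqrt (∑ i ∈ Finset.range (k + 1), ∫ t in Ioo 0 T, v i t ^ 2) * A := by
  obtain ⟨C₀, hC₀, HG⟩ := exists_duhamelOp hM hT
  have hs := hM.nonneg
  set D : ℝ := (max T 1 ^ k) ^ 2 with hD
  have hTi : ∀ i ≤ k, T ^ i ≤ max T 1 ^ k := fun i hi =>
    (pow_le_pow_left₀ hT.le (le_max_left _ _) i).trans (pow_le_pow_right₀ (le_max_right _ _) hi)
  have hD1 : ∀ i ≤ k, (T ^ i) ^ 2 ≤ D := fun i hi =>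
    pow_le_pow_left₀ (by positivity) (hTi i hi) 2
  -- The factor `k + 1` is the number of terms in Cauchy–Schwarz, `(2^k)²` bounds the squared
  -- binomial coefficients, and `C₀` is the constant of the Duhamel operators.
  set Q : ℝ := ((k + 1 : ℕ) : ℝ) * (2 ^ k) ^ 2 * C₀ with hQ
  have hQ0 : 0 ≤ Q := by positivity
  have hD0 : 0 ≤ D := by positivity
  -- The first entry is the rate in the exponential of the fixed point bound; the second is the
  -- prefactor, including the cost of at most `k` primitives.
  refine ⟨max (2 * (Q * D)) (2 * max T 1 ^ k * Real.sqrt Q), by positivity, fun v hv a ha => ?_⟩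
  choose! G hG1 hG2 using fun i (hi : i ≤ k) => HG (v i) (hv.memLp i hi)
  have hvi : ∀ i ≤ k, Integrable (fun t => v i t ^ 2) (volume.restrict (Ioo 0 T)) := fun i hi =>
    (hv.memLp i hi).integrable_sq
  set S : ℝ := ∑ i ∈ Finset.range (k + 1), ∫ t in Ioo 0 T, v i t ^ 2 with hS
  have hS0 : 0 ≤ S := Finset.sum_nonneg fun i _ => integral_nonneg fun t => sq_nonneg _
  -- a bound common to the operator and to the right-hand side
  have hcore : ∀ (w : ℕ → Path s T) (ρ : ℝ → ℝ), ContinuousOn ρ (Icc 0 T) →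
      (∀ i ≤ k, ∀ t : Icc (0 : ℝ) T, ‖w i t‖ ^ 2 ≤ ρ t) → ∀ t : Icc (0 : ℝ) T,
      ‖(Complex.I • ∑ i ∈ Finset.range (k + 1), (k.choose i : ℂ) • G i (w i)) t‖ ^ 2 ≤
        ∫ τ in (0 : ℝ)..t, (Q * ∑ i ∈ Finset.range (k + 1), v i τ ^ 2) * ρ τ := by
    intro w ρ hρ hw t
    have hint : ∀ i ∈ Finset.range (k + 1),
        IntervalIntegrable (fun τ => v i τ ^ 2 * ρ τ) volume 0 t := by
      intro i hi
      have hi' : i ≤ k := by simpa [Nat.lt_succ_iff] using hi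
      refine (intervalIntegrable_of_integrable t.2 (hvi i hi')).mul_continuousOn ?_
      rw [uIcc_of_le t.2.1]
      exact hρ.mono (Icc_subset_Icc_right t.2.2)
    rw [ContinuousMap.smul_apply, norm_smul, Complex.norm_I, one_mul, ContinuousMap.sum_apply]
    refine (norm_sum_sq_le _ _).trans ?_
    rw [Finset.card_range]
    have h1 : ∀ i ∈ Finset.range (k + 1), ‖((k.choose i : ℂ) • G i (w i)) t‖ ^ 2 ≤
        (2 ^ k) ^ 2 * (C₀ * ∫ τ in (0 : ℝ)..t, v i τ ^ 2 * ρ τ) := by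
      intro i hi
      have hi' : i ≤ k := by simpa [Nat.lt_succ_iff] using hi
      rw [ContinuousMap.smul_apply, norm_smul, mul_pow, Complex.norm_natCast]
      have hch : ((k.choose i : ℕ) : ℝ) ≤ 2 ^ k := by exact_mod_cast Nat.choose_le_two_pow k i
      have h2 : ∫ τ in (0 : ℝ)..t, v i τ ^ 2 * ‖extPath hT.le (w i) τ‖ ^ 2 ≤
          ∫ τ in (0 : ℝ)..t, v i τ ^ 2 * ρ τ := by
        refine intervalIntegral.integral_mono_on t.2.1
          (intervalIntegrable_of_integrable t.2 (integrable_sq_mul_norm_sq (hv.memLp i hi')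
            (continuous_extPath hT.le (w i)).continuousOn)) (hint i hi) fun τ hτ => ?_
        have hτ' : τ ∈ Icc 0 T := ⟨hτ.1, hτ.2.trans t.2.2⟩
        have := hw i hi' ⟨τ, hτ'⟩
        rw [extPath, projIcc_of_mem hT.le hτ']
        gcongr
      refine mul_le_mul (by gcongr) ((hG2 i hi' (w i) t).trans (by gcongr)) (by positivity)
        (by positivity)
    refine (mul_le_mul_of_nonneg_left (Finset.sum_le_sum h1) (by positivity)).trans_eq ?_
    have h3 : (fun τ => (Q * ∑ i ∈ Finset.range (k + 1), v i τ ^ 2) * ρ τ) =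
        fun τ => Q * ∑ i ∈ Finset.range (k + 1), v i τ ^ 2 * ρ τ := by
      funext τ
      rw [mul_assoc, Finset.sum_mul]
    rw [h3, intervalIntegral.integral_const_mul, intervalIntegral.integral_finsetSum hint,
      ← Finset.mul_sum, ← Finset.mul_sum, hQ]
    ring
  -- the fixed point
  set K : Path s T →L[ℂ] Path s T := Complex.I • ∑ i ∈ Finset.range (k + 1),
    (k.choose i : ℂ) • (G i).comp (primOp hT ^ i) with hK
  choose f hf using fun n => exists_path_eq (T := T) (fun t => HZero.group hs t (a n))
    (HZero.continuous_group_apply hs (a n)).continuousOn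
  set r : Path s T := Complex.I • ∑ i ∈ Finset.range (k + 1), (k.choose i : ℂ) • G i (f (k - i))
    with hr
  have hKw : ∀ w, K w = Complex.I • ∑ i ∈ Finset.range (k + 1),
      (k.choose i : ℂ) • G i ((primOp hT ^ i) w) := by
    intro w
    simp [hK]
  have hsumI : Integrable (fun τ => ∑ i ∈ Finset.range (k + 1), v i τ ^ 2)
      (volume.restrict (Ioo 0 T)) := integrable_finsetSum _ fun i hi =>
    hvi i (by simpa [Nat.lt_succ_iff] using hi)
  have hsumS : ∫ τ in Ioo 0 T, ∑ i ∈ Finset.range (k + 1), v i τ ^ 2 = S :=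
    integral_finsetSum _ fun i hi => hvi i (by simpa [Nat.lt_succ_iff] using hi)
  have hIoo : ∀ f : ℝ → ℝ, ∫ τ in (0 : ℝ)..T, f τ = ∫ τ in Ioo 0 T, f τ := fun f => by
    rw [intervalIntegral.integral_of_le hT.le, integral_Ioc_eq_integral_Ioo]
  obtain ⟨ω, hω, hωn, -⟩ := exists_fixedPoint hs hT
    (γ := fun τ => Q * D * ∑ i ∈ Finset.range (k + 1), v i τ ^ 2) (hsumI.const_mul _)
    (fun τ => mul_nonneg (by positivity) (Finset.sum_nonneg fun i _ => sq_nonneg _)) K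
    (by
      intro w ρ hρ hρc hw t
      rw [hKw]
      have hρ0 : ∀ t : Icc (0 : ℝ) T, 0 ≤ ρ t := fun t => (sq_nonneg _).trans (hw t)
      refine (hcore _ (fun t => D * ρ t) (continuousOn_const.mul hρc) (fun i hi t => ?_) t).trans_eq ?_
      · refine (norm_sq_primOp_pow_le hT hρ hw i t).trans ?_
        have := hρ0 t
        have := hD1 i hi
        gcongr
      · refine congrArg (fun f : ℝ → ℝ => ∫ τ in (0 : ℝ)..t, f τ) (funext fun τ => ?_)
        ring) r
  have hωG : ω = Complex.I • ∑ i ∈ Finset.range (k + 1),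
      (k.choose i : ℂ) • G i (f (k - i) + (primOp hT ^ i) ω) := by
    nth_rewrite 1 [hω]
    rw [hKw, hr, ← smul_add, ← Finset.sum_add_distrib]
    simp only [map_add, smul_add]
  have hstate : ∀ i ≤ k, ∀ τ ∈ Icc 0 T, extPath hT.le (f (k - i) + (primOp hT ^ i) ω) τ =
      state hs a (fun n => iterPath hT ω (k - n)) (k - i) τ := by
    intro i hi τ hτ
    rw [extPath, projIcc_of_mem hT.le hτ, ContinuousMap.add_apply, hf, ← iterPath_eq, state,
      Nat.sub_sub_self hi]
  have hsc : ∀ i, Continuous (state hs a (fun n => iterPath hT ω (k - n)) (k - i)) := fun i =>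
    continuous_state hs (continuous_iterPath hT ω _)
  have hduh : ∀ j, ∀ t ∈ Icc 0 T, HZero.coef j (extPath hT.le ω t) =
      Complex.exp (-Complex.I * eigenvalue j * t) * (Complex.I * ∫ τ in (0 : ℝ)..t,
        Complex.exp (Complex.I * eigenvalue j * τ) *
          source hs M v a (fun n => iterPath hT ω (k - n)) j k τ) := by
    intro j t ht
    have hint : ∀ i ∈ Finset.range (k + 1), IntervalIntegrable (fun τ : ℝ => (k.choose i : ℂ) *
        (Complex.exp (Complex.I * eigenvalue j * τ) * ((v i τ : ℂ) * mulCoef M j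
          (state hs a (fun n => iterPath hT ω (k - n)) (k - i) τ)))) volume 0 t := fun i hi =>
      (intervalIntegrable_of_integrable ht (integrable_duhamel M hs
        (hv.memLp i (by simpa [Nat.lt_succ_iff] using hi)) (hsc i).continuousOn j)).const_mul _
    have e1 : (fun τ : ℝ => Complex.exp (Complex.I * eigenvalue j * τ) *
          source hs M v a (fun n => iterPath hT ω (k - n)) j k τ) =
        fun τ : ℝ => ∑ i ∈ Finset.range (k + 1), (k.choose i : ℂ) *
          (Complex.exp (Complex.I * eigenvalue j * τ) * ((v i τ : ℂ) * mulCoef M j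
          (state hs a (fun n => iterPath hT ω (k - n)) (k - i) τ))) := by
      funext τ
      rw [source, leibniz_eq_sum_range, Finset.mul_sum]
      exact Finset.sum_congr rfl fun i _ => by ring
    have e2 : HZero.coef j (ω ⟨t, ht⟩) = HZero.coef j ((Complex.I • ∑ i ∈ Finset.range (k + 1),
        (k.choose i : ℂ) • G i (f (k - i) + (primOp hT ^ i) ω)) ⟨t, ht⟩) :=
      congrArg (fun z : Path s T => HZero.coef j (z ⟨t, ht⟩)) hωG
    rw [e1, intervalIntegral.integral_finsetSum hint, extPath, projIcc_of_mem hT.le ht, e2,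
      ContinuousMap.smul_apply, ContinuousMap.sum_apply, ← HZero.coefCLM_apply hs, map_smul,
      map_sum, smul_eq_mul, mul_left_comm (Complex.exp _) Complex.I]
    refine congrArg (Complex.I * ·) ?_
    rw [Finset.mul_sum]
    refine (Finset.sum_congr rfl fun i hi => ?_)
    have hi' : i ≤ k := by simpa [Nat.lt_succ_iff] using hi
    rw [ContinuousMap.smul_apply, map_smul, HZero.coefCLM_apply, hG1 i hi',
      intervalIntegral.integral_const_mul, smul_eq_mul, mul_left_comm]
    refine congrArg _ (congrArg _ (intervalIntegral.integral_congr fun τ hτ => ?_))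
    rw [uIcc_of_le ht.1] at hτ
    rw [← hstate i hi' τ ⟨hτ.1, hτ.2.trans ht.2⟩]
  refine ⟨fun n => iterPath hT ω (k - n), ?_, ?_⟩
  · refine isEvolution_of_prim_last hs hT.le hv M ha (fun n _ => continuous_iterPath hT ω _)
      (fun n hn t => ?_) (fun n hn => ?_) fun j => ?_
    · have := hasDerivAt_iterPath hs hT ω (k - (n + 1)) t
      rwa [show k - (n + 1) + 1 = k - n by omega] at this
    -- For `n = k` no primitive is taken, and the vanishing at `0` comes from the Duhamel formula.
    · rcases hkn : k - n with _ | i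
      · refine HZero.coef_ext fun j => ?_
        have := hduh j 0 (left_mem_Icc.2 hT.le)
        simp only [intervalIntegral.integral_same, mul_zero] at this
        rw [HZero.coef_zero, iterPath, this]
      · simp [iterPath]
    · have h1 : IntervalIntegrable (fun t : ℝ => Complex.exp (Complex.I * eigenvalue j * t) *
          source hs M v a (fun n => iterPath hT ω (k - n)) j k t) volume 0 T := by
        have e1 : (fun τ : ℝ => Complex.exp (Complex.I * eigenvalue j * τ) *
              source hs M v a (fun n => iterPath hT ω (k - n)) j k τ) =
            fun τ : ℝ => ∑ i ∈ Finset.range (k + 1), (k.choose i : ℂ) *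
              (Complex.exp (Complex.I * eigenvalue j * τ) * ((v i τ : ℂ) * mulCoef M j
              (state hs a (fun n => iterPath hT ω (k - n)) (k - i) τ))) := by
          funext τ
          rw [source, leibniz_eq_sum_range, Finset.mul_sum]
          exact Finset.sum_congr rfl fun i _ => by ring
        rw [e1]
        exact intervalIntegrable_of_integrable (right_mem_Icc.2 hT.le)
          (integrable_finsetSum _ fun i hi => (integrable_duhamel M hs
            (hv.memLp i (by simpa [Nat.lt_succ_iff] using hi)) (hsc i).continuousOn j).const_mul _)
      have h2 := isPrim_of_duhamel hT.le h1 (hduh j)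
      simpa only [Nat.sub_self, iterPath] using h2
  · intro A hA n hn t ht
    have hA0 : 0 ≤ A := (norm_nonneg _).trans (hA 0 (Nat.zero_le _))
    have hrn : ‖r‖ ≤ Real.sqrt Q * Real.sqrt S * A := by
      refine (ContinuousMap.norm_le _ (by positivity)).2 fun t => ?_
      refine le_of_sq_le_sq ?_ (by positivity)
      refine (hcore (fun i => f (k - i)) (fun _ => A ^ 2) continuousOn_const (fun i hi t => ?_)
        t).trans ?_
      · rw [hf]
        have := (HZero.norm_group_le hs t (a (k - i))).trans (hA (k - i) (by omega))
        gcongr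
      · rw [intervalIntegral.integral_mul_const, intervalIntegral.integral_const_mul, mul_pow,
          mul_pow, Real.sq_sqrt hQ0, Real.sq_sqrt hS0]
        gcongr
        rw [← hsumS, ← hIoo]
        exact intervalIntegral.integral_mono_interval le_rfl t.2.1 t.2.2
          (Filter.Eventually.of_forall fun τ => Finset.sum_nonneg fun i _ => sq_nonneg _)
          (intervalIntegrable_of_integrable (right_mem_Icc.2 hT.le) hsumI)
    have h1 : ‖iterPath hT ω (k - n) t‖ ≤ max T 1 ^ k * ‖ω‖ := by
      rw [iterPath_eq hT ω _ ht]
      refine le_of_sq_le_sq ((norm_sq_primOp_pow_le hT (ρ := fun _ => ‖ω‖ ^ 2)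
        (fun _ _ _ _ _ => le_rfl) (fun t => ?_) (k - n) ⟨t, ht⟩).trans ?_) (by positivity)
      · have := ω.norm_coe_le_norm t
        gcongr
      · rw [mul_pow]
        gcongr
        exact hTi _ (by omega)
    rw [intervalIntegral.integral_const_mul, hIoo, hsumS] at hωn
    set C := max (2 * (Q * D)) (2 * max T 1 ^ k * Real.sqrt Q)
    have hC1 : 2 * (Q * D) ≤ C := le_max_left _ _
    have hC2 : 2 * max T 1 ^ k * Real.sqrt Q ≤ C := le_max_right _ _
    have h2 : Real.exp (2 * (Q * D * S)) ≤ Real.exp (C * S) := by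
      refine Real.exp_le_exp.2 ?_
      calc _ = (2 * (Q * D)) * S := by ring
        _ ≤ _ := by gcongr
    calc _ ≤ max T 1 ^ k * (2 * Real.exp (2 * (Q * D * S)) * (Real.sqrt Q * Real.sqrt S * A)) :=
          h1.trans (mul_le_mul_of_nonneg_left (hωn.trans (by gcongr)) (by positivity))
      _ = 2 * max T 1 ^ k * Real.sqrt Q * Real.exp (2 * (Q * D * S)) * Real.sqrt S * A := by ring
      _ ≤ _ := by gcongr

/-! ### Functions of `H^k_0(0,T)` -/

theorem IsPrim.mul_real {T : ℝ} (hT : 0 ≤ T) {F f G g : ℝ → ℝ} (hF : IsPrim T F f)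
    (hG : IsPrim T G g) : IsPrim T (fun t => F t * G t) fun t => f t * G t + F t * g t := by
  have h := (hF.ofReal.mul hT hG.ofReal).clm Complex.reCLM
  simpa [← Complex.ofReal_mul, ← Complex.ofReal_add] using h

theorem integral_Ioo_eq {E : Type*} [NormedAddCommGroup E] [NormedSpace ℝ E] {T : ℝ} (hT : 0 ≤ T)
    (f : ℝ → E) : ∫ t in Ioo 0 T, f t = ∫ t in (0 : ℝ)..T, f t := by
  rw [intervalIntegral.integral_of_le hT, integral_Ioc_eq_integral_Ioo]

theorem IsTestFunction.iteratedDeriv_eq_zero {T : ℝ} {φ : ℝ → ℝ} (h : IsTestFunction 0 T φ)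
    (n : ℕ) : iteratedDeriv n φ 0 = 0 ∧ iteratedDeriv n φ T = 0 := by
  have key : ∀ t, t ∉ Ioo 0 T → iteratedDeriv n φ t = 0 := by
    intro t ht
    have h1 : t ∉ tsupport φ := fun hh => ht (h.2.2 hh)
    have h2 : φ =ᶠ[nhds t] fun _ => 0 := notMem_tsupport_iff_eventuallyEq.1 h1
    rw [h2.iteratedDeriv_eq]
    simp
  exact ⟨key 0 (by simp), key T (by simp)⟩

theorem IsTestFunction.isPrim_iteratedDeriv {T : ℝ} {φ : ℝ → ℝ} (h : IsTestFunction 0 T φ)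
    (n : ℕ) : IsPrim T (iteratedDeriv n φ) (iteratedDeriv (n + 1) φ) := by
  have hc : ∀ m : ℕ, ((m : ℕ) : WithTop ℕ∞) ≤ ((⊤ : ℕ∞) : WithTop ℕ∞) := fun m => by
    exact_mod_cast le_top
  refine IsPrim.of_hasDerivAt (fun t => ?_) (h.1.continuous_iteratedDeriv (n + 1) (hc _))
  rw [iteratedDeriv_succ]
  exact ((h.1.differentiable_iteratedDeriv n (by
    exact_mod_cast ENat.natCast_lt_top n)) t).hasDerivAt

theorem integrable_mul_continuousOn {T : ℝ} {g χ : ℝ → ℝ}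
    (hg : MemLp g 2 (volume.restrict (Ioo 0 T))) (hχ : ContinuousOn χ (Icc 0 T)) :
    Integrable (fun t => g t * χ t) (volume.restrict (Ioo 0 T)) := by
  obtain ⟨B, -, -, hB⟩ := ContinuousOn.ae_norm_le hχ
  exact (hg.integrable (by norm_num)).mul_bdd (ContinuousOn.aestronglyMeasurable_Ioo hχ) hB

theorem ContinuousOn.memLp_two {E : Type*} [NormedAddCommGroup E] {T : ℝ} {χ : ℝ → E}
    (hχ : ContinuousOn χ (Icc 0 T)) : MemLp χ 2 (volume.restrict (Ioo 0 T)) := by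
  obtain ⟨B, -, -, hB⟩ := ContinuousOn.ae_norm_le hχ
  exact MemLp.of_bound (ContinuousOn.aestronglyMeasurable_Ioo hχ) B hB

theorem inner_toLp_real {T : ℝ} {η : ℝ → ℝ} (hη : MemLp η 2 (volume.restrict (Ioo 0 T)))
    (w : Lp ℝ 2 (volume.restrict (Ioo (0 : ℝ) T))) :
    inner ℝ hη.toLp w = ∫ t in Ioo 0 T, w t * η t := by
  rw [L2.inner_def]
  refine integral_congr_ae ?_
  filter_upwards [hη.coeFn_toLp] with t ht
  rw [ht, RCLike.inner_apply]
  rfl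

/-- The left side is a continuous functional of the jet, and it vanishes on jets of test functions
by integration by parts. Nothing is required of `χ` at the ends; this is how the zero traces of `u`
are retained by the closure. -/
theorem H0.integral_add_eq_zero {T : ℝ} (hT : 0 < T) {k : ℕ} (u : H0 T k) {i : ℕ} (hi : i < k)
    {χ η : ℝ → ℝ} (hχ : IsPrim T χ η) (hη : MemLp η 2 (volume.restrict (Ioo 0 T))) :
    (∫ t in Ioo 0 T, (u : Jets T k) ⟨i, by omega⟩ t * η t) +
      ∫ t in Ioo 0 T, (u : Jets T k) ⟨i + 1, by omega⟩ t * χ t = 0 := by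
  have hχ2 := ContinuousOn.memLp_two hχ.continuousOn
  set Λ : Jets T k → ℝ := fun w => inner ℝ hη.toLp (w ⟨i, by omega⟩) +
    inner ℝ hχ2.toLp (w ⟨i + 1, by omega⟩) with hΛ
  have hc : Continuous Λ := by fun_prop
  have hu : (u : Jets T k) ∈ closure (testJets T k : Set (Jets T k)) := u.2
  have h0 : ∀ w ∈ closure (testJets T k : Set (Jets T k)), Λ w = 0 := by
    intro w hw
    refine closure_minimal (t := {w | Λ w = 0}) ?_ (isClosed_eq hc continuous_const) hw
    rintro w ⟨φ, hφ, hw⟩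
    change Λ w = 0
    rw [hΛ]
    simp only [inner_toLp_real]
    have e1 : ∫ t in Ioo 0 T, w ⟨i, by omega⟩ t * η t = ∫ t in Ioo 0 T, iteratedDeriv i φ t * η t := by
      refine integral_congr_ae ?_
      filter_upwards [hw ⟨i, by omega⟩] with t ht
      rw [ht]
    have e2 : ∫ t in Ioo 0 T, w ⟨i + 1, by omega⟩ t * χ t =
        ∫ t in Ioo 0 T, iteratedDeriv (i + 1) φ t * χ t := by
      refine integral_congr_ae ?_
      filter_upwards [hw ⟨i + 1, by omega⟩] with t ht
      rw [ht]
    have hp := hφ.isPrim_iteratedDeriv i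
    have hp2 := hφ.isPrim_iteratedDeriv (i + 1)
    have i1 := integrable_mul_continuousOn hη hp.continuousOn
    have i2 := integrable_mul_continuousOn (ContinuousOn.memLp_two hp2.continuousOn) hχ.continuousOn
    have i1' : Integrable (fun t => iteratedDeriv i φ t * η t) (volume.restrict (Ioo 0 T)) := by
      simpa only [mul_comm] using i1
    rw [e1, e2, ← integral_add i1' i2, integral_Ioo_eq hT.le]
    have := (hp.mul_real hT.le hχ).integral_eq hT.le
    rw [(hφ.iteratedDeriv_eq_zero i).1, (hφ.iteratedDeriv_eq_zero i).2] at this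
    simp only [zero_mul, sub_zero] at this
    refine Eq.trans ?_ this
    simp only [add_comm]
  have := h0 u hu
  simpa only [hΛ, inner_toLp_real] using this

theorem H0.ae_eq_primitive {T : ℝ} (hT : 0 < T) {k : ℕ} (u : H0 T k) {i : ℕ} (hi : i < k) :
    (∀ᵐ t ∂volume.restrict (Ioo 0 T), (u : Jets T k) ⟨i, by omega⟩ t =
      ∫ τ in (0 : ℝ)..t, (u : Jets T k) ⟨i + 1, by omega⟩ τ) ∧
      ∫ τ in (0 : ℝ)..T, (u : Jets T k) ⟨i + 1, by omega⟩ τ = 0 := by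
  set f := (u : Jets T k) ⟨i, by omega⟩ with hf
  set g := (u : Jets T k) ⟨i + 1, by omega⟩ with hg
  have hTm : T ∈ Icc 0 T := right_mem_Icc.2 hT.le
  have hfL : MemLp f 2 (volume.restrict (Ioo 0 T)) := Lp.memLp f
  have hgL : MemLp g 2 (volume.restrict (Ioo 0 T)) := Lp.memLp g
  have hzero : ∫ τ in (0 : ℝ)..T, g τ = 0 := by
    -- Testing with the constant `χ = 1` shows that the next derivative has mean zero.
    have := H0.integral_add_eq_zero hT u hi (χ := fun _ => 1) (η := fun _ => 0)
      ⟨by simp, by simp⟩ (by simp)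
    simpa [integral_Ioo_eq hT.le] using this
  refine ⟨?_, hzero⟩
  have hD : IsPrim T (fun t => ∫ τ in (0 : ℝ)..t, g τ) g := by
    simpa using IsPrim.of_continuousOn
      (intervalIntegrable_of_integrable hTm (hgL.integrable (by norm_num))) 0
  set D : ℝ → ℝ := fun t => ∫ τ in (0 : ℝ)..t, g τ with hDdef
  have hh : MemLp (fun t => D t - f t) 2 (volume.restrict (Ioo 0 T)) :=
    (ContinuousOn.memLp_two hD.continuousOn).sub hfL
  set h : ℝ → ℝ := fun t => D t - f t
  have hH : IsPrim T (fun t => -(∫ τ in (0 : ℝ)..T, h τ) + ∫ τ in (0 : ℝ)..t, h τ) h :=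
    IsPrim.of_continuousOn (intervalIntegrable_of_integrable hTm (hh.integrable (by norm_num))) _
  -- The test function has derivative `h = D - f`. Comparing with the integration by parts of the
  -- primitive `D`, which vanishes at both ends, gives `∫ h² = 0`.
  have h1 := H0.integral_add_eq_zero hT u hi hH hh
  have h2 := (hD.mul_real hT.le hH).integral_eq hT.le
  have hDT : D T = 0 := hzero
  have hD0 : D 0 = 0 := by simp [hDdef]
  rw [hDT, hD0, zero_mul, zero_mul, sub_zero, ← integral_Ioo_eq hT.le, integral_add
    (integrable_mul_continuousOn hgL hH.continuousOn) (by
      simpa only [mul_comm] using integrable_mul_continuousOn hh hD.continuousOn)] at h2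
  have h3 : ∫ t in Ioo 0 T, h t ^ 2 = 0 := by
    have e : ∀ t, h t ^ 2 = D t * h t - f t * h t := fun t => by simp only [h]; ring
    have i3 : Integrable (fun t => f t * h t) (volume.restrict (Ioo 0 T)) := hfL.integrable_mul hh
    simp only [e]
    rw [integral_sub (by simpa only [mul_comm] using integrable_mul_continuousOn hh hD.continuousOn)
      i3]
    linarith
  rw [integral_eq_zero_iff_of_nonneg (fun t => sq_nonneg _) hh.integrable_sq] at h3
  filter_upwards [h3] with t ht
  have : h t = 0 := by simpa using ht
  simp only [h] at this
  linarith

theorem iterPrim_succ (u : ℝ → ℝ) (n : ℕ) (t : ℝ) :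
    iterPrim u (n + 1) t = ∫ τ in (0 : ℝ)..t, iterPrim u n τ := rfl

theorem iterPrim_congr {T : ℝ} {u v : ℝ → ℝ} (h : ∀ᵐ t ∂volume.restrict (Ioo 0 T), u t = v t)
    (n : ℕ) {t : ℝ} (ht : t ∈ Icc 0 T) : iterPrim u (n + 1) t = iterPrim v (n + 1) t := by
  induction n generalizing t with
  | zero =>
    rw [iterPrim_succ, iterPrim_succ, ← integral_Ioo_eq ht.1, ← integral_Ioo_eq ht.1]
    exact integral_congr_ae (ae_mono (Measure.restrict_mono (Ioo_subset_Ioo_right ht.2) le_rfl) h)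
  | succ n ih =>
    rw [iterPrim_succ, iterPrim_succ]
    refine intervalIntegral.integral_congr fun τ hτ => ?_
    rw [uIcc_of_le ht.1] at hτ
    exact ih ⟨hτ.1, hτ.2.trans ht.2⟩

theorem isPrim_iterPrim {T : ℝ} (hT : 0 ≤ T) {u : ℝ → ℝ}
    (hu : Integrable u (volume.restrict (Ioo 0 T))) (n : ℕ) :
    IsPrim T (iterPrim u (n + 1)) (iterPrim u n) := by
  induction n with
  | zero =>
    change IsPrim T (fun t => ∫ τ in (0 : ℝ)..t, u τ) u
    simpa using IsPrim.of_continuousOn (intervalIntegrable_of_integrable (right_mem_Icc.2 hT) hu) 0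
  | succ n ih =>
    have := ih.continuousOn
    rw [← uIcc_of_le hT] at this
    change IsPrim T (fun t => ∫ τ in (0 : ℝ)..t, iterPrim u (n + 1) τ) (iterPrim u (n + 1))
    simpa using IsPrim.of_continuousOn this.intervalIntegrable 0

theorem memLp_iterPrim {T : ℝ} (hT : 0 ≤ T) {u : ℝ → ℝ} (hu : MemLp u 2 (volume.restrict (Ioo 0 T)))
    (n : ℕ) : MemLp (iterPrim u n) 2 (volume.restrict (Ioo 0 T)) := by
  cases n with
  | zero => exact hu
  | succ n =>
    exact ContinuousOn.memLp_two (isPrim_iterPrim hT (hu.integrable (by norm_num)) n).continuousOn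

/-- The continuous representatives of the derivatives of `u ∈ H^k_0(0,T)`. -/
def H0.jet {T : ℝ} {k : ℕ} (u : H0 T k) (i : ℕ) : ℝ → ℝ :=
  iterPrim ((u : Jets T k) (Fin.last k)) (k - i)

theorem H0.jet_ae_eq {T : ℝ} (hT : 0 < T) {k : ℕ} (u : H0 T k) {i : ℕ} (hi : i ≤ k) :
    ∀ᵐ t ∂volume.restrict (Ioo 0 T), u.jet i t = (u : Jets T k) ⟨i, by omega⟩ t := by
  obtain ⟨m, rfl⟩ : ∃ m, i = k - m := ⟨k - i, by omega⟩
  induction m with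
  | zero => exact Filter.Eventually.of_forall fun t => by simp [H0.jet, iterPrim, Fin.last]
  | succ m ih =>
    rcases Nat.lt_or_ge m k with hm | hm
    · have e : k - (m + 1) + 1 = k - m := by omega
      filter_upwards [(H0.ae_eq_primitive hT u (i := k - (m + 1)) (by omega)).1,
        ae_restrict_mem measurableSet_Ioo] with t ht htm
      rw [ht, H0.jet, show k - (k - (m + 1)) = k - (k - m) + 1 by omega, iterPrim_succ,
        ← integral_Ioo_eq htm.1.le, ← integral_Ioo_eq htm.1.le]
      simp only [e]
      exact integral_congr_ae (ae_mono
        (Measure.restrict_mono (Ioo_subset_Ioo_right htm.2.le) le_rfl) (ih (by omega)))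
    · have := ih (by omega)
      simpa only [show k - (m + 1) = k - m by omega] using this

theorem H0.isControl_jet {T : ℝ} (hT : 0 < T) {k : ℕ} (u : H0 T k) : IsControl T k u.jet := by
  have hL : MemLp ((u : Jets T k) (Fin.last k)) 2 (volume.restrict (Ioo 0 T)) := Lp.memLp _
  refine ⟨fun i hi => ?_, fun i hi => ?_, fun i hi => ?_, fun i _ => memLp_iterPrim hT.le hL _⟩
  · have := isPrim_iterPrim hT.le (hL.integrable (by norm_num)) (k - (i + 1))
    rwa [show k - (i + 1) + 1 = k - i by omega] at this
  · rw [H0.jet, show k - i = k - (i + 1) + 1 by omega, iterPrim_succ]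
    simp
  · rw [H0.jet, show k - i = k - (i + 1) + 1 by omega, iterPrim_succ,
      ← integral_Ioo_eq hT.le]
    refine (integral_congr_ae (H0.jet_ae_eq hT u hi)).trans ?_
    rw [integral_Ioo_eq hT.le]
    exact (H0.ae_eq_primitive hT u hi).2

theorem H0.jet_zero_ae_eq {T : ℝ} (hT : 0 < T) {k : ℕ} (u : H0 T k) :
    ∀ᵐ t ∂volume.restrict (Ioo 0 T), u.jet 0 t = u.fn t := H0.jet_ae_eq hT u (Nat.zero_le _)

theorem H0.memLp_fn {T : ℝ} {k : ℕ} (u : H0 T k) : MemLp u.fn 2 (volume.restrict (Ioo 0 T)) :=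
  Lp.memLp _

theorem H0.norm_sq_eq {T : ℝ} (hT : 0 < T) {k : ℕ} (u : H0 T k) {i : ℕ} (hi : i ≤ k) :
    ‖(u : Jets T k) ⟨i, by omega⟩‖ ^ 2 = ∫ t in Ioo 0 T, u.jet i t ^ 2 := by
  rw [norm_Lp_sq]
  refine integral_congr_ae ?_
  filter_upwards [H0.jet_ae_eq hT u hi] with t ht
  rw [ht, Real.norm_eq_abs, sq_abs]

/-! ### Poincaré inequalities for functions vanishing at `0` -/

theorem IsPrim.sq_le_mul_integral_sq {T : ℝ} (hT : 0 < T) {F f : ℝ → ℝ} (h : IsPrim T F f)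
    (h0 : F 0 = 0) (hf : MemLp f 2 (volume.restrict (Ioo 0 T))) {t : ℝ} (ht : t ∈ Icc 0 T) :
    F t ^ 2 ≤ T * ∫ τ in Ioo 0 T, f τ ^ 2 := by
  have hft : MemLp (fun τ => (f τ : ℂ)) 2 (volume.restrict (Ioo 0 t)) :=
    (hf.mono_measure (Measure.restrict_mono (Ioo_subset_Ioo_right ht.2) le_rfl)).ofReal
  have h1 := norm_integral_mul_sq_le (f := fun _ => (1 : ℂ)) (memLp_const 1) hft
  simp only [one_mul, norm_one, one_pow, integral_const, Complex.norm_real, Real.norm_eq_abs,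
    sq_abs, MeasurableSet.univ, measureReal_restrict_apply, univ_inter, Real.volume_real_Ioo,
    sub_zero, max_eq_left ht.1, smul_eq_mul, mul_one, integral_complex_ofReal] at h1
  have h2 : F t = ∫ τ in Ioo 0 t, f τ := by rw [h.eq t ht, h0, zero_add, integral_Ioo_eq ht.1]
  rw [h2]
  refine h1.trans (mul_le_mul ht.2 ?_ (integral_nonneg fun _ => sq_nonneg _) hT.le)
  exact setIntegral_mono_set hf.integrable_sq (Filter.Eventually.of_forall fun _ => sq_nonneg _)
    (Ioo_subset_Ioo_right ht.2).eventuallyLE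

theorem IsPrim.integral_sq_le {T : ℝ} (hT : 0 < T) {F f : ℝ → ℝ} (h : IsPrim T F f)
    (h0 : F 0 = 0) (hf : MemLp f 2 (volume.restrict (Ioo 0 T))) :
    ∫ t in Ioo 0 T, F t ^ 2 ≤ T ^ 2 * ∫ τ in Ioo 0 T, f τ ^ 2 := by
  refine (setIntegral_mono_on (ContinuousOn.memLp_two h.continuousOn).integrable_sq
    (integrable_const (T * ∫ τ in Ioo 0 T, f τ ^ 2)) measurableSet_Ioo fun t ht =>
      h.sq_le_mul_integral_sq hT h0 hf (Ioo_subset_Icc_self ht)).trans_eq ?_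
  simp [hT.le]
  ring

theorem IsControl.integral_sq_le {T : ℝ} (hT : 0 < T) {k : ℕ} {v : ℕ → ℝ → ℝ}
    (hv : IsControl T k v) {i : ℕ} (hi : i ≤ k) :
    ∫ t in Ioo 0 T, v i t ^ 2 ≤ (max T 1 ^ k) ^ 2 * ∫ t in Ioo 0 T, v k t ^ 2 := by
  obtain ⟨m, rfl⟩ : ∃ m, i = k - m := ⟨k - i, by omega⟩
  have h1 : ∀ m ≤ k, ∫ t in Ioo 0 T, v (k - m) t ^ 2 ≤
      (T ^ m) ^ 2 * ∫ t in Ioo 0 T, v k t ^ 2 := by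
    intro m hm
    induction m with
    | zero => simp
    | succ m ih =>
      have h2 := hv.prim (k - (m + 1)) (by omega)
      rw [show k - (m + 1) + 1 = k - m by omega] at h2
      refine (h2.integral_sq_le hT (hv.zero _ (by omega)) (hv.memLp _ (by omega))).trans ?_
      calc _ ≤ T ^ 2 * ((T ^ m) ^ 2 * ∫ t in Ioo 0 T, v k t ^ 2) := by
            gcongr
            exact ih (by omega)
        _ = _ := by ring
  rcases Nat.le_total m k with hm | hm
  · refine (h1 m hm).trans ?_
    have : T ^ m ≤ max T 1 ^ k := (pow_le_pow_left₀ hT.le (le_max_left _ _) m).trans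
      (pow_le_pow_right₀ (le_max_right _ _) hm)
    have h3 : 0 ≤ ∫ t in Ioo 0 T, v k t ^ 2 := integral_nonneg fun _ => sq_nonneg _
    gcongr
  · have h2 := h1 k le_rfl
    rw [Nat.sub_eq_zero_of_le hm]
    rw [Nat.sub_self] at h2
    refine h2.trans ?_
    have : T ^ k ≤ max T 1 ^ k := pow_le_pow_left₀ hT.le (le_max_left _ _) k
    have h3 : 0 ≤ ∫ t in Ioo 0 T, v k t ^ 2 := integral_nonneg fun _ => sq_nonneg _
    gcongr

/-! ### Weak solutions -/

theorem intervalIntegrable_smul_continuousOn {E : Type*} [NormedAddCommGroup E] [NormedSpace ℂ E]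
    {T t : ℝ} (ht : t ∈ Icc 0 T) {g : ℝ → ℝ} (hg : Integrable g (volume.restrict (Ioo 0 T)))
    {f : ℝ → E} (hf : ContinuousOn f (Icc 0 t)) :
    IntervalIntegrable (fun τ => (g τ : ℂ) • f τ) volume 0 t := by
  have h1 : IntegrableOn (fun τ => (g τ : ℂ)) (Icc 0 t) := by
    rw [integrableOn_Icc_iff_integrableOn_Ioo]
    exact (IntegrableOn.mono_set hg (Ioo_subset_Ioo_right ht.2)).ofReal
  have h2 := h1.smul_continuousOn hf isCompact_Icc
  rw [intervalIntegrable_iff_integrableOn_Icc_of_le ht.1]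
  exact h2

theorem schrGroup_smul (t : ℝ) (c : ℂ) (φ : L2) : schrGroup t (c • φ) = c • schrGroup t φ :=
  coeff_ext fun j => by rw [coeff_schrGroup, coeff_smul, coeff_smul, coeff_schrGroup]; ring

/-- The vector equation is equivalent to the scalar equations for its coefficients: the coefficient
functionals commute with the integral, and `e^{-iλ_j(t-τ)}` splits into a factor in `t` and one in
`τ`. -/
theorem duhamel_iff {s T : ℝ} (hs : 0 ≤ s) {M : L2 →L[ℂ] L2} {g : ℝ → ℝ}
    (hg : MemLp g 2 (volume.restrict (Ioo 0 T))) {ψ : ℝ → HZero s}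
    (hψ : ContinuousOn ψ (Icc 0 T)) (φ₀ : L2) {t : ℝ} (ht : t ∈ Icc 0 T) :
    HZero.toL2 (ψ t) = schrGroup t φ₀ + Complex.I • ∫ τ in (0 : ℝ)..t,
      schrGroup (t - τ) ((g τ : ℂ) • M (HZero.toL2 (ψ τ))) ↔
    ∀ j, HZero.coef j (ψ t) = Complex.exp (-Complex.I * eigenvalue j * t) *
      (coeff j φ₀ + Complex.I * ∫ τ in (0 : ℝ)..t, Complex.exp (Complex.I * eigenvalue j * τ) *
        ((g τ : ℂ) * mulCoef M j (ψ τ))) := by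
  have hc : ContinuousOn (fun τ => schrGroup (t - τ) (M (HZero.toL2 (ψ τ)))) (Icc 0 t) :=
    continuousOn_schrGroup (M.continuous.comp_continuousOn ((HZero.toL2CLM hs).continuous.comp_continuousOn
      (hψ.mono (Icc_subset_Icc_right ht.2)))) (by fun_prop)
  have hI : IntervalIntegrable (fun τ => schrGroup (t - τ) ((g τ : ℂ) • M (HZero.toL2 (ψ τ))))
      volume 0 t := by
    simp only [schrGroup_smul]
    exact intervalIntegrable_smul_continuousOn ht (hg.integrable (by norm_num)) hc
  have hcoef : ∀ j, coeff j (schrGroup t φ₀ + Complex.I • ∫ τ in (0 : ℝ)..t,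
      schrGroup (t - τ) ((g τ : ℂ) • M (HZero.toL2 (ψ τ)))) =
      Complex.exp (-Complex.I * eigenvalue j * t) *
      (coeff j φ₀ + Complex.I * ∫ τ in (0 : ℝ)..t, Complex.exp (Complex.I * eigenvalue j * τ) *
        ((g τ : ℂ) * mulCoef M j (ψ τ))) := by
    intro j
    have h1 := ((coeffCLM j).restrictScalars ℝ).intervalIntegral_comp_comm hI
    simp only [ContinuousLinearMap.coe_restrictScalars', coeffCLM_apply] at h1
    rw [coeff_add, coeff_smul, ← h1, coeff_schrGroup, mul_add, mul_left_comm (Complex.exp _) Complex.I,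
      ← intervalIntegral.integral_const_mul (Complex.exp _)]
    refine congrArg (_ + Complex.I * ·) (congrArg (fun f : ℝ → ℂ => ∫ τ in (0 : ℝ)..t, f τ)
      (funext fun τ => ?_))
    have h2 : Complex.exp (-Complex.I * eigenvalue j * (t - τ : ℝ)) =
        Complex.exp (-Complex.I * eigenvalue j * t) * Complex.exp (Complex.I * eigenvalue j * τ) := by
      rw [← Complex.exp_add]
      push_cast
      ring_nf
    rw [coeff_schrGroup, coeff_smul, mulCoef, h2]
    ring
  constructor
  · intro h j
    rw [HZero.coef, h, hcoef]
  · intro h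
    exact coeff_ext fun j => by rw [hcoef]; exact h j

/-- The difference of two solutions is a fixed point of `iG`, where `G` is the Duhamel operator with
weight `g`, and the only fixed point is `0`. -/
theorem eqOn_of_duhamel {s T : ℝ} {M : L2 →L[ℂ] L2} (hM : IsRegularMul s M) (hT : 0 < T)
    {g : ℝ → ℝ} (hg : MemLp g 2 (volume.restrict (Ioo 0 T))) {c : ℕ+ → ℂ} {ψ χ : ℝ → HZero s}
    (hψ : ContinuousOn ψ (Icc 0 T)) (hχ : ContinuousOn χ (Icc 0 T))
    (h1 : ∀ t ∈ Icc 0 T, ∀ j, HZero.coef j (ψ t) = Complex.exp (-Complex.I * eigenvalue j * t) *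
      (c j + Complex.I * ∫ τ in (0 : ℝ)..t, Complex.exp (Complex.I * eigenvalue j * τ) *
        ((g τ : ℂ) * mulCoef M j (ψ τ))))
    (h2 : ∀ t ∈ Icc 0 T, ∀ j, HZero.coef j (χ t) = Complex.exp (-Complex.I * eigenvalue j * t) *
      (c j + Complex.I * ∫ τ in (0 : ℝ)..t, Complex.exp (Complex.I * eigenvalue j * τ) *
        ((g τ : ℂ) * mulCoef M j (χ τ)))) : EqOn χ ψ (Icc 0 T) := by
  have hs := hM.nonneg
  obtain ⟨C, hC, HG⟩ := exists_duhamelOp hM hT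
  obtain ⟨G, hG1, hG2⟩ := HG g hg
  obtain ⟨d, hd⟩ := exists_path_eq (fun t => χ t - ψ t) (hχ.sub hψ)
  have hfix : d = 0 + (Complex.I • G) d := by
    ext1 t
    refine HZero.coef_ext fun j => ?_
    rw [zero_add, smul_apply, ContinuousMap.smul_apply, HZero.coef_smul, hG1,
      hd, HZero.coef_sub, h1 t t.2, h2 t t.2, ← mul_sub, add_sub_add_left_eq_sub, ← mul_sub,
      ← intervalIntegral.integral_sub
        (intervalIntegrable_of_integrable t.2 (integrable_duhamel M hs hg hχ j))
        (intervalIntegrable_of_integrable t.2 (integrable_duhamel M hs hg hψ j)), mul_left_comm]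
    refine congrArg (fun z => Complex.I * (Complex.exp _ * z))
      (intervalIntegral.integral_congr fun τ hτ => ?_)
    rw [uIcc_of_le t.2.1] at hτ
    have hτ' : τ ∈ Icc 0 T := ⟨hτ.1, hτ.2.trans t.2.2⟩
    rw [extPath, projIcc_of_mem hT.le hτ', hd]
    simp only [← mulCoefCLM_apply M hs, map_sub]
    ring
  obtain ⟨w, -, -, hw⟩ := exists_fixedPoint hs hT (γ := fun t => C * g t ^ 2)
    (hg.integrable_sq.const_mul C) (fun t => by positivity) (Complex.I • G)
    (fun w ρ hρ hρc hw t => by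
      rw [smul_apply, ContinuousMap.smul_apply, norm_smul, Complex.norm_I,
        one_mul]
      refine (hG2 w t).trans ?_
      rw [← intervalIntegral.integral_const_mul]
      have hi := intervalIntegrable_of_integrable t.2 (hg.integrable_sq.const_mul C)
      refine intervalIntegral.integral_mono_on t.2.1
        ((intervalIntegrable_of_integrable t.2 (integrable_sq_mul_norm_sq hg
          (continuous_extPath hT.le w).continuousOn)).const_mul C)
        (hi.mul_continuousOn ?_) fun τ hτ => ?_
      · rw [uIcc_of_le t.2.1]
        exact hρc.mono (Icc_subset_Icc_right t.2.2)
      · have hτ' : τ ∈ Icc 0 T := ⟨hτ.1, hτ.2.trans t.2.2⟩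
        have := hw ⟨τ, hτ'⟩
        rw [extPath, projIcc_of_mem hT.le hτ', mul_assoc]
        gcongr) 0
  have hd0 : d = 0 := (hw d hfix).trans (hw 0 (by simp)).symm
  intro t ht
  have := hd ⟨t, ht⟩
  rw [hd0] at this
  exact sub_eq_zero.1 this.symm

theorem contDiff_of_hasDerivAt {E : Type*} [NormedAddCommGroup E] [NormedSpace ℝ E] (k : ℕ)
    {f : ℕ → ℝ → E} (h : ∀ n < k, ∀ t, HasDerivAt (f n) (f (n + 1) t) t)
    (hc : ∀ n ≤ k, Continuous (f n)) : ContDiff ℝ k (f 0) := by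
  induction k generalizing f with
  | zero => exact contDiff_zero.2 (hc 0 le_rfl)
  | succ k ih =>
    rw [Nat.cast_succ, contDiff_succ_iff_deriv]
    refine ⟨fun t => (h 0 (by omega) t).differentiableAt, by simp, ?_⟩
    have : deriv (f 0) = f 1 := funext fun t => (h 0 (by omega) t).deriv
    rw [this]
    exact ih (f := fun n => f (n + 1)) (fun n hn => h (n + 1) (by omega))
      fun n hn => hc (n + 1) (by omega)

theorem source_zero_index {s : ℝ} (hs : 0 ≤ s) (M : L2 →L[ℂ] L2) (v : ℕ → ℝ → ℝ) (a : ℕ → HZero s)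
    (E : ℕ → ℝ → HZero s) (j : ℕ+) (t : ℝ) :
    source hs M v a E j 0 t = (v 0 t : ℂ) * mulCoef M j (state hs a E 0 t) := by
  simp [source, leibniz]

theorem IsEvolution.contDiff {s T : ℝ} {hs : 0 ≤ s} {k : ℕ} {M : L2 →L[ℂ] L2} {v : ℕ → ℝ → ℝ}
    {a : ℕ → HZero s} {E : ℕ → ℝ → HZero s} (h : IsEvolution hs T k M v a E)
    (ha : ∀ n < k, ∀ j, HZero.coef j (a (n + 1)) = -Complex.I * eigenvalue j * HZero.coef j (a n)) :
    ContDiff ℝ k (state hs a E 0) :=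
  contDiff_of_hasDerivAt k (fun n hn t => hasDerivAt_state hs (ha n hn) (h.deriv n hn t))
    fun n hn => continuous_state hs (h.cont n hn)

theorem IsEvolution.duhamel {s T : ℝ} {hs : 0 ≤ s} (hT : 0 ≤ T) {k : ℕ} {M : L2 →L[ℂ] L2}
    {v : ℕ → ℝ → ℝ} {a : ℕ → HZero s} {E : ℕ → ℝ → HZero s} (h : IsEvolution hs T k M v a E)
    {t : ℝ} (ht : t ∈ Icc 0 T) (j : ℕ+) :
    HZero.coef j (E 0 t) = Complex.exp (-Complex.I * eigenvalue j * t) *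
      (Complex.I * ∫ τ in (0 : ℝ)..t, Complex.exp (Complex.I * eigenvalue j * τ) *
        ((v 0 τ : ℂ) * mulCoef M j (state hs a E 0 τ))) := by
  have h1 := (h.prim 0 (Nat.zero_le _) j).duhamel hT ht
  simpa only [h.zero 0 (Nat.zero_le _), HZero.coef_zero, zero_add, source_zero_index] using h1

/-- At the final time the derivatives of the evolution are those of a free evolution. -/
theorem IsEvolution.coef_final {s T : ℝ} {hs : 0 ≤ s} (hT : 0 ≤ T) {k : ℕ} {M : L2 →L[ℂ] L2}
    {v : ℕ → ℝ → ℝ} (hv : IsControl T k v) {a : ℕ → HZero s} {E : ℕ → ℝ → HZero s}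
    (h : IsEvolution hs T k M v a E) (j : ℕ+) {n : ℕ} (hn : n ≤ k) :
    HZero.coef j (E n T) = (-Complex.I * eigenvalue j) ^ n * HZero.coef j (E 0 T) := by
  induction n with
  | zero => simp
  | succ n ih =>
    rw [h.succ n (by omega) T (right_mem_Icc.2 hT), ih (by omega), source,
      leibniz_zero_of fun i hi => by rw [hv.final i (by omega), Complex.ofReal_zero]]
    ring

/-! ### Estimates of Duhamel integrals in spaces of higher order -/

theorem natCast_sq_le_eigenvalue (j : ℕ+) : (j : ℝ) ^ 2 ≤ eigenvalue j := by
  rw [eigenvalue, mul_pow]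
  have h1 : 1 ≤ Real.pi := by linarith [Real.pi_gt_three]
  exact le_mul_of_one_le_right (by positivity) (one_le_pow₀ h1)

theorem eigenvalue_nonneg (j : ℕ+) : 0 ≤ eigenvalue j := sq_nonneg _

theorem norm_I_mul_eigenvalue (j : ℕ+) : ‖Complex.I * (eigenvalue j : ℂ)‖ = eigenvalue j := by
  rw [norm_mul, Complex.norm_I, one_mul, Complex.norm_real, Real.norm_of_nonneg (eigenvalue_nonneg j)]

theorem sum_norm_sum_sq_le {ι κ E : Type*} [NormedAddCommGroup E] (F : Finset ι) (S : Finset κ)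
    (w : ι → ℝ) (x : κ → ι → E) {B : ℝ}
    (h : ∀ l ∈ S, ∑ i ∈ F, (w i * ‖x l i‖) ^ 2 ≤ B) :
    ∑ i ∈ F, (w i * ‖∑ l ∈ S, x l i‖) ^ 2 ≤ (S.card : ℝ) ^ 2 * B := by
  have h1 : ∀ i, (w i * ‖∑ l ∈ S, x l i‖) ^ 2 ≤ S.card * ∑ l ∈ S, (w i * ‖x l i‖) ^ 2 := by
    intro i
    simp only [mul_pow]
    rw [← Finset.mul_sum, mul_left_comm]
    exact mul_le_mul_of_nonneg_left (norm_sum_sq_le S fun l => x l i) (sq_nonneg _)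
  calc _ ≤ ∑ i ∈ F, S.card * ∑ l ∈ S, (w i * ‖x l i‖) ^ 2 := Finset.sum_le_sum fun i _ => h1 i
    _ = S.card * ∑ l ∈ S, ∑ i ∈ F, (w i * ‖x l i‖) ^ 2 := by
      rw [← Finset.mul_sum, Finset.sum_comm]
    _ ≤ S.card * ∑ l ∈ S, B := by gcongr with l hl; exact h l hl
    _ = _ := by rw [Finset.sum_const, nsmul_eq_mul]; ring

theorem integral_sq_mul_norm_sq_le {E : Type*} [NormedAddCommGroup E] {T : ℝ} {g : ℝ → ℝ}
    (hg : MemLp g 2 (volume.restrict (Ioo 0 T))) {f : ℝ → E} (hf : ContinuousOn f (Icc 0 T)) {X : ℝ}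
    (hX : ∀ t ∈ Icc 0 T, ‖f t‖ ≤ X) :
    ∫ t in Ioo 0 T, g t ^ 2 * ‖f t‖ ^ 2 ≤ (∫ t in Ioo 0 T, g t ^ 2) * X ^ 2 := by
  rw [← integral_mul_const]
  refine setIntegral_mono_on (integrable_sq_mul_norm_sq hg hf) (hg.integrable_sq.mul_const _)
    measurableSet_Ioo fun t ht => ?_
  have := hX t (Ioo_subset_Icc_self ht)
  gcongr

theorem leibniz_final {T : ℝ} {k : ℕ} {v : ℕ → ℝ → ℝ} (hv : IsControl T k v) (b : ℕ → ℝ → ℂ)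
    {n : ℕ} (hn : n < k) : leibniz (fun i t => (v i t : ℂ)) b n 0 = 0 ∧
      leibniz (fun i t => (v i t : ℂ)) b n T = 0 :=
  ⟨leibniz_zero_of fun i hi => by rw [hv.zero i (by omega), Complex.ofReal_zero],
    leibniz_zero_of fun i hi => by rw [hv.final i (by omega), Complex.ofReal_zero]⟩

/-- Each factor `iλ_j` is written as a derivative of the exponential and moved onto the product `v
b`. No boundary term arises while the order is below `k`, since the derivatives of the control
vanish at `0` and `T`. -/
theorem eigenvalue_pow_mul_integral {T : ℝ} (hT : 0 < T) {k : ℕ} {v : ℕ → ℝ → ℝ}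
    (hv : IsControl T k v) {b : ℕ → ℝ → ℂ} (hb : ∀ n < k, IsPrim T (b n) (b (n + 1))) (j : ℕ+)
    {m : ℕ} (hm : m ≤ k) :
    (Complex.I * eigenvalue j) ^ m * ∫ t in Ioo 0 T, Complex.exp (Complex.I * eigenvalue j * t) *
        ((v 0 t : ℂ) * b 0 t) =
      (-1) ^ m * ∫ t in Ioo 0 T, Complex.exp (Complex.I * eigenvalue j * t) *
        leibniz (fun i t => (v i t : ℂ)) b m t := by
  induction m with
  | zero => simp [leibniz]
  | succ m ih =>
    have h1 := IsPrim.leibniz (n := m) hT.le (fun i hi => (hv.prim i (by omega)).ofReal)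
      fun i hi => hb i (by omega)
    have h2 := (isPrim_exp (T := T) (Complex.I * eigenvalue j)).mul hT.le h1
    have h3 := h2.integral_eq hT.le
    have hc := h1.continuousOn
    have hce : Continuous fun t : ℝ => Complex.exp (Complex.I * eigenvalue j * t) := by fun_prop
    rw [← uIcc_of_le hT.le] at hc
    have i1 : IntervalIntegrable (fun t : ℝ => Complex.I * eigenvalue j *
        Complex.exp (Complex.I * eigenvalue j * t) * leibniz (fun i t => (v i t : ℂ)) b m t)
        volume 0 T := ((continuous_const.mul hce).continuousOn.mul hc).intervalIntegrable
    have i2 : IntervalIntegrable (fun t : ℝ => Complex.exp (Complex.I * eigenvalue j * t) *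
        leibniz (fun i t => (v i t : ℂ)) b (m + 1) t) volume 0 T :=
      h1.integrable.continuousOn_mul hce.continuousOn
    rw [(leibniz_final hv b hm).1, (leibniz_final hv b hm).2, intervalIntegral.integral_add
      i1 i2] at h3
    simp only [mul_assoc (Complex.I * (eigenvalue j : ℂ))] at h3
    rw [intervalIntegral.integral_const_mul] at h3
    rw [pow_succ', mul_assoc, ih (by omega), integral_Ioo_eq hT.le, integral_Ioo_eq hT.le]
    linear_combination (-1) ^ m * h3

/-- The additional weight `j^{2m} ≤ λ_j^m` is exchanged for `m` time derivatives of the product, and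
each Leibniz term is bounded by `exists_hidden_regularity`. Only derivatives of `v` up to order `m`
occur, which is the origin of the `H^m` norm. -/
theorem exists_positive_estimate {s T : ℝ} {M : L2 →L[ℂ] L2} (hM : IsRegularMul s M) (hT : 0 < T)
    (k : ℕ) : ∃ C : ℝ, 0 ≤ C ∧ ∀ v : ℕ → ℝ → ℝ, IsControl T k v → ∀ Y : ℕ → ℝ → HZero s,
      (∀ n < k, ∀ t, HasDerivAt (Y n) (Y (n + 1) t) t) → (∀ n ≤ k, Continuous (Y n)) →
      ∀ X : ℝ, (∀ n ≤ k, ∀ t ∈ Icc 0 T, ‖Y n t‖ ≤ X) → ∀ m ≤ k, ∀ F : Finset ℕ+,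
        ∑ j ∈ F, ((j : ℝ) ^ (s + 2 * m) * ‖∫ t in Ioo 0 T,
          Complex.exp (Complex.I * eigenvalue j * t) *
            ((v 0 t : ℂ) * mulCoef M j (Y 0 t))‖) ^ 2 ≤
          C * ((∑ i ∈ Finset.range (m + 1), ∫ t in Ioo 0 T, v i t ^ 2) * X ^ 2) := by
  obtain ⟨C, hC, H⟩ := exists_hidden_regularity hM hT
  have hs := hM.nonneg
  refine ⟨(k + 1) ^ 2 * ((2 ^ k) ^ 2 * C), by positivity, fun v hv Y hY hYc X hX m hm F => ?_⟩
  set S := ∑ i ∈ Finset.range (m + 1), ∫ t in Ioo 0 T, v i t ^ 2 with hS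
  have hnn : ∀ i, 0 ≤ ∫ t in Ioo 0 T, v i t ^ 2 := fun i => integral_nonneg fun _ => sq_nonneg _
  have hS0 : 0 ≤ S := Finset.sum_nonneg fun i _ => hnn i
  have hint : ∀ (j : ℕ+), ∀ i ∈ Finset.range (m + 1), Integrable (fun t : ℝ =>
      (m.choose i : ℂ) * (Complex.exp (Complex.I * eigenvalue j * t) *
        ((v i t : ℂ) * mulCoef M j (Y (m - i) t)))) (volume.restrict (Ioo 0 T)) := fun j i hi =>
    (integrable_duhamel M hs (hv.memLp i (by have := Finset.mem_range.1 hi; omega))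
      (hYc (m - i) (by omega)).continuousOn j).const_mul _
  have hstep : ∀ j : ℕ+, (j : ℝ) ^ (s + 2 * m) * ‖∫ t in Ioo 0 T,
      Complex.exp (Complex.I * eigenvalue j * t) * ((v 0 t : ℂ) * mulCoef M j (Y 0 t))‖ ≤
      (j : ℝ) ^ s * ‖∑ i ∈ Finset.range (m + 1), (m.choose i : ℂ) * ∫ t in Ioo 0 T,
        Complex.exp (Complex.I * eigenvalue j * t) *
          ((v i t : ℂ) * mulCoef M j (Y (m - i) t))‖ := by
    intro j
    have h1 := congrArg norm (eigenvalue_pow_mul_integral hT hv (b := fun n t => mulCoef M j (Y n t))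
      (fun n hn => isPrim_mulCoef hs M j (hY n hn) (hYc (n + 1) hn)) j hm)
    rw [norm_mul, norm_pow, norm_I_mul_eigenvalue, norm_mul, norm_pow, norm_neg, norm_one, one_pow,
      one_mul] at h1
    have h2 : (fun t : ℝ => Complex.exp (Complex.I * eigenvalue j * t) *
        leibniz (fun i t => (v i t : ℂ)) (fun n t => mulCoef M j (Y n t)) m t) = fun t : ℝ =>
        ∑ i ∈ Finset.range (m + 1), (m.choose i : ℂ) *
          (Complex.exp (Complex.I * eigenvalue j * t) *
            ((v i t : ℂ) * mulCoef M j (Y (m - i) t))) := by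
      funext t
      rw [leibniz_eq_sum_range, Finset.mul_sum]
      exact Finset.sum_congr rfl fun i _ => by ring
    rw [h2, integral_finsetSum _ (hint j)] at h1
    simp only [integral_const_mul] at h1
    have hj : (0 : ℝ) < j := by exact_mod_cast j.pos
    rw [Real.rpow_add hj, mul_assoc, ← h1]
    have h3 : (j : ℝ) ^ (2 * m : ℝ) ≤ eigenvalue j ^ m := by
      rw [show (2 * m : ℝ) = ((2 * m : ℕ) : ℝ) by push_cast; ring, Real.rpow_natCast, pow_mul]
      exact pow_le_pow_left₀ (by positivity) (natCast_sq_le_eigenvalue j) m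
    gcongr
  calc _ ≤ ∑ j ∈ F, ((j : ℝ) ^ s * ‖∑ i ∈ Finset.range (m + 1), (m.choose i : ℂ) * ∫ t in Ioo 0 T,
        Complex.exp (Complex.I * eigenvalue j * t) *
          ((v i t : ℂ) * mulCoef M j (Y (m - i) t))‖) ^ 2 :=
        Finset.sum_le_sum fun j _ => pow_le_pow_left₀ (by positivity) (hstep j) 2
    _ ≤ ((Finset.range (m + 1)).card : ℝ) ^ 2 * ((2 ^ k) ^ 2 * (C * (S * X ^ 2))) := by
        refine sum_norm_sum_sq_le F _ (fun j : ℕ+ => (j : ℝ) ^ s) _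
          fun i hi => ?_
        have hi' : i ≤ m := by have := Finset.mem_range.1 hi; omega
        have hch : ((m.choose i : ℕ) : ℝ) ≤ 2 ^ k := by
          calc ((m.choose i : ℕ) : ℝ) ≤ 2 ^ m := by exact_mod_cast Nat.choose_le_two_pow m i
            _ ≤ 2 ^ k := pow_le_pow_right₀ (by norm_num) hm
        simp only [norm_mul, Complex.norm_natCast, mul_left_comm _ ((m.choose i : ℕ) : ℝ)]
        simp only [mul_pow ((m.choose i : ℕ) : ℝ)]
        rw [← Finset.mul_sum]
        refine mul_le_mul (by gcongr) ?_ (Finset.sum_nonneg fun _ _ => sq_nonneg _) (by positivity)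
        refine (H (v i) (hv.memLp i (by omega)) (Y (m - i)) (hYc _ (by omega)).continuousOn F).trans ?_
        refine mul_le_mul_of_nonneg_left ((integral_sq_mul_norm_sq_le (hv.memLp i (by omega))
          (hYc (m - i) (by omega)).continuousOn (hX (m - i) (by omega))).trans ?_) hC
        exact mul_le_mul_of_nonneg_right
          (Finset.single_le_sum (f := fun i => ∫ t in Ioo 0 T, v i t ^ 2) (fun i _ => hnn i) hi)
          (sq_nonneg _)
    _ ≤ (k + 1) ^ 2 * ((2 ^ k) ^ 2 * (C * (S * X ^ 2))) := by
        rw [Finset.card_range]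
        have : ((m + 1 : ℕ) : ℝ) ≤ k + 1 := by exact_mod_cast Nat.succ_le_succ hm
        gcongr
    _ = _ := by ring

/-! ### Estimates of Duhamel integrals in spaces of lower order -/

theorem sum_norm_add_sq_le {ι E : Type*} [NormedAddCommGroup E] (F : Finset ι) (w : ι → ℝ)
    (x y : ι → E) {A B : ℝ} (hx : ∑ i ∈ F, (w i * ‖x i‖) ^ 2 ≤ A)
    (hy : ∑ i ∈ F, (w i * ‖y i‖) ^ 2 ≤ B) :
    ∑ i ∈ F, (w i * ‖x i + y i‖) ^ 2 ≤ 2 * (A + B) := by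
  have h1 : ∀ i, (w i * ‖x i + y i‖) ^ 2 ≤ 2 * ((w i * ‖x i‖) ^ 2 + (w i * ‖y i‖) ^ 2) := by
    intro i
    have h2 := add_sq_le (a := ‖x i‖) (b := ‖y i‖)
    have h3 : ‖x i + y i‖ ^ 2 ≤ (‖x i‖ + ‖y i‖) ^ 2 :=
      pow_le_pow_left₀ (norm_nonneg _) (norm_add_le _ _) 2
    simp only [mul_pow]
    rw [← mul_add, mul_left_comm]
    exact mul_le_mul_of_nonneg_left (h3.trans h2) (sq_nonneg _)
  refine (Finset.sum_le_sum fun i _ => h1 i).trans ?_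
  rw [← Finset.mul_sum, Finset.sum_add_distrib]
  gcongr

theorem sq_integral_abs_mul_le {T : ℝ} {f g : ℝ → ℝ} (hf : MemLp f 2 (volume.restrict (Ioo 0 T)))
    (hg : MemLp g 2 (volume.restrict (Ioo 0 T))) :
    (∫ t in Ioo 0 T, |f t * g t|) ^ 2 ≤ (∫ t in Ioo 0 T, f t ^ 2) * ∫ t in Ioo 0 T, g t ^ 2 := by
  have h1 := norm_integral_mul_sq_le (f := fun t => ((|f t| : ℝ) : ℂ)) (g := fun t => ((|g t| : ℝ) : ℂ))
    hf.abs.ofReal hg.abs.ofReal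
  simpa only [← Complex.ofReal_mul, ← abs_mul, integral_complex_ofReal, Complex.norm_real,
    Real.norm_eq_abs, sq_abs, abs_abs] using h1

theorem sq_integral_abs_le {T : ℝ} (hT : 0 ≤ T) {f : ℝ → ℝ}
    (hf : MemLp f 2 (volume.restrict (Ioo 0 T))) :
    (∫ t in Ioo 0 T, |f t|) ^ 2 ≤ T * ∫ t in Ioo 0 T, f t ^ 2 := by
  have h1 := sq_integral_abs_mul_le hf (memLp_const (1 : ℝ))
  simp only [mul_one, one_pow, integral_const, measureReal_restrict_apply, MeasurableSet.univ,
    univ_inter, Real.volume_real_Ioo, sub_zero, max_eq_left hT, smul_eq_mul] at h1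
  linarith

theorem HZero.exists_incl {s : ℝ} (hs : 2 ≤ s) : ∃ D : HZero s →L[ℂ] HZero (s - 2),
    (∀ φ, toL2 (D φ) = toL2 φ) ∧ ∀ φ, ‖D φ‖ ≤ ‖φ‖ := by
  obtain ⟨D, hD, hn⟩ := exists_diag (r := s - 2) (s := s) (by linarith) (fun _ => 1) zero_le_one
    (fun j => by
      rw [norm_one, mul_one, one_mul]
      exact Real.rpow_le_rpow_of_exponent_le (by exact_mod_cast one_le (a := j)) (by linarith))
  refine ⟨D, fun φ => coeff_ext fun j => ?_, fun φ => (hn φ).trans_eq (one_mul _)⟩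
  have := hD j φ
  rwa [one_mul] at this

theorem HZero.exists_laplacian {s : ℝ} (hs : 2 ≤ s) : ∃ A : HZero s →L[ℂ] HZero (s - 2),
    (∀ j φ, coef j (A φ) = eigenvalue j * coef j φ) ∧ ∀ φ, ‖A φ‖ ≤ Real.pi ^ 2 * ‖φ‖ :=
  exists_diag (by linarith) (fun j => (eigenvalue j : ℂ)) (sq_nonneg _) fun j => by
    have hj : (0 : ℝ) < j := by exact_mod_cast j.pos
    rw [Complex.norm_real, Real.norm_of_nonneg (eigenvalue_nonneg j), eigenvalue, mul_pow,
      Real.rpow_sub hj, show (j : ℝ) ^ (2 : ℝ) = (j : ℝ) ^ 2 from Real.rpow_natCast _ 2]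
    refine le_of_eq ?_
    field_simp

/-- A product with `μ` may leave `H^s_{(0)}` because of the traces, but it stays in `H^{s-2}_{(0)}`.
-/
theorem IsRegularMul.exists_lowOp {s : ℝ} {M : L2 →L[ℂ] L2} (hM : IsRegularMul s M) :
    ∃ (N : HZero s →L[ℂ] HZero (s - 2)) (C : ℝ), 0 ≤ C ∧
      (∀ φ, HZero.toL2 (N φ) = M (HZero.toL2 φ)) ∧ ∀ φ, ‖N φ‖ ≤ C * ‖φ‖ := by
  have hs2 : 0 ≤ s - 2 := by have := hM.two_le; linarith
  obtain ⟨C, hC, H⟩ := hM.low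
  obtain ⟨D, hD, hDn⟩ := HZero.exists_incl hM.two_le
  have key : ∀ φ : HZero s, ∃ χ : HZero (s - 2), HZero.toL2 χ = M (HZero.toL2 φ) ∧
      ‖χ‖ ≤ Real.sqrt C * ‖φ‖ := by
    intro φ
    obtain ⟨χ, hχ, hn⟩ := HZero.exists_of_sum_le hs2 (fun j => coeff j (M (HZero.toL2 φ)))
      (B := Real.sqrt C * ‖φ‖) (by positivity) (fun F => by
        have h1 := H (D φ) F
        simp only [mulCoef, hD] at h1
        rw [mul_pow, Real.sq_sqrt hC]
        refine h1.trans ?_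
        have := hDn φ
        gcongr)
    exact ⟨χ, coeff_ext hχ, hn⟩
  choose N hN hNn using key
  refine ⟨LinearMap.mkContinuous ⟨⟨N, fun φ χ => ?_⟩, fun c φ => ?_⟩ (Real.sqrt C) hNn,
    Real.sqrt C, Real.sqrt_nonneg C, hN, hNn⟩
  · exact HZero.toL2_injective _ (by simp only [map_add, hN])
  · exact HZero.toL2_injective _ (by simp only [map_smul, hN, RingHom.id_apply])

/-- In `H^{s-2}_{(0)}` there are no trace terms, so Minkowski's inequality replaces Bessel's. The
weight `g` then only has to be integrable, as is the case for a product of two square integrable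
functions. -/
theorem IsRegularMul.exists_low_estimate {s : ℝ} {M : L2 →L[ℂ] L2} (hM : IsRegularMul s M) :
    ∃ C : ℝ, 0 ≤ C ∧ ∀ (T : ℝ) (g : ℝ → ℝ), Integrable g (volume.restrict (Ioo 0 T)) →
      ∀ f : ℝ → HZero (s - 2), ContinuousOn f (Icc 0 T) → ∀ B, 0 ≤ B →
      (∀ t ∈ Icc 0 T, ‖f t‖ ≤ B) → ∀ F : Finset ℕ+,
        ∑ j ∈ F, ((j : ℝ) ^ (s - 2) * ‖∫ t in Ioo 0 T, Complex.exp (Complex.I * eigenvalue j * t) *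
          ((g t : ℂ) * mulCoef M j (f t))‖) ^ 2 ≤ C * (B * ∫ t in Ioo 0 T, |g t|) ^ 2 := by
  have hs2 : 0 ≤ s - 2 := by have := hM.two_le; linarith
  obtain ⟨C, hC, H⟩ := hM.low
  refine ⟨C, hC, fun T g hg f hf B hB hfB F => ?_⟩
  have h1 := sum_norm_integral_mul_sq_le F hg (B := Real.sqrt C * B)
    (c := fun j t => (((j : ℝ) ^ (s - 2) : ℝ) : ℂ) * (Complex.exp (Complex.I * eigenvalue j * t) *
      mulCoef M j (f t)))
    (fun j _ => ContinuousOn.aestronglyMeasurable_Ioo (continuousOn_const.mul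
      ((Continuous.continuousOn (by fun_prop)).mul
        ((mulCoefCLM M hs2 j).continuous.comp_continuousOn hf)))) (by positivity)
    ((ae_restrict_iff' measurableSet_Ioo).2 (Filter.Eventually.of_forall fun t ht => by
      simp only [norm_mul, norm_exp_I_eigenvalue, one_mul, Complex.norm_real]
      have h2 := H (f t) F
      simp only [Real.norm_eq_abs, abs_of_nonneg (Real.rpow_nonneg (Nat.cast_nonneg _) _)]
      rw [mul_pow, Real.sq_sqrt hC]
      have := hfB t (Ioo_subset_Icc_self ht)
      exact h2.trans (by gcongr)))
  rw [mul_assoc, mul_pow, Real.sq_sqrt hC] at h1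
  refine le_trans (le_of_eq ?_) h1
  refine Finset.sum_congr rfl fun j _ => ?_
  congr 1
  have e : (fun t : ℝ => (g t : ℂ) * ((((j : ℝ) ^ (s - 2) : ℝ) : ℂ) *
      (Complex.exp (Complex.I * eigenvalue j * t) * mulCoef M j (f t)))) =
      fun t : ℝ => (((j : ℝ) ^ (s - 2) : ℝ) : ℂ) * (Complex.exp (Complex.I * eigenvalue j * t) *
          ((g t : ℂ) * mulCoef M j (f t))) := by
    funext t; ring
  rw [e, integral_const_mul, norm_mul, Complex.norm_real,
    Real.norm_of_nonneg (Real.rpow_nonneg (Nat.cast_nonneg _) _)]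

theorem IsEvolution.isPrim_coef_state {s T : ℝ} {hs : 0 ≤ s} {k : ℕ} {M : L2 →L[ℂ] L2}
    {v : ℕ → ℝ → ℝ} {a : ℕ → HZero s} {E : ℕ → ℝ → HZero s} (h : IsEvolution hs T k M v a E)
    (b : ℕ → HZero s) {n : ℕ} (hn : n ≤ k) (j : ℕ+) :
    IsPrim T (fun t => HZero.coef j (state hs b E n t)) fun t =>
      -Complex.I * eigenvalue j * HZero.coef j (state hs b E n t) +
        Complex.I * source hs M v a E j n t := by
  have h1 := (h.prim n hn j).add
    ((isPrim_exp (T := T) (-Complex.I * eigenvalue j)).const_mul (HZero.coef j (b n)))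
  convert h1 using 1
  · funext t
    rw [state, HZero.coef_add, HZero.coef_group]
    ring
  · funext t
    rw [state, HZero.coef_add, HZero.coef_group]
    ring

/-- The image by `M` of the last derivative of the evolution is a primitive. -/
theorem IsEvolution.isPrim_mulCoef_last {s T : ℝ} (hT : 0 < T) {hs : 0 ≤ s} {k : ℕ}
    {M : L2 →L[ℂ] L2} {v : ℕ → ℝ → ℝ} (hv : IsControl T k v) {a : ℕ → HZero s}
    {E : ℕ → ℝ → HZero s} (h : IsEvolution hs T k M v a E) (b : ℕ → HZero s)
    (hs2 : 0 ≤ s - 2) {A N : HZero s →L[ℂ] HZero (s - 2)}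
    (hA : ∀ j φ, HZero.coef j (A φ) = eigenvalue j * HZero.coef j φ)
    (hN : ∀ φ, HZero.toL2 (N φ) = M (HZero.toL2 φ)) (j : ℕ+) :
    IsPrim T (fun t => mulCoef M j (state hs b E k t)) fun t =>
      -Complex.I * mulCoef M j (A (state hs b E k t)) + ∑ i ∈ Finset.range (k + 1),
        Complex.I * (k.choose i * ((v i t : ℂ) * mulCoef M j (N (state hs a E (k - i) t)))) := by
  -- The `k`-th derivative of the state is not differentiable in `H^s_{(0)}`, but in `L²` the
  -- equation exhibits it as a primitive of this curve, to which the bounded functional `coeff j ∘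
  -- M` can be applied.
  set z : ℝ → L2 := fun t => (-Complex.I) • HZero.toL2 (A (state hs b E k t)) +
    ∑ i ∈ Finset.range (k + 1), (v i t : ℂ) •
      ((Complex.I * k.choose i) • HZero.toL2 (N (state hs a E (k - i) t))) with hz
  have hTm : T ∈ Icc 0 T := right_mem_Icc.2 hT.le
  have hcb : Continuous (state hs b E k) := continuous_state hs (h.cont k le_rfl)
  have hca : ∀ i, Continuous (state hs a E (k - i)) := fun i =>
    continuous_state hs (h.cont _ (Nat.sub_le _ _))
  have hι := (HZero.toL2CLM (s := s - 2) hs2).continuous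
  have hzi : IntervalIntegrable z volume 0 T := by
    have h2 : IntervalIntegrable (fun t => ∑ i ∈ Finset.range (k + 1), (v i t : ℂ) •
        ((Complex.I * k.choose i) • HZero.toL2 (N (state hs a E (k - i) t)))) volume 0 T := by
      have h3 : ∀ i ∈ Finset.range (k + 1), IntervalIntegrable (fun t => (v i t : ℂ) •
          ((Complex.I * k.choose i) • HZero.toL2 (N (state hs a E (k - i) t)))) volume 0 T := by
        intro i hi
        refine intervalIntegrable_smul_continuousOn hTm ((hv.memLp i (by
          have := Finset.mem_range.1 hi; omega)).integrable (by norm_num)) ?_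
        exact ((hι.comp (N.continuous.comp (hca i))).const_smul
          (Complex.I * k.choose i)).continuousOn
      exact ⟨integrable_finsetSum _ fun i hi => (h3 i hi).1,
        integrable_finsetSum _ fun i hi => (h3 i hi).2⟩
    refine IntervalIntegrable.add ?_ h2
    exact ((hι.comp (A.continuous.comp hcb)).const_smul (-Complex.I)).intervalIntegrable _ _
  have hzc : ∀ n t, coeff n (z t) = -Complex.I * eigenvalue n * HZero.coef n (state hs b E k t) +
      Complex.I * source hs M v a E n k t := by
    intro n t
    rw [hz, source, leibniz_eq_sum_range, Finset.mul_sum]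
    simp only
    rw [← coeffCLM_apply, map_add, map_sum, map_smul, coeffCLM_apply, smul_eq_mul, mul_assoc]
    congr 1
    · exact congrArg _ (hA n _)
    · refine Finset.sum_congr rfl fun i _ => ?_
      rw [map_smul, map_smul, coeffCLM_apply, hN, smul_eq_mul, smul_eq_mul, mulCoef]
      ring
  have hprim : IsPrim T (fun t => HZero.toL2 (state hs b E k t)) z := by
    refine ⟨hzi, fun t ht => coeff_ext fun n => ?_⟩
    have h1 := (h.isPrim_coef_state b le_rfl n).eq t ht
    have h2 := ((coeffCLM n).restrictScalars ℝ).intervalIntegral_comp_comm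
      (hzi.mono_set (uIcc_subset_uIcc left_mem_uIcc (by rwa [uIcc_of_le hT.le])))
    simp only [ContinuousLinearMap.coe_restrictScalars', coeffCLM_apply, hzc] at h2
    rw [coeff_add, ← h2]
    exact h1
  have h3 := hprim.clm (((coeffCLM j).comp M).restrictScalars ℝ)
  refine h3.congr (fun t _ => rfl) (Filter.Eventually.of_forall fun t => ?_) hT.le
  simp only [hz, ContinuousLinearMap.coe_restrictScalars', map_add, map_sum, map_smul, smul_eq_mul]
  congr 1
  refine Finset.sum_congr rfl fun i _ => ?_
  change (v i t : ℂ) * (Complex.I * k.choose i * mulCoef M j (N (state hs a E (k - i) t))) = _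
  ring

/-- Repeated integration by parts onto the iterated primitives of `u`. These vanish at `0` by
construction, and at `T` from the second one on by hypothesis, so only the first boundary term
survives. -/
theorem integral_mul_eq_iterPrim {T : ℝ} (hT : 0 < T) {k : ℕ} {u : ℝ → ℝ}
    (hu : Integrable u (volume.restrict (Ioo 0 T))) {h : ℕ → ℝ → ℂ}
    (hh : ∀ n ≤ k, IsPrim T (h n) (h (n + 1)))
    (hz : ∀ n, 2 ≤ n → n ≤ k + 1 → iterPrim u n T = 0) {l : ℕ} (hl : l ≤ k) :
    ∫ t in Ioo 0 T, (u t : ℂ) * h 0 t = (iterPrim u 1 T : ℂ) * h 0 T +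
      (-1) ^ (l + 1) * ∫ t in Ioo 0 T, (iterPrim u (l + 1) t : ℂ) * h (l + 1) t := by
  have hstep : ∀ n ≤ k, ∫ t in Ioo 0 T, (iterPrim u n t : ℂ) * h n t =
      (iterPrim u (n + 1) T : ℂ) * h n T -
        ∫ t in Ioo 0 T, (iterPrim u (n + 1) t : ℂ) * h (n + 1) t := by
    intro n hn
    have h1 := (isPrim_iterPrim hT.le hu n).ofReal
    have h2 := (h1.mul hT.le (hh n hn)).integral_eq hT.le
    have c1 := h1.continuousOn
    have c2 := (hh n hn).continuousOn
    rw [← uIcc_of_le hT.le] at c1 c2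
    rw [intervalIntegral.integral_add (h1.integrable.mul_continuousOn c2)
      ((hh n hn).integrable.continuousOn_mul c1), iterPrim_succ u n 0,
      intervalIntegral.integral_same, Complex.ofReal_zero, zero_mul, sub_zero] at h2
    rw [integral_Ioo_eq hT.le, integral_Ioo_eq hT.le, ← h2]
    ring
  induction l with
  | zero =>
    have := hstep 0 (Nat.zero_le _)
    simp only [iterPrim] at this ⊢
    rw [this]
    ring
  | succ l ih =>
    rw [ih (by omega), hstep (l + 1) hl, hz (l + 1 + 1) (by omega) (by omega), Complex.ofReal_zero]
    ring

/-- The contribution of the time derivative of the last derivative of the evolution. -/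
theorem IsRegularMul.exists_last_estimate {s T : ℝ} {M : L2 →L[ℂ] L2} (hM : IsRegularMul s M)
    (hT : 0 < T) (k : ℕ) {A N : HZero s →L[ℂ] HZero (s - 2)} :
    ∃ K : ℝ, 0 ≤ K ∧ ∀ v : ℕ → ℝ → ℝ, (∀ i ≤ k, MemLp (v i) 2 (volume.restrict (Ioo 0 T))) →
      ∀ ξ : ℝ → HZero s, Continuous ξ → ∀ Y : ℕ → ℝ → HZero s, (∀ i ≤ k, Continuous (Y i)) →
      ∀ X Z : ℝ, 0 ≤ X → 0 ≤ Z → (∀ t ∈ Icc 0 T, ‖ξ t‖ ≤ X) →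
      (∀ i ≤ k, ∀ t ∈ Icc 0 T, ‖Y i t‖ ≤ Z) →
      (∀ i ≤ k, (∫ t in Ioo 0 T, v i t ^ 2) * Z ^ 2 ≤ X ^ 2) →
      ∀ U : ℝ → ℝ, ContinuousOn U (Icc 0 T) → ∀ F : Finset ℕ+,
        ∑ j ∈ F, ((j : ℝ) ^ (s - 2) * ‖∫ t in Ioo 0 T, Complex.exp (Complex.I * eigenvalue j * t) *
          ((U t : ℂ) * (-Complex.I * mulCoef M j (A (ξ t)) + ∑ i ∈ Finset.range (k + 1),
            Complex.I * (k.choose i * ((v i t : ℂ) * mulCoef M j (N (Y (k - i) t))))))‖) ^ 2 ≤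
          K * ((∫ t in Ioo 0 T, U t ^ 2) * X ^ 2) := by
  obtain ⟨C, hC, H⟩ := hM.exists_low_estimate
  have hs2 : 0 ≤ s - 2 := by have := hM.two_le; linarith
  refine ⟨2 * (C * ‖A‖ ^ 2 * T + (k + 1) ^ 2 * ((2 ^ k) ^ 2 * (C * ‖N‖ ^ 2))), by positivity, ?_⟩
  intro v hv ξ hξ Y hY X Z hX hZ hξX hYZ hvZ U hU F
  have hUL := ContinuousOn.memLp_two hU
  have hUi : Integrable U (volume.restrict (Ioo 0 T)) := hUL.integrable (by norm_num)
  have hUv : ∀ i ≤ k, Integrable (fun t => U t * v i t) (volume.restrict (Ioo 0 T)) := fun i hi =>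
    hUL.integrable_mul (hv i hi)
  set Q := ∫ t in Ioo 0 T, U t ^ 2 with hQ
  have hQ0 : 0 ≤ Q := integral_nonneg fun _ => sq_nonneg _
  have hint : ∀ (g : ℝ → ℝ), Integrable g (volume.restrict (Ioo 0 T)) → ∀ f : ℝ → HZero (s - 2),
      Continuous f → ∀ j : ℕ+, Integrable (fun t : ℝ => Complex.exp (Complex.I * eigenvalue j * t) *
        ((g t : ℂ) * mulCoef M j (f t))) (volume.restrict (Ioo 0 T)) := by
    intro g hg f hf j
    have hc : Continuous fun t => mulCoef M j (f t) := (mulCoefCLM M hs2 j).continuous.comp hf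
    obtain ⟨B, -, -, hB⟩ := ContinuousOn.ae_norm_le (T := T) hc.continuousOn
    refine (Integrable.mul_bdd (hg.ofReal) hc.aestronglyMeasurable hB).bdd_mul (c := 1)
      (Continuous.aestronglyMeasurable (by fun_prop)) ?_
    exact Filter.Eventually.of_forall fun t => (norm_exp_I_eigenvalue j t).le
  have hsplit : ∀ j : ℕ+, ∫ t in Ioo 0 T, Complex.exp (Complex.I * eigenvalue j * t) *
      ((U t : ℂ) * (-Complex.I * mulCoef M j (A (ξ t)) + ∑ i ∈ Finset.range (k + 1),
        Complex.I * (k.choose i * ((v i t : ℂ) * mulCoef M j (N (Y (k - i) t)))))) =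
      -Complex.I * (∫ t in Ioo 0 T, Complex.exp (Complex.I * eigenvalue j * t) *
        ((U t : ℂ) * mulCoef M j (A (ξ t)))) + ∑ i ∈ Finset.range (k + 1),
      (Complex.I * k.choose i) * ∫ t in Ioo 0 T, Complex.exp (Complex.I * eigenvalue j * t) *
        (((U t * v i t : ℝ) : ℂ) * mulCoef M j (N (Y (k - i) t))) := by
    intro j
    have i1 := (hint U hUi _ (A.continuous.comp hξ) j).const_mul (-Complex.I)
    have i2 : ∀ i ∈ Finset.range (k + 1), Integrable (fun t : ℝ => (Complex.I * k.choose i) *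
        (Complex.exp (Complex.I * eigenvalue j * t) *
        (((U t * v i t : ℝ) : ℂ) * mulCoef M j (N (Y (k - i) t))))) (volume.restrict (Ioo 0 T)) :=
      fun i hi => (hint _ (hUv i (by have := Finset.mem_range.1 hi; omega)) _
        (N.continuous.comp (hY (k - i) (Nat.sub_le _ _))) j).const_mul _
    simp only [← integral_const_mul]
    rw [← integral_finsetSum _ i2]
    refine Eq.trans ?_ (integral_add i1 (integrable_finsetSum _ i2))
    refine integral_congr_ae (Filter.Eventually.of_forall fun t => ?_)
    simp only [mul_add, Finset.mul_sum]
    congr 1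
    · ring
    · refine Finset.sum_congr rfl fun i _ => ?_
      push_cast
      ring
  simp only [hsplit]
  refine (sum_norm_add_sq_le F (fun j : ℕ+ => (j : ℝ) ^ (s - 2)) _ _
    (A := C * ‖A‖ ^ 2 * T * (Q * X ^ 2))
    (B := ((Finset.range (k + 1)).card : ℝ) ^ 2 * ((2 ^ k) ^ 2 * (C * ‖N‖ ^ 2) * (Q * X ^ 2)))
    ?_ (sum_norm_sum_sq_le F _ (fun j : ℕ+ => (j : ℝ) ^ (s - 2)) _ fun i hi => ?_)).trans_eq ?_
  · simp only [norm_mul, norm_neg, Complex.norm_I, one_mul]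
    refine (H T U hUi _ (A.continuous.comp hξ).continuousOn (‖A‖ * X) (by positivity)
      (fun t ht => (A.le_opNorm _).trans (by have := hξX t ht; gcongr)) F).trans ?_
    have h1 := sq_integral_abs_le hT.le hUL
    calc C * (‖A‖ * X * ∫ t in Ioo 0 T, |U t|) ^ 2 =
        C * ‖A‖ ^ 2 * X ^ 2 * (∫ t in Ioo 0 T, |U t|) ^ 2 := by ring
      _ ≤ C * ‖A‖ ^ 2 * X ^ 2 * (T * Q) := by gcongr
      _ = _ := by ring
  · have hi' : i ≤ k := by have := Finset.mem_range.1 hi; omega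
    have hch : ((k.choose i : ℕ) : ℝ) ≤ 2 ^ k := by exact_mod_cast Nat.choose_le_two_pow k i
    simp only [norm_mul, Complex.norm_I, one_mul, Complex.norm_natCast,
      mul_left_comm _ ((k.choose i : ℕ) : ℝ)]
    simp only [mul_pow ((k.choose i : ℕ) : ℝ)]
    rw [← Finset.mul_sum, mul_assoc ((2 ^ k : ℝ) ^ 2)]
    refine mul_le_mul (by gcongr) ?_ (Finset.sum_nonneg fun _ _ => sq_nonneg _) (by positivity)
    refine (H T _ (hUv i hi') _ (N.continuous.comp (hY (k - i) (Nat.sub_le _ _))).continuousOn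
      (‖N‖ * Z) (by positivity)
      (fun t ht => (N.le_opNorm _).trans (by have := hYZ (k - i) (Nat.sub_le _ _) t ht; gcongr))
      F).trans ?_
    have h1 := sq_integral_abs_mul_le hUL (hv i hi')
    -- The bound `Z` on the full state need not be small; multiplied by the norm of the control it
    -- is at most `X`, which supplies the missing smallness.
    have h2 := hvZ i hi'
    calc C * (‖N‖ * Z * ∫ t in Ioo 0 T, |U t * v i t|) ^ 2 =
        C * ‖N‖ ^ 2 * Z ^ 2 * (∫ t in Ioo 0 T, |U t * v i t|) ^ 2 := by ring
      _ ≤ C * ‖N‖ ^ 2 * Z ^ 2 * (Q * ∫ t in Ioo 0 T, v i t ^ 2) := by gcongr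
      _ = C * ‖N‖ ^ 2 * (Q * ((∫ t in Ioo 0 T, v i t ^ 2) * Z ^ 2)) := by ring
      _ ≤ _ := by gcongr
  · rw [Finset.card_range]
    push_cast
    ring

theorem rpow_mul_eigenvalue_pow_le (s : ℝ) (j : ℕ+) {i l : ℕ} (h : i ≤ l) :
    (j : ℝ) ^ (s - 2 * l) * eigenvalue j ^ i ≤ (Real.pi ^ 2) ^ l * (j : ℝ) ^ s := by
  have hj : (0 : ℝ) < j := by exact_mod_cast j.pos
  have hj1 : (1 : ℝ) ≤ j := by exact_mod_cast one_le (a := j)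
  have hpi : 1 ≤ Real.pi ^ 2 := one_le_pow₀ (by linarith [Real.pi_gt_three])
  have h1 : 1 ≤ eigenvalue j :=
    (one_le_pow₀ hj1).trans (natCast_sq_le_eigenvalue j)
  calc (j : ℝ) ^ (s - 2 * l) * eigenvalue j ^ i ≤ (j : ℝ) ^ (s - 2 * l) * eigenvalue j ^ l := by
        gcongr
    _ = _ := by
        rw [Real.rpow_sub hj, show (2 * l : ℝ) = ((2 * l : ℕ) : ℝ) by push_cast; ring,
          Real.rpow_natCast, eigenvalue, pow_mul, mul_pow (j : ℝ) Real.pi 2, mul_pow]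
        field_simp

/-- The control is integrated `l + 1` times and the derivatives are distributed over `e^{iλ_j t}`
and the state. A factor `λ_j^i`, `i ≤ l+1`, is absorbed by the weight `j^{-2(l+1)}`, after which
`exists_hidden_regularity` applies. The data `a` drive the evolution, whereas `b` gives the state
being estimated; in the application `b` is the difference with the reference datum, so `X` is small
and `Z` is not. -/
theorem exists_negative_estimate {s T : ℝ} {M : L2 →L[ℂ] L2} (hM : IsRegularMul s M) (hT : 0 < T)
    (k : ℕ) : ∃ C : ℝ, 0 ≤ C ∧ ∀ v : ℕ → ℝ → ℝ, IsControl T k v → ∀ (a b : ℕ → HZero s)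
      (E : ℕ → ℝ → HZero s), IsEvolution hM.nonneg T k M v a E →
      (∀ n < k, ∀ j, HZero.coef j (b (n + 1)) = -Complex.I * eigenvalue j * HZero.coef j (b n)) →
      ∀ X Z : ℝ, 0 ≤ X → 0 ≤ Z → (∀ n ≤ k, ∀ t ∈ Icc 0 T, ‖state hM.nonneg b E n t‖ ≤ X) →
      (∀ n ≤ k, ∀ t ∈ Icc 0 T, ‖state hM.nonneg a E n t‖ ≤ Z) →
      (∀ i ≤ k, (∫ t in Ioo 0 T, v i t ^ 2) * Z ^ 2 ≤ X ^ 2) →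
      (∀ n, 2 ≤ n → n ≤ k + 1 → iterPrim (v 0) n T = 0) → ∀ l ≤ k, ∀ F : Finset ℕ+,
        ∑ j ∈ F, ((j : ℝ) ^ (s - 2 * (l + 1 : ℕ)) * ‖∫ t in Ioo 0 T,
          Complex.exp (Complex.I * eigenvalue j * t) *
            ((v 0 t : ℂ) * mulCoef M j (state hM.nonneg b E 0 t))‖) ^ 2 ≤
          C * ((|iterPrim (v 0) 1 T| +
            Real.sqrt (∫ t in Ioo 0 T, iterPrim (v 0) (l + 1) t ^ 2)) ^ 2 * X ^ 2) := by
  have hs := hM.nonneg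
  have hs2 : 0 ≤ s - 2 := by have := hM.two_le; linarith
  obtain ⟨C₁, hC₁, H₁⟩ := exists_hidden_regularity hM hT
  obtain ⟨A, hA, -⟩ := HZero.exists_laplacian hM.two_le
  obtain ⟨N, -, -, hN, -⟩ := hM.exists_lowOp
  obtain ⟨K, hK, H₂⟩ := hM.exists_last_estimate hT k (A := A) (N := N)
  obtain ⟨C₃, hC₃, H₃⟩ := hM.low
  obtain ⟨D, hD, hDn⟩ := HZero.exists_incl hM.two_le
  set P : ℝ := 2 ^ (k + 1) * (Real.pi ^ 2) ^ (k + 1) with hP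
  refine ⟨2 * (C₃ + (k + 2) ^ 2 * (P ^ 2 * C₁ + K)), by positivity, ?_⟩
  intro v hv a b E hE hb X Z hX hZ hbX haZ hvZ hz l hl F
  have hu : Integrable (v 0) (volume.restrict (Ioo 0 T)) :=
    (hv.memLp 0 (Nat.zero_le _)).integrable (by norm_num)
  set U := iterPrim (v 0) (l + 1) with hU
  have hUc : ContinuousOn U (Icc 0 T) := (isPrim_iterPrim hT.le hu l).continuousOn
  have hUL := ContinuousOn.memLp_two hUc
  set Q := ∫ t in Ioo 0 T, U t ^ 2 with hQ
  have hQ0 : 0 ≤ Q := integral_nonneg fun _ => sq_nonneg _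
  have hcb : ∀ n ≤ k, Continuous (state hs b E n) := fun n hn => continuous_state hs (hE.cont n hn)
  set γ : ℕ+ → ℝ → ℂ := fun j t => -Complex.I * mulCoef M j (A (state hs b E k t)) +
    ∑ i ∈ Finset.range (k + 1), Complex.I * (k.choose i * ((v i t : ℂ) *
      mulCoef M j (N (state hs a E (k - i) t)))) with hγ
  -- Successive time derivatives of the coefficient of `M` applied to the state. Up to order `k`
  -- they come from derivatives in `H^s_{(0)}`; the one of order `k + 1` is the expression `γ` given
  -- by the equation.
  set β : ℕ+ → ℕ → ℝ → ℂ := fun j i => if i ≤ k then fun t => mulCoef M j (state hs b E i t) else γ j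
    with hβ
  have hβ1 : ∀ j, ∀ i ≤ k, β j i = fun t => mulCoef M j (state hs b E i t) := fun j i hi => by
    simp only [hβ, if_pos hi]
  have hβ2 : ∀ j, β j (k + 1) = γ j := fun j => by
    simp only [hβ, if_neg (Nat.not_succ_le_self k)]
  have hβp : ∀ j, ∀ i ≤ k, IsPrim T (β j i) (β j (i + 1)) := by
    intro j i hi
    rcases hi.lt_or_eq with hi' | rfl
    · rw [hβ1 j i hi, hβ1 j (i + 1) hi']
      exact isPrim_mulCoef hs M j (fun t => hasDerivAt_state hs (hb i hi') (hE.deriv i hi' t))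
        (hcb _ hi')
    · rw [hβ1 j i hi, hβ2]
      exact hE.isPrim_mulCoef_last hT hv b hs2 hA hN j
  set e : ℕ+ → ℕ → ℝ → ℂ := fun j i t =>
    (Complex.I * eigenvalue j) ^ i * Complex.exp (Complex.I * eigenvalue j * t) with he
  have hep : ∀ j i, IsPrim T (e j i) (e j (i + 1)) := by
    intro j i
    have := (isPrim_exp (T := T) (Complex.I * eigenvalue j)).const_mul ((Complex.I * eigenvalue j) ^ i)
    simpa only [he, pow_succ, mul_assoc] using this
  have hint : ∀ j : ℕ+, ∀ i ∈ Finset.range (l + 1 + 1), Integrable (fun t : ℝ =>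
      ((l + 1).choose i * (Complex.I * eigenvalue j) ^ i) *
        (Complex.exp (Complex.I * eigenvalue j * t) * ((U t : ℂ) * β j (l + 1 - i) t)))
      (volume.restrict (Ioo 0 T)) := by
    intro j i hi
    have h1 : IntervalIntegrable (β j (l + 1 - i)) volume 0 T := by
      rcases Nat.eq_zero_or_pos (l + 1 - i) with h0 | h0
      · have h2 := (hβp j 0 (Nat.zero_le _)).continuousOn
        rw [h0]
        rw [← uIcc_of_le hT.le] at h2
        exact h2.intervalIntegrable
      · have h2 := (hβp j (l + 1 - i - 1) (by omega)).integrable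
        rwa [Nat.sub_add_cancel h0] at h2
    have h2 : ContinuousOn (fun t => (U t : ℂ)) (uIcc 0 T) := by
      rw [uIcc_of_le hT.le]
      exact Complex.continuous_ofReal.comp_continuousOn hUc
    have h3 := (((h1.continuousOn_mul h2).continuousOn_mul (g := fun t : ℝ =>
      Complex.exp (Complex.I * eigenvalue j * t)) (Continuous.continuousOn (by fun_prop))).const_mul
        ((l + 1).choose i * (Complex.I * eigenvalue j) ^ i : ℂ))
    exact (intervalIntegrable_iff_integrableOn_Ioo_of_le hT.le).1 h3
  have hmain : ∀ j : ℕ+, ∫ t in Ioo 0 T, Complex.exp (Complex.I * eigenvalue j * t) *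
      ((v 0 t : ℂ) * mulCoef M j (state hs b E 0 t)) =
      (iterPrim (v 0) 1 T : ℂ) * (Complex.exp (Complex.I * eigenvalue j * T) *
        mulCoef M j (state hs b E 0 T)) + ∑ i ∈ Finset.range (l + 1 + 1), (-1) ^ (l + 1) *
      (((l + 1).choose i * (Complex.I * eigenvalue j) ^ i) * ∫ t in Ioo 0 T,
        Complex.exp (Complex.I * eigenvalue j * t) * ((U t : ℂ) * β j (l + 1 - i) t)) := by
    intro j
    have h1 := integral_mul_eq_iterPrim hT hu (h := leibniz (e j) (β j)) (fun n hn =>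
      IsPrim.leibniz hT.le (fun i _ => hep j i) fun i hi => hβp j i (by omega)) hz hl
    have h2 : ∀ t, leibniz (e j) (β j) 0 t = Complex.exp (Complex.I * eigenvalue j * t) *
        mulCoef M j (state hs b E 0 t) := by
      intro t
      rw [leibniz_eq_sum_range]
      simp [he, hβ1]
    have h3 : (fun t : ℝ => (iterPrim (v 0) (l + 1) t : ℂ) * leibniz (e j) (β j) (l + 1) t) = fun t : ℝ =>
        ∑ i ∈ Finset.range (l + 1 + 1), ((l + 1).choose i * (Complex.I * eigenvalue j) ^ i) *
          (Complex.exp (Complex.I * eigenvalue j * t) * ((U t : ℂ) * β j (l + 1 - i) t)) := by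
      funext t
      rw [leibniz_eq_sum_range, Finset.mul_sum]
      exact Finset.sum_congr rfl fun i _ => by simp only [he]; ring
    rw [h3, integral_finsetSum _ (hint j), Finset.mul_sum] at h1
    simp only [integral_const_mul, h2, mul_left_comm (v 0 _ : ℂ)] at h1
    exact h1
  have hj1 : ∀ j : ℕ+, (1 : ℝ) ≤ j := fun j => by exact_mod_cast one_le (a := j)
  have hw : ∀ j : ℕ+, (j : ℝ) ^ (s - 2 * (l + 1 : ℕ)) ≤ (j : ℝ) ^ (s - 2) := fun j =>
    Real.rpow_le_rpow_of_exponent_le (hj1 j) (by push_cast; linarith [Nat.cast_nonneg (α := ℝ) l])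
  simp only [hmain]
  refine (sum_norm_add_sq_le F (fun j : ℕ+ => (j : ℝ) ^ (s - 2 * (l + 1 : ℕ))) _ _
    (A := C₃ * ((iterPrim (v 0) 1 T) ^ 2 * X ^ 2))
    (B := ((Finset.range (l + 1 + 1)).card : ℝ) ^ 2 * ((P ^ 2 * C₁ + K) * (Q * X ^ 2)))
    ?_ (sum_norm_sum_sq_le F _ (fun j : ℕ+ => (j : ℝ) ^ (s - 2 * (l + 1 : ℕ))) _
      fun i hi => ?_)).trans ?_
  -- The boundary term at `T` is estimated in `H^{s-2}_{(0)}`, where `M` is bounded; the weight is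
  -- at most `j^{s-2}` because `l + 1 ≥ 1`.
  · have h1 : ∀ j ∈ F, ((j : ℝ) ^ (s - 2 * (l + 1 : ℕ)) * ‖(iterPrim (v 0) 1 T : ℂ) *
        (Complex.exp (Complex.I * eigenvalue j * T) * mulCoef M j (state hs b E 0 T))‖) ^ 2 ≤
        (iterPrim (v 0) 1 T) ^ 2 *
          ((j : ℝ) ^ (s - 2) * ‖mulCoef M j (D (state hs b E 0 T))‖) ^ 2 := by
      intro j _
      rw [norm_mul, norm_mul, norm_exp_I_eigenvalue, one_mul, Complex.norm_real, Real.norm_eq_abs,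
        ← sq_abs (iterPrim (v 0) 1 T), ← mul_pow, mul_left_comm, mulCoef, mulCoef, hD]
      have := hw j
      gcongr
    refine (Finset.sum_le_sum h1).trans ?_
    rw [← Finset.mul_sum]
    have h2 := H₃ (D (state hs b E 0 T)) F
    have h3 := (hDn (state hs b E 0 T)).trans (hbX 0 (Nat.zero_le _) T (right_mem_Icc.2 hT.le))
    calc _ ≤ (iterPrim (v 0) 1 T) ^ 2 * (C₃ * X ^ 2) := by
          refine mul_le_mul_of_nonneg_left (h2.trans ?_) (sq_nonneg _)
          gcongr
      _ = _ := by ring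
  · have hi' : i ≤ l + 1 := by have := Finset.mem_range.1 hi; omega
    simp only [norm_mul, norm_pow, norm_neg, norm_one, one_pow, one_mul, Complex.norm_natCast,
      Complex.norm_I, Complex.norm_real, Real.norm_of_nonneg (eigenvalue_nonneg _)]
    rcases Nat.lt_or_ge k (l + 1 - i) with hki | hki
    -- Order `k + 1` is reached only when `l = k` and no derivative falls on the exponential. The
    -- weight is then at most `j^{s-2}`, which suffices for the estimate in the lower space.
    · obtain ⟨rfl, rfl⟩ : i = 0 ∧ l = k := by omega
      simp only [Nat.choose_zero_right, Nat.cast_one, pow_zero, one_mul, Nat.sub_zero, hβ2]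
      calc _ ≤ ∑ j ∈ F, ((j : ℝ) ^ (s - 2) * ‖∫ t in Ioo 0 T,
            Complex.exp (Complex.I * eigenvalue j * t) * ((U t : ℂ) * γ j t)‖) ^ 2 := by
            refine Finset.sum_le_sum fun j _ => ?_
            have := hw j
            gcongr
        _ ≤ K * (Q * X ^ 2) := H₂ v hv.memLp _ (hcb _ le_rfl) (state hs a E)
            (fun i hi => continuous_state hs (hE.cont i hi)) X Z hX hZ (hbX _ le_rfl) haZ hvZ U hUc F
        _ ≤ _ := by
            refine mul_le_mul_of_nonneg_right ?_ (by positivity)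
            have : 0 ≤ P ^ 2 * C₁ := by positivity
            linarith
    · simp only [hβ1 _ _ hki]
      have h1 : ∀ j ∈ F, ((j : ℝ) ^ (s - 2 * (l + 1 : ℕ)) * (((l + 1).choose i : ℝ) *
          eigenvalue j ^ i * ‖∫ t in Ioo 0 T, Complex.exp (Complex.I * eigenvalue j * t) *
            ((U t : ℂ) * mulCoef M j (state hs b E (l + 1 - i) t))‖)) ^ 2 ≤
          P ^ 2 * ((j : ℝ) ^ s * ‖∫ t in Ioo 0 T, Complex.exp (Complex.I * eigenvalue j * t) *
            ((U t : ℂ) * mulCoef M j (state hs b E (l + 1 - i) t))‖) ^ 2 := by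
        intro j _
        rw [← mul_pow]
        have hch : (((l + 1).choose i : ℕ) : ℝ) ≤ 2 ^ (k + 1) := by
          calc (((l + 1).choose i : ℕ) : ℝ) ≤ 2 ^ (l + 1) := by
                exact_mod_cast Nat.choose_le_two_pow (l + 1) i
            _ ≤ 2 ^ (k + 1) := pow_le_pow_right₀ (by norm_num) (by omega)
        have hpi : 1 ≤ Real.pi ^ 2 := one_le_pow₀ (by linarith [Real.pi_gt_three])
        have h2 := rpow_mul_eigenvalue_pow_le s j hi'
        have h3 : (Real.pi ^ 2) ^ (l + 1) ≤ (Real.pi ^ 2) ^ (k + 1) :=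
          pow_le_pow_right₀ hpi (by omega)
        have hev := eigenvalue_nonneg j
        refine pow_le_pow_left₀ (by positivity) ?_ 2
        set I := ‖∫ t in Ioo 0 T, Complex.exp (Complex.I * eigenvalue j * t) *
          ((U t : ℂ) * mulCoef M j (state hs b E (l + 1 - i) t))‖
        calc _ = (((l + 1).choose i : ℕ) : ℝ) *
              ((j : ℝ) ^ (s - 2 * (l + 1 : ℕ)) * eigenvalue j ^ i) * I := by ring
          _ ≤ 2 ^ (k + 1) * ((Real.pi ^ 2) ^ (k + 1) * (j : ℝ) ^ s) * I := by
              refine mul_le_mul_of_nonneg_right (mul_le_mul hch (h2.trans ?_) (by positivity)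
                (by positivity)) (norm_nonneg _)
              gcongr
          _ = _ := by rw [hP]; ring
      refine (Finset.sum_le_sum h1).trans ?_
      rw [← Finset.mul_sum, add_mul, mul_assoc]
      refine le_add_of_le_of_nonneg (mul_le_mul_of_nonneg_left ((H₁ U hUL _
        (hcb _ hki).continuousOn F).trans ?_) (sq_nonneg _)) (by positivity)
      exact mul_le_mul_of_nonneg_left
        (integral_sq_mul_norm_sq_le hUL (hcb _ hki).continuousOn (hbX _ hki)) hC₁
  · rw [Finset.card_range]
    have h1 : ((l + 1 + 1 : ℕ) : ℝ) ≤ k + 2 := by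
      have : (l : ℝ) ≤ k := by exact_mod_cast hl
      push_cast
      linarith
    set V := |iterPrim (v 0) 1 T| with hV
    have hV0 : 0 ≤ V := abs_nonneg _
    have h2 : iterPrim (v 0) 1 T ^ 2 ≤ (V + Real.sqrt Q) ^ 2 := by
      rw [← sq_abs]
      have := Real.sqrt_nonneg Q
      gcongr
      linarith
    have h3 : Q ≤ (V + Real.sqrt Q) ^ 2 := by
      nth_rewrite 1 [← Real.sq_sqrt hQ0]
      gcongr
      linarith
    calc _ ≤ 2 * (C₃ * ((V + Real.sqrt Q) ^ 2 * X ^ 2) +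
          (k + 2) ^ 2 * ((P ^ 2 * C₁ + K) * ((V + Real.sqrt Q) ^ 2 * X ^ 2))) := by gcongr
      _ = _ := by ring

/-! ### The multiplication operator -/

theorem MemSobolev.mono {a b : ℝ} {N N' : ℕ} {f : ℝ → ℝ} (h : MemSobolev a b N f) (hN : N' ≤ N) :
    MemSobolev a b N' f := ⟨h.1, fun n hn => h.2 n (hn.trans hN)⟩

theorem exists_isRegularMul {p : ℕ} {μ : ℝ → ℝ} (hμ : MemSobolev 0 1 (2 * p + 3) μ)
    (hμ0 : ∀ n < p, DerivVanishesAtEnds 0 1 (2 * n + 1) μ) :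
    ∃ M : L2 →L[ℂ] L2, (∀ φ, M φ = mulL2 μ φ) ∧ IsRegularMul (2 * p + 3) M := by
  obtain ⟨m, hm, hμm, hmL, hw⟩ := hμ.exists_chain
  obtain ⟨B, -, -, hB⟩ := ContinuousOn.ae_norm_le (hm 0 (by omega)).continuousOn
  obtain ⟨M, hM⟩ := exists_mulCLM (μ := μ) (B := B) hμ.1.1 (by
    filter_upwards [hB, hμm] with x h1 h2
    rwa [h2])
  have hM2 : ∀ φ, ∀ᵐ x ∂volume.restrict (Ioo (0 : ℝ) 1), M φ x = μ x * φ x := fun φ => (hM φ).2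
  have hends : ∀ n < p, m (2 * n + 1) 0 = 0 ∧ m (2 * n + 1) 1 = 0 := fun n hn =>
    (hμ0 n hn).eq_zero (hm (2 * n + 1) (by omega)).continuousOn (hw _ (by omega))
  refine ⟨M, fun φ => (hM φ).1, by linarith [Nat.cast_nonneg (α := ℝ) p], ?_, ?_⟩
  -- With `q = p + 1`, the traces of order `2p+2` contain `μ^{(2p+1)}`, about whose end values
  -- nothing is assumed.
  · obtain ⟨b₀, b₁, d, C, hC, hd, hdec, -⟩ := exists_mul_decomposition (q := p + 1)
      (s := 2 * p + 3) (by push_cast; ring) hM2 hμm (fun i hi => hm i (by omega)) hmL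
      fun n hn => hends n (by omega)
    exact ⟨b₀, b₁, d, C, hC, hd, hdec⟩
  -- With `q = p`, the traces of order `2p` only involve odd derivatives of `μ` up to order `2p-1`,
  -- so they all vanish.
  · obtain ⟨b₀, b₁, d, C, hC, hd, hdec, hb⟩ := exists_mul_decomposition (q := p)
      (s := 2 * p + 3 - 2) (by push_cast; ring) hM2 hμm (fun i hi => hm i (by omega))
      (ContinuousOn.memLp_two (hm (2 * p + 1) (by omega)).continuousOn)
      fun n hn => hends n (by omega)
    obtain ⟨rfl, rfl⟩ := hb hends
    refine ⟨C, hC, fun φ F => (le_of_eq ?_).trans (hd φ F)⟩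
    refine Finset.sum_congr rfl fun j _ => ?_
    have h1 := congrArg norm (hdec φ j)
    rw [norm_mul, Complex.norm_real, Real.norm_of_nonneg (Real.rpow_nonneg (Nat.cast_nonneg _) _)] at h1
    simp only [zero_apply, mul_zero, zero_add] at h1
    rw [mulCoef, h1]

/-! ### The projection `Π_{ψ_1(T)} P_J` -/

open Classical in
theorem HZero.coef_projJ {s : ℝ} (J : Set ℕ+) (j : ℕ+) (φ : HZero s) :
    coef j (projJ J φ) = if j ∈ J then coef j φ else 0 := coeff_starProjection J j (toL2 φ)

theorem HZero.coef_groundState (s t : ℝ) (j : ℕ+) : coef j (groundState s t) =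
    Complex.exp (-Complex.I * eigenvalue 1 * t) * if j = 1 then 1 else 0 := by
  rw [groundState, coef_smul, coef_mode]

theorem HZero.inner_groundState {s : ℝ} (T : ℝ) (φ : HZero s) :
    inner ℂ (toL2 (groundState s T)) (toL2 φ) =
      (starRingEnd ℂ) (Complex.exp (-Complex.I * eigenvalue 1 * T)) * coef 1 φ := by
  rw [groundState, map_smul, inner_smul_left]
  rfl

/-- Only the first coefficient changes. In the direction of `ψ_1(T)`, a vector of modulus one, the
projection removes the real part and keeps the imaginary part. -/
theorem HZero.norm_coef_projTangent_le {s : ℝ} (T : ℝ) (φ : HZero s) (j : ℕ+) :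
    ‖coef j (projTangent T φ)‖ ≤ ‖coef j φ‖ := by
  rw [projTangent, coef_sub, coef_smul, coef_groundState, inner_groundState]
  split_ifs with hj
  · subst hj
    set e := Complex.exp (-Complex.I * eigenvalue 1 * T) with he
    have hn : ‖e‖ = 1 := norm_exp_eigenvalue 1 T
    have h1 : e * (starRingEnd ℂ) e = 1 := by
      rw [Complex.mul_conj, Complex.normSq_eq_norm_sq, hn]; norm_num
    set w := (starRingEnd ℂ) e * coef 1 φ with hw
    have h2 : coef 1 φ = e * w := by rw [hw, ← mul_assoc, h1, one_mul]
    have h3 : coef 1 φ - (w.re : ℂ) * (e * 1) = e * (w.im * Complex.I) := by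
      rw [h2]
      linear_combination e * (Complex.re_add_im w).symm
    rw [h3, h2, norm_mul, norm_mul, norm_mul, Complex.norm_I, mul_one, Complex.norm_real, hn,
      one_mul, one_mul]
    exact Complex.abs_im_le_norm w
  · simp

theorem HZero.norm_coef_proj_le {s : ℝ} (T : ℝ) (J : Set ℕ+) (φ : HZero s) (j : ℕ+) :
    ‖coef j (projTangent T (projJ J φ))‖ ≤ ‖coef j φ‖ := by
  refine (norm_coef_projTangent_le T _ j).trans ?_
  rw [coef_projJ]
  split_ifs <;> simp

/-- Linear over `ℝ` only, because of the real part in the projection onto the tangent space. -/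
theorem HZero.exists_proj (s T : ℝ) (J : Set ℕ+) : ∃ P : HZero s →L[ℝ] HZero s,
    ∀ φ, P φ = projTangent T (projJ J φ) := by
  have hadd : ∀ φ χ : HZero s, projTangent T (projJ J (φ + χ)) =
      projTangent T (projJ J φ) + projTangent T (projJ J χ) := by
    intro φ χ
    have h1 : projJ J (φ + χ) = projJ J φ + projJ J χ := coef_ext fun j => by
      rw [coef_add, coef_projJ, coef_projJ, coef_projJ, coef_add]; split_ifs <;> simp
    rw [h1, projTangent, projTangent, projTangent, map_add, inner_add_right, Complex.add_re,
      Complex.ofReal_add, add_smul]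
    abel
  have hsmul : ∀ (c : ℝ) (φ : HZero s), projTangent T (projJ J (c • φ)) =
      c • projTangent T (projJ J φ) := by
    intro c φ
    have hc : ∀ χ : HZero s, c • χ = (c : ℂ) • χ := fun χ => (Complex.coe_smul c χ).symm
    have h1 : projJ J (c • φ) = c • projJ J φ := coef_ext fun j => by
      rw [hc, hc, coef_smul, coef_projJ, coef_projJ, coef_smul]; split_ifs <;> simp
    rw [h1, projTangent, projTangent, smul_sub, hc (projJ J φ), map_smul, inner_smul_right,
      Complex.re_ofReal_mul, Complex.ofReal_mul, mul_smul, hc]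
  refine ⟨LinearMap.mkContinuous ⟨⟨fun φ => projTangent T (projJ J φ), hadd⟩, hsmul⟩ 1 fun φ => ?_,
    fun φ => rfl⟩
  rw [one_mul]
  refine norm_le_of_sum_le (norm_nonneg _) fun F => ?_
  refine le_trans (Finset.sum_le_sum fun j _ => ?_) (sum_le_norm_sq φ F)
  have := norm_coef_proj_le T J φ j
  simp only [LinearMap.coe_mk, AddHom.coe_mk]
  gcongr

theorem hNorm_le_of_sum_le {s : ℝ} {φ : L2} {B : ℝ} (hB : 0 ≤ B)
    (h : ∀ F : Finset ℕ+, ∑ j ∈ F, ((j : ℝ) ^ s * ‖coeff j φ‖) ^ 2 ≤ B ^ 2) : hNorm s φ ≤ B := by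
  rw [hNorm]
  refine Real.sqrt_le_iff.2 ⟨hB, ?_⟩
  exact Real.tsum_le_of_sum_le (fun j => by positivity) h

/-! ### The final state -/

/-- The operators `(-iA)^n`, which give the initial values of the time derivatives of the free
evolution. Each of them uses at most the `2k` orders of regularity separating `H^r_{(0)}` from
`H^s_{(0)}`. -/
theorem HZero.exists_derivOp {r s : ℝ} {k : ℕ} (hs : 0 ≤ s) (hr : r = s + 2 * k) :
    ∃ (D : ℕ → HZero r →L[ℂ] HZero s) (C : ℝ), 0 ≤ C ∧
      (∀ n ≤ k, ∀ j φ, coef j (D n φ) = (-Complex.I * eigenvalue j) ^ n * coef j φ) ∧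
      ∀ n ≤ k, ∀ φ, ‖D n φ‖ ≤ C * ‖φ‖ := by
  have h1 : ∀ n, ∃ D : HZero r →L[ℂ] HZero s, n ≤ k →
      (∀ j φ, coef j (D φ) = (-Complex.I * eigenvalue j) ^ n * coef j φ) ∧
      ∀ φ, ‖D φ‖ ≤ (Real.pi ^ 2) ^ k * ‖φ‖ := by
    intro n
    by_cases hn : n ≤ k
    · obtain ⟨D, hD⟩ := exists_diag (r := s) (s := r) hs
        (fun j => (-Complex.I * (eigenvalue j : ℂ)) ^ n) (C := (Real.pi ^ 2) ^ k) (by positivity)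
        (fun j => by
          rw [norm_pow, neg_mul, norm_neg, norm_I_mul_eigenvalue]
          have := rpow_mul_eigenvalue_pow_le r j hn
          rwa [show r - 2 * k = s by rw [hr]; ring] at this)
      exact ⟨D, fun _ => hD⟩
    -- Orders above `k` do not matter.
    · exact ⟨0, fun h => absurd h hn⟩
  choose D hD using h1
  exact ⟨D, (Real.pi ^ 2) ^ k, by positivity, fun n hn => (hD n hn).1, fun n hn => (hD n hn).2⟩

theorem coef_succ_of_pow {s : ℝ} {k : ℕ} {a : ℕ → HZero s} {c : ℕ+ → ℂ}
    (h : ∀ n ≤ k, ∀ j, HZero.coef j (a n) = (-Complex.I * eigenvalue j) ^ n * c j) :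
    ∀ n < k, ∀ j, HZero.coef j (a (n + 1)) = -Complex.I * eigenvalue j * HZero.coef j (a n) := by
  intro n hn j
  rw [h n hn.le, h (n + 1) hn]
  ring

theorem H0.sum_jet_eq_norm_sq {T : ℝ} (hT : 0 < T) {k : ℕ} (u : H0 T k) :
    ∑ i ∈ Finset.range (k + 1), ∫ t in Ioo 0 T, u.jet i t ^ 2 = ‖u‖ ^ 2 := by
  rw [Submodule.coe_norm, PiLp.norm_sq_eq_of_L2, Finset.sum_range]
  exact Finset.sum_congr rfl fun i _ => (H0.norm_sq_eq hT u (by omega)).symm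

theorem H0.norm_le_norm0 {T : ℝ} (hT : 0 < T) {k : ℕ} (u : H0 T k) :
    ‖u‖ ≤ (k + 1) * max T 1 ^ k * u.norm0 := by
  have h0 : 0 ≤ u.norm0 := norm_nonneg _
  refine le_of_sq_le_sq ?_ (by positivity)
  rw [← H0.sum_jet_eq_norm_sq hT u]
  have h1 : ∀ i ∈ Finset.range (k + 1), ∫ t in Ioo 0 T, u.jet i t ^ 2 ≤
      (max T 1 ^ k) ^ 2 * u.norm0 ^ 2 := by
    intro i hi
    have h2 := (H0.isControl_jet hT u).integral_sq_le hT (i := i)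
      (by have := Finset.mem_range.1 hi; omega)
    rwa [← H0.norm_sq_eq hT u le_rfl] at h2
  refine (Finset.sum_le_sum h1).trans ?_
  rw [Finset.sum_const, Finset.card_range, nsmul_eq_mul]
  push_cast
  have hk : (0 : ℝ) ≤ k := Nat.cast_nonneg _
  calc ((k : ℝ) + 1) * ((max T 1 ^ k) ^ 2 * u.norm0 ^ 2) ≤
      ((k : ℝ) + 1) ^ 2 * ((max T 1 ^ k) ^ 2 * u.norm0 ^ 2) := by
        gcongr
        nlinarith
    _ = _ := by ring

/-- The evolution in `H^s_{(0)}` from an initial state in `H^{s+2k}_{(0)}`. -/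
theorem exists_evolution_of_initial {r s T : ℝ} {M : L2 →L[ℂ] L2} (hM : IsRegularMul s M)
    (hT : 0 < T) {k : ℕ} {D : ℕ → HZero r →L[ℂ] HZero s} {C : ℝ} (hC : 0 ≤ C)
    (hD : ∀ n ≤ k, ∀ j φ, HZero.coef j (D n φ) =
      (-Complex.I * eigenvalue j) ^ n * HZero.coef j φ)
    (hDn : ∀ n ≤ k, ∀ φ, ‖D n φ‖ ≤ C * ‖φ‖) :
    ∃ K : ℝ, 0 ≤ K ∧ ∀ (ψ₀ : HZero r) (u : H0 T k), ∃ E : ℕ → ℝ → HZero s,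
      IsEvolution hM.nonneg T k M u.jet (fun n => D n ψ₀) E ∧ ∀ n ≤ k, ∀ t ∈ Icc 0 T,
        ‖E n t‖ ≤ K * Real.exp (K * ‖u‖ ^ 2) * (‖u‖ * ‖ψ₀‖) := by
  obtain ⟨K, hK, H⟩ := exists_evolution hM hT k
  refine ⟨K * (1 + C), by positivity, fun ψ₀ u => ?_⟩
  obtain ⟨E, hE, hn⟩ := H u.jet (H0.isControl_jet hT u) (fun n => D n ψ₀)
    (coef_succ_of_pow fun n hn j => hD n hn j ψ₀)
  refine ⟨E, hE, fun n hnk t ht => (hn (C * ‖ψ₀‖) (fun i hi => hDn i hi ψ₀) n hnk t ht).trans ?_⟩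
  rw [H0.sum_jet_eq_norm_sq hT u, Real.sqrt_sq (norm_nonneg _)]
  have h1 : Real.exp (K * ‖u‖ ^ 2) ≤ Real.exp (K * (1 + C) * ‖u‖ ^ 2) := by
    refine Real.exp_le_exp.2 ?_
    have : K ≤ K * (1 + C) := le_mul_of_one_le_right hK (by linarith)
    gcongr
  calc _ = K * C * Real.exp (K * ‖u‖ ^ 2) * (‖u‖ * ‖ψ₀‖) := by ring
    _ ≤ K * (1 + C) * Real.exp (K * (1 + C) * ‖u‖ ^ 2) * (‖u‖ * ‖ψ₀‖) := by
      have : C ≤ 1 + C := by linarith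
      gcongr

/-- At time `T` the source terms of order below `k` vanish, so `E k T = (-iA)^k (E 0 T)`. As the
left side is in `H^s_{(0)}`, the deviation gains `2k` orders; the free part is in `H^r_{(0)}` since
the initial datum is. -/
theorem IsEvolution.exists_final {r s T : ℝ} {hs : 0 ≤ s} (hT : 0 ≤ T) {k : ℕ}
    (hr : r = s + 2 * k) {M : L2 →L[ℂ] L2} {v : ℕ → ℝ → ℝ} (hv : IsControl T k v)
    {a : ℕ → HZero s} {E : ℕ → ℝ → HZero s} (h : IsEvolution hs T k M v a E) {ψ₀ : HZero r}
    (ha : ∀ j, HZero.coef j (a 0) = HZero.coef j ψ₀) :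
    ∃ χ : HZero r, HZero.toL2 χ = HZero.toL2 (state hs a E 0 T) := by
  have hr0 : 0 ≤ r := by rw [hr]; positivity
  obtain ⟨w, hw, -⟩ := HZero.exists_of_sum_le hr0 (fun j => HZero.coef j (E 0 T))
    (norm_nonneg (E k T)) (fun F => by
      refine le_trans (Finset.sum_le_sum fun j _ => ?_) (HZero.sum_le_norm_sq (E k T) F)
      have hj : (0 : ℝ) < j := by exact_mod_cast j.pos
      rw [h.coef_final hT hv j le_rfl, norm_mul, norm_pow, neg_mul, norm_neg,
        norm_I_mul_eigenvalue, hr, Real.rpow_add hj, mul_assoc]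
      have h3 : (j : ℝ) ^ (2 * k : ℝ) ≤ eigenvalue j ^ k := by
        rw [show (2 * k : ℝ) = ((2 * k : ℕ) : ℝ) by push_cast; ring, Real.rpow_natCast, pow_mul]
        exact pow_le_pow_left₀ (by positivity) (natCast_sq_le_eigenvalue j) k
      gcongr)
  refine ⟨HZero.group hr0 T ψ₀ + w, coeff_ext fun j => ?_⟩
  change HZero.coef j _ = HZero.coef j _
  rw [state, HZero.coef_add, HZero.coef_add, HZero.coef_group, HZero.coef_group, hw, ha]

theorem integral_mul_congr_ae {T t : ℝ} (ht : t ∈ Icc 0 T) {u v : ℝ → ℝ}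
    (h : ∀ᵐ τ ∂volume.restrict (Ioo 0 T), u τ = v τ) (f e : ℝ → ℂ) :
    ∫ τ in (0 : ℝ)..t, e τ * ((u τ : ℂ) * f τ) = ∫ τ in (0 : ℝ)..t, e τ * ((v τ : ℂ) * f τ) := by
  rw [← integral_Ioo_eq ht.1, ← integral_Ioo_eq ht.1]
  refine integral_congr_ae ?_
  filter_upwards [ae_mono (Measure.restrict_mono (Ioo_subset_Ioo_right ht.2) le_rfl) h] with τ hτ
  rw [hτ]

theorem isWeakSolution_iff {T : ℝ} {p k : ℕ} {μ : ℝ → ℝ} {M : L2 →L[ℂ] L2}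
    (hMμ : ∀ φ, M φ = mulL2 μ φ) {ψ₀ : HZero (2 * (p + k) + 3)} {u : H0 T k}
    {ψ : ℝ → HZero (2 * p + 3)} : IsWeakSolution T p k μ ψ₀ u ψ ↔ ContDiffOn ℝ k ψ (Icc 0 T) ∧
      ∀ t ∈ Icc 0 T, ∀ j, HZero.coef j (ψ t) = Complex.exp (-Complex.I * eigenvalue j * t) *
        (HZero.coef j ψ₀ + Complex.I * ∫ τ in (0 : ℝ)..t,
          Complex.exp (Complex.I * eigenvalue j * τ) * ((u.fn τ : ℂ) * mulCoef M j (ψ τ))) := by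
  have hs : (0 : ℝ) ≤ 2 * p + 3 := by positivity
  constructor
  · rintro ⟨h1, h2⟩
    refine ⟨h1, fun t ht => ?_⟩
    refine (duhamel_iff hs (H0.memLp_fn u) h1.continuousOn (HZero.toL2 ψ₀) ht).1 ?_
    simp only [hMμ]
    exact h2 t ht
  · rintro ⟨h1, h2⟩
    refine ⟨h1, fun t ht => ?_⟩
    have := (duhamel_iff hs (H0.memLp_fn u) h1.continuousOn (HZero.toL2 ψ₀) ht).2 (h2 t ht)
    simpa only [hMμ] using this

theorem IsEvolution.isWeakSolution {T : ℝ} (hT : 0 < T) {p k : ℕ} {μ : ℝ → ℝ} {M : L2 →L[ℂ] L2}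
    (hMμ : ∀ φ, M φ = mulL2 μ φ) {hs : (0 : ℝ) ≤ 2 * p + 3} {ψ₀ : HZero (2 * (p + k) + 3)}
    {u : H0 T k} {a : ℕ → HZero (2 * p + 3)} {E : ℕ → ℝ → HZero (2 * p + 3)}
    (h : IsEvolution hs T k M u.jet a E) (ha0 : ∀ j, HZero.coef j (a 0) = HZero.coef j ψ₀)
    (ha : ∀ n < k, ∀ j, HZero.coef j (a (n + 1)) = -Complex.I * eigenvalue j * HZero.coef j (a n)) :
    IsWeakSolution T p k μ ψ₀ u (state hs a E 0) := by
  refine (isWeakSolution_iff hMμ).2 ⟨(h.contDiff ha).contDiffOn, fun t ht j => ?_⟩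
  rw [← integral_mul_congr_ae ht (H0.jet_zero_ae_eq hT u), state, HZero.coef_add,
    HZero.coef_group, ha0, h.duhamel hT.le ht, ← mul_add]

theorem IsWeakSolution.eqOn {T : ℝ} (hT : 0 < T) {p k : ℕ} {μ : ℝ → ℝ} {M : L2 →L[ℂ] L2}
    (hMμ : ∀ φ, M φ = mulL2 μ φ) (hM : IsRegularMul (2 * p + 3) M) {ψ₀ : HZero (2 * (p + k) + 3)}
    {u : H0 T k} {ψ χ : ℝ → HZero (2 * p + 3)} (hψ : IsWeakSolution T p k μ ψ₀ u ψ)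
    (hχ : IsWeakSolution T p k μ ψ₀ u χ) : EqOn χ ψ (Icc 0 T) := by
  have h1 := (isWeakSolution_iff hMμ).1 hψ
  have h2 := (isWeakSolution_iff hMμ).1 hχ
  exact eqOn_of_duhamel hM hT (H0.memLp_fn u) h1.1.continuousOn h2.1.continuousOn h1.2 h2.2

theorem toL2_finalState {T : ℝ} (hT : 0 < T) {p k : ℕ} {μ : ℝ → ℝ} {M : L2 →L[ℂ] L2}
    (hMμ : ∀ φ, M φ = mulL2 μ φ) (hM : IsRegularMul (2 * p + 3) M) {ψ₀ : HZero (2 * (p + k) + 3)}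
    {u : H0 T k} {ψ : ℝ → HZero (2 * p + 3)} (hψ : IsWeakSolution T p k μ ψ₀ u ψ)
    {χ : HZero (2 * (p + k) + 3)} (hχ : HZero.toL2 χ = HZero.toL2 (ψ T)) :
    HZero.toL2 (finalState T p k μ ψ₀ u) = HZero.toL2 (ψ T) := by
  have h : ∃ (χ : HZero (2 * (p + k) + 3)) (ψ : ℝ → HZero (2 * p + 3)),
    IsWeakSolution T p k μ ψ₀ u ψ ∧ HZero.toL2 χ = HZero.toL2 (ψ T) := ⟨χ, ψ, hψ, hχ⟩
  rw [finalState, dif_pos h]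
  -- The solution underlying the chosen final state need not be the given `ψ`; uniqueness identifies
  -- the two at time `T`.
  obtain ⟨ψ', h1, h2⟩ := h.choose_spec
  rw [h2, hψ.eqOn hT hMμ hM h1 (right_mem_Icc.2 hT.le)]

/-! ### The linearized end-point map and the remainder -/

theorem H0.fn_add_ae {T : ℝ} {k : ℕ} (u w : H0 T k) :
    ∀ᵐ t ∂volume.restrict (Ioo 0 T), (u + w).fn t = u.fn t + w.fn t :=
  Lp.coeFn_add ((u : Jets T k) 0) ((w : Jets T k) 0)

theorem H0.fn_smul_ae {T : ℝ} {k : ℕ} (c : ℝ) (u : H0 T k) :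
    ∀ᵐ t ∂volume.restrict (Ioo 0 T), (c • u).fn t = c * u.fn t :=
  Lp.coeFn_smul c ((u : Jets T k) 0)

theorem H0.fn_zero_ae (T : ℝ) (k : ℕ) :
    ∀ᵐ t ∂volume.restrict (Ioo 0 T), (0 : H0 T k).fn t = 0 :=
  Lp.coeFn_zero ℝ 2 (volume.restrict (Ioo 0 T))

/-- Continuity into `H^r_{(0)}` is `exists_positive_estimate` with `m = k`, applied to the free
evolution of `φ₁` and its time derivatives. -/
theorem exists_linearizedOp {r s T : ℝ} {M : L2 →L[ℂ] L2} (hM : IsRegularMul s M)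
    (hT : 0 < T) {k : ℕ} (hr : r = s + 2 * k) {D : ℕ → HZero r →L[ℂ] HZero s} {C : ℝ}
    (hD : ∀ n ≤ k, ∀ j φ, HZero.coef j (D n φ) =
      (-Complex.I * eigenvalue j) ^ n * HZero.coef j φ)
    (hDn : ∀ n ≤ k, ∀ φ, ‖D n φ‖ ≤ C * ‖φ‖) (φ₁ : HZero r) :
    ∃ L : HZero r × H0 T k →L[ℝ] HZero r, ∀ x j, HZero.coef j (L x) =
      Complex.exp (-Complex.I * eigenvalue j * T) * (HZero.coef j x.1 + Complex.I *
        ∫ τ in (0 : ℝ)..T, Complex.exp (Complex.I * eigenvalue j * τ) *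
          ((x.2.fn τ : ℂ) * mulCoef M j (HZero.group hM.nonneg τ (D 0 φ₁)))) := by
  have hs := hM.nonneg
  have hr0 : 0 ≤ r := by rw [hr]; positivity
  have hTm : T ∈ Icc 0 T := right_mem_Icc.2 hT.le
  obtain ⟨K, hK, H⟩ := exists_positive_estimate hM hT k
  have ha := coef_succ_of_pow (a := fun n => D n φ₁) fun n hn j => hD n hn j φ₁
  have key : ∀ u : H0 T k, ∃ w : HZero r, (∀ j, HZero.coef j w =
      Complex.exp (-Complex.I * eigenvalue j * T) * (Complex.I * ∫ τ in (0 : ℝ)..T,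
        Complex.exp (Complex.I * eigenvalue j * τ) *
          ((u.fn τ : ℂ) * mulCoef M j (HZero.group hs τ (D 0 φ₁))))) ∧
      ‖w‖ ≤ Real.sqrt K * (C * ‖φ₁‖) * ‖u‖ := by
    intro u
    have hX : 0 ≤ C * ‖φ₁‖ := (norm_nonneg _).trans (hDn 0 (Nat.zero_le _) φ₁)
    refine HZero.exists_of_sum_le hr0 _ (by positivity) fun F => ?_
    have h1 := H u.jet (H0.isControl_jet hT u) (fun n t => HZero.group hs t (D n φ₁))
      (fun n hn t => HZero.hasDerivAt_group hs (ha n hn) t)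
      (fun n _ => HZero.continuous_group_apply hs _) (C * ‖φ₁‖)
      (fun n hn t _ => (HZero.norm_group_le hs t _).trans (hDn n hn φ₁)) k le_rfl F
    rw [H0.sum_jet_eq_norm_sq hT u, ← hr] at h1
    refine le_trans (le_of_eq (Finset.sum_congr rfl fun j _ => ?_)) (h1.trans_eq ?_)
    · rw [norm_mul, HZero.norm_exp_eigenvalue, one_mul, norm_mul, Complex.norm_I, one_mul,
        ← integral_mul_congr_ae hTm (H0.jet_zero_ae_eq hT u), integral_Ioo_eq hT.le]
    · rw [mul_pow _ ‖u‖, mul_pow (Real.sqrt K), Real.sq_sqrt hK]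
      ring
  choose N hN hNn using key
  have hint : ∀ (u : H0 T k) j, IntervalIntegrable (fun τ : ℝ =>
      Complex.exp (Complex.I * eigenvalue j * τ) *
        ((u.fn τ : ℂ) * mulCoef M j (HZero.group hs τ (D 0 φ₁)))) volume 0 T := fun u j =>
    intervalIntegrable_of_integrable hTm (integrable_duhamel M hs (H0.memLp_fn u)
      (HZero.continuous_group_apply hs _).continuousOn j)
  let N' : H0 T k →ₗ[ℝ] HZero r :=
    { toFun := N
      map_add' := fun u w => HZero.coef_ext fun j => by
        rw [HZero.coef_add, hN, hN, hN, integral_mul_congr_ae (v := fun t => u.fn t + w.fn t) hTm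
          (H0.fn_add_ae u w), ← mul_add, ← mul_add, ← intervalIntegral.integral_add (hint u j)
          (hint w j)]
        refine congrArg (fun z => Complex.exp _ * (Complex.I * z))
          (congrArg (fun f : ℝ → ℂ => ∫ τ in (0 : ℝ)..T, f τ) (funext fun τ => ?_))
        push_cast
        ring
      map_smul' := fun c u => HZero.coef_ext fun j => by
        rw [RingHom.id_apply, ← Complex.coe_smul c (N u), HZero.coef_smul, hN, hN,
          integral_mul_congr_ae (v := fun t => c * u.fn t) hTm (H0.fn_smul_ae c u),
          mul_left_comm (c : ℂ), mul_left_comm (c : ℂ), ← intervalIntegral.integral_const_mul (c : ℂ)]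
        refine congrArg (fun z => Complex.exp _ * (Complex.I * z))
          (congrArg (fun f : ℝ → ℂ => ∫ τ in (0 : ℝ)..T, f τ) (funext fun τ => ?_))
        push_cast
        ring }
  let N'' : H0 T k →L[ℝ] HZero r := N'.mkContinuous _ hNn
  refine ⟨((HZero.group hr0 T).restrictScalars ℝ).comp (ContinuousLinearMap.fst ℝ _ _) +
    N''.comp (ContinuousLinearMap.snd ℝ _ _), fun x j => ?_⟩
  change HZero.coef j (HZero.group hr0 T x.1 + N x.2) = _
  rw [HZero.coef_add, HZero.coef_group, hN, mul_add]

theorem exists_final_regularity {T : ℝ} (hT : 0 < T) {p k : ℕ} {μ : ℝ → ℝ} {M : L2 →L[ℂ] L2}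
    (hMμ : ∀ φ, M φ = mulL2 μ φ) (hM : IsRegularMul (2 * p + 3) M)
    {D : ℕ → HZero (2 * (p + k) + 3) →L[ℂ] HZero (2 * p + 3)}
    (hD : ∀ n ≤ k, ∀ j φ, HZero.coef j (D n φ) =
      (-Complex.I * eigenvalue j) ^ n * HZero.coef j φ)
    {ψ₀ : HZero (2 * (p + k) + 3)} {u : H0 T k} {E : ℕ → ℝ → HZero (2 * p + 3)}
    (hE : IsEvolution hM.nonneg T k M u.jet (fun n => D n ψ₀) E) :
    IsWeakSolution T p k μ ψ₀ u (state hM.nonneg (fun n => D n ψ₀) E 0) ∧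
    HZero.toL2 (finalState T p k μ ψ₀ u) =
      HZero.toL2 (state hM.nonneg (fun n => D n ψ₀) E 0 T) := by
  have h0 : ∀ j, HZero.coef j (D 0 ψ₀) = HZero.coef j ψ₀ := fun j => by
    rw [hD 0 (Nat.zero_le _), pow_zero, one_mul]
  have hsol := hE.isWeakSolution hT hMμ h0 (coef_succ_of_pow fun n hn j => hD n hn j ψ₀)
  obtain ⟨χ, hχ⟩ := hE.exists_final hT.le (r := 2 * (p + k) + 3) (by ring)
    (H0.isControl_jet hT u) h0
  exact ⟨hsol, toL2_finalState hT hMμ hM hsol hχ⟩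

/-- An exact identity: the solution and the linearized equation differ only in that `μ` multiplies
the full solution in one and the free evolution of `φ₁` in the other. By linearity in the datum, the
difference of these two states is the state with the same deviation `E` and initial datum `ψ₀ - φ₁`.
-/
theorem coef_remainder {T : ℝ} (hT : 0 < T) {p k : ℕ} {μ : ℝ → ℝ} {M : L2 →L[ℂ] L2}
    (hMμ : ∀ φ, M φ = mulL2 μ φ) (hM : IsRegularMul (2 * p + 3) M)
    {D : ℕ → HZero (2 * (p + k) + 3) →L[ℂ] HZero (2 * p + 3)}
    (hD : ∀ n ≤ k, ∀ j φ, HZero.coef j (D n φ) =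
      (-Complex.I * eigenvalue j) ^ n * HZero.coef j φ)
    {φ₁ ψ₀ : HZero (2 * (p + k) + 3)} {u : H0 T k} {E E₁ : ℕ → ℝ → HZero (2 * p + 3)}
    (hE : IsEvolution hM.nonneg T k M u.jet (fun n => D n ψ₀) E)
    (hE₁ : IsEvolution hM.nonneg T k M (0 : H0 T k).jet (fun n => D n φ₁) E₁)
    {L : HZero (2 * (p + k) + 3) × H0 T k →L[ℝ] HZero (2 * (p + k) + 3)}
    (hL : ∀ x j, HZero.coef j (L x) =
      Complex.exp (-Complex.I * eigenvalue j * T) * (HZero.coef j x.1 + Complex.I *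
        ∫ τ in (0 : ℝ)..T, Complex.exp (Complex.I * eigenvalue j * τ) *
          ((x.2.fn τ : ℂ) * mulCoef M j (HZero.group hM.nonneg τ (D 0 φ₁))))) (j : ℕ+) :
    HZero.coef j (finalState T p k μ ψ₀ u - finalState T p k μ φ₁ 0 - L (ψ₀ - φ₁, u)) =
      Complex.exp (-Complex.I * eigenvalue j * T) * (Complex.I * ∫ τ in Ioo 0 T,
        Complex.exp (Complex.I * eigenvalue j * τ) * ((u.jet 0 τ : ℂ) *
          mulCoef M j (state hM.nonneg (fun n => D n (ψ₀ - φ₁)) E 0 τ))) := by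
  have hs := hM.nonneg
  have hTm : T ∈ Icc 0 T := right_mem_Icc.2 hT.le
  obtain ⟨h1, h2⟩ := exists_final_regularity hT hMμ hM hD hE
  obtain ⟨h3, h4⟩ := exists_final_regularity hT hMμ hM hD hE₁
  have e1 : HZero.coef j (finalState T p k μ ψ₀ u) = _ :=
    (congrArg (coeff j) h2).trans (((isWeakSolution_iff hMμ).1 h1).2 T hTm j)
  have e2 : HZero.coef j (finalState T p k μ φ₁ 0) = _ :=
    (congrArg (coeff j) h4).trans (((isWeakSolution_iff hMμ).1 h3).2 T hTm j)
  rw [integral_mul_congr_ae (v := fun _ => 0) hTm (H0.fn_zero_ae T k)] at e2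
  simp only [Complex.ofReal_zero, zero_mul, mul_zero, intervalIntegral.integral_zero, add_zero] at e2
  have hca : Continuous (state hs (fun n => D n ψ₀) E 0) :=
    continuous_state hs (hE.cont 0 (Nat.zero_le _))
  have e3 : ∫ τ in Ioo 0 T, Complex.exp (Complex.I * eigenvalue j * τ) * ((u.jet 0 τ : ℂ) *
      mulCoef M j (state hs (fun n => D n (ψ₀ - φ₁)) E 0 τ)) =
      (∫ τ in (0 : ℝ)..T, Complex.exp (Complex.I * eigenvalue j * τ) * ((u.fn τ : ℂ) *
        mulCoef M j (state hs (fun n => D n ψ₀) E 0 τ))) -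
      ∫ τ in (0 : ℝ)..T, Complex.exp (Complex.I * eigenvalue j * τ) * ((u.fn τ : ℂ) *
        mulCoef M j (HZero.group hs τ (D 0 φ₁))) := by
    rw [integral_Ioo_eq hT.le, integral_mul_congr_ae hTm (H0.jet_zero_ae_eq hT u),
      ← intervalIntegral.integral_sub
        (intervalIntegrable_of_integrable hTm (integrable_duhamel M hs (H0.memLp_fn u)
          hca.continuousOn j))
        (intervalIntegrable_of_integrable hTm (integrable_duhamel M hs (H0.memLp_fn u)
          (HZero.continuous_group_apply hs _).continuousOn j))]
    refine congrArg (fun f : ℝ → ℂ => ∫ τ in (0 : ℝ)..T, f τ) (funext fun τ => ?_)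
    simp only [state, map_sub, ← mulCoefCLM_apply M hs, map_add]
    ring
  rw [HZero.coef_sub, HZero.coef_sub, e1, e2, hL, e3]
  simp only [HZero.coef_sub]
  ring

/-- No bound on `‖ψ₀‖` is available, so the full state only gets a bound `Z` depending on `ψ₀`. What
is small is the product of `Z` with a norm of `u`, and this is all that `exists_negative_estimate`
asks for. -/
theorem exists_state_bounds {r s T : ℝ} {M : L2 →L[ℂ] L2} (hM : IsRegularMul s M) (hT : 0 < T)
    {k : ℕ} {D : ℕ → HZero r →L[ℂ] HZero s} {C K : ℝ} (hC : 0 ≤ C) (hK : 0 ≤ K)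
    (hDn : ∀ n ≤ k, ∀ φ, ‖D n φ‖ ≤ C * ‖φ‖) (φ₁ : HZero r) {R : ℝ} (hR : 0 < R) :
    ∃ B : ℝ, 0 ≤ B ∧ ∀ (ψ₀ : HZero r) (u : H0 T k) (E : ℕ → ℝ → HZero s), u.norm0 < R →
      (∀ n ≤ k, ∀ t ∈ Icc 0 T, ‖E n t‖ ≤ K * Real.exp (K * ‖u‖ ^ 2) * (‖u‖ * ‖ψ₀‖)) →
      ∃ Z, 0 ≤ Z ∧
        (∀ n ≤ k, ∀ t ∈ Icc 0 T, ‖state hM.nonneg (fun n => D n (ψ₀ - φ₁)) E n t‖ ≤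
          B * (‖ψ₀ - φ₁‖ + u.norm0)) ∧
        (∀ n ≤ k, ∀ t ∈ Icc 0 T, ‖state hM.nonneg (fun n => D n ψ₀) E n t‖ ≤ Z) ∧
        ∀ i ≤ k, (∫ t in Ioo 0 T, u.jet i t ^ 2) * Z ^ 2 ≤
          (B * (‖ψ₀ - φ₁‖ + u.norm0)) ^ 2 := by
  have hs := hM.nonneg
  set c : ℝ := (k + 1) * max T 1 ^ k with hc
  have hc0 : 0 ≤ c := by positivity
  set G : ℝ := K * Real.exp (K * (c * R) ^ 2) with hG
  have hG0 : 0 ≤ G := by positivity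
  set q : ℝ := c * (‖φ₁‖ + R) with hq
  have hq0 : 0 ≤ q := by positivity
  refine ⟨C + G * q + (C + G * (c * R)) * q, by positivity, fun ψ₀ u E huR hE => ?_⟩
  have hn0 : 0 ≤ u.norm0 := norm_nonneg _
  have hun : ‖u‖ ≤ c * u.norm0 := H0.norm_le_norm0 hT u
  have huR' : ‖u‖ ≤ c * R := hun.trans (by gcongr)
  set d := ‖ψ₀ - φ₁‖ with hd
  have hd0 : 0 ≤ d := norm_nonneg _
  have hψ : ‖ψ₀‖ ≤ ‖φ₁‖ + d := by
    have := norm_add_le φ₁ (ψ₀ - φ₁)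
    rwa [add_sub_cancel] at this
  -- As `‖ψ₀‖ ≤ ‖φ₁‖ + d`, the term linear in `u` is kept, while in `d ‖u‖` the factor `‖u‖` is
  -- bounded through `R`.
  have hprod : ‖u‖ * ‖ψ₀‖ ≤ q * (d + u.norm0) := by
    calc ‖u‖ * ‖ψ₀‖ ≤ (c * u.norm0) * (‖φ₁‖ + d) := by gcongr
      _ = c * ‖φ₁‖ * u.norm0 + c * d * u.norm0 := by ring
      _ ≤ c * ‖φ₁‖ * (d + u.norm0) + c * (d + u.norm0) * R := by
        gcongr <;> linarith
      _ = _ := by rw [hq]; ring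
  have hexp : K * Real.exp (K * ‖u‖ ^ 2) ≤ G := by rw [hG]; gcongr
  have hE' : ∀ n ≤ k, ∀ t ∈ Icc 0 T, ‖E n t‖ ≤ G * (‖u‖ * ‖ψ₀‖) := fun n hn t ht =>
    (hE n hn t ht).trans (mul_le_mul_of_nonneg_right hexp (by positivity))
  have hS0 : 0 ≤ d + u.norm0 := by positivity
  refine ⟨(C + G * (c * R)) * ‖ψ₀‖, by positivity, fun n hn t ht => ?_, fun n hn t ht => ?_,
    fun i hi => ?_⟩
  · refine (norm_add_le _ _).trans ?_
    have h1 := (HZero.norm_group_le hs t (D n (ψ₀ - φ₁))).trans (hDn n hn _)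
    calc _ ≤ C * d + G * (q * (d + u.norm0)) := add_le_add h1 ((hE' n hn t ht).trans (by gcongr))
      _ ≤ C * (d + u.norm0) + G * (q * (d + u.norm0)) +
          (C + G * (c * R)) * q * (d + u.norm0) := by
        have : C * d ≤ C * (d + u.norm0) := by gcongr; linarith
        have : 0 ≤ (C + G * (c * R)) * q * (d + u.norm0) := by positivity
        linarith
      _ = _ := by ring
  · refine (norm_add_le _ _).trans ?_
    have h1 := (HZero.norm_group_le hs t (D n ψ₀)).trans (hDn n hn _)
    calc _ ≤ C * ‖ψ₀‖ + G * (c * R * ‖ψ₀‖) := add_le_add h1 ((hE' n hn t ht).trans (by gcongr))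
      _ = _ := by ring
  · have h1 : ∫ t in Ioo 0 T, u.jet i t ^ 2 ≤ ‖u‖ ^ 2 := by
      rw [← H0.sum_jet_eq_norm_sq hT u]
      exact Finset.single_le_sum (f := fun i => ∫ t in Ioo 0 T, u.jet i t ^ 2)
        (fun i _ => integral_nonneg fun _ => sq_nonneg _) (Finset.mem_range.2 (by omega))
    calc _ ≤ ‖u‖ ^ 2 * ((C + G * (c * R)) * ‖ψ₀‖) ^ 2 := by gcongr
      _ = ((C + G * (c * R)) * (‖u‖ * ‖ψ₀‖)) ^ 2 := by ring
      _ ≤ ((C + G * (c * R)) * (q * (d + u.norm0))) ^ 2 := by gcongr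
      _ ≤ _ := by
        refine pow_le_pow_left₀ (by positivity) ?_ 2
        have : 0 ≤ (C + G * q) * (d + u.norm0) := by positivity
        linarith

/-! ### Remainder estimates -/

theorem H0.sobNorm_natCast {T : ℝ} (hT : 0 < T) {k : ℕ} (u : H0 T k) {m : ℕ} (hm : m ≤ k) :
    u.sobNorm (m : ℤ) = Real.sqrt (∑ i ∈ Finset.range (m + 1), ∫ t in Ioo 0 T, u.jet i t ^ 2) := by
  change Real.sqrt _ = _
  congr 1
  refine Finset.sum_bij (fun i _ => (i : ℕ)) (fun i hi => ?_) (fun i _ j _ h => Fin.ext h)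
    (fun i hi => ?_) fun i _ => ?_
  · exact Finset.mem_range.2 (Nat.lt_succ_of_le (Finset.mem_filter.1 hi).2)
  · have := Finset.mem_range.1 hi
    exact ⟨⟨i, by omega⟩, Finset.mem_filter.2 ⟨Finset.mem_univ _, Nat.le_of_lt_succ this⟩, rfl⟩
  · exact H0.norm_sq_eq hT u (Nat.le_of_lt_succ i.2)

theorem H0.sobNorm_negSucc {T : ℝ} (hT : 0 < T) {k : ℕ} (u : H0 T k) (l : ℕ) :
    u.sobNorm (Int.negSucc l) = |iterPrim (u.jet 0) 1 T| +
      Real.sqrt (∫ t in Ioo 0 T, iterPrim (u.jet 0) (l + 1) t ^ 2) := by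
  have h := H0.jet_zero_ae_eq hT u
  change |iterPrim u.fn 1 T| + Real.sqrt (∫ t in (0 : ℝ)..T, iterPrim u.fn (l + 1) t ^ 2) = _
  rw [iterPrim_congr h 0 (right_mem_Icc.2 hT.le), ← integral_Ioo_eq hT.le]
  congr 2
  refine setIntegral_congr_fun measurableSet_Ioo fun t ht => ?_
  simp only [iterPrim_congr h l (Ioo_subset_Icc_self ht)]

theorem H0.sobNorm_nonneg {T : ℝ} {k : ℕ} (u : H0 T k) (m : ℤ) : 0 ≤ u.sobNorm m := by
  cases m with
  | ofNat m => exact Real.sqrt_nonneg _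
  | negSucc l => exact add_nonneg (abs_nonneg _) (Real.sqrt_nonneg _)

theorem H0.sobNorm_self {T : ℝ} (hT : 0 < T) {k : ℕ} (u : H0 T k) : u.sobNorm (k : ℤ) = ‖u‖ := by
  rw [H0.sobNorm_natCast hT u le_rfl, H0.sum_jet_eq_norm_sq hT u, Real.sqrt_sq (norm_nonneg _)]

theorem H0.norm0_le_norm {T : ℝ} {k : ℕ} (u : H0 T k) : u.norm0 ≤ ‖u‖ :=
  PiLp.norm_apply_le (u : Jets T k) (Fin.last k)

/-- The linearized map is fixed before `R`, and the estimate is stated for the final state before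
projection. The moment conditions are required for `m < 0` only, so that the case `m = k` can serve
for differentiability at every `u`. -/
theorem exists_linearization {T : ℝ} (hT : 0 < T) {p k : ℕ} {μ : ℝ → ℝ}
    (hμ : MemSobolev 0 1 (2 * p + 3) μ)
    (hμ0 : ∀ n < p, DerivVanishesAtEnds 0 1 (2 * n + 1) μ) (φ₁ : HZero (2 * (p + k) + 3)) :
    (∀ (ψ₀ : HZero (2 * (p + k) + 3)) (u : H0 T k), ∃ ψ : ℝ → HZero (2 * p + 3),
      IsWeakSolution T p k μ ψ₀ u ψ ∧
      HZero.toL2 (finalState T p k μ ψ₀ u) = HZero.toL2 (ψ T) ∧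
      ∀ χ : ℝ → HZero (2 * p + 3), IsWeakSolution T p k μ ψ₀ u χ → EqOn χ ψ (Icc 0 T)) ∧
    ∃ L : HZero (2 * (p + k) + 3) × H0 T k →L[ℝ] HZero (2 * (p + k) + 3),
      ∀ R : ℝ, 0 < R → ∃ C : ℝ, 0 < C ∧ ∀ (ψ₀ : HZero (2 * (p + k) + 3)) (u : H0 T k),
        u.norm0 < R → ∀ m : ℤ, -(k + 1) ≤ m → m ≤ k →
        (m < 0 → ∀ n : ℕ, 2 ≤ n → n ≤ k + 1 → iterPrim u.fn n T = 0) → ∀ F : Finset ℕ+,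
        ∑ j ∈ F, ((j : ℝ) ^ (2 * (p + m) + 3 : ℝ) * ‖HZero.coef j (finalState T p k μ ψ₀ u -
          finalState T p k μ φ₁ 0 - L (ψ₀ - φ₁, u))‖) ^ 2 ≤
            (C * u.sobNorm m * (‖ψ₀ - φ₁‖ + u.norm0)) ^ 2 := by
  obtain ⟨M, hMμ, hM⟩ := exists_isRegularMul hμ hμ0
  have hs := hM.nonneg
  have hr : (2 * (p + k) + 3 : ℝ) = (2 * p + 3) + 2 * k := by ring
  obtain ⟨D, C, hC, hD, hDn⟩ := HZero.exists_derivOp hs hr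
  obtain ⟨K, hK, hE⟩ := exists_evolution_of_initial hM hT hC hD hDn
  obtain ⟨L, hL⟩ := exists_linearizedOp hM hT hr hD hDn φ₁
  obtain ⟨E₁, hE₁, -⟩ := hE φ₁ 0
  obtain ⟨C₁, hC₁, H₁⟩ := exists_positive_estimate hM hT k
  obtain ⟨C₂, hC₂, H₂⟩ := exists_negative_estimate hM hT k
  refine ⟨fun ψ₀ u => ?_, L, fun R hR => ?_⟩
  · obtain ⟨E, hE, -⟩ := hE ψ₀ u
    obtain ⟨h1, h2⟩ := exists_final_regularity hT hMμ hM hD hE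
    exact ⟨_, h1, h2, fun χ hχ => h1.eqOn hT hMμ hM hχ⟩
  obtain ⟨B, hB, H⟩ := exists_state_bounds hM hT hC hK hDn φ₁ hR
  -- The sum `C₁ + C₂` covers both signs of `m`; the `+ 1` makes the constant positive.
  refine ⟨Real.sqrt (C₁ + C₂) * B + 1, by positivity, fun ψ₀ u hu m hm1 hm2 hm F => ?_⟩
  obtain ⟨E, hE, hEb⟩ := hE ψ₀ u
  obtain ⟨Z, hZ, hb, ha, hZi⟩ := H ψ₀ u E hu hEb
  have hn0 : 0 ≤ u.norm0 := norm_nonneg _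
  set S := ‖ψ₀ - φ₁‖ + u.norm0
  have hS : 0 ≤ S := by positivity
  have hN := u.sobNorm_nonneg m
  simp_rw [coef_remainder hT hMμ hM hD hE hE₁ hL, norm_mul, HZero.norm_exp_eigenvalue,
    Complex.norm_I, one_mul]
  have hfin : (C₁ + C₂) * (u.sobNorm m ^ 2 * (B * S) ^ 2) ≤
      ((Real.sqrt (C₁ + C₂) * B + 1) * u.sobNorm m * S) ^ 2 := by
    calc _ = (Real.sqrt (C₁ + C₂) * B * u.sobNorm m * S) ^ 2 := by
          have := Real.sq_sqrt (show 0 ≤ C₁ + C₂ by positivity)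
          linear_combination -(u.sobNorm m ^ 2 * (B * S) ^ 2) * this
      _ ≤ _ := by gcongr; linarith
  have hb' := coef_succ_of_pow (a := fun n => D n (ψ₀ - φ₁)) fun n hn j => hD n hn j (ψ₀ - φ₁)
  refine le_trans ?_ hfin
  cases m with
  | ofNat m =>
    have hmk : m ≤ k := by
      simp only [Int.ofNat_eq_natCast] at hm2
      omega
    have h1 := H₁ u.jet (H0.isControl_jet hT u) (state hs (fun n => D n (ψ₀ - φ₁)) E)
      (fun n hn t => hasDerivAt_state hs (hb' n hn) (hE.deriv n hn t))
      (fun n hn => continuous_state hs (hE.cont n hn)) (B * S) hb m hmk F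
    rw [Int.ofNat_eq_natCast, H0.sobNorm_natCast hT u hmk, Real.sq_sqrt
      (Finset.sum_nonneg fun i _ => integral_nonneg fun _ => sq_nonneg _)]
    have e : (2 * (p + ((m : ℤ) : ℝ)) + 3 : ℝ) = 2 * p + 3 + 2 * m := by push_cast; ring
    rw [e]
    refine h1.trans (mul_le_mul_of_nonneg_right (by linarith) ?_)
    exact mul_nonneg (Finset.sum_nonneg fun i _ => integral_nonneg fun _ => sq_nonneg _)
      (sq_nonneg _)
  | negSucc l =>
    have hlk : l ≤ k := by
      have := hm1
      rw [Int.negSucc_eq] at this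
      omega
    have hz : ∀ n, 2 ≤ n → n ≤ k + 1 → iterPrim (u.jet 0) n T = 0 := fun n hn hnk => by
      rw [← hm (Int.negSucc_lt_zero l) n hn hnk]
      obtain ⟨n, rfl⟩ : ∃ i, n = i + 1 := ⟨n - 1, by omega⟩
      exact (iterPrim_congr (H0.jet_zero_ae_eq hT u) n (right_mem_Icc.2 hT.le))
    have h2 := H₂ u.jet (H0.isControl_jet hT u) _ _ E hE hb' (B * S) Z (by positivity) hZ hb ha
      hZi hz l hlk F
    rw [H0.sobNorm_negSucc hT]
    have e : (2 * (p + ((Int.negSucc l : ℤ) : ℝ)) + 3 : ℝ) = 2 * p + 3 - 2 * ((l + 1 : ℕ) : ℝ) := by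
      rw [Int.negSucc_eq]; push_cast; ring
    rw [e]
    exact h2.trans (mul_le_mul_of_nonneg_right (by linarith) (by positivity))

/-! ### Differentiability of the end-point map -/

theorem endPointMap_sub_sub {T : ℝ} {p k : ℕ} {μ : ℝ → ℝ} {J : Set ℕ+}
    {φ₁ : HZero (2 * (p + k) + 3)}
    {L : HZero (2 * (p + k) + 3) × H0 T k →L[ℝ] HZero (2 * (p + k) + 3)}
    {P : HZero (2 * (p + k) + 3) →L[ℝ] HZero (2 * (p + k) + 3)}
    (hP : ∀ φ, P φ = HZero.projTangent T (HZero.projJ J φ))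
    (x : HZero (2 * (p + k) + 3) × H0 T k) :
    endPointMap T p k μ J x - endPointMap T p k μ J (φ₁, 0) -
        (ContinuousLinearMap.fst ℝ _ _).prod (P.comp L) (x - (φ₁, 0)) =
      (0, P (finalState T p k μ x.1 x.2 - finalState T p k μ φ₁ 0 - L (x.1 - φ₁, x.2))) := by
  have e : x - (φ₁, 0) = (x.1 - φ₁, x.2) := Prod.ext rfl (sub_zero _)
  refine Prod.ext ?_ ?_
  · change x.1 - φ₁ - (x.1 - φ₁) = 0
    exact sub_self _
  · change HZero.projTangent T (HZero.projJ J _) - HZero.projTangent T (HZero.projJ J _) -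
      P (L (x - (φ₁, 0))) = P _
    rw [← hP, ← hP, e, map_sub, map_sub]

/-- Near `(φ₁, 0)` the estimate for `m = k` bounds the remainder by a multiple of `‖x - (φ₁, 0)‖²`,
because `u.sobNorm k` is the norm of `u` and `u.norm0` is at most that norm. -/
theorem hasFDerivAt_endPointMap {T : ℝ} (hT : 0 < T) {p k : ℕ} {μ : ℝ → ℝ} (J : Set ℕ+)
    {φ₁ : HZero (2 * (p + k) + 3)}
    {L : HZero (2 * (p + k) + 3) × H0 T k →L[ℝ] HZero (2 * (p + k) + 3)}
    {P : HZero (2 * (p + k) + 3) →L[ℝ] HZero (2 * (p + k) + 3)}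
    (hP : ∀ φ, P φ = HZero.projTangent T (HZero.projJ J φ)) {C : ℝ} (hC : 0 < C)
    (h : ∀ (ψ₀ : HZero (2 * (p + k) + 3)) (u : H0 T k), u.norm0 < 1 → ∀ F : Finset ℕ+,
      ∑ j ∈ F, ((j : ℝ) ^ (2 * (p + k) + 3 : ℝ) * ‖HZero.coef j (finalState T p k μ ψ₀ u -
        finalState T p k μ φ₁ 0 - L (ψ₀ - φ₁, u))‖) ^ 2 ≤
          (C * u.sobNorm k * (‖ψ₀ - φ₁‖ + u.norm0)) ^ 2) :
    HasFDerivAt (endPointMap T p k μ J)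
      ((ContinuousLinearMap.fst ℝ _ _).prod (P.comp L)) (φ₁, 0) := by
  rw [hasFDerivAt_iff_isLittleO]
  refine Asymptotics.IsBigO.trans_isLittleO (g := fun x => ‖x - (φ₁, 0)‖ ^ 2) ?_ ?_
  · refine Asymptotics.IsBigO.of_bound (‖P‖ * (C * 2)) ?_
    filter_upwards [Metric.ball_mem_nhds (φ₁, (0 : H0 T k)) one_pos] with x hx
    rw [mem_ball_iff_norm] at hx
    have h1 : ‖x.1 - φ₁‖ ≤ ‖x - (φ₁, 0)‖ := norm_fst_le (x - (φ₁, 0))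
    have h2 : ‖x.2‖ ≤ ‖x - (φ₁, 0)‖ := by
      have := norm_snd_le (x - (φ₁, 0))
      rwa [Prod.snd_sub, sub_zero] at this
    have h3 := x.2.norm0_le_norm
    have h4 : ‖finalState T p k μ x.1 x.2 - finalState T p k μ φ₁ 0 - L (x.1 - φ₁, x.2)‖ ≤
        C * ‖x.2‖ * (‖x.1 - φ₁‖ + x.2.norm0) :=
      HZero.norm_le_of_sum_le
        (mul_nonneg (by positivity) (add_nonneg (norm_nonneg _) (norm_nonneg _))) fun F => by
        have := h x.1 x.2 (h3.trans_lt (h2.trans_lt hx)) F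
        rwa [H0.sobNorm_self hT] at this
    rw [endPointMap_sub_sub hP, Prod.norm_mk, norm_zero, max_eq_right (norm_nonneg _), norm_pow,
      norm_norm]
    calc _ ≤ ‖P‖ * (C * ‖x.2‖ * (‖x.1 - φ₁‖ + x.2.norm0)) := P.le_opNorm_of_le h4
      _ ≤ ‖P‖ * (C * ‖x - (φ₁, 0)‖ * (‖x - (φ₁, 0)‖ + ‖x - (φ₁, 0)‖)) := by
        have hn0 : 0 ≤ x.2.norm0 := norm_nonneg _
        have h5 := h3.trans h2
        gcongr
      _ = _ := by ring
  · refine (Asymptotics.isLittleO_norm_pow_id one_lt_two).comp_tendsto ?_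
    have : Continuous fun x : HZero (2 * (p + k) + 3) × H0 T k => x - (φ₁, 0) :=
      continuous_id.sub continuous_const
    have := this.tendsto (φ₁, 0)
    rwa [sub_self] at this

end

end BilinearSchrodinger

/-! ### The proposition -/

theorem proposition4p3 (T : ℝ) (hT : 0 < T) (p k : ℕ) (hpk : k ≤ p) (μ : ℝ → ℝ)
    (hμ : MemSobolev 0 1 (2 * (p + k) + 3) μ)
    (hμ0 : ∀ n < p, DerivVanishesAtEnds 0 1 (2 * n + 1) μ) :
    -- the end-point map is well defined: the solution exists, is unique and ends in `H^{2(p+k)+3}`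
    (∀ (ψ₀ : HZero (2 * (p + k) + 3)) (u : H0 T k), ∃ ψ : ℝ → HZero (2 * p + 3),
      IsWeakSolution T p k μ ψ₀ u ψ ∧
      HZero.toL2 (finalState T p k μ ψ₀ u) = HZero.toL2 (ψ T) ∧
      ∀ χ : ℝ → HZero (2 * p + 3), IsWeakSolution T p k μ ψ₀ u χ → EqOn χ ψ (Icc 0 T)) ∧
    -- it is (Fréchet) differentiable at `(φ_1, 0)`
    (∀ J : Set ℕ+, DifferentiableAt ℝ (endPointMap T p k μ J) (HZero.mode _ 1, 0)) ∧
    -- the estimates of the remainder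
    ∀ R : ℝ, 0 < R → ∃ C : ℝ, 0 < C ∧
      ∀ (J : Set ℕ+) (ψ₀ : HZero (2 * (p + k) + 3)) (u : H0 T k),
        u.norm0 < R →
        (∀ n : ℕ, 2 ≤ n → n ≤ k + 1 → iterPrim u.fn n T = 0) →
        ∀ m : ℤ, -(k + 1) ≤ m → m ≤ k →
          pairNorm (2 * (p + m) + 3)
              (endPointMap T p k μ J (ψ₀, u) - endPointMap T p k μ J (HZero.mode _ 1, 0) -
                fderiv ℝ (endPointMap T p k μ J) (HZero.mode _ 1, 0)
                  (ψ₀ - HZero.mode _ 1, u)) ≤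
            C * u.sobNorm m * (‖ψ₀ - HZero.mode _ 1‖ + u.norm0) := by
  obtain ⟨hsol, L, hL⟩ := exists_linearization hT (hμ.mono (by omega)) hμ0
    (k := k) (HZero.mode (2 * (p + k) + 3) 1)
  choose P hP using fun J => HZero.exists_proj (2 * (p + k) + 3) T J
  set φ₁ : HZero (2 * (p + k) + 3) := HZero.mode _ 1
  have hder : ∀ J, HasFDerivAt (endPointMap T p k μ J)
      ((ContinuousLinearMap.fst ℝ _ _).prod ((P J).comp L)) (φ₁, 0) := by
    -- Any positive radius would do, differentiability being local; for `m = k ≥ 0` the moment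
    -- conditions are void.
    obtain ⟨C, hC, h⟩ := hL 1 one_pos
    refine fun J => hasFDerivAt_endPointMap hT J (hP J) hC fun ψ₀ u hu F => ?_
    have := h ψ₀ u hu k (by omega) le_rfl (fun hk => by omega) F
    rwa [Int.cast_natCast] at this
  refine ⟨hsol, fun J => (hder J).differentiableAt, fun R hR => ?_⟩
  obtain ⟨C, hC, h⟩ := hL R hR
  refine ⟨C, hC, fun J ψ₀ u hu hu0 m hm1 hm2 => ?_⟩
  have e : ((ψ₀ - φ₁, u) : HZero (2 * (p + k) + 3) × H0 T k) = (ψ₀, u) - (φ₁, 0) :=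
    Prod.ext rfl (sub_zero _).symm
  rw [(hder J).fderiv, e, endPointMap_sub_sub (hP J), pairNorm]
  have hz : hNorm (2 * (p + m) + 3)
      (HZero.toL2 (0 : HZero (2 * (p + k) + 3))) = 0 := by
    simp [hNorm, coeff]
  rw [hz, zero_add]
  refine hNorm_le_of_sum_le (mul_nonneg (mul_nonneg hC.le (u.sobNorm_nonneg m))
    (add_nonneg (norm_nonneg _) (norm_nonneg _))) fun F => ?_
  -- The projections do not increase any coefficient, so the bound for the unprojected remainder
  -- applies with a constant independent of `J`.
  refine (Finset.sum_le_sum fun j _ => ?_).trans (h ψ₀ u hu m hm1 hm2 (fun _ => hu0) F)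
  rw [hP]
  have := HZero.norm_coef_proj_le T J
    (finalState T p k μ ψ₀ u - finalState T p k μ φ₁ 0 - L (ψ₀ - φ₁, u)) j
  gcongr
  exact this
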